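/- Let $D\ge 0$, let $V:\mathbb R^D\to\mathbb R$ be smooth, and let $K(y,z;T)$ be a heat kernel of $-\partial^2+V$: a $C^2$ solution of $\partial_TK=\partial_y^2K-V(y)K$ for $T>0$ with $\int K(y,z;T)\varphi(y)\,dy\to\varphi(z)$ as $T\to0^+$ for all continuous compactly supported $\varphi$. Indices are summed over $1,\dots,D$, $\partial_{\mu_1\cdots\mu_k}V=\partial_{\mu_1}\cdots\partial_{\mu_k}V$, and at a point $x$ let $2\Omega^2=\partial\partial V(x)$; even functions of $\Omega$ are functions of the symmetric matrix $\Omega^2$, with removable singularities at $\Omega=0$ filled in. All $V$ and derivatives are taken at $x$. Put $$P(T)=\frac{e^{-TV}}{(4\pi T)^{D/2}}\,{\det}^{-1/2}\!\Big(\frac{\sinh 2\Omega T}{2\Omega T}\Big),\qquad P^{SI}(T)=\frac{e^{-TV}}{(4\pi T)^{D/2}}\,{\det}^{-1/2}\!\Big(\frac{\sinh^2\Omega T}{\Omega^2T^2}\Big),$$ $$G(t,t')=\frac{\sinh(2\Omega t)\sinh(2\Omega(T-t'))-\Theta(t-t')\sinh(2\Omega T)\sinh(2\Omega(t-t'))}{\Omega\sinh(2\Omega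 T)},$$ $$\mathcal G(t,t')=-\frac1{2T\Omega^2}+\frac{\cosh(\Omega(T+2t-2t'))}{2\Omega\sinh\Omega T}-\Theta(t-t')\frac{\sinh(2\Omega(t-t'))}{\Omega}.$$ For $\Gamma\in\{G,\mathcal G\}$ let $S_\Gamma[\eta]=\int_0^T\!\int_0^T\eta_\mu(t)\Gamma^{\mu\nu}(t,t')\eta_\nu(t')\,dt\,dt'$, let $W_{(k)}(t)=\frac{(-1)^k}{k!}\,\partial_{\mu_1\cdots\mu_k}V\,\frac{\delta^k}{\delta\eta_{\mu_1}(t)\cdots\delta\eta_{\mu_k}(t)}$, and let $Z^\Gamma_N(T)$ be the sum of all terms $$\frac{(-1)^n}{n!}\int_{[0,T]^n}dt_1\cdots dt_n\,W_{(k_1)}(t_1)\cdots W_{(k_n)}(t_n)\,e^{\frac12S_\Gamma[\eta]}\Big|_{\eta=\partial V},\qquad n\ge0,\ k_i\ge3,\ n+\tfrac12\textstyle\sum_ik_i\le N,$$ of the perturbative expansion of $e^{-\int_0^T dt\sum_{k\ge3}W_{(k)}(t)}\,e^{\frac12S_\Gamma[\eta]}\big|_{\eta=\partial V}$. There are universal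 polynomials $c_j$, $c_j^{SI}$, $J_j^\mu$ ($j\ge0$) in the partial derivatives of $V$ (those of order zero included), depending only on $D$, such that for all such $V$, $K$ and all $x$ and $N\ge0$ the following hold, with $O(\cdot)$ referring to $T\to0^+$. (1) For every $T>0$ with $\det\frac{\sinh 2\Omega T}{2\Omega T}\neq0$, $G$ is the Green function of $-\frac12\partial_t^2+2\Omega^2$ on $[0,T]$ with vanishing Dirichlet boundary conditions, and $\frac12S_G[\partial V]=\partial_\mu V\big[\frac{\Omega T-\tanh\Omega T}{4\Omega^3}\big]^{\mu\nu}\partial_\nu V$. For every $T>0$ with $\det\frac{\sinh^2\Omega T}{\Omega^2T^2}\ne0$, $\mathcal G$ is its string-inspired Green function: for continuous $f$, $u(t)=\int_0^T\mathcal G(t,s)f(s)\,ds$ solves $-\frac12u''+2\Omega^2u=f-\frac1T\int_0^Tf$, $u(0)=u(T)$, $\int_0^Tu=0$; and $S_{\mathcal G}[\partial V]=0$. (2) $K(x,x;T)=P(T)\,\big(Z^G_N(T)+O(T^{N+1})\big)$. That is, to all orders $K(x,x;T)=P(T)\,e^{-\int dt\sum_{k\ge3}W_{(k)}}e^{\frac12S_G[\eta]}|_{\eta=\partial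 V}$. (3) There is a function $\Sigma$ such that, for all $T>0$ with $\det\frac{\sinh2\Omega T}{2\Omega T}>0$, $$K(x,x;T)=P(T)\,\exp\!\Big(\partial_\mu V\Big[\frac{\Omega T-\tanh\Omega T}{4\Omega^3}\Big]^{\mu\nu}\partial_\nu V\Big)\,\Sigma(x,x;T),\qquad \Sigma(x,x;T)=\sum_{j=0}^Nc_jT^j+O(T^{N+1})\ \text{ for every } N.$$ The factors in front of $\Sigma$ resum all invariants built from $V$, $\partial V$ and $\partial\partial V$: for $j\ge1$ every monomial of $c_j$ contains a derivative of $V$ of order at least $3$, and none contains the undifferentiated $V$; the same holds for $c_j^{SI}$. Moreover $c_0=1$, $c_1=c_2=0$, $$c_3=-\tfrac1{60}\partial_{\mu\mu\nu\nu}V,\qquad c_4=\tfrac1{30}\partial_{\mu\mu\nu}V\,\partial_\nu V-\tfrac1{840}\partial_{\mu\mu\nu\nu\rho\rho}V,$$ $$c_5=\tfrac{17}{5040}\partial_{\mu\mu\nu}V\,\partial_{\nu\rho\rho}V+\tfrac1{840}\partial_{\mu\nu\rho}V\,\partial_{\mu\nu\rho}V+\tfrac1{280}\partial_{\rho\mu\mu\nu\nu}V\,\partial_\rho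 V+\tfrac1{210}\partial_{\mu\nu}V\,\partial_{\rho\rho\mu\nu}V-\tfrac1{15120}\partial_{\mu\mu\nu\nu\rho\rho\sigma\sigma}V.$$ (4) (String-inspired analogue.) $Z_N^{\mathcal G}(T)=1+\sum_{j=0}^Nc_j^{SI}T^j+O(T^{N+1})$ with $c^{SI}_0=c^{SI}_1=c^{SI}_2=0$, $c_3^{SI}=-\frac1{288}\partial_{\mu\mu\nu\nu}V$, $c_4^{SI}=-\frac1{10368}\partial_{\mu\mu\nu\nu\rho\rho}V$, $c_5^{SI}=\frac1{45360}\partial_{\mu\nu\rho}V\,\partial_{\mu\nu\rho}V+\frac1{4320}\partial_{\mu\mu\rho\sigma}V\,\partial_{\rho\sigma}V-\frac1{497664}\partial_{\mu\mu\nu\nu\rho\rho\sigma\sigma}V$; and the string-inspired density agrees with the diagonal heat kernel up to a total divergence, order by order in $T$: $$(4\pi T)^{D/2}\big(K(x,x;T)-P^{SI}(T)\,Z_N^{\mathcal G}(T)\big)=\sum_{n=0}^N\big(\partial_\mu J_n^\mu\big)(x)\,T^n+O(T^{N+1}).$$ -/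

import Mathlib

open Set Filter Topology MeasureTheory Asymptotics Matrix
open scoped ContDiff

noncomputable section

namespace Worldline

/-- `D`-dimensional Euclidean space. -/
abbrev E (D : ℕ) : Type := EuclideanSpace ℝ (Fin D)

/-- The partial derivative `∂_{μ₁ ⋯ μ_k} f (x)`. -/
def pd {D k : ℕ} (f : E D → ℝ) (x : E D) (μ : Fin k → Fin D) : ℝ :=
  iteratedFDeriv ℝ k f x (fun i => EuclideanSpace.single (μ i) (1 : ℝ))

/-- The vector `∂_μ V(x)`. -/
def grad {D : ℕ} (V : E D → ℝ) (x : E D) : Fin D → ℝ := fun μ => pd V x ![μ]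

/-- The matrix `∂_{μν} V(x)`. -/
def hess {D : ℕ} (V : E D → ℝ) (x : E D) : Matrix (Fin D) (Fin D) ℝ :=
  Matrix.of fun μ ν => pd V x ![μ, ν]

/-! ### The heat kernel -/

/-- `K T y z` is a heat kernel (fundamental solution of the heat equation) of `-∂² + V`:
`∂_T K = ∂_y² K - V(y) K` classically for `T > 0`, and `K T y z → δ(y - z)` weakly as `T → 0+`. -/
structure IsHeatKernel {D : ℕ} (V : E D → ℝ) (K : ℝ → E D → E D → ℝ) : Prop where
  contDiffOn : ∀ z, ContDiffOn ℝ 2 (fun q : ℝ × E D => K q.1 q.2 z) (Ioi 0 ×ˢ univ)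
  heat_eq : ∀ T > 0, ∀ y z,
    HasDerivAt (fun s => K s y z) ((∑ μ, pd (fun y' => K T y' z) y ![μ, μ]) - V y * K T y z) T
  initial : ∀ φ : E D → ℝ, Continuous φ → HasCompactSupport φ → ∀ z,
    Tendsto (fun T => ∫ y, K T y z * φ y) (𝓝[>] 0) (𝓝 (φ z))

/-! ### Functions of the matrix `Ω`, where `2 Ω² = ∂∂V` -/

/-- For an even function `f` of `ω` (possibly with a removable singularity at `ω = 0`, where the
limiting value is `f₀`), real on the real and the imaginary axis: its value as a function of the
real number `w = ω²`. For `w < 0` the root `ω` is imaginary. -/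
def evenFn (f : ℂ → ℂ) (f₀ : ℝ) (w : ℝ) : ℝ :=
  if w = 0 then f₀ else (f ((w : ℂ) ^ (1 / 2 : ℂ))).re

/-- `f(Ω)` for such an even function `f`, where `2 Ω² = ∂∂V(x)`, through the functional calculus of
the symmetric matrix `Ω²`. -/
def ofOmega {D : ℕ} (V : E D → ℝ) (x : E D) (f : ℂ → ℂ) (f₀ : ℝ) : Matrix (Fin D) (Fin D) ℝ :=
  cfc (evenFn f f₀) ((1 / 2 : ℝ) • hess V x)

/-- `sinh(2ΩT) / (2ΩT)`. -/
def detMatD {D : ℕ} (V : E D → ℝ) (x : E D) (T : ℝ) : Matrix (Fin D) (Fin D) ℝ :=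
  ofOmega V x (fun om => Complex.sinh (2 * om * T) / (2 * om * T)) 1

/-- `sinh²(ΩT) / (Ω²T²)`. -/
def detMatSI {D : ℕ} (V : E D → ℝ) (x : E D) (T : ℝ) : Matrix (Fin D) (Fin D) ℝ :=
  ofOmega V x (fun om => Complex.sinh (om * T) ^ 2 / (om ^ 2 * T ^ 2)) 1

/-- `(ΩT - tanh(ΩT)) / (4Ω³)`. -/
def expMat {D : ℕ} (V : E D → ℝ) (x : E D) (T : ℝ) : Matrix (Fin D) (Fin D) ℝ :=
  ofOmega V x (fun om => (om * T - Complex.tanh (om * T)) / (4 * om ^ 3)) (T ^ 3 / 12)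

/-- The worldline Green function `G(t,t')` with Dirichlet boundary conditions on `[0,T]`. -/
def greenD {D : ℕ} (V : E D → ℝ) (x : E D) (T t t' : ℝ) : Matrix (Fin D) (Fin D) ℝ :=
  ofOmega V x
    (fun om => (Complex.sinh (2 * om * t) * Complex.sinh (2 * om * (T - t'))
        - (if t' ≤ t then Complex.sinh (2 * om * T) * Complex.sinh (2 * om * (t - t')) else 0))
      / (om * Complex.sinh (2 * om * T)))
    (-|t - t'| + (t + t') - 2 * t * t' / T)

/-- The worldline Green function `𝒢(t,t')` with string-inspired boundary conditions on `[0,T]`. -/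
def greenSI {D : ℕ} (V : E D → ℝ) (x : E D) (T t t' : ℝ) : Matrix (Fin D) (Fin D) ℝ :=
  ofOmega V x
    (fun om => -(1 / (2 * T * om ^ 2))
      + Complex.cosh (om * (T + 2 * t - 2 * t')) / (2 * om * Complex.sinh (om * T))
      - (if t' ≤ t then Complex.sinh (2 * om * (t - t')) / om else 0))
    (-|t - t'| + (t - t') ^ 2 / T + T / 6)

/-- `G` is the Green function of `Δ = -½ ∂_t² + H` on `[0,T]` with vanishing Dirichlet boundary
conditions: `u(t) = ∫₀ᵀ G(t,s) f(s) ds` solves `-½ u'' + H u = f`, `u(0) = u(T) = 0`. -/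
def IsGreenD {D : ℕ} (T : ℝ) (H : Matrix (Fin D) (Fin D) ℝ)
    (G : ℝ → ℝ → Matrix (Fin D) (Fin D) ℝ) : Prop :=
  ∀ f : ℝ → Fin D → ℝ, Continuous f → ∃ u u' : ℝ → Fin D → ℝ,
    (∀ t ∈ Icc 0 T, u t = ∫ s in (0 : ℝ)..T, G t s *ᵥ f s) ∧ ContinuousOn u (Icc 0 T) ∧
    (∀ t ∈ Ioo 0 T, HasDerivAt u (u' t) t ∧
      HasDerivAt u' ((2 : ℝ) • (H *ᵥ u t - f t)) t) ∧
    u 0 = 0 ∧ u T = 0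

/-- `G` is the Green function of `Δ = -½ ∂_t² + H` on `[0,T]` with string-inspired boundary
conditions: `u(t) = ∫₀ᵀ G(t,s) f(s) ds` solves `-½ u'' + H u = f - (1/T) ∫₀ᵀ f`, `u(0) = u(T)`,
`∫₀ᵀ u = 0`. -/
def IsGreenSI {D : ℕ} (T : ℝ) (H : Matrix (Fin D) (Fin D) ℝ)
    (G : ℝ → ℝ → Matrix (Fin D) (Fin D) ℝ) : Prop :=
  ∀ f : ℝ → Fin D → ℝ, Continuous f → ∃ u u' : ℝ → Fin D → ℝ,
    (∀ t ∈ Icc 0 T, u t = ∫ s in (0 : ℝ)..T, G t s *ᵥ f s) ∧ ContinuousOn u (Icc 0 T) ∧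
    (∀ t ∈ Ioo 0 T, HasDerivAt u (u' t) t ∧
      HasDerivAt u' ((2 : ℝ) • (H *ᵥ u t - (f t - T⁻¹ • ∫ s in (0 : ℝ)..T, f s))) t) ∧
    u 0 = u T ∧ ∫ s in (0 : ℝ)..T, u s = 0

/-! ### The perturbative worldline expansion -/

/-- The quadratic functional `S_bos[η] = ∫∫ η(s)·G(s,s')·η(s') ds ds'` of the source
`η(s) = a + ∑ᵢ pᵢ δ(s - tᵢ)`, with a constant vector `a`, times `tᵢ` and vectors `pᵢ`. -/
def bosAction {D n : ℕ} (T : ℝ) (G : ℝ → ℝ → Matrix (Fin D) (Fin D) ℝ) (a : Fin D → ℝ)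
    (t : Fin n → ℝ) (p : Fin n → Fin D → ℝ) : ℝ :=
  (∫ s in (0 : ℝ)..T, ∫ s' in (0 : ℝ)..T, a ⬝ᵥ (G s s' *ᵥ a))
    + (∑ i, ∫ s in (0 : ℝ)..T, p i ⬝ᵥ (G (t i) s *ᵥ a))
    + (∑ i, ∫ s in (0 : ℝ)..T, a ⬝ᵥ (G s (t i) *ᵥ p i))
    + ∑ i, ∑ j, p i ⬝ᵥ (G (t i) (t j) *ᵥ p j)

/-- The functional derivative `δ/δη_μ(tᵢ)`: the derivative with respect to the strength of a source
`e_μ δ(s - tᵢ)`. -/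
def funDeriv {D n : ℕ} (i : Fin n) (μ : Fin D) (F : (Fin n → Fin D → ℝ) → ℝ) :
    (Fin n → Fin D → ℝ) → ℝ :=
  fun p => lineDeriv ℝ F p (Pi.single i (Pi.single μ 1))

/-- The vertex operator
`W_(k)(tᵢ) = ((-1)^k / k!) ∂_{μ₁⋯μ_k} V(x) δ^k / (δη_{μ₁}(tᵢ) ⋯ δη_{μ_k}(tᵢ))`. -/
def vertexOp {D n : ℕ} (V : E D → ℝ) (x : E D) (k : ℕ) (i : Fin n)
    (F : (Fin n → Fin D → ℝ) → ℝ) : (Fin n → Fin D → ℝ) → ℝ :=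
  fun p => ∑ μ : Fin k → Fin D, ((-1) ^ k / (k.factorial : ℝ)) * pd V x μ *
    (List.ofFn μ).foldr (fun m F' => funDeriv i m F') F p

/-- The term
`((-1)^n / n!) ∫_{[0,T]^n} dt₁⋯dt_n W_(k₁)(t₁) ⋯ W_(k_n)(t_n) exp(½ S_bos[η])` at `η = ∂V(x)`
of the expansion of `exp(-∫ dt ∑_{k ≥ 3} W_(k)(t)) exp(½ S_bos[η])` at `η = ∂V(x)`. -/
def worldlineTerm {D : ℕ} (V : E D → ℝ) (x : E D)
    (G : ℝ → ℝ → ℝ → Matrix (Fin D) (Fin D) ℝ) (T : ℝ) (n : ℕ) (k : Fin n → ℕ) : ℝ :=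
  ((-1) ^ n / (n.factorial : ℝ)) * ∫ t in Icc (0 : Fin n → ℝ) (fun _ => T),
    (List.finRange n).foldr (fun i F => vertexOp V x (k i) i F)
      (fun p => Real.exp (bosAction T (G T) (grad V x) t p / 2)) 0

/-- The partial sum of the expansion of `exp(-∫ dt ∑_{k ≥ 3} W_(k)(t)) exp(½ S_bos[η])` at
`η = ∂V(x)` over all terms with `n` vertices of orders `k₁, …, k_n ≥ 3` such that
`n + (k₁ + ⋯ + k_n) / 2 ≤ N`. -/
def worldlineSum {D : ℕ} (V : E D → ℝ) (x : E D)
    (G : ℝ → ℝ → ℝ → Matrix (Fin D) (Fin D) ℝ) (N : ℕ) (T : ℝ) : ℝ :=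
  ∑ n ∈ Finset.range (N + 1),
    ∑ k ∈ (Fintype.piFinset fun _ : Fin n => Finset.Icc 3 (2 * N)).filter
        (fun k => 2 * n + ∑ i, k i ≤ 2 * N),
      worldlineTerm V x G T n k

/-- `e^{-TV} (4πT)^{-D/2} det^{-1/2}(sinh(2ΩT)/(2ΩT))` at `x`. -/
def prefactorD {D : ℕ} (V : E D → ℝ) (x : E D) (T : ℝ) : ℝ :=
  Real.exp (-T * V x) / (4 * Real.pi * T) ^ ((D : ℝ) / 2) * (detMatD V x T).det ^ (-(1 / 2) : ℝ)

/-- `e^{-TV} (4πT)^{-D/2} det^{-1/2}(sinh²(ΩT)/(Ω²T²))` at `x`. -/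
def prefactorSI {D : ℕ} (V : E D → ℝ) (x : E D) (T : ℝ) : ℝ :=
  Real.exp (-T * V x) / (4 * Real.pi * T) ^ ((D : ℝ) / 2) * (detMatSI V x T).det ^ (-(1 / 2) : ℝ)

/-! ### Differential polynomials in `V` -/

/-- Universal polynomials in the derivatives of a potential; the variable `⟨k, μ⟩` stands for
`∂_{μ₁⋯μ_k} V`. -/
abbrev JetPoly (D : ℕ) : Type := MvPolynomial ((k : ℕ) × (Fin k → Fin D)) ℝ

/-- The value at `x` of a universal polynomial on the derivatives of `V`. -/
def JetPoly.val {D : ℕ} (P : JetPoly D) (V : E D → ℝ) (x : E D) : ℝ :=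
  MvPolynomial.eval (fun i => pd V x i.2) P

/-- Every monomial of `P` contains a derivative of `V` of order at least three, and none contains
the undifferentiated `V`: `P` contains no invariant built from `V`, `∂V` and `∂∂V` only. -/
def JetPoly.HigherOnly {D : ℕ} (P : JetPoly D) : Prop :=
  ∀ m ∈ P.support, (∃ i ∈ m.support, 3 ≤ i.1) ∧ ∀ i ∈ m.support, 1 ≤ i.1

end Worldline

end

open Worldline

noncomputable section

namespace Worldline

open Finset (sum_congr mul_sum sum_mul sum_comm sum_add_distrib sum_sub_distrib prod_congr
  sum_range_succ sum_range_succ' abs_sum_le_sum_abs sum_le_sum sum_eq_zero sum_nonneg sum_eq_single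
  prod_eq_zero sum_div sum_const single_le_sum mul_prod_erase sum_subset)
open Finset.HasAntidiagonal (antidiagonal)
open Function (update update_self update_of_ne)
open intervalIntegral (integral_congr integral_of_le integral_eq_sub_of_hasDerivAt)
open Real (exp pi_pos sqrt_pos sq_sqrt norm_eq_abs)
local notation "𝕀" => Icc (0 : ℝ) 1
local notation "ℛ" => Finset.range
local notation "Smooth" => ContDiff ℝ ∞
local notation:max "ℳ" s:max => MvPolynomial s ℝ
local notation:max "𝒞₂" κ:max => Continuous fun p : ℝ × ℝ => κ (Prod.fst p) (Prod.snd p)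
local notation:50 f:51 "=O₀" k:max => f =O[𝓝[>] 0] fun T : ℝ => T ^ k
set_option hygiene false in
local notation:max "𝕁" n:max => Fin n × Fin D
set_option hygiene false in
local notation "𝒿" => jetAt V x

section

/-! ### Wick's theorem for polynomials -/

section Wick

open MvPolynomial

variable {ι κ : Type*} [Fintype ι] [Fintype κ]

omit [Fintype ι] in
lemma pderiv_comm (α β : ι) (F : ℳ ι) :
    pderiv α (pderiv β F) = pderiv β (pderiv α F) := by
  classical
  ext m
  simp only [coeff_pderiv, Finsupp.add_apply, Finsupp.single_apply]
  rw [add_right_comm]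
  by_cases h : α = β
  · subst h; simp
  · simp only [h, Ne.symm h, if_false]
    push_cast
    ring

/-- The operator `½ C ∂∂`. -/
def contr (C : ι → ι → ℝ) : ℳ ι →ₗ[ℝ] ℳ ι := (1 / 2 : ℝ) • ∑ α, ∑ β, C α β •
    ((pderiv (R := ℝ) α).toLinearMap ∘ₗ (pderiv (R := ℝ) β).toLinearMap)

lemma contr_apply (C : ι → ι → ℝ) (F : ℳ ι) :
    contr C F = (1 / 2 : ℝ) • ∑ α, ∑ β, C α β • pderiv α (pderiv β F) := by
  simp [contr, LinearMap.sum_apply]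

lemma map_contr (φ : ℳ ι →ₗ[ℝ] ℝ) (C : ι → ι → ℝ) (F : ℳ ι) :
    φ (contr C F) = 1 / 2 * ∑ α, ∑ β, C α β * φ (pderiv α (pderiv β F)) := by
  simp [contr_apply]

lemma pderiv_contr (C : ι → ι → ℝ) (γ : ι) (F : ℳ ι) :
    pderiv γ (contr C F) = contr C (pderiv γ F) := by
  simp only [contr_apply, map_sum, Derivation.map_smul, pderiv_comm γ]

lemma contr_comm (C C' : ι → ι → ℝ) (F : ℳ ι) :
    contr C (contr C' F) = contr C' (contr C F) := by
  rw [contr_apply, contr_apply C F]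
  simp only [pderiv_contr, map_smul, map_sum]

lemma contr_X_mul {C : ι → ι → ℝ} (hC : ∀ α β, C α β = C β α) (α : ι) (F : ℳ ι) :
    contr C (X α * F) = X α * contr C F + ∑ β, C α β • pderiv β F := by
  classical
  have h : ∀ (β : ι) (G : ℳ ι), pderiv β (X α * G) = X α * pderiv β G + if β = α then G else 0 := by
    intro β G
    rw [pderiv_mul, pderiv_X, add_comm]
    grind
  simp only [contr_apply, h, map_add, apply_ite (pderiv _), map_zero, smul_add, sum_add_distrib,
    smul_ite, smul_zero, Finset.sum_ite_eq', Finset.sum_ite_irrel, Finset.sum_const_zero,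
    Finset.mem_univ, if_true, mul_smul_comm, mul_sum, hC _ α]
  module

/-- `(½ C ∂∂)^k F / k!` evaluated at `b`. -/
def wk (C : ι → ι → ℝ) (b : ι → ℝ) : ℕ → ℳ ι →ₗ[ℝ] ℝ
  | 0 => (aeval b).toLinearMap
  | k + 1 => (1 / ((k : ℝ) + 1)) • wk C b k ∘ₗ contr C

lemma wk_zero (C : ι → ι → ℝ) (b : ι → ℝ) (F : ℳ ι) :
    wk C b 0 F = eval b F := by rfl

lemma wk_succ' (C : ι → ι → ℝ) (b : ι → ℝ) (k : ℕ) (F : ℳ ι) :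
    wk C b (k + 1) F
      = (1 / (2 * ((k : ℝ) + 1))) * ∑ α, ∑ β, C α β * wk C b k (pderiv α (pderiv β F)) := by
  simp only [wk, LinearMap.smul_apply, LinearMap.comp_apply, map_contr, smul_eq_mul]
  field_simp

lemma wk_contr (C : ι → ι → ℝ) (b : ι → ℝ) (k : ℕ) (F : ℳ ι) :
    wk C b k (contr C F) = ((k : ℝ) + 1) * wk C b (k + 1) F := by
  simp only [wk, LinearMap.smul_apply, LinearMap.comp_apply, smul_eq_mul]
  field_simp

lemma wk_continuousOn {X : Type*} [TopologicalSpace X] {s : Set X} {C : X → ι → ι → ℝ}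
    {b : X → ι → ℝ} (hC : ∀ α β, ContinuousOn (fun x => C x α β) s)
    (hb : ∀ α, ContinuousOn (fun x => b x α) s) (k : ℕ) (F : ℳ ι) :
    ContinuousOn (fun x => wk (C x) (b x) k F) s := by
  induction k generalizing F with
  | zero =>
    simp only [wk_zero]
    have : ContinuousOn b s := continuousOn_pi.2 hb
    exact (MvPolynomial.continuous_eval F).comp_continuousOn this
  | succ k ih =>
    simp only [wk_succ']
    fun_prop

lemma hasDerivAt_eval {b : ℝ → ι → ℝ} {b' : ι → ℝ} {x : ℝ}
    (hb : ∀ α, HasDerivAt (fun y => b y α) (b' α) x) (F : ℳ ι) :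
    HasDerivAt (fun y => eval (b y) F) (∑ α, b' α * eval (b x) (pderiv α F)) x := by
  classical
  induction F using MvPolynomial.induction_on with
  | C a => simpa using hasDerivAt_const x a
  | add p q hp hq =>
    simp only [map_add, mul_add, sum_add_distrib]
    exact hp.add hq
  | mul_X p i hp =>
    simp only [map_mul, eval_X]
    refine (hp.mul (hb i)).congr_deriv ?_
    simp only [Derivation.leibniz, smul_eq_mul, pderiv_X, map_add, map_mul, eval_X, mul_add,
      sum_add_distrib, Pi.single_apply, apply_ite (eval (b x)), map_one, map_zero]
    rw [add_comm, sum_mul]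
    congr 1
    · rw [sum_eq_single i] <;> simp +contextual [eq_comm, mul_comm]
    grind

lemma hasDerivAt_wk {C : ℝ → ι → ι → ℝ} {C' : ι → ι → ℝ} {b : ℝ → ι → ℝ} {b' : ι → ℝ} {x : ℝ}
    (hC : ∀ α β, HasDerivAt (fun y => C y α β) (C' α β) x)
    (hb : ∀ α, HasDerivAt (fun y => b y α) (b' α) x) (k : ℕ) (F : ℳ ι) :
    HasDerivAt (fun y => wk (C y) (b y) (k + 1) F) (wk (C x) (b x) k (contr C' F)
        + ∑ α, b' α * wk (C x) (b x) (k + 1) (pderiv α F)) x := by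
  have step : ∀ (k : ℕ) (Φ : ℳ ι →ₗ[ℝ] ℝ)
      (_ : ∀ F, HasDerivAt (fun y => wk (C y) (b y) k F) (Φ F) x) (F : ℳ ι),
      HasDerivAt (fun y => wk (C y) (b y) (k + 1) F)
        (1 / ((k : ℝ) + 1) * (wk (C x) (b x) k (contr C' F) + Φ (contr (C x) F))) x := by
    intro k Φ h F
    simp only [wk_succ']
    refine ((HasDerivAt.fun_sum fun α _ => HasDerivAt.fun_sum fun β _ =>
      (hC α β).mul (h (pderiv α (pderiv β F)))).const_mul _).congr_deriv ?_
    simp only [map_contr, sum_add_distrib]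
    field_simp
  induction k generalizing F with
  | zero =>
    refine (step 0 (∑ α, b' α • (wk (C x) (b x) 0 ∘ₗ (pderiv (R := ℝ) α).toLinearMap))
      (fun F => (hasDerivAt_eval hb F).congr_deriv (by simp [wk_zero])) F).congr_deriv ?_
    simp [pderiv_contr, wk_contr]
  | succ k ih =>
    refine (step (k + 1) (wk (C x) (b x) k ∘ₗ contr C'
      + ∑ α, b' α • (wk (C x) (b x) (k + 1) ∘ₗ (pderiv (R := ℝ) α).toLinearMap))
      (fun F => (ih F).congr_deriv (by simp)) F).congr_deriv ?_
    simp [contr_comm C', pderiv_contr, wk_contr]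
    simp only [mul_left_comm (b' _), ← mul_sum]
    field_simp
    ring

lemma wk_X_mul_zero (C : ι → ι → ℝ) (b : ι → ℝ) (α : ι) (F : ℳ ι) :
    wk C b 0 (X α * F) = b α * wk C b 0 F := by
  simp [wk_zero]

lemma wk_X_mul_succ {C : ι → ι → ℝ} (hC : ∀ α β, C α β = C β α) (b : ι → ℝ) (α : ι) (k : ℕ)
    (F : ℳ ι) :
    wk C b (k + 1) (X α * F) = b α * wk C b (k + 1) F + ∑ β, C α β * wk C b k (pderiv β F) := by
  refine mul_left_cancel₀ (Nat.cast_add_one_ne_zero k : (k : ℝ) + 1 ≠ 0) ?_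
  induction k generalizing F with
  | zero =>
    rw [← wk_contr, mul_add, mul_left_comm, ← wk_contr, contr_X_mul hC]
    simp [wk_zero]
  | succ k ih =>
    have h := mul_left_cancel₀ (Nat.cast_add_one_ne_zero k) (ih (contr C F))
    rw [← wk_contr, contr_X_mul hC, map_add, h, wk_contr]
    simp only [map_sum, map_smul, smul_eq_mul, pderiv_contr, wk_contr, mul_left_comm (C α _),
      ← mul_sum]
    push_cast
    ring

lemma contr_rename {f : κ → ι} (hf : Function.Injective f) (C : ι → ι → ℝ) (F : ℳ κ) :
    contr C (rename f F) = rename f (contr (fun i j => C (f i) (f j)) F) := by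
  classical
  have h : ∀ (G : ℳ κ) (β : ι), β ∉ Set.range f → pderiv β (rename f G) = 0 := by
    intro G β hβ
    refine pderiv_eq_zero_of_notMem_vars fun h => hβ ?_
    have := vars_rename f G h
    simp_all
  simp only [contr_apply, map_smul, map_sum]
  congr 1
  refine (Fintype.sum_of_injective f hf _ _ (fun α hα => sum_eq_zero fun β _ => ?_) fun a =>
    Fintype.sum_of_injective f hf _ _ (fun β hβ => ?_) fun c => ?_).symm
  · rw [pderiv_comm, h F α hα, map_zero, smul_zero]
  · rw [h F β hβ, map_zero, smul_zero]
  · rw [pderiv_rename hf, pderiv_rename hf]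

lemma wk_rename {f : κ → ι} (hf : Function.Injective f) (C : ι → ι → ℝ) (b : ι → ℝ) (k : ℕ)
    (F : ℳ κ) :
    wk C b k (rename f F) = wk (fun i j => C (f i) (f j)) (b ∘ f) k F := by
  induction k generalizing F with
  | zero => simp [wk_zero, eval_rename]
  | succ k ih => simp [wk, contr_rename hf, ih]

omit [Fintype ι] in
lemma degree_of_mem_support_pderiv {α : ι} {F : ℳ ι} {d : ℕ}
    (h : ∀ m ∈ F.support, m.degree < d + 1) :
    ∀ m ∈ (pderiv α F).support, m.degree < d := by
  classical
  intro m hm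
  rw [mem_support_iff, coeff_pderiv] at hm
  have := h (m + Finsupp.single α 1) (mem_support_iff.2 (left_ne_zero_of_mul hm))
  simp_all

lemma wk_eq_zero (C : ι → ι → ℝ) (b : ι → ℝ) {k : ℕ} {F : ℳ ι}
    (h : ∀ m ∈ F.support, m.degree < 2 * k) : wk C b k F = 0 := by
  induction k generalizing F with
  | zero =>
    have : F = 0 := by
      rw [← support_eq_empty, Finset.eq_empty_iff_forall_notMem]
      simp_all
    simp [this]
  | succ k ih =>
    rw [wk_succ']
    rw [sum_eq_zero, mul_zero]
    refine fun α _ => sum_eq_zero fun β _ => ?_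
    rw [ih, mul_zero]
    exact degree_of_mem_support_pderiv (degree_of_mem_support_pderiv h)

lemma wk_eq_zero_of_totalDegree (C : ι → ι → ℝ) (b : ι → ℝ) {k : ℕ} {F : ℳ ι}
    (h : F.totalDegree < 2 * k) : wk C b k F = 0 :=
  wk_eq_zero C b fun _ hm => (le_totalDegree hm).trans_lt h

lemma wk_smul_cov (c : ℝ) (C : ι → ι → ℝ) (b : ι → ℝ) (k : ℕ) (F : ℳ ι) :
    wk (fun α β => c * C α β) b k F = c ^ k * wk C b k F := by
  induction k generalizing F with
  | zero => simp [wk_zero]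
  | succ k ih =>
    simp only [wk_succ', ih, mul_sum]
    ring

lemma wk_smul_mean (s : ℝ) (C : ι → ι → ℝ) (b : ι → ℝ) (k d : ℕ) {F : ℳ ι}
    (h : F.IsHomogeneous (d + 2 * k)) :
    wk C (fun α => s * b α) k F = s ^ d * wk C b k F := by
  induction k generalizing F with
  | zero =>
    simp only [wk_zero, eval_eq, mul_sum]
    refine sum_congr rfl fun m hm => ?_
    have hd : m.degree = d := by rw [Finsupp.degree_eq_weight_one]; exact h (mem_support_iff.1 hm)
    rw [← hd]
    simp only [mul_pow, Finset.prod_mul_distrib, Finset.prod_pow_eq_pow_sum, Finsupp.degree_apply]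
    ring
  | succ k ih =>
    simp only [wk_succ', mul_sum]
    refine sum_congr rfl fun α _ => sum_congr rfl fun β _ => ?_
    rw [ih]
    · ring
    · exact (h.pderiv (i := β)).pderiv (i := α)

/-- `exp(½ C ∂∂) F` evaluated at `b`: the Gaussian expectation of `F` with mean `b` and
covariance `C`. -/
def wickFun (C : ι → ι → ℝ) (b : ι → ℝ) (F : ℳ ι) : ℝ := ∑ k ∈ ℛ (F.totalDegree + 1), wk C b k F

lemma wickFun_eq_sum (C : ι → ι → ℝ) (b : ι → ℝ) {F : ℳ ι} {K : ℕ}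
    (hK : F.totalDegree < 2 * K) : wickFun C b F = ∑ k ∈ ℛ K, wk C b k F := by
  have key : ∀ K₁ K₂ : ℕ, K₁ ≤ K₂ → F.totalDegree < 2 * K₁ →
      ∑ k ∈ ℛ K₁, wk C b k F = ∑ k ∈ ℛ K₂, wk C b k F := by
    intro K₁ K₂ h h1
    refine sum_subset (by simpa using h) fun k _ hk => ?_
    refine wk_eq_zero_of_totalDegree C b ?_
    simp at hk; omega
  rcases le_total (F.totalDegree + 1) K with h | h
  · exact key _ _ h (by omega)
  · exact (key _ _ h hK).symm

/-- `wickFun` as a linear map. -/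
def W (C : ι → ι → ℝ) (b : ι → ℝ) : ℳ ι →ₗ[ℝ] ℝ where
  toFun := wickFun C b
  map_add' F G := by
    have h := totalDegree_add F G
    have e := fun {H} h => wickFun_eq_sum C b (F := H) (K := F.totalDegree + G.totalDegree + 1) h
    rw [e (by omega), e (by omega), e (by omega), ← sum_add_distrib]
    simp
  map_smul' c F := by
    have h := totalDegree_smul_le c F
    rw [wickFun_eq_sum C b (K := F.totalDegree + 1) (by omega),
      wickFun_eq_sum C b (F := F) (K := F.totalDegree + 1) (by omega), RingHom.id_apply,
      smul_eq_mul, mul_sum]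
    simp

lemma W_eq_sum (C : ι → ι → ℝ) (b : ι → ℝ) {F : ℳ ι} {K : ℕ}
    (hK : F.totalDegree < 2 * K) : W C b F = ∑ k ∈ ℛ K, wk C b k F :=
  wickFun_eq_sum C b hK

lemma W_continuousOn {X : Type*} [TopologicalSpace X] {s : Set X} {C : X → ι → ι → ℝ}
    {b : X → ι → ℝ} (hC : ∀ α β, ContinuousOn (fun x => C x α β) s)
    (hb : ∀ α, ContinuousOn (fun x => b x α) s) (F : ℳ ι) :
    ContinuousOn (fun x => W (C x) (b x) F) s :=
  continuousOn_finsetSum (ℛ (F.totalDegree + 1)) fun k _ => wk_continuousOn hC hb k F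

lemma W_C (C : ι → ι → ℝ) (b : ι → ℝ) (a : ℝ) : W C b (MvPolynomial.C a) = a := by
  rw [W_eq_sum (K := 1) _ _ (by simp)]
  simp [wk_zero]

lemma W_one (C : ι → ι → ℝ) (b : ι → ℝ) : W C b 1 = 1 := W_C C b 1

lemma W_rename {f : κ → ι} (hf : Function.Injective f) (C : ι → ι → ℝ) (b : ι → ℝ) (F : ℳ κ) :
    W C b (rename f F) = W (fun i j => C (f i) (f j)) (b ∘ f) F := by
  rw [W_eq_sum (K := F.totalDegree + 1) _ _ ((totalDegree_rename_le f F).trans_lt (by omega)),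
    W_eq_sum (K := F.totalDegree + 1) _ _ (by omega)]
  exact sum_congr rfl fun k _ => wk_rename hf C b k F

omit [Fintype ι] in
lemma totalDegree_pderiv_le (α : ι) (F : ℳ ι) : (pderiv α F).totalDegree ≤ F.totalDegree := by
  refine Finset.sup_le fun m hm => ?_
  have := degree_of_mem_support_pderiv (α := α) (F := F) (d := F.totalDegree)
    (fun m hm => Nat.lt_succ_of_le (le_totalDegree hm)) m hm
  exact this.le

/-- Gaussian integration by parts. -/
lemma W_X_mul {C : ι → ι → ℝ} (hC : ∀ α β, C α β = C β α) (b : ι → ℝ) (α : ι) (F : ℳ ι) :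
    W C b (X α * F) = b α * W C b F + ∑ β, C α β * W C b (pderiv β F) := by
  have h1 : (X α * F).totalDegree ≤ 1 + F.totalDegree :=
    (totalDegree_mul _ _).trans (by rw [totalDegree_X])
  have h2 := fun β => totalDegree_pderiv_le β F
  rw [W_eq_sum (K := F.totalDegree + 1 + 1) _ _ (by omega),
    W_eq_sum (F := F) (K := F.totalDegree + 1 + 1) _ _ (by omega)]
  have h3 : ∀ β, W C b (pderiv β F) = ∑ k ∈ ℛ (F.totalDegree + 1),
      wk C b k (pderiv β F) := fun β => W_eq_sum _ _ (by have := h2 β; omega)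
  simp only [h3, mul_sum]
  rw [sum_comm, sum_range_succ', sum_range_succ' (fun k => b α * wk C b k F), wk_X_mul_zero]
  simp only [wk_X_mul_succ hC, sum_add_distrib]
  ring

lemma hasDerivAt_W {C : ℝ → ι → ι → ℝ} {C' : ι → ι → ℝ} {b : ℝ → ι → ℝ} {b' : ι → ℝ} {x : ℝ}
    (hC : ∀ α β, HasDerivAt (fun y => C y α β) (C' α β) x)
    (hb : ∀ α, HasDerivAt (fun y => b y α) (b' α) x) (F : ℳ ι) :
    HasDerivAt (fun y => W (C y) (b y) F)
      (1 / 2 * (∑ α, ∑ β, C' α β * W (C x) (b x) (pderiv α (pderiv β F)))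
        + ∑ α, b' α * W (C x) (b x) (pderiv α F)) x := by
  have h2 := fun β => totalDegree_pderiv_le β F
  have h3 : (contr C' F).totalDegree ≤ F.totalDegree := by
    rw [contr_apply]
    exact (totalDegree_smul_le _ _).trans (totalDegree_finsetSum_le fun α _ =>
      totalDegree_finsetSum_le fun β _ => (totalDegree_smul_le _ _).trans
        ((totalDegree_pderiv_le _ _).trans (h2 β)))
  have e : ∀ (C : ι → ι → ℝ) (b : ι → ℝ) {G : ℳ ι}
      (_ : G.totalDegree ≤ F.totalDegree), W C b G = eval b G
        + ∑ k ∈ ℛ (F.totalDegree + 1), wk C b (k + 1) G := by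
    intro C b G hG
    rw [W_eq_sum (K := F.totalDegree + 1 + 1) _ _ (by omega), sum_range_succ', wk_zero, add_comm]
  rw [← map_contr (W _ _)]
  simp only [e _ _ le_rfl, e _ _ (h2 _), W_eq_sum (K := F.totalDegree + 1) _ _ (h3.trans_lt (by omega))]
  refine ((hasDerivAt_eval hb F).add (HasDerivAt.fun_sum fun k _ =>
    hasDerivAt_wk hC hb k F)).congr_deriv ?_
  simp only [sum_add_distrib, mul_add, mul_sum]
  rw [sum_comm]
  ring

lemma hasDerivAt_W_polynomial {C : ℝ → ι → ι → ℝ} {C' : ι → ι → ℝ} {b : ℝ → ι → ℝ} {b' : ι → ℝ}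
    {c : ℝ → ℝ} {c' x : ℝ} (hC : ∀ α β, HasDerivAt (fun y => C y α β) (C' α β) x)
    (hb : ∀ α, HasDerivAt (fun y => b y α) (b' α) x) (hc : HasDerivAt c c' x)
    (p : Polynomial (ℳ ι)) :
    HasDerivAt (fun y => W (C y) (b y) (p.eval (MvPolynomial.C (c y))))
      (1 / 2 * (∑ α, ∑ β, C' α β * W (C x) (b x)
          (pderiv α (pderiv β (p.eval (MvPolynomial.C (c x))))))
        + ∑ α, b' α * W (C x) (b x) (pderiv α (p.eval (MvPolynomial.C (c x))))
        + c' * W (C x) (b x) (p.derivative.eval (MvPolynomial.C (c x)))) x := by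
  have hCm : ∀ (Λ : ℳ ι →ₗ[ℝ] ℝ) (r : ℝ) (F : ℳ ι), Λ (F * MvPolynomial.C r) = r * Λ F := by
    intro Λ r F
    rw [mul_comm, MvPolynomial.C_mul', map_smul, smul_eq_mul]
  induction p using Polynomial.induction_on' with
  | add p q hp hq =>
    simp only [Polynomial.eval_add, map_add, mul_add, sum_add_distrib]
    exact (hp.add hq).congr_deriv (by ring)
  | monomial m F =>
    simp only [Polynomial.eval_monomial, Polynomial.derivative_monomial, ← map_pow, hCm (W _ _)]
    have hpd : ∀ (α : ι) (r : ℝ) (G : ℳ ι),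
        pderiv α (G * MvPolynomial.C r) = pderiv α G * MvPolynomial.C r := by
      intro α r G; rw [mul_comm, pderiv_C_mul, mul_comm]
    simp only [hpd, hCm (W _ _)]
    refine ((hc.pow m).mul (hasDerivAt_W hC hb F)).congr_deriv ?_
    have : W (C x) (b x) (F * (m : ℳ ι)) = m * W (C x) (b x) F := by
      rw [← hCm (W (C x) (b x))]; simp
    simp only [this, mul_left_comm _ (c x ^ m), ← mul_sum, Pi.pow_apply]
    ring

end Wick

end

section

/-! ### Vertices -/

section Vertices

open MvPolynomial

variable {D n : ℕ}

/-- The polynomial `A` in the variables of the `i`-th point. -/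
def vtx (i : Fin n) (A : ℳ (Fin D)) : ℳ (𝕁 n) := rename (Prod.mk i) A

/-- The product of the polynomials `A i` in the variables of the `i`-th point. -/
def pt (A : Fin n → ℳ (Fin D)) : ℳ (𝕁 n) := ∏ i, vtx i (A i)

lemma pderiv_vtx (i : Fin n) (ν : Fin D) (A : ℳ (Fin D)) :
    pderiv (i, ν) (vtx i A) = vtx i (pderiv ν A) :=
  pderiv_rename (Prod.mk_right_injective i) ν A

lemma pderiv_vtx_of_ne {i j : Fin n} (h : i ≠ j) (ν : Fin D) (A : ℳ (Fin D)) :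
    pderiv (i, ν) (vtx j A) = 0 := by
  classical
  refine pderiv_eq_zero_of_notMem_vars fun hm => ?_
  have := vars_rename _ _ hm
  simp_all

lemma pderiv_prod_vtx_erase (A : Fin n → ℳ (Fin D)) (i : Fin n) (ν : Fin D) :
    pderiv (i, ν) (∏ j ∈ Finset.univ.erase i, vtx j (A j)) = 0 := by
  refine Finset.prod_induction _ (fun G => pderiv (i, ν) G = 0) ?_ pderiv_one ?_
  · simp_all
  · intro j hj; exact pderiv_vtx_of_ne (Finset.ne_of_mem_erase hj).symm _ _

lemma pt_update (A : Fin n → ℳ (Fin D)) (i : Fin n) (B : ℳ (Fin D)) :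
    pt (update A i B) = vtx i B * ∏ j ∈ Finset.univ.erase i, vtx j (A j) := by
  rw [pt, ← mul_prod_erase _ _ (Finset.mem_univ i), update_self]
  congr 1
  refine prod_congr rfl fun j hj => ?_
  simp_all

lemma pderiv_pt (A : Fin n → ℳ (Fin D)) (i : Fin n) (ν : Fin D) :
    pderiv (i, ν) (pt A) = pt (update A i (pderiv ν (A i))) := by
  rw [pt_update, pt, ← mul_prod_erase _ _ (Finset.mem_univ i), pderiv_mul, pderiv_vtx,
    pderiv_prod_vtx_erase, mul_zero, add_zero]

/-- The embedding of the variables of `n` points that skips the `i`-th of `n + 1` points. -/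
def skip (i : Fin (n + 1)) : 𝕁 n → 𝕁 (n + 1) := Prod.map i.succAbove id

lemma skip_injective (i : Fin (n + 1)) : Function.Injective (skip (D := D) i) :=
  Function.Injective.prodMap Fin.succAbove_right_injective Function.injective_id

lemma pt_succAbove (i : Fin (n + 1)) (A : Fin (n + 1) → ℳ (Fin D)) :
    pt A = vtx i (A i) * rename (skip i) (pt fun j => A (i.succAbove j)) := by
  rw [pt, Fin.prod_univ_succAbove _ i, pt, map_prod]
  congr 1
  refine prod_congr rfl fun j _ => ?_
  rw [vtx, vtx, rename_rename]
  rfl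

lemma pderiv_rename_skip (i : Fin (n + 1)) (ν : Fin D) (F : ℳ (𝕁 n)) :
    pderiv (i, ν) (rename (skip i) F) = 0 := by
  classical
  refine pderiv_eq_zero_of_notMem_vars fun hm => ?_
  have := vars_rename _ _ hm
  simp only [Finset.mem_image, skip] at this
  simp_all

lemma wk_vtx_mul {C : 𝕁 n → 𝕁 n → ℝ} (hC : ∀ α β, C α β = C β α)
    {i : Fin n} (hi : ∀ ν β, C (i, ν) β = 0) (b : 𝕁 n → ℝ) (k : ℕ)
    (A : ℳ (Fin D)) (F : ℳ (𝕁 n)) :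
    wk C b k (vtx i A * F) = eval (fun ν => b (i, ν)) A * wk C b k F := by
  induction A using MvPolynomial.induction_on with
  | C a => rw [vtx, rename_C, C_mul', map_smul, eval_C, smul_eq_mul]
  | add p q hp hq =>
    simp only [vtx, map_add, add_mul] at *
    rw [hp, hq]
  | mul_X p μ hp =>
    have e : vtx i (p * X μ) * F = X (i, μ) * (vtx i p * F) := by
      simp only [vtx, map_mul, rename_X]; ring
    rw [e]
    have : wk C b k (X (i, μ) * (vtx i p * F)) = b (i, μ) * wk C b k (vtx i p * F) := by
      cases k with
      | zero => exact wk_X_mul_zero _ _ _ _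
      | succ k => rw [wk_X_mul_succ hC]; simp [hi]
    rw [this, hp, map_mul, eval_X]; ring

/-- Integrating out a quadratic vertex at the `i`-th point. -/
lemma W_quadratic_mul {C : 𝕁 (n + 1) → 𝕁 (n + 1) → ℝ}
    (hC : ∀ α β, C α β = C β α) (i : Fin (n + 1)) (b : 𝕁 (n + 1) → ℝ)
    (v₀ : ℝ) (a : Fin D → ℝ) (H : Fin D → Fin D → ℝ) (hH : ∀ μ ν, H μ ν = H ν μ)
    (F : ℳ (𝕁 n)) :
    W C b (vtx i (MvPolynomial.C v₀ + ∑ μ, MvPolynomial.C (a μ) * X μ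
        + ∑ μ, ∑ ν, MvPolynomial.C (H μ ν / 2) * (X μ * X ν)) * rename (skip i) F)
      = (v₀ + ∑ μ, a μ * b (i, μ) + 1 / 2 * (∑ μ, ∑ ν, H μ ν * (b (i, μ) * b (i, ν)))
          + 1 / 2 * (∑ μ, ∑ ν, H μ ν * C (i, μ) (i, ν)))
          * W (fun p q => C (skip i p) (skip i q)) (b ∘ skip i) F
        + (∑ p, (∑ μ, (a μ + ∑ ν, H μ ν * b (i, ν)) * C (i, μ) (skip i p))
          * W (fun p q => C (skip i p) (skip i q)) (b ∘ skip i) (pderiv p F))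
        + 1 / 2 * (∑ p, ∑ q, (∑ μ, ∑ ν, H μ ν * C (i, μ) (skip i p) * C (i, ν) (skip i q))
          * W (fun p q => C (skip i p) (skip i q)) (b ∘ skip i) (pderiv p (pderiv q F))) := by
  classical
  set R : ℳ (𝕁 n) → ℳ (𝕁 (n + 1)) := fun G => rename (skip i) G with hR
  set w : ℳ (𝕁 n) →ₗ[ℝ] ℝ := W (fun p q => C (skip i p) (skip i q)) (b ∘ skip i)
  have hWR : ∀ G, W C b (R G) = w G := fun G => W_rename (skip_injective i) C b G
  have hd : ∀ p G, pderiv (skip i p) (R G) = R (pderiv p G) := fun p G =>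
    pderiv_rename (skip_injective i) _ _
  have hsum : ∀ (f : 𝕁 (n + 1) → ℝ) (hf : ∀ ν, f (i, ν) = 0), ∑ β, f β = ∑ p, f (skip i p) := by
    intro f hf
    rw [Fintype.sum_prod_type, Fin.sum_univ_succAbove _ i, Fintype.sum_prod_type]
    simp [hf, skip]
  set d : Fin D → ℳ (𝕁 n) →ₗ[ℝ] ℳ (𝕁 n) := fun μ =>
    ∑ p, C (i, μ) (skip i p) • (pderiv (R := ℝ) p).toLinearMap with hdd
  have wd : ∀ μ G, w (d μ G) = ∑ p, C (i, μ) (skip i p) * w (pderiv p G) := by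
    simp [hdd, LinearMap.sum_apply]
  have h1 : ∀ μ G, W C b (X (i, μ) * R G) = b (i, μ) * w G + w (d μ G) := by
    intro μ G
    rw [W_X_mul hC, hWR, wd, hsum]
    · simp only [hd, hWR]
    · intro ν; simp [hR, pderiv_rename_skip]
  have h2 : ∀ μ ν, W C b (X (i, μ) * (X (i, ν) * R F)) = b (i, μ) * (b (i, ν) * w F + w (d ν F))
        + (C (i, μ) (i, ν) * w F + (b (i, ν) * w (d μ F) + w (d ν (d μ F)))) := by
    intro μ ν
    have e : ∀ β, W C b (pderiv β (X (i, ν) * R F))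
        = (if β = (i, ν) then w F else 0) + W C b (X (i, ν) * pderiv β (R F)) := by
      intro β
      rw [pderiv_mul, map_add, pderiv_X]
      grind
    rw [W_X_mul hC, h1]
    simp only [e, mul_add, sum_add_distrib, mul_ite, mul_zero, Finset.sum_ite_eq',
      Finset.mem_univ, if_true]
    rw [hsum]
    · simp only [hd, h1, mul_add, sum_add_distrib]
      congr 2
      rw [wd μ F, mul_sum]
      congr 1
      · exact sum_congr rfl fun _ _ => by ring
      · simp [hdd, LinearMap.sum_apply]
    · intro ν'; simp [hR, pderiv_rename_skip]
  have e : vtx i (MvPolynomial.C v₀ + ∑ μ, MvPolynomial.C (a μ) * X μ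
        + ∑ μ, ∑ ν, MvPolynomial.C (H μ ν / 2) * (X μ * X ν)) * rename (skip i) F
      = v₀ • R F + ∑ μ, a μ • (X (i, μ) * R F)
        + ∑ μ, ∑ ν, (H μ ν / 2) • (X (i, μ) * (X (i, ν) * R F)) := by
    simp only [vtx, map_add, map_sum, map_mul, rename_C, rename_X, add_mul, sum_mul,
      ← C_mul', mul_assoc, hR]
  have s1 : ∑ p, (∑ μ, (a μ + ∑ ν, H μ ν * b (i, ν)) * C (i, μ) (skip i p)) * w (pderiv p F)
      = ∑ μ, (a μ + ∑ ν, H μ ν * b (i, ν)) * w (d μ F) := by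
    simp only [wd, mul_sum, sum_mul, mul_assoc]
    exact sum_comm
  have s2 : ∑ p, ∑ q, (∑ μ, ∑ ν, H μ ν * C (i, μ) (skip i p) * C (i, ν) (skip i q))
        * w (pderiv p (pderiv q F)) = ∑ μ, ∑ ν, H μ ν * w (d ν (d μ F)) := by
    have h : ∀ μ ν, w (d ν (d μ F)) = ∑ p, ∑ q, C (i, μ) (skip i p) * (C (i, ν) (skip i q)
        * w (pderiv q (pderiv p F))) := fun μ ν => by
      simp [hdd, LinearMap.sum_apply, mul_sum]
    simp only [h, mul_sum, sum_mul]
    rw [sum_congr rfl fun p _ => sum_comm, sum_comm]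
    refine sum_congr rfl fun μ _ => ?_
    rw [sum_congr rfl fun p _ => sum_comm, sum_comm]
    refine sum_congr rfl fun ν _ => sum_congr rfl fun p _ => sum_congr rfl fun q _ => ?_
    rw [pderiv_comm p q]
    ring
  have s3 : ∑ μ, ∑ ν, H μ ν * (b (i, μ) * w (d ν F)) = ∑ μ, ∑ ν, H μ ν * (b (i, ν) * w (d μ F)) := by
    rw [sum_comm]
    simp only [hH]
  rw [e, s1, s2]
  simp only [map_add, map_sum, map_smul, smul_eq_mul, h1, h2, hWR]
  clear_value w d
  simp only [mul_add, add_mul, sum_add_distrib, div_mul_eq_mul_div, ← sum_div, s3, sum_mul, mul_assoc]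
  ring

end Vertices

end

section

/-! ### Jets -/

section Jets

open MvPolynomial

variable {D n : ℕ}


abbrev JetVar (D : ℕ) : Type := (k : ℕ) × (Fin k → Fin D)

/-- A jet: values for all partial derivatives at a point. -/
abbrev Jet (D : ℕ) : Type := JetVar D → ℝ

/-- Symmetry of the partial derivatives. -/
def Jet.Sym (v : Jet D) : Prop :=
  ∀ (k : ℕ) (μ : Fin k → Fin D) (σ : Equiv.Perm (Fin k)), v ⟨k, μ ∘ σ⟩ = v ⟨k, μ⟩

def consIdx (ν : Fin D) (i : JetVar D) : JetVar D := ⟨i.1 + 1, Fin.cons ν i.2⟩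

def Jet.shift (v : Jet D) (ν : Fin D) : Jet D := fun i => v (consIdx ν i)

def Jet.val0 (v : Jet D) : ℝ := v ⟨0, Fin.elim0⟩

/-- The jet of a function at a point. -/
def jetAt (V : E D → ℝ) (x : E D) : Jet D := fun i => pd V x i.2

lemma Jet.Sym.shift {v : Jet D} (hv : v.Sym) (ν : Fin D) : (v.shift ν).Sym := by
  intro k μ σ
  have := hv (k + 1) (Fin.cons ν μ) (Equiv.Perm.decomposeFin.symm (0, σ))
  simp only [Jet.shift, consIdx]
  rw [← this]
  congr 2
  funext i
  refine Fin.cases ?_ (fun j => ?_) i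
  · simp
  · simp

/-- The homogeneous part of degree `k` of the Taylor polynomial. -/
def piece (v : Jet D) (k : ℕ) : ℳ (Fin D) :=
  ∑ μ : Fin k → Fin D, MvPolynomial.C (v ⟨k, μ⟩ / (k.factorial : ℝ)) * ∏ i, X (μ i)

lemma piece_zero (v : Jet D) : piece v 0 = MvPolynomial.C v.val0 := by
  simp [piece, Jet.val0]
  congr 2

lemma nsmul_piece_succ (v : Jet D) (k : ℕ) :
    (k + 1) • piece v (k + 1) = ∑ ρ, X ρ * piece (v.shift ρ) k := by
  simp only [piece, mul_sum, Finset.smul_sum]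
  rw [← (Fin.consEquiv fun _ => Fin D).sum_comp, Fintype.sum_prod_type]
  refine sum_congr rfl fun ρ _ => sum_congr rfl fun μ _ => ?_
  simp only [Fin.consEquiv, Equiv.coe_fn_mk, Fin.prod_univ_succ, Fin.cons_zero, Fin.cons_succ,
    Jet.shift, consIdx, Nat.factorial_succ]
  rw [mul_left_comm (X ρ), ← smul_mul_assoc, nsmul_eq_mul, ← map_natCast C, ← map_mul]
  congr 2
  push_cast
  field_simp

lemma piece_isHomogeneous (v : Jet D) (k : ℕ) : (piece v k).IsHomogeneous k := by
  refine IsHomogeneous.sum _ _ _ fun μ _ => IsHomogeneous.C_mul ?_ _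
  simpa using IsHomogeneous.prod Finset.univ _ (fun _ => 1) fun i _ => isHomogeneous_X ℝ (μ i)

lemma Jet.Sym.shift_comm {v : Jet D} (hv : v.Sym) (μ ν : Fin D) :
    (v.shift μ).shift ν = (v.shift ν).shift μ := by
  funext i
  simp only [Jet.shift, consIdx]
  rw [← hv _ _ (Equiv.swap 0 1)]
  congr 2
  funext j
  refine j.cases (by simp) fun j => j.cases (by simp) fun j => ?_
  simp [Equiv.swap_apply_of_ne_of_ne (Fin.succ_ne_zero _) (Fin.succ_succ_ne_one j)]

lemma pderiv_piece_succ {v : Jet D} (hv : v.Sym) (ν : Fin D) (k : ℕ) :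
    pderiv ν (piece v (k + 1)) = piece (v.shift ν) k := by
  induction k generalizing v with
  | zero =>
    have h := nsmul_piece_succ v 0
    rw [zero_add, one_smul] at h
    simp [h, piece_zero, pderiv_X, Pi.single_apply]
  | succ k ih =>
    refine smul_right_injective _ (Nat.succ_ne_zero (k + 1)) ?_
    simp only [← map_nsmul, nsmul_piece_succ, map_sum, pderiv_mul, ih (hv.shift _), pderiv_X,
      hv.shift_comm _ ν, Pi.single_apply, ite_mul, one_mul, zero_mul, sum_add_distrib]
    rw [← nsmul_piece_succ, succ_nsmul' _ (k + 1)]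
    simp

def taylorP (v : Jet D) (M : ℕ) : ℳ (Fin D) := ∑ k ∈ ℛ (M + 1), piece v k

lemma pderiv_taylorP_succ {v : Jet D} (hv : v.Sym) (ν : Fin D) (M : ℕ) :
    pderiv ν (taylorP v (M + 1)) = taylorP (v.shift ν) M := by
  rw [taylorP, sum_range_succ', map_add, piece_zero, pderiv_C, add_zero, map_sum, taylorP]
  exact sum_congr rfl fun k _ => pderiv_piece_succ hv ν k

lemma eval_zero_piece (v : Jet D) (k : ℕ) : eval 0 (piece v (k + 1)) = 0 := by
  rw [piece, map_sum]
  simp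

lemma eval_zero_taylorP (v : Jet D) (M : ℕ) : eval 0 (taylorP v M) = v.val0 := by
  rw [taylorP, sum_range_succ', map_add, map_sum, piece_zero, eval_C]
  rw [sum_eq_zero fun k _ => eval_zero_piece v k, zero_add]

def addDeriv (α : 𝕁 n) (v : Fin n → Jet D) : Fin n → Jet D := update v α.1 ((v α.1).shift α.2)

/-- `(½ C ∂∂)^k / k!` on a product of functions of one point each, at coinciding points. -/
def wj (C : 𝕁 n → 𝕁 n → ℝ) : ℕ → (Fin n → Jet D) → ℝ
  | 0, v => ∏ i, (v i).val0
  | k + 1, v => (1 / (2 * ((k : ℝ) + 1))) * ∑ α, ∑ β, C α β * wj C k (addDeriv α (addDeriv β v))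

lemma wk_taylorP (C : 𝕁 n → 𝕁 n → ℝ) (k : ℕ) (v : Fin n → Jet D)
    (hv : ∀ i, (v i).Sym) (M : Fin n → ℕ) (hM : ∀ i, 2 * k ≤ M i) :
    wk C 0 k (pt fun i => taylorP (v i) (M i)) = wj C k v := by
  induction k generalizing v M with
  | zero =>
    rw [wk_zero, wj, pt, map_prod]
    refine prod_congr rfl fun i _ => ?_
    rw [vtx, eval_rename]
    exact eval_zero_taylorP _ _
  | succ k ih =>
    rw [wk_succ', wj]
    congr 1
    have step : ∀ (α : 𝕁 n) (v : Fin n → Jet D) (_ : ∀ i, (v i).Sym) (M : Fin n → ℕ)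
        (_ : 1 ≤ M α.1), pderiv α (pt fun i => taylorP (v i) (M i))
          = pt fun i => taylorP (addDeriv α v i) (update M α.1 (M α.1 - 1) i) := by
      rintro ⟨i, ν⟩ v hv M hM
      rw [pderiv_pt]
      congr 1
      funext j
      by_cases h : j = i
      · subst h
        obtain ⟨m, hm⟩ := Nat.exists_eq_add_of_le hM
        simp only [addDeriv, update_self]
        simp only at hm
        rw [hm, add_comm 1 m, pderiv_taylorP_succ (hv _)]
        simp
      · simp [addDeriv, h]
    have hsym : ∀ (α : 𝕁 n) (v : Fin n → Jet D) (_ : ∀ i, (v i).Sym),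
        ∀ i, (addDeriv α v i).Sym := by
      rintro ⟨i, ν⟩ v hv j
      by_cases h : j = i
      · subst h; simpa [addDeriv] using (hv j).shift ν
      · simpa [addDeriv, h] using hv j
    refine sum_congr rfl fun α _ => sum_congr rfl fun β _ => ?_
    have hβ : 1 ≤ M β.1 := by have := hM β.1; omega
    rw [step β v hv M hβ, step α _ (hsym β v hv), ih _ (hsym α _ (hsym β v hv))]
    · grind
    grind

/-! ### The jet of a smooth function -/

def dd (ν : Fin D) (V : E D → ℝ) : E D → ℝ := fun y => pd V y ![ν]

lemma dd_eq (ν : Fin D) (V : E D → ℝ) (x : E D) :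
    dd ν V x = fderiv ℝ V x (EuclideanSpace.single ν 1) := by
  simp [dd, pd, iteratedFDeriv_one_apply]

section

variable {V : E D → ℝ} (hV : Smooth V)
include hV

lemma contDiff_dd (ν : Fin D) : Smooth (dd ν V) := by
  have : dd ν V = fun x => fderiv ℝ V x (EuclideanSpace.single ν 1) := funext (dd_eq ν V)
  rw [this]
  fun_prop

lemma contDiff_pd {k : ℕ} (μ : Fin k → Fin D) :
    Smooth fun x => pd V x μ := by
  have h : Smooth (iteratedFDeriv ℝ k V) :=
    hV.iteratedFDeriv_right (m := ∞) (i := k) (by exact_mod_cast le_top)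
  exact (ContinuousMultilinearMap.apply ℝ (fun _ : Fin k => E D) ℝ
    (fun i => EuclideanSpace.single (μ i) (1 : ℝ))).contDiff.comp h

lemma pd_cons (x : E D) {k : ℕ} (μ : Fin k → Fin D)
    (ν : Fin D) : pd V x (Fin.cons ν μ : Fin (k + 1) → Fin D) = dd ν (fun y => pd V y μ) x := by
  rw [dd_eq, pd, iteratedFDeriv_succ_apply_left]
  have hd : DifferentiableAt ℝ (iteratedFDeriv ℝ k V) x :=
    (hV.differentiable_iteratedFDeriv (m := k) (by exact_mod_cast WithTop.coe_lt_top _)) x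
  exact DFunLike.congr_fun ((ContinuousMultilinearMap.apply ℝ (fun _ : Fin k => E D) ℝ fun i =>
    EuclideanSpace.single (μ i) (1 : ℝ)).hasFDerivAt.comp x hd.hasFDerivAt).fderiv.symm _

lemma dd_comm (μ ν : Fin D) :
    dd μ (dd ν V) = dd ν (dd μ V) := by
  have h : ∀ (μ ν : Fin D) (x : E D), dd μ (dd ν V) x
      = fderiv ℝ (fderiv ℝ V) x (EuclideanSpace.single μ 1) (EuclideanSpace.single ν 1) := by
    intro μ ν x
    rw [dd_eq, funext (dd_eq ν V), fderiv_clm_apply ((hV.fderiv_right (m := ∞)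
      (by simp)).differentiable (by simp) x) (by fun_prop)]
    simp
  funext x
  rw [h, h]
  exact (hV.contDiffAt.isSymmSndFDerivAt (by
    rw [minSmoothness_of_isRCLikeNormedField]
    exact (WithTop.coe_le_coe.2 le_top : ((2 : ℕ∞) : WithTop ℕ∞) ≤ ∞))).eq _ _

lemma jetAt_dd (x : E D) (ν : Fin D) :
    jetAt (dd ν V) x = (𝒿).shift ν := by
  funext ⟨k, μ⟩
  change pd (dd ν V) x μ = pd V x (Fin.cons ν μ : Fin (k + 1) → Fin D)
  induction k generalizing x with
  | zero =>
    rw [show (Fin.cons ν μ : Fin 1 → Fin D) = ![ν] by funext i; fin_cases i; rfl]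
    rfl
  | succ k ih =>
    rw [← Fin.cons_self_tail μ, pd_cons (contDiff_dd hV ν), funext fun y => ih y (Fin.tail μ),
      funext fun y => pd_cons hV y _ _, dd_comm (contDiff_pd hV _), pd_cons hV]
    congr 1
    funext y
    rw [pd_cons hV]

lemma jetAt_sym (x : E D) : (𝒿).Sym := by
  intro k μ σ
  change pd V x (μ ∘ σ) = pd V x μ
  induction k generalizing x with
  | zero => rfl
  | succ k ih =>
    have hσ : σ ∈ Submonoid.closure (Set.range fun i : Fin k => Equiv.swap i.castSucc i.succ) := by
      rw [Equiv.Perm.mclosure_swap_castSucc_succ]; trivial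
    induction hσ using Submonoid.closure_induction generalizing μ with
    | one => rfl
    | mul σ τ _ _ h1 h2 => rw [Equiv.Perm.coe_mul, ← Function.comp_assoc, h2, h1]
    | mem σ h =>
      obtain ⟨i, rfl⟩ := h
      cases k with
      | zero => exact i.elim0
      | succ k =>
        refine Fin.cases ?_ (fun j => ?_) i
        · have h : ∀ μ ν (ρ : Fin k → Fin D), pd V x (Fin.cons μ (Fin.cons ν ρ : Fin (k + 1) → Fin D)
              : Fin (k + 2) → Fin D) = dd μ (dd ν fun y => pd V y ρ) x := fun μ ν ρ => by
            rw [pd_cons hV]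
            congr 1
            funext y
            exact pd_cons hV y _ _
          have e : μ ∘ Equiv.swap (Fin.castSucc (0 : Fin (k + 1))) (Fin.succ 0)
              = Fin.cons (μ 1) (Fin.cons (μ 0) (Fin.tail (Fin.tail μ)) : Fin (k + 1) → Fin D) := by
            funext i
            exact i.cases (by simp) fun i => i.cases (by simp) fun j => rfl
          rw [e, h, dd_comm (contDiff_pd hV _), ← h, show μ 1 = Fin.tail μ 0 from rfl,
            Fin.cons_self_tail, Fin.cons_self_tail]
        · have e : μ ∘ Equiv.swap (Fin.castSucc j.succ) (Fin.succ j.succ)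
              = Fin.cons (μ 0) (Fin.tail μ ∘ Equiv.swap j.castSucc j.succ) := by
            funext i
            refine i.cases rfl fun i => ?_
            simp only [Function.comp, Fin.cons_succ, Fin.tail, ← Fin.succ_castSucc]
            grind
          rw [e, pd_cons hV, ← Fin.cons_self_tail μ, pd_cons hV]
          simp_all

end

def addD (α : 𝕁 n) (V : Fin n → E D → ℝ) : Fin n → E D → ℝ := update V α.1 (dd α.2 (V α.1))

lemma addD_contDiff {V : Fin n → E D → ℝ} (hV : ∀ i, Smooth (V i)) (α : 𝕁 n) :
    ∀ i, Smooth (addD α V i) := by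
  intro i
  by_cases h : i = α.1
  · subst h; simpa [addD] using contDiff_dd (hV _) _
  · simpa [addD, h] using hV i

lemma addD_comm {V : Fin n → E D → ℝ} (hV : ∀ i, Smooth (V i)) (α β : 𝕁 n) :
    addD α (addD β V) = addD β (addD α V) := by
  funext i
  by_cases h : α.1 = β.1
  · simp only [addD, h, update_self, Function.update_idem]
    rw [dd_comm (hV _)]
  · simp [addD, h, Ne.symm h, Function.update_comm h]

lemma addDeriv_jetAt {V : Fin n → E D → ℝ} (hV : ∀ i, Smooth (V i)) (α : 𝕁 n)
    (x : E D) : addDeriv α (fun i => jetAt (V i) x) = fun i => jetAt (addD α V i) x := by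
  funext i
  by_cases h : i = α.1
  · subst h; simp [addDeriv, addD, jetAt_dd (hV _)]
  · simp [addDeriv, addD, h]

lemma dd_add {f g : E D → ℝ} (hf : Smooth f) (hg : Smooth g) (ν : Fin D) (x : E D) :
    dd ν (fun y => f y + g y) x = dd ν f x + dd ν g x := by
  rw [dd_eq, dd_eq, dd_eq, fderiv_fun_add (hf.differentiable (by simp) x) (hg.differentiable (by simp) x)]
  rfl

lemma dd_sum {κ : Type*} {s : Finset κ} {f : κ → E D → ℝ} (hf : ∀ i ∈ s, Smooth (f i))
    (ν : Fin D) (x : E D) : dd ν (fun y => ∑ i ∈ s, f i y) x = ∑ i ∈ s, dd ν (f i) x := by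
  simp only [dd_eq]
  rw [fderiv_fun_sum fun i hi => (hf i hi).differentiable (by simp) x]
  simp

lemma dd_const_mul {f : E D → ℝ} (hf : Smooth f) (c : ℝ) (ν : Fin D) (x : E D) :
    dd ν (fun y => c * f y) x = c * dd ν f x := by
  rw [dd_eq, dd_eq, fderiv_const_mul (hf.differentiable (by simp) x)]
  rfl

lemma dd_prod {V : Fin n → E D → ℝ} (hV : ∀ i, Smooth (V i)) (ν : Fin D) (x : E D) :
    dd ν (fun y => ∏ i, V i y) x = ∑ i, ∏ j, addD (i, ν) V j x := by
  classical
  rw [dd_eq, fderiv_finsetProd fun i _ => (hV i).differentiable (by simp) x]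
  simp only [_root_.sum_apply, _root_.smul_apply, smul_eq_mul]
  refine sum_congr rfl fun i _ => ?_
  rw [← mul_prod_erase _ _ (Finset.mem_univ i), mul_comm]
  congr 1
  · simp [addD, dd_eq]
  · refine prod_congr rfl fun j hj => ?_
    simp [addD, Finset.ne_of_mem_erase hj]

variable {X : Type*} [TopologicalSpace X] [MeasurableSpace X] {m : Measure X}
  (hm : ∀ f : X → ℝ, Continuous f → Integrable f m)
  {C : X → 𝕁 n → 𝕁 n → ℝ} (hC : ∀ α β, Continuous fun x => C x α β) (k : ℕ)

omit [MeasurableSpace X] in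
include hC in
lemma continuous_wj (w : Fin n → Jet D) :
    Continuous fun x => wj (C x) k w := by
  induction k generalizing w with
  | zero => exact continuous_const
  | succ k ih =>
    refine continuous_const.mul ?_
    fun_prop

include hm hC

lemma integral_wj_succ {c : X → ℝ} (hc : Continuous c) (v : Fin n → Jet D) :
    ∫ x, c x * wj (C x) (k + 1) v ∂m = (1 / (2 * ((k : ℝ) + 1))) * ∑ α, ∑ β,
      ∫ x, (c x * C x α β) * wj (C x) k (addDeriv α (addDeriv β v)) ∂m := by
  have hcont : ∀ α β, Continuous fun x => c x * C x α β * wj (C x) k (addDeriv α (addDeriv β v)) :=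
    fun α β => (hc.mul (hC α β)).mul (continuous_wj hC k _)
  simp only [wj, mul_left_comm (c _), integral_const_mul]
  congr 1
  simp only [mul_sum, ← mul_assoc]
  rw [integral_finsetSum _ fun α _ => hm _ (by fun_prop)]
  exact sum_congr rfl fun α _ => integral_finsetSum _ fun β _ => hm _ (hcont α β)

/-- Integrated contractions are universal polynomials in the jet. -/
lemma exists_jetPoly_integral_wj (c : X → ℝ) (hc : Continuous c) (e : Fin n → JetVar D → JetVar D) :
    ∃ P : JetPoly D, ∀ v : Jet D, eval v P = ∫ x, c x * wj (C x) k (fun i => v ∘ e i) ∂m := by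
  classical
  induction k generalizing c e with
  | zero =>
    refine ⟨MvPolynomial.C (∫ x, c x ∂m) * ∏ i, MvPolynomial.X (e i ⟨0, Fin.elim0⟩), fun v => ?_⟩
    simp only [wj, map_mul, eval_C, map_prod, eval_X, Jet.val0, Function.comp]
    rw [integral_mul_const]
  | succ k ih =>
    have key : ∀ α β, ∃ P : JetPoly D, ∀ v : Jet D, eval v P
        = ∫ x, (c x * C x α β) * wj (C x) k (addDeriv α (addDeriv β fun i => v ∘ e i)) ∂m := by
      intro α β
      have add : ∀ (α : 𝕁 n) (e : Fin n → JetVar D → JetVar D) (v : Jet D),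
          addDeriv α (fun i => v ∘ e i)
          = fun i => v ∘ update e α.1 (e α.1 ∘ consIdx α.2) i := by
        intro α e v
        funext i
        by_cases h : i = α.1
        · subst h; simp only [addDeriv, update_self]; rfl
        · simp [addDeriv, h]
      obtain ⟨P, hP⟩ := ih (fun x => c x * C x α β) (hc.mul (hC α β))
        (update (update e β.1 (e β.1 ∘ consIdx β.2)) α.1
          (update e β.1 (e β.1 ∘ consIdx β.2) α.1 ∘ consIdx α.2))
      refine ⟨P, fun v => ?_⟩
      rw [hP, add, add]
    choose P hP using key
    refine ⟨MvPolynomial.C (1 / (2 * ((k : ℝ) + 1))) * ∑ α, ∑ β, P α β, fun v => ?_⟩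
    simp only [map_mul, eval_C, map_sum, hP]
    rw [integral_wj_succ hm hC k hc]

lemma dd_integral_wj (c : X → ℝ) (hc : Continuous c) (V : Fin n → E D → ℝ) (hV : ∀ i, Smooth (V i)) :
    Smooth (fun y => ∫ x, c x * wj (C x) k (fun i => jetAt (V i) y) ∂m) ∧
    ∀ ν y, dd ν (fun y => ∫ x, c x * wj (C x) k (fun i => jetAt (V i) y) ∂m) y
      = ∑ i, ∫ x, c x * wj (C x) k (fun j => jetAt (addD (i, ν) V j) y) ∂m := by
  induction k generalizing c V with
  | zero =>
    have h0 : ∀ (V : Fin n → E D → ℝ) (y : E D), ∫ x, c x * wj (C x) 0 (fun i => jetAt (V i) y) ∂m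
        = (∫ x, c x ∂m) * ∏ i, V i y := by
      intro V y
      simp only [wj, Jet.val0, jetAt, pd, iteratedFDeriv_zero_apply]
      rw [integral_mul_const]
    have hp : Smooth fun y => ∏ i, V i y := contDiff_prod fun i _ => hV i
    simp only [h0]
    refine ⟨contDiff_const.mul hp, fun ν y => ?_⟩
    rw [dd_const_mul hp, dd_prod hV, mul_sum]
  | succ k ih =>
    have hs : ∀ (V : Fin n → E D → ℝ) (_ : ∀ i, Smooth (V i)) (y : E D),
        ∫ x, c x * wj (C x) (k + 1) (fun i => jetAt (V i) y) ∂m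
        = (1 / (2 * ((k : ℝ) + 1))) * ∑ α, ∑ β, ∫ x, (c x * C x α β) *
          wj (C x) k (fun i => jetAt (addD α (addD β V) i) y) ∂m := by
      intro V hV y
      rw [integral_wj_succ hm hC k hc]
      simp only [addDeriv_jetAt hV, addDeriv_jetAt (addD_contDiff hV _)]
    have e1 := fun α β => ih (fun x => c x * C x α β) (hc.mul (hC α β)) (addD α (addD β V))
      (addD_contDiff (addD_contDiff hV β) α)
    simp only [hs V hV]
    have c1 : ∀ α, Smooth fun y => ∑ β, ∫ x, (c x * C x α β) *
          wj (C x) k (fun i => jetAt (addD α (addD β V) i) y) ∂m :=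
      fun α => ContDiff.sum fun β _ => (e1 α β).1
    have c2 : Smooth fun y => ∑ α, ∑ β, ∫ x, (c x * C x α β) *
          wj (C x) k (fun i => jetAt (addD α (addD β V) i) y) ∂m :=
      ContDiff.sum fun α _ => c1 α
    refine ⟨contDiff_const.mul c2, fun ν y => ?_⟩
    rw [dd_const_mul c2, dd_sum fun α _ => c1 α]
    rw [sum_congr rfl fun i _ => hs _ (addD_contDiff hV (i, ν)) y, ← mul_sum]
    congr 1
    rw [sum_comm]
    refine sum_congr rfl fun α _ => ?_
    rw [dd_sum fun β _ => (e1 α β).1, sum_comm]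
    refine sum_congr rfl fun β _ => ?_
    rw [(e1 α β).2]
    refine sum_congr rfl fun i _ => ?_
    rw [addD_comm (addD_contDiff hV β) (i, ν) α, addD_comm hV (i, ν) β]

end Jets

end

section

open scoped Pointwise

/-! ### Integrals over cubes -/

section Cubes

variable {n : ℕ}

local notation "ins" => Fin.insertNth (α := fun _ => ℝ)

def cube (n : ℕ) : Set (Fin n → ℝ) := Icc 0 1

lemma isCompact_cube : IsCompact (cube n) := isCompact_Icc

lemma measurableSet_cube : MeasurableSet (cube n) := measurableSet_Icc

lemma mem_cube {τ : Fin n → ℝ} : τ ∈ cube n ↔ ∀ i, τ i ∈ 𝕀 := by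
  simp [cube, Set.mem_Icc, Pi.le_def, forall_and]

lemma integrable_cube (f : (Fin n → ℝ) → ℝ) (hf : Continuous f) :
    Integrable f (volume.restrict (cube n)) :=
  hf.continuousOn.integrableOn_compact isCompact_cube

lemma insertNth_mem_cube {i : Fin (n + 1)} {s : ℝ} {τ : Fin n → ℝ} :
    ins i s τ ∈ cube (n + 1) ↔ s ∈ 𝕀 ∧ τ ∈ cube n := by
  rw [mem_cube, mem_cube, Fin.forall_iff_succAbove i]
  simp

lemma continuous_insertNth (i : Fin (n + 1)) :
    Continuous fun p : ℝ × (Fin n → ℝ) => ins i p.1 p.2 := by fun_prop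

lemma setIntegral_insertNth (i : Fin (n + 1)) {S : Set (Fin (n + 1) → ℝ)}
    (hS : MeasurableSet S) (φ : (Fin (n + 1) → ℝ) → ℝ) (hφ : IntegrableOn φ S) :
    ∫ τ in S, φ τ = ∫ s, ∫ τ, S.indicator φ (ins i s τ) := by
  have mp := (volume_preserving_piFinSuccAbove (fun _ : Fin (n + 1) => ℝ) i).symm
  rw [← integral_indicator hS, ← mp.integral_comp (MeasurableEquiv.measurableEmbedding _)]
  rw [Measure.volume_eq_prod, integral_prod]
  · rfl
  · rw [← Measure.volume_eq_prod]
    exact (mp.integrable_comp_emb (MeasurableEquiv.measurableEmbedding _)).2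
      ((integrable_indicator_iff hS).2 hφ)

lemma integrableOn_insertNth {φ : (Fin (n + 1) → ℝ) → ℝ} (hφ : ContinuousOn φ (cube (n + 1)))
    (i : Fin (n + 1)) : IntegrableOn (fun p : ℝ × (Fin n → ℝ) => φ (ins i p.1 p.2))
      (𝕀 ×ˢ cube n) (volume.prod volume) :=
  (hφ.comp (continuous_insertNth i).continuousOn fun _ hp =>
    insertNth_mem_cube.2 hp).integrableOn_compact (isCompact_Icc.prod isCompact_cube)

/-- Fubini for the `i`-th coordinate, integrated last. -/
lemma integral_cube_succ (i : Fin (n + 1)) {φ : (Fin (n + 1) → ℝ) → ℝ}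
    (hφ : ContinuousOn φ (cube (n + 1))) :
    ∫ τ in cube (n + 1), φ τ = ∫ s in 𝕀, ∫ τ in cube n, φ (ins i s τ) := by
  have mp := (volume_preserving_piFinSuccAbove (fun _ : Fin (n + 1) => ℝ) i).symm
  have e : (MeasurableEquiv.piFinSuccAbove (fun _ => ℝ) i).symm ⁻¹' cube (n + 1)
      = 𝕀 ×ˢ cube n := ext fun _ => insertNth_mem_cube
  rw [← mp.setIntegral_preimage_emb (MeasurableEquiv.measurableEmbedding _), e,
    Measure.volume_eq_prod]
  exact setIntegral_prod _ (integrableOn_insertNth hφ i)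

/-- Fubini for the `i`-th coordinate, integrated first. -/
lemma integral_cube_succ' (i : Fin (n + 1)) {φ : (Fin (n + 1) → ℝ) → ℝ}
    (hφ : ContinuousOn φ (cube (n + 1))) :
    ∫ τ in cube (n + 1), φ τ = ∫ τ in cube n, ∫ s in 𝕀, φ (ins i s τ) := by
  rw [integral_cube_succ i hφ, integral_integral_swap]
  have := integrableOn_insertNth hφ i
  rwa [IntegrableOn, ← Measure.prod_restrict] at this

lemma setIntegral_Icc_smul (r : ℝ) (hr : 0 < r) (φ : (Fin n → ℝ) → ℝ) :
    ∫ τ in Icc (0 : Fin n → ℝ) (fun _ => r), φ τ = r ^ n * ∫ τ in cube n, φ (r • τ) := by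
  have h := Measure.setIntegral_comp_smul_of_pos (volume : Measure (Fin n → ℝ)) φ (cube n) hr
  have e : r • cube n = Icc (0 : Fin n → ℝ) (fun _ => r) := by
    ext τ
    rw [Set.mem_smul_set_iff_inv_smul_mem₀ hr.ne', mem_cube]
    simp only [Pi.smul_apply, smul_eq_mul, Set.mem_Icc, Pi.le_def, Pi.zero_apply, ← forall_and]
    refine forall_congr' fun i => ?_
    rw [inv_mul_le_iff₀ hr, mul_one, mul_nonneg_iff_of_pos_left (inv_pos.2 hr)]
  rw [h, e, Module.finrank_fin_fun, smul_eq_mul, ← mul_assoc, mul_inv_cancel₀ (by positivity),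
    one_mul]

lemma continuous_face {φ : (Fin (n + 1) → ℝ) → ℝ} (hφ : Continuous φ) (i : Fin (n + 1)) :
    Continuous fun r : ℝ => ∫ τ in cube n, φ (r • ins i 1 τ) :=
  continuous_parametric_integral_of_continuous (f := fun r τ => φ (r • ins i 1 τ)) (s := cube n)
    (hφ.comp (continuous_fst.smul ((continuous_insertNth i).comp
      (continuous_const.prodMk continuous_snd)))) isCompact_cube

/-- Decomposition of the cube according to the largest coordinate. -/
lemma integral_cube_eq_faces {φ : (Fin (n + 1) → ℝ) → ℝ} (hφ : Continuous φ) :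
    ∫ τ in cube (n + 1), φ τ = ∫ s in 𝕀,
      s ^ n * ∑ i : Fin (n + 1), ∫ τ in cube n, φ (s • ins i 1 τ) := by
  set A : Fin (n + 1) → Set (Fin (n + 1) → ℝ) := fun i => {τ | τ ∈ cube (n + 1) ∧ ∀ j, τ j ≤ τ i}
    with hA
  have hAm : ∀ i, MeasurableSet (A i) := fun i => by
    rw [show A i = cube (n + 1) ∩ ⋂ j, {τ | τ j ≤ τ i} by ext; simp [hA]]
    exact measurableSet_cube.inter (MeasurableSet.iInter fun j => measurableSet_le (by fun_prop)
      (by fun_prop))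
  have hU : cube (n + 1) = ⋃ i, A i := by
    ext τ
    simpa [hA] using fun _ => Finite.exists_max τ
  have hd : Pairwise (Function.onFun (AEDisjoint volume) A) := by
    intro i j hij
    have h0 : volume ((LinearMap.ker ((LinearMap.proj i : (Fin (n + 1) → ℝ) →ₗ[ℝ] ℝ)
        - LinearMap.proj j) : Submodule ℝ (Fin (n + 1) → ℝ)) : Set (Fin (n + 1) → ℝ)) = 0 := by
      refine Measure.addHaar_submodule _ _ fun h => ?_
      have h1 : (Pi.single i 1 : Fin (n + 1) → ℝ) ∈ (⊤ : Submodule ℝ (Fin (n + 1) → ℝ)) := trivial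
      simp [← h, LinearMap.mem_ker, hij.symm] at h1
    refine measure_mono_null (fun τ hτ => ?_) h0
    simp only [SetLike.mem_coe, LinearMap.mem_ker, LinearMap.sub_apply, LinearMap.proj_apply]
    grind
  have hi : ∀ i, IntegrableOn φ (A i) := fun i =>
    IntegrableOn.mono_set (hφ.continuousOn.integrableOn_compact isCompact_cube) fun τ hτ => hτ.1
  have key : ∀ i, ∫ τ in A i, φ τ = ∫ s in 𝕀, s ^ n * ∫ τ in cube n, φ (s • ins i 1 τ) := by
    intro i
    rw [setIntegral_insertNth i (hAm i) φ (hi i), ← integral_indicator measurableSet_Icc]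
    have h0 : ∀ᵐ s : ℝ, s ≠ 0 := by simp [ae_iff]
    refine integral_congr_ae ?_
    filter_upwards [h0] with s hs0
    have hmem : ∀ τ, ins i s τ ∈ A i ↔
        s ∈ 𝕀 ∧ τ ∈ Icc (0 : Fin n → ℝ) (fun _ => s) := by
      intro τ
      simp only [hA, mem_ofPred_eq, Fin.forall_iff_succAbove i,
        Fin.insertNth_apply_same, Fin.insertNth_apply_succAbove, le_refl, true_and, mem_cube,
        Set.mem_Icc, Pi.le_def, Pi.zero_apply]
      grind
    by_cases hs : s ∈ 𝕀
    · have e : (fun τ => (A i).indicator φ (ins i s τ))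
          = (Icc (0 : Fin n → ℝ) (fun _ => s)).indicator fun τ => φ (ins i s τ) := by
        funext τ
        exact indicator_eq_indicator ((hmem τ).trans (and_iff_right hs)) rfl
      rw [indicator_of_mem hs, e, integral_indicator measurableSet_Icc,
        setIntegral_Icc_smul s (hs.1.lt_of_ne' hs0)]
      congr! 4 with τ
      funext j
      refine i.succAboveCases ?_ (fun j => ?_) j <;> simp
    · simp [indicator, hmem, hs]
  have hint : IntegrableOn φ (⋃ i, A i) := by
    rw [← hU]; exact hφ.continuousOn.integrableOn_compact isCompact_cube
  rw [hU, integral_iUnion_ae (fun i => (hAm i).nullMeasurableSet) hd hint, tsum_fintype]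
  simp only [key, mul_sum]
  exact (integral_finsetSum _ fun i _ => ((continuous_pow n).mul
    (continuous_face hφ i)).continuousOn.integrableOn_compact isCompact_Icc).symm

lemma hasDerivAt_setIntegral {Y : Type*} [TopologicalSpace Y] [MeasurableSpace Y]
    [OpensMeasurableSpace Y] [T2Space Y] [SecondCountableTopology Y] {μ : Measure Y}
    [IsFiniteMeasureOnCompacts μ] {S : Set Y} (hS : IsCompact S) {I : Set ℝ} (hI : IsOpen I)
    {ψ ψ' : ℝ → Y → ℝ} (hψ : ∀ x ∈ I, ContinuousOn (ψ x) S)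
    (hψ' : ContinuousOn (Function.uncurry ψ') (I ×ˢ S))
    (hd : ∀ x ∈ I, ∀ y ∈ S, HasDerivAt (fun x => ψ x y) (ψ' x y) x) {x : ℝ} (hx : x ∈ I) :
    HasDerivAt (fun x => ∫ y in S, ψ x y ∂μ) (∫ y in S, ψ' x y ∂μ) x := by
  obtain ⟨ε, hε, hball⟩ := Metric.nhds_basis_closedBall.mem_iff.1 (hI.mem_nhds hx)
  have hK : IsCompact (Metric.closedBall x ε ×ˢ S) := (isCompact_closedBall x ε).prod hS
  obtain ⟨B, hB⟩ := hK.exists_bound_of_continuousOn (hψ'.mono (prod_mono hball subset_rfl))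
  have hSm := hS.measurableSet
  have h1 : ∀ x ∈ I, ContinuousOn (ψ' x) S := fun x hx =>
    hψ'.comp (Continuous.prodMk_right x).continuousOn fun y hy => ⟨hx, hy⟩
  refine (hasDerivAt_integral_of_dominated_loc_of_deriv_le (F' := ψ') (bound := fun _ => B)
    (Metric.closedBall_mem_nhds x hε) ?_ ?_ ?_ ?_ ?_ ?_).2
  · filter_upwards [hI.mem_nhds hx] with y hy
    exact (hψ y hy).aestronglyMeasurable hSm
  · exact (hψ x hx).integrableOn_compact hS
  · exact (h1 x hx).aestronglyMeasurable hSm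
  · filter_upwards [ae_restrict_mem hSm] with y hy z hz
    simp_all
  · have : IsFiniteMeasure (μ.restrict S) := ⟨by simpa using hS.measure_lt_top⟩
    simp
  · filter_upwards [ae_restrict_mem hSm] with y hy z hz
    grind

lemma continuousOn_setIntegral {Z Y : Type*} [TopologicalSpace Z] [FirstCountableTopology Z]
    [TopologicalSpace Y] [MeasurableSpace Y]
    [OpensMeasurableSpace Y] [T2Space Y] [SecondCountableTopology Y] {μ : Measure Y}
    [IsFiniteMeasureOnCompacts μ] {S : Set Y} (hS : IsCompact S) {U : Set Z}
    {ψ : Z → Y → ℝ} (hψ : ContinuousOn (Function.uncurry ψ) (U ×ˢ S)) :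
    ContinuousOn (fun z => ∫ y in S, ψ z y ∂μ) U := by
  intro q hq
  apply Metric.continuousWithinAt_iff'.2 (fun ε εpos ↦ ?_)
  obtain ⟨δ, δpos, hδ⟩ := exists_pos_mul_lt εpos (μ.real S)
  obtain ⟨v, v_mem, hv⟩ : ∃ v ∈ 𝓝[U] q, ∀ p ∈ v, ∀ x ∈ S, dist (ψ p x) (ψ q x) < δ :=
    hS.mem_uniformity_of_prod hψ hq (Metric.dist_mem_uniformity δpos)
  have hc : ∀ p ∈ U, IntegrableOn (ψ p) S μ := fun p hp =>
    ContinuousOn.integrableOn_compact hS (hψ.comp (Continuous.prodMk_right p).continuousOn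
      fun y hy => ⟨hp, hy⟩)
  filter_upwards [v_mem, self_mem_nhdsWithin] with p hp hpU
  rw [dist_eq_norm, ← integral_sub (hc p hpU) (hc q hq)]
  refine (norm_setIntegral_le_of_norm_le_const hS.measure_lt_top fun y hy => ?_).trans_lt
    (by rwa [mul_comm])
  rw [← dist_eq_norm]
  exact (hv p hp y hy).le

/-- The divergence theorem for the dilation field on the cube. -/
lemma integral_cube_euler {φ : (Fin (n + 1) → ℝ) → ℝ} (hφ : Continuous φ)
    {φ' : ℝ → (Fin (n + 1) → ℝ) → ℝ} (hφ' : Continuous (Function.uncurry φ'))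
    (hd : ∀ s > 0, ∀ τ, HasDerivAt (fun s : ℝ => φ (s • τ)) (φ' s τ) s) :
    ((n : ℝ) + 1) * (∫ τ in cube (n + 1), φ τ) + ∫ τ in cube (n + 1), φ' 1 τ
      = ∑ i : Fin (n + 1), ∫ τ in cube n, φ (ins i 1 τ) := by
  set h : ℝ → ℝ := fun r => r ^ n * ∑ i : Fin (n + 1), ∫ τ in cube n, φ (r • ins i 1 τ) with hh
  have hcont : Continuous h :=
    (continuous_pow n).mul (continuous_finsetSum _ fun i _ => continuous_face hφ i)
  set Ψ : ℝ → ℝ := fun S => S ^ (n + 1) * ∫ τ in cube (n + 1), φ (S • τ) with hΨ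
  have d1 : HasDerivAt Ψ (((n : ℝ) + 1) * (∫ τ in cube (n + 1), φ τ)
      + ∫ τ in cube (n + 1), φ' 1 τ) 1 := by
    have := (hasDerivAt_pow (n + 1) (1 : ℝ)).mul (hasDerivAt_setIntegral (μ := volume)
      (isCompact_cube (n := n + 1)) isOpen_Ioi (ψ := fun s τ => φ (s • τ)) (ψ' := φ')
      (fun x _ => (hφ.comp (continuous_const_smul x)).continuousOn) hφ'.continuousOn
      (fun s hs τ _ => hd s hs τ) (x := 1) (mem_Ioi.2 zero_lt_one))
    exact this.congr_deriv (by simp)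
  have d2 : HasDerivAt (fun S => ∫ r in (0 : ℝ)..S, h r) (h 1) 1 :=
    intervalIntegral.integral_hasDerivAt_right (hcont.intervalIntegrable _ _)
      (hcont.stronglyMeasurableAtFilter _ _) hcont.continuousAt
  have e : ∀ S > 0, Ψ S = ∫ r in (0 : ℝ)..S, h r := by
    intro S hS
    have h1 := integral_cube_eq_faces (φ := fun τ => φ (S • τ)) (hφ.comp (continuous_const_smul S))
    simp only [hΨ]
    rw [h1, integral_Icc_eq_integral_Ioc, ← integral_of_le zero_le_one]
    have h2 := intervalIntegral.mul_integral_comp_mul_left (a := 0) (b := 1) (f := h) S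
    rw [mul_zero, mul_one] at h2
    rw [← h2, pow_succ', mul_assoc, ← intervalIntegral.integral_const_mul]
    congr 2
    funext s
    simp only [hh, mul_pow, smul_smul]
    ring
  have d3 : HasDerivAt Ψ (h 1) 1 :=
    d2.congr_of_eventuallyEq (eventually_of_mem (lt_mem_nhds zero_lt_one) e)
  rw [d1.unique d3]
  simp [hh]

end Cubes

end

section

/-! ### Green functions as resolvents of the free one -/

/-- A family `k z` of kernels on `[0,1]` with `k z = k 0 - z (k 0 * k z)`, and the corresponding
determinant `φ`. -/
structure KernelDatum where
  k : ℝ → ℝ → ℝ → ℝ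
  φ : ℝ → ℝ
  r : ℝ
  r_pos : 0 < r
  r_le : r ≤ 1 / 2
  symm : ∀ z, |z| < r → ∀ s ∈ 𝕀, ∀ t ∈ 𝕀, k z s t = k z t s
  cont_zero : 𝒞₂ (k 0)
  bound_zero : ∀ s ∈ 𝕀, ∀ t ∈ 𝕀, |k 0 s t| ≤ 1
  cont : ∀ z, |z| < r → ContinuousOn (fun p : ℝ × ℝ => k z p.1 p.2) (𝕀 ×ˢ 𝕀)
  eqn : ∀ z, |z| < r → ∀ s ∈ 𝕀, ∀ t ∈ 𝕀, k z s t = k 0 s t - z * ∫ u in 𝕀, k 0 s u * k z u t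
  φ_zero : φ 0 = 1
  φ_pos : ∀ z, |z| < r → 0 < φ z
  φ_cont : ContinuousAt φ 0
  φ_deriv : ∀ z, |z| < r → z ≠ 0 → HasDerivAt φ (φ z * ∫ s in 𝕀, k z s s) z

namespace KernelDatum

variable (𝒦 : KernelDatum)

lemma setIntegral_abs_le {f : ℝ → ℝ} {M : ℝ} (h : ∀ u ∈ 𝕀, |f u| ≤ M) :
    |∫ u in 𝕀, f u| ≤ M := by
  have := norm_setIntegral_le_of_norm_le_const (μ := volume) (s := 𝕀) (f := f) (C := M) (by simp) h
  simpa using this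

lemma cont_left {g : ℝ → ℝ → ℝ} (hg : ContinuousOn (fun p : ℝ × ℝ => g p.1 p.2) (𝕀 ×ˢ 𝕀)) {t : ℝ}
    (ht : t ∈ 𝕀) : ContinuousOn (fun s => g s t) 𝕀 :=
  hg.comp (f := fun s => (s, t)) (by fun_prop) fun _ hs => ⟨hs, ht⟩

lemma cont_right {g : ℝ → ℝ → ℝ} (hg : ContinuousOn (fun p : ℝ × ℝ => g p.1 p.2) (𝕀 ×ˢ 𝕀)) {t : ℝ}
    (ht : t ∈ 𝕀) : ContinuousOn (fun s => g t s) 𝕀 :=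
  hg.comp (f := fun s => (t, s)) (by fun_prop) fun _ hs => ⟨ht, hs⟩

lemma int_comp {g h : ℝ → ℝ → ℝ} (hg : ContinuousOn (fun p : ℝ × ℝ => g p.1 p.2) (𝕀 ×ˢ 𝕀))
    (hh : ContinuousOn (fun p : ℝ × ℝ => h p.1 p.2) (𝕀 ×ˢ 𝕀)) {s t : ℝ} (hs : s ∈ 𝕀) (ht : t ∈ 𝕀) :
    IntegrableOn (fun u => g s u * h u t) 𝕀 :=
  ((cont_right hg hs).mul (cont_left hh ht)).integrableOn_compact isCompact_Icc

lemma cont_comp {g h : ℝ → ℝ → ℝ} (hg : ContinuousOn (fun p : ℝ × ℝ => g p.1 p.2) (𝕀 ×ˢ 𝕀))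
    (hh : ContinuousOn (fun p : ℝ × ℝ => h p.1 p.2) (𝕀 ×ˢ 𝕀)) :
    ContinuousOn (fun p : ℝ × ℝ => ∫ u in 𝕀, g p.1 u * h u p.2) (𝕀 ×ˢ 𝕀) := by
  refine continuousOn_setIntegral isCompact_Icc ?_
  refine ContinuousOn.mul (hg.comp (f := fun q : (ℝ × ℝ) × ℝ => (q.1.1, q.2)) (by fun_prop) ?_)
    (hh.comp (f := fun q : (ℝ × ℝ) × ℝ => (q.2, q.1.2)) (by fun_prop) ?_)
  · rintro q ⟨h1, h2⟩; exact ⟨h1.1, h2⟩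
  · rintro q ⟨h1, h2⟩; exact ⟨h2, h1.2⟩

lemma comp_assoc {f g h : ℝ → ℝ → ℝ} (hf : ContinuousOn (fun p : ℝ × ℝ => f p.1 p.2) (𝕀 ×ˢ 𝕀))
    (hg : ContinuousOn (fun p : ℝ × ℝ => g p.1 p.2) (𝕀 ×ˢ 𝕀))
    (hh : ContinuousOn (fun p : ℝ × ℝ => h p.1 p.2) (𝕀 ×ˢ 𝕀)) {s t : ℝ} (hs : s ∈ 𝕀) (ht : t ∈ 𝕀) :
    ∫ u in 𝕀, (∫ v in 𝕀, f s v * g v u) * h u t = ∫ v in 𝕀, f s v * ∫ u in 𝕀, g v u * h u t := by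
  simp only [← integral_mul_const, ← integral_const_mul]
  rw [integral_integral_swap]
  · simp only [mul_assoc]
  · have hc : ContinuousOn (Function.uncurry fun u v : ℝ => f s v * g v u * h u t) (𝕀 ×ˢ 𝕀) := by
      refine ContinuousOn.mul (ContinuousOn.mul ?_ ?_) ?_
      · exact (cont_right hf hs).comp (f := Prod.snd) (by fun_prop) fun q hq => hq.2
      · exact hg.comp (f := fun q : ℝ × ℝ => (q.2, q.1)) (by fun_prop) fun q hq => ⟨hq.2, hq.1⟩
      · exact (cont_left hh ht).comp (f := Prod.fst) (by fun_prop) fun q hq => hq.1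
    have := hc.integrableOn_compact (μ := volume) (isCompact_Icc.prod isCompact_Icc)
    rwa [IntegrableOn, Measure.volume_eq_prod, ← Measure.prod_restrict] at this

lemma exists_max {g : ℝ → ℝ → ℝ} (hg : ContinuousOn (fun p : ℝ × ℝ => g p.1 p.2) (𝕀 ×ˢ 𝕀)) :
    ∃ s ∈ 𝕀, ∃ t ∈ 𝕀, ∀ s' ∈ 𝕀, ∀ t' ∈ 𝕀, |g s' t'| ≤ |g s t| := by
  obtain ⟨p, hp, hmax⟩ := (isCompact_Icc.prod isCompact_Icc).exists_isMaxOn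
    (s := 𝕀 ×ˢ 𝕀) ⟨(0, 0), by simp⟩ hg.abs
  exact ⟨p.1, hp.1, p.2, hp.2, fun s hs t ht => hmax (a := (s, t)) ⟨hs, ht⟩⟩

/-- A priori bound for the resolvent equation. -/
lemma bound_of_eqn {z a : ℝ} (hz : |z| < 𝒦.r) {f g : ℝ → ℝ → ℝ}
    (hg : ContinuousOn (fun p : ℝ × ℝ => g p.1 p.2) (𝕀 ×ˢ 𝕀))
    (hf : ∀ s ∈ 𝕀, ∀ t ∈ 𝕀, |f s t| ≤ a)
    (h : ∀ s ∈ 𝕀, ∀ t ∈ 𝕀, g s t = f s t - z * ∫ u in 𝕀, 𝒦.k 0 s u * g u t) :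
    ∀ s ∈ 𝕀, ∀ t ∈ 𝕀, |g s t| ≤ 2 * a := by
  obtain ⟨s, hs, t, ht, hmax⟩ := exists_max hg
  have h1 : |∫ u in 𝕀, 𝒦.k 0 s u * g u t| ≤ |g s t| := by
    refine setIntegral_abs_le fun u hu => ?_
    rw [abs_mul]
    calc |𝒦.k 0 s u| * |g u t| ≤ 1 * |g s t| :=
          mul_le_mul (𝒦.bound_zero s hs u hu) (hmax u hu t ht) (abs_nonneg _) zero_le_one
      _ = |g s t| := one_mul _
  have h2 : |g s t| ≤ a + 1 / 2 * |g s t| := by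
    calc |g s t| = |f s t - z * ∫ u in 𝕀, 𝒦.k 0 s u * g u t| := by rw [← h s hs t ht]
      _ ≤ |f s t| + |z * ∫ u in 𝕀, 𝒦.k 0 s u * g u t| := abs_sub _ _
      _ ≤ a + 1 / 2 * |g s t| := by
        rw [abs_mul]
        have := 𝒦.r_le
        gcongr
        · exact hf s hs t ht
        · linarith
  grind

lemma cont0 : ContinuousOn (fun p : ℝ × ℝ => 𝒦.k 0 p.1 p.2) (𝕀 ×ˢ 𝕀) := 𝒦.cont_zero.continuousOn

lemma bound {z : ℝ} (hz : |z| < 𝒦.r) : ∀ s ∈ 𝕀, ∀ t ∈ 𝕀, |𝒦.k z s t| ≤ 2 := by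
  simpa using 𝒦.bound_of_eqn hz (𝒦.cont z hz) 𝒦.bound_zero (𝒦.eqn z hz)

/-- The resolvent identity. -/
lemma resolvent {y z : ℝ} (hy : |y| < 𝒦.r) (hz : |z| < 𝒦.r) {s t : ℝ} (hs : s ∈ 𝕀) (ht : t ∈ 𝕀) :
    𝒦.k z s t - 𝒦.k y s t = -(z - y) * ∫ u in 𝕀, 𝒦.k z s u * 𝒦.k y u t := by
  set d : ℝ → ℝ → ℝ := fun s t => 𝒦.k z s t - 𝒦.k y s t
    + (z - y) * ∫ u in 𝕀, 𝒦.k z s u * 𝒦.k y u t with hd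
  have hcz := 𝒦.cont z hz
  have hcy := 𝒦.cont y hy
  have hcc := cont_comp hcz hcy
  have hdc : ContinuousOn (fun p : ℝ × ℝ => d p.1 p.2) (𝕀 ×ˢ 𝕀) :=
    (hcz.sub hcy).add (continuousOn_const.mul hcc)
  have heq : ∀ s ∈ 𝕀, ∀ t ∈ 𝕀, d s t = 0 - z * ∫ u in 𝕀, 𝒦.k 0 s u * d u t := by
    intro s hs t ht
    have e1 : ∫ u in 𝕀, 𝒦.k 0 s u * d u t = (∫ u in 𝕀, 𝒦.k 0 s u * 𝒦.k z u t)
        - (∫ u in 𝕀, 𝒦.k 0 s u * 𝒦.k y u t)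
        + (z - y) * ∫ u in 𝕀, 𝒦.k 0 s u * ∫ v in 𝕀, 𝒦.k z u v * 𝒦.k y v t := by
      rw [← integral_sub (int_comp 𝒦.cont0 hcz hs ht) (int_comp 𝒦.cont0 hcy hs ht),
        ← integral_const_mul, ← integral_add]
      · grind
      · exact (int_comp 𝒦.cont0 hcz hs ht).sub (int_comp 𝒦.cont0 hcy hs ht)
      · exact (int_comp (h := fun s t => ∫ u in 𝕀, 𝒦.k z s u * 𝒦.k y u t) 𝒦.cont0 hcc hs ht).const_mul _
    have e2 : ∫ u in 𝕀, 𝒦.k z s u * 𝒦.k y u t = (∫ u in 𝕀, 𝒦.k 0 s u * 𝒦.k y u t)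
        - z * ∫ u in 𝕀, 𝒦.k 0 s u * ∫ v in 𝕀, 𝒦.k z u v * 𝒦.k y v t := by
      rw [← comp_assoc 𝒦.cont0 hcz hcy hs ht, ← integral_const_mul, ← integral_sub]
      · refine setIntegral_congr_fun measurableSet_Icc fun u hu => ?_
        rw [𝒦.eqn z hz s hs u hu]; ring
      · exact int_comp 𝒦.cont0 hcy hs ht
      · exact (int_comp (g := fun s t => ∫ v in 𝕀, 𝒦.k 0 s v * 𝒦.k z v t) (cont_comp 𝒦.cont0 hcz) hcy
          hs ht).const_mul _
    rw [e1]
    simp only [hd]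
    rw [e2, 𝒦.eqn z hz s hs t ht]
    have e3 := 𝒦.eqn y hy s hs t ht
    linear_combination -e3
  have h0 := 𝒦.bound_of_eqn (a := 0) hz hdc (fun _ _ _ _ => by simp) heq s hs t ht
  have h1 : d s t = 0 := by simpa using h0
  linarith

lemma comp_bound {y z : ℝ} (hy : |y| < 𝒦.r) (hz : |z| < 𝒦.r) {s t : ℝ} (hs : s ∈ 𝕀) (ht : t ∈ 𝕀) :
    |∫ u in 𝕀, 𝒦.k z s u * 𝒦.k y u t| ≤ 4 := by
  refine setIntegral_abs_le fun u hu => ?_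
  rw [abs_mul]
  calc _ ≤ (2 : ℝ) * 2 := mul_le_mul (𝒦.bound hz s hs u hu) (𝒦.bound hy u hu t ht) (abs_nonneg _)
        (by norm_num)
    _ = 4 := by norm_num

lemma lipschitz {y z : ℝ} (hy : |y| < 𝒦.r) (hz : |z| < 𝒦.r) {s t : ℝ} (hs : s ∈ 𝕀) (ht : t ∈ 𝕀) :
    |𝒦.k z s t - 𝒦.k y s t| ≤ 4 * |z - y| := by
  rw [𝒦.resolvent hy hz hs ht, abs_mul, abs_neg, mul_comm]
  exact mul_le_mul_of_nonneg_right (𝒦.comp_bound hy hz hs ht) (abs_nonneg _)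

lemma cont_joint : ContinuousOn (fun p : ℝ × ℝ × ℝ => 𝒦.k p.1 p.2.1 p.2.2)
    ({z | |z| < 𝒦.r} ×ˢ 𝕀 ×ˢ 𝕀) := by
  rintro ⟨y, s, t⟩ ⟨hy, hst⟩
  have h1 : Tendsto (fun p : ℝ × ℝ × ℝ => 𝒦.k y p.2.1 p.2.2)
      (𝓝[{z | |z| < 𝒦.r} ×ˢ 𝕀 ×ˢ 𝕀] (y, s, t)) (𝓝 (𝒦.k y s t)) :=
    ((𝒦.cont y hy).comp (f := fun p : ℝ × ℝ × ℝ => p.2) (s := {z | |z| < 𝒦.r} ×ˢ 𝕀 ×ˢ 𝕀)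
      (by fun_prop) fun p hp => hp.2) (y, s, t) ⟨hy, hst⟩
  have h2 : Tendsto (fun p : ℝ × ℝ × ℝ => 𝒦.k p.1 p.2.1 p.2.2 - 𝒦.k y p.2.1 p.2.2)
      (𝓝[{z | |z| < 𝒦.r} ×ˢ 𝕀 ×ˢ 𝕀] (y, s, t)) (𝓝 0) := by
    refine squeeze_zero_norm' (a := fun p : ℝ × ℝ × ℝ => 4 * |p.1 - y|) ?_ ?_
    · filter_upwards [self_mem_nhdsWithin] with p hp
      exact 𝒦.lipschitz hy hp.1 hp.2.1 hp.2.2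
    · have : Continuous fun p : ℝ × ℝ × ℝ => 4 * |p.1 - y| := by fun_prop
      have := (this.tendsto (y, s, t)).mono_left
        (nhdsWithin_le_nhds (s := {z | |z| < 𝒦.r} ×ˢ 𝕀 ×ˢ 𝕀))
      simpa using this
  have h3 := h2.add h1
  rw [zero_add] at h3
  exact h3.congr fun p => by ring

lemma isOpen_r : IsOpen {z : ℝ | |z| < 𝒦.r} := isOpen_lt continuous_abs continuous_const

lemma hasDerivAt_k {z : ℝ} (hz : |z| < 𝒦.r) {s t : ℝ} (hs : s ∈ 𝕀) (ht : t ∈ 𝕀) :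
    HasDerivAt (fun z => 𝒦.k z s t) (-∫ u in 𝕀, 𝒦.k z s u * 𝒦.k z u t) z := by
  rw [hasDerivAt_iff_tendsto_slope]
  have hc : ContinuousOn (fun y => ∫ u in 𝕀, 𝒦.k y s u * 𝒦.k z u t) {z | |z| < 𝒦.r} := by
    refine continuousOn_setIntegral isCompact_Icc (ContinuousOn.mul ?_ ?_)
    · exact 𝒦.cont_joint.comp (f := fun q : ℝ × ℝ => (q.1, s, q.2)) (by fun_prop)
        fun q hq => ⟨hq.1, hs, hq.2⟩
    · exact (cont_left (𝒦.cont z hz) ht).comp (f := Prod.snd) (by fun_prop) fun q hq => hq.2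
  have hc' := ((hc z hz).continuousAt (𝒦.isOpen_r.mem_nhds hz)).neg.tendsto
  refine (hc'.mono_left nhdsWithin_le_nhds).congr' ?_
  have h1 : ∀ᶠ y in 𝓝[≠] z, |y| < 𝒦.r := nhdsWithin_le_nhds (𝒦.isOpen_r.mem_nhds hz)
  filter_upwards [h1, self_mem_nhdsWithin] with y hy hne
  have : y - z ≠ 0 := sub_ne_zero.2 hne
  rw [slope_def_field, 𝒦.resolvent hz hy hs ht]
  simp only [Pi.neg_apply]
  field_simp

lemma cont_trace : ContinuousOn (fun z => ∫ s in 𝕀, 𝒦.k z s s) {z | |z| < 𝒦.r} := by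
  refine continuousOn_setIntegral isCompact_Icc ?_
  exact 𝒦.cont_joint.comp (f := fun q : ℝ × ℝ => (q.1, q.2, q.2)) (by fun_prop)
        fun q hq => ⟨hq.1, hq.2, hq.2⟩

lemma hasDerivAt_φ {z : ℝ} (hz : |z| < 𝒦.r) :
    HasDerivAt 𝒦.φ (𝒦.φ z * ∫ s in 𝕀, 𝒦.k z s s) z := by
  by_cases h0 : z = 0
  · subst h0
    have hr := 𝒦.r_pos
    obtain ⟨ε, hε, hb⟩ := Metric.isOpen_iff.1 𝒦.isOpen_r 0 (by simpa using hr)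
    have hφc : ContinuousAt (fun z => 𝒦.φ z * ∫ s in 𝕀, 𝒦.k z s s) 0 :=
      𝒦.φ_cont.mul (𝒦.cont_trace.continuousAt (𝒦.isOpen_r.mem_nhds (by simpa using hr)))
    have hd : ∀ y ≠ (0 : ℝ), y ∈ Metric.ball (0 : ℝ) ε →
        HasDerivAt 𝒦.φ (𝒦.φ y * ∫ s in 𝕀, 𝒦.k y s s) y := fun y hy hyb => 𝒦.φ_deriv y (hb hyb) hy
    have h1 : HasDerivWithinAt 𝒦.φ (𝒦.φ 0 * ∫ s in 𝕀, 𝒦.k 0 s s) (Ici 0) 0 := by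
      refine hasDerivWithinAt_Ici_of_tendsto_deriv (s := Ioo 0 ε) ?_ 𝒦.φ_cont.continuousWithinAt
        (Ioo_mem_nhdsGT hε) ?_
      · intro y hy
        exact (hd y hy.1.ne' (by rw [Metric.mem_ball, Real.dist_0_eq_abs, abs_of_pos hy.1]; exact hy.2)
          ).differentiableAt.differentiableWithinAt
      · refine (hφc.tendsto.mono_left nhdsWithin_le_nhds).congr' ?_
        filter_upwards [Ioo_mem_nhdsGT hε] with y hy
        exact (hd y hy.1.ne' (by rw [Metric.mem_ball, Real.dist_0_eq_abs, abs_of_pos hy.1]; exact hy.2)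
          ).deriv.symm
    have h2 : HasDerivWithinAt 𝒦.φ (𝒦.φ 0 * ∫ s in 𝕀, 𝒦.k 0 s s) (Iic 0) 0 := by
      refine hasDerivWithinAt_Iic_of_tendsto_deriv (s := Ioo (-ε) 0) ?_ 𝒦.φ_cont.continuousWithinAt
        (Ioo_mem_nhdsLT (by linarith)) ?_
      · intro y hy
        exact (hd y hy.2.ne (by rw [Metric.mem_ball, Real.dist_0_eq_abs, abs_of_neg hy.2]; linarith [hy.1])
          ).differentiableAt.differentiableWithinAt
      · refine (hφc.tendsto.mono_left nhdsWithin_le_nhds).congr' ?_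
        filter_upwards [Ioo_mem_nhdsLT (show -ε < 0 by linarith)] with y hy
        exact (hd y hy.2.ne (by rw [Metric.mem_ball, Real.dist_0_eq_abs, abs_of_neg hy.2]; linarith [hy.1])
          ).deriv.symm
    have := h2.union h1
    simp_all
  · exact 𝒦.φ_deriv z hz h0

end KernelDatum

end

section

open MvPolynomial

/-! ### Moving the quadratic part of the potential into the Green function -/

/-- The interval on which the interpolation parameter lives. -/
def paramSet : Set ℝ := Ioo (-1) 2

/-- Covariances `C l s t`, means `b l s` and normalizations `N l` of the Gaussian weights in which
the part `v₀ + a x + ½ x H x` of the potential has been multiplied by `l`. -/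
structure Interpolation (D : ℕ) where
  T : ℝ
  v₀ : ℝ
  a : Fin D → ℝ
  H : Fin D → Fin D → ℝ
  C : ℝ → ℝ → ℝ → Fin D → Fin D → ℝ
  b : ℝ → ℝ → Fin D → ℝ
  N : ℝ → ℝ
  H_symm : ∀ μ ν, H μ ν = H ν μ
  C_symm : ∀ l ∈ paramSet, ∀ s ∈ 𝕀, ∀ t ∈ 𝕀, ∀ μ ν, C l s t μ ν = C l t s ν μ
  C_cont : ∀ μ ν, ContinuousOn (fun p : ℝ × ℝ × ℝ => C p.1 p.2.1 p.2.2 μ ν) (paramSet ×ˢ 𝕀 ×ˢ 𝕀)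
  b_cont : ∀ μ, ContinuousOn (fun p : ℝ × ℝ => b p.1 p.2 μ) (paramSet ×ˢ 𝕀)
  C_deriv : ∀ l ∈ paramSet, ∀ s ∈ 𝕀, ∀ t ∈ 𝕀, ∀ μ ν, HasDerivAt (fun l => C l s t μ ν)
    (-T * ∫ u in 𝕀, ∑ ρ, ∑ σ, H ρ σ * C l u s ρ μ * C l u t σ ν) l
  b_deriv : ∀ l ∈ paramSet, ∀ s ∈ 𝕀, ∀ μ, HasDerivAt (fun l => b l s μ)
    (-T * ∫ u in 𝕀, ∑ ρ, (a ρ + ∑ σ, H ρ σ * b l u σ) * C l u s ρ μ) l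
  N_deriv : ∀ l ∈ paramSet, HasDerivAt N (N l * (-T * ∫ u in 𝕀, (v₀ + ∑ μ, a μ * b l u μ
    + 1 / 2 * (∑ μ, ∑ ν, H μ ν * (b l u μ * b l u ν)) + 1 / 2 * (∑ μ, ∑ ν, H μ ν * C l u u μ ν)))) l

namespace Interpolation

variable {D n : ℕ} (Φ : Interpolation D)

lemma isOpen_paramSet : IsOpen paramSet := isOpen_Ioo

local notation "ins" => Fin.insertNth (α := fun _ => ℝ)

set_option hygiene false in
local notation:max "𝒱" l:max => pt fun _ => vert Φ R l

set_option hygiene false in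
local notation:max "𝒬" l:max i:max => pt (update (fun _ => vert Φ R l) i (quad Φ))

def cov (l : ℝ) (τ : Fin n → ℝ) (p q : 𝕁 n) : ℝ := Φ.C l (τ p.1) (τ q.1) p.2 q.2

def mean (l : ℝ) (τ : Fin n → ℝ) (p : 𝕁 n) : ℝ := Φ.b l (τ p.1) p.2

def covInt (l : ℝ) (τ : Fin n → ℝ) (u : ℝ) (p q : 𝕁 n) : ℝ :=
  ∑ ρ, ∑ σ, Φ.H ρ σ * Φ.C l u (τ p.1) ρ p.2 * Φ.C l u (τ q.1) σ q.2

def covDeriv (l : ℝ) (τ : Fin n → ℝ) (p q : 𝕁 n) : ℝ := -Φ.T * ∫ u in 𝕀, Φ.covInt l τ u p q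

def meanInt (l : ℝ) (τ : Fin n → ℝ) (u : ℝ) (p : 𝕁 n) : ℝ :=
  ∑ ρ, (Φ.a ρ + ∑ σ, Φ.H ρ σ * Φ.b l u σ) * Φ.C l u (τ p.1) ρ p.2

def meanDeriv (l : ℝ) (τ : Fin n → ℝ) (p : 𝕁 n) : ℝ := -Φ.T * ∫ u in 𝕀, Φ.meanInt l τ u p

def scalar (l u : ℝ) : ℝ := Φ.v₀ + ∑ μ, Φ.a μ * Φ.b l u μ
    + 1 / 2 * (∑ μ, ∑ ν, Φ.H μ ν * (Φ.b l u μ * Φ.b l u ν))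
    + 1 / 2 * (∑ μ, ∑ ν, Φ.H μ ν * Φ.C l u u μ ν)

def quad : ℳ (Fin D) := MvPolynomial.C Φ.v₀ + ∑ μ, MvPolynomial.C (Φ.a μ) * X μ
        + ∑ μ, ∑ ν, MvPolynomial.C (Φ.H μ ν / 2) * (X μ * X ν)

lemma cov_cont (p q : 𝕁 n) : ContinuousOn (fun z : ℝ × (Fin n → ℝ) => Φ.cov z.1 z.2 p q)
    (paramSet ×ˢ cube n) :=
  (Φ.C_cont p.2 q.2).comp (f := fun z : ℝ × (Fin n → ℝ) => (z.1, z.2 p.1, z.2 q.1)) (by fun_prop)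
    fun _ hz => ⟨hz.1, mem_cube.1 hz.2 _, mem_cube.1 hz.2 _⟩

lemma mean_cont (p : 𝕁 n) : ContinuousOn (fun z : ℝ × (Fin n → ℝ) => Φ.mean z.1 z.2 p)
    (paramSet ×ˢ cube n) :=
  (Φ.b_cont p.2).comp (f := fun z : ℝ × (Fin n → ℝ) => (z.1, z.2 p.1)) (by fun_prop)
    fun _ hz => ⟨hz.1, mem_cube.1 hz.2 _⟩

lemma C_comp {Z : Type*} [TopologicalSpace Z] {S : Set Z} {f g h : Z → ℝ} (hf : ContinuousOn f S)
    (hg : ContinuousOn g S) (hh : ContinuousOn h S) (hfm : MapsTo f S paramSet) (hgm : MapsTo g S 𝕀)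
    (hhm : MapsTo h S 𝕀) (μ ν : Fin D) : ContinuousOn (fun z => Φ.C (f z) (g z) (h z) μ ν) S :=
  (Φ.C_cont μ ν).comp (f := fun z => (f z, g z, h z)) (hf.prodMk (hg.prodMk hh))
    fun _ hz => ⟨hfm hz, hgm hz, hhm hz⟩

lemma b_comp {Z : Type*} [TopologicalSpace Z] {S : Set Z} {f g : Z → ℝ} (hf : ContinuousOn f S)
    (hg : ContinuousOn g S) (hfm : MapsTo f S paramSet) (hgm : MapsTo g S 𝕀)
    (μ : Fin D) : ContinuousOn (fun z => Φ.b (f z) (g z) μ) S :=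
  (Φ.b_cont μ).comp (f := fun z => (f z, g z)) (hf.prodMk hg) fun _ hz => ⟨hfm hz, hgm hz⟩

lemma C_point_cont (p : 𝕁 n) (ρ : Fin D) : ContinuousOn (fun z : (ℝ × (Fin n → ℝ)) × ℝ =>
    Φ.C z.1.1 z.2 (z.1.2 p.1) ρ p.2) ((paramSet ×ˢ cube n) ×ˢ 𝕀) :=
  Φ.C_comp (by fun_prop) (by fun_prop) (by fun_prop) (fun _ hz => hz.1.1) (fun _ hz => hz.2)
    (fun _ hz => mem_cube.1 hz.1.2 _) _ _

lemma covDeriv_cont (p q : 𝕁 n) :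
    ContinuousOn (fun z : ℝ × (Fin n → ℝ) => Φ.covDeriv z.1 z.2 p q) (paramSet ×ˢ cube n) := by
  refine continuousOn_const.mul (continuousOn_setIntegral isCompact_Icc ?_)
  have hC := Φ.C_point_cont (n := n)
  simp only [Function.uncurry_def, covInt]
  fun_prop

lemma meanDeriv_cont (p : 𝕁 n) :
    ContinuousOn (fun z : ℝ × (Fin n → ℝ) => Φ.meanDeriv z.1 z.2 p) (paramSet ×ˢ cube n) := by
  refine continuousOn_const.mul (continuousOn_setIntegral isCompact_Icc ?_)
  have hC := Φ.C_point_cont (n := n)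
  have hb : ∀ σ, ContinuousOn (fun z : (ℝ × (Fin n → ℝ)) × ℝ => Φ.b z.1.1 z.2 σ)
      ((paramSet ×ˢ cube n) ×ˢ 𝕀) := fun σ =>
    Φ.b_comp (by fun_prop) (by fun_prop) (fun _ hz => hz.1.1) (fun _ hz => hz.2) _
  simp only [Function.uncurry_def, meanInt]
  fun_prop

lemma scalar_cont {l : ℝ} (hl : l ∈ paramSet) : ContinuousOn (Φ.scalar l) 𝕀 := by
  have hb : ∀ μ, ContinuousOn (fun u => Φ.b l u μ) 𝕀 := fun μ =>
    Φ.b_comp continuousOn_const continuousOn_id (fun _ _ => hl) (fun _ h => h) μ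
  have hC : ∀ μ ν, ContinuousOn (fun u => Φ.C l u u μ ν) 𝕀 := fun μ ν =>
    Φ.C_comp continuousOn_const continuousOn_id continuousOn_id (fun _ _ => hl) (fun _ h => h)
      (fun _ h => h) μ ν
  unfold scalar
  fun_prop

variable (R : ℳ (Fin D))

def vert (l : ℝ) : ℳ (Fin D) := R + MvPolynomial.C (1 - l) * Φ.quad

def ev (l : ℝ) (τ : Fin n → ℝ) (F : ℳ (𝕁 n)) : ℝ := W (Φ.cov l τ) (Φ.mean l τ) F

/-- The `n`-vertex integral. -/
def vInt (n : ℕ) (l : ℝ) : ℝ := ∫ τ in cube n, Φ.ev l τ (𝒱 l)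

/-- The `n`-vertex integral with one vertex replaced by the quadratic potential. -/
def qInt (n : ℕ) (l : ℝ) : ℝ := ∑ i : Fin n, ∫ τ in cube n, Φ.ev l τ (𝒬 l i)

def evDeriv (l : ℝ) (τ : Fin n → ℝ) (F : ℳ (𝕁 n)) : ℝ :=
  1 / 2 * (∑ p, ∑ q, Φ.covDeriv l τ p q * Φ.ev l τ (pderiv p (pderiv q F)))
    + ∑ p, Φ.meanDeriv l τ p * Φ.ev l τ (pderiv p F)

def vertPoly (n : ℕ) : Polynomial (ℳ (𝕁 n)) :=
  ∏ i : Fin n, (Polynomial.C (vtx i R) + Polynomial.X * Polynomial.C (vtx i Φ.quad))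

lemma eval_vtx_add (i : Fin n) (l : ℝ) : (Polynomial.C (vtx i R)
    + Polynomial.X * Polynomial.C (vtx i Φ.quad)).eval (MvPolynomial.C (1 - l))
      = vtx i (Φ.vert R l) := by
  simp [vtx, vert]
  exact mul_comm _ _

lemma eval_vertPoly (l : ℝ) : (Φ.vertPoly R n).eval (MvPolynomial.C (1 - l)) = 𝒱 l := by
  simp only [vertPoly, Polynomial.eval_prod, pt, eval_vtx_add]

lemma eval_derivative_vertPoly (l : ℝ) :
    (Φ.vertPoly R n).derivative.eval (MvPolynomial.C (1 - l)) = ∑ i, 𝒬 l i := by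
  rw [vertPoly, Polynomial.derivative_prod_finset, Polynomial.eval_finsetSum]
  refine sum_congr rfl fun i _ => ?_
  rw [pt_update, Polynomial.eval_mul, Polynomial.eval_prod, mul_comm]
  simp only [eval_vtx_add]
  simp

lemma hasDerivAt_ev {l : ℝ} (hl : l ∈ paramSet) {τ : Fin n → ℝ} (hτ : τ ∈ cube n) :
    HasDerivAt (fun l => Φ.ev l τ (𝒱 l)) (Φ.evDeriv l τ (𝒱 l) - ∑ i, Φ.ev l τ (𝒬 l i)) l := by
  have h := hasDerivAt_W_polynomial (C := fun l => Φ.cov l τ) (C' := Φ.covDeriv l τ)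
    (b := fun l => Φ.mean l τ) (b' := Φ.meanDeriv l τ) (c := fun l => 1 - l) (c' := -1) (x := l)
    (fun p q => Φ.C_deriv l hl _ (mem_cube.1 hτ _) _ (mem_cube.1 hτ _) _ _)
    (fun p => Φ.b_deriv l hl _ (mem_cube.1 hτ _) _)
    (by simpa using (hasDerivAt_id l).const_sub 1) (Φ.vertPoly R n)
  simp only [eval_vertPoly, eval_derivative_vertPoly, map_sum] at h
  refine h.congr_deriv ?_
  simp only [evDeriv, ev]; ring

lemma ev_cont (p : Polynomial (ℳ (𝕁 n))) :
    ContinuousOn (fun z : ℝ × (Fin n → ℝ) => Φ.ev z.1 z.2 (p.eval (MvPolynomial.C (1 - z.1))))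
      (paramSet ×ˢ cube n) := by
  have e : ∀ z : ℝ × (Fin n → ℝ), Φ.ev z.1 z.2 (p.eval (MvPolynomial.C (1 - z.1)))
      = ∑ k ∈ ℛ (p.natDegree + 1), (1 - z.1) ^ k * Φ.ev z.1 z.2 (p.coeff k) := by
    intro z
    rw [ev, Polynomial.eval_eq_sum_range, map_sum]
    refine sum_congr rfl fun k _ => ?_
    rw [← map_pow, mul_comm, MvPolynomial.C_mul', map_smul, smul_eq_mul, ev]
  simp only [e]
  refine continuousOn_finsetSum _ fun k _ => ContinuousOn.mul (by fun_prop) ?_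
  exact W_continuousOn (fun p q => Φ.cov_cont p q) (fun p => Φ.mean_cont p) _

lemma exists_pderiv_polynomial (α : 𝕁 n) (p : Polynomial (ℳ (𝕁 n))) :
    ∃ q : Polynomial (ℳ (𝕁 n)), ∀ c : ℝ,
      pderiv α (p.eval (MvPolynomial.C c)) = q.eval (MvPolynomial.C c) := by
  induction p using Polynomial.induction_on' with
  | add p q hp hq =>
    obtain ⟨p', hp'⟩ := hp
    obtain ⟨q', hq'⟩ := hq
    exact ⟨p' + q', fun c => by simp [hp', hq']⟩
  | monomial m F =>
    refine ⟨Polynomial.monomial m (pderiv α F), fun c => ?_⟩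
    rw [Polynomial.eval_monomial, Polynomial.eval_monomial, ← map_pow, mul_comm, pderiv_C_mul, mul_comm]

lemma evDeriv_cont (p : Polynomial (ℳ (𝕁 n))) :
    ContinuousOn (fun z : ℝ × (Fin n → ℝ) => Φ.evDeriv z.1 z.2 (p.eval (MvPolynomial.C (1 - z.1))))
      (paramSet ×ˢ cube n) := by
  refine (continuousOn_const.mul ?_).add ?_
  · refine continuousOn_finsetSum _ fun α _ => continuousOn_finsetSum _ fun β _ =>
      (Φ.covDeriv_cont α β).mul ?_
    obtain ⟨q, hq⟩ := exists_pderiv_polynomial β p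
    obtain ⟨q', hq'⟩ := exists_pderiv_polynomial α q
    simp only [hq, hq']
    exact Φ.ev_cont q'
  · refine continuousOn_finsetSum _ fun α _ => (Φ.meanDeriv_cont α).mul ?_
    obtain ⟨q, hq⟩ := exists_pderiv_polynomial α p
    simp only [hq]
    exact Φ.ev_cont q

def _root_.Worldline.updPoly (R Q : ℳ (Fin D)) (i : Fin n) :
    Polynomial (ℳ (𝕁 n)) :=
  Polynomial.C (vtx i Q) * ∏ j ∈ Finset.univ.erase i,
    (Polynomial.C (vtx j R) + Polynomial.X * Polynomial.C (vtx j Q))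

lemma eval_updPoly (i : Fin n) (l : ℝ) :
    (updPoly R Φ.quad i).eval (MvPolynomial.C (1 - l)) = 𝒬 l i := by
  simp only [updPoly, pt_update, Polynomial.eval_mul, Polynomial.eval_C, Polynomial.eval_prod,
    eval_vtx_add]

lemma ev_update_cont (i : Fin n) :
    ContinuousOn (fun z : ℝ × (Fin n → ℝ) => Φ.ev z.1 z.2 (𝒬 z.1 i)) (paramSet ×ˢ cube n) := by
  simpa only [eval_updPoly] using Φ.ev_cont (updPoly R Φ.quad i)

lemma ev_vert_cont :
    ContinuousOn (fun z : ℝ × (Fin n → ℝ) => Φ.ev z.1 z.2 (𝒱 z.1)) (paramSet ×ˢ cube n) := by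
  simpa only [eval_vertPoly] using Φ.ev_cont (Φ.vertPoly R n)

lemma evDeriv_vert_cont :
    ContinuousOn (fun z : ℝ × (Fin n → ℝ) => Φ.evDeriv z.1 z.2 (𝒱 z.1)) (paramSet ×ˢ cube n) := by
  simpa only [eval_vertPoly] using Φ.evDeriv_cont (Φ.vertPoly R n)

lemma slice {f : ℝ × (Fin n → ℝ) → ℝ} (hf : ContinuousOn f (paramSet ×ˢ cube n)) {l : ℝ}
    (hl : l ∈ paramSet) : ContinuousOn (fun τ => f (l, τ)) (cube n) :=
  hf.comp (f := fun τ => (l, τ)) (by fun_prop) fun _ h => ⟨hl, h⟩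

lemma integrable_slice {f : ℝ × (Fin n → ℝ) → ℝ} (hf : ContinuousOn f (paramSet ×ˢ cube n))
    {l : ℝ} (hl : l ∈ paramSet) : IntegrableOn (fun τ => f (l, τ)) (cube n) :=
  (slice hf hl).integrableOn_compact isCompact_cube

lemma hasDerivAt_vInt {l : ℝ} (hl : l ∈ paramSet) :
    HasDerivAt (Φ.vInt R n) ((∫ τ in cube n, Φ.evDeriv l τ (𝒱 l)) - Φ.qInt R n l) l := by
  have c := Φ.evDeriv_vert_cont R (n := n)
  have c3 := continuousOn_finsetSum Finset.univ fun i _ => Φ.ev_update_cont R (n := n) i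
  refine (hasDerivAt_setIntegral (μ := volume) (isCompact_cube (n := n)) isOpen_paramSet
    (ψ' := fun l τ => Φ.evDeriv l τ (𝒱 l) - ∑ i, Φ.ev l τ (𝒬 l i)) (fun l hl => slice (Φ.ev_vert_cont R) hl) (c.sub c3)
    (fun l hl τ hτ => Φ.hasDerivAt_ev R hl hτ) hl).congr_deriv ?_
  exact (integral_sub (integrable_slice c hl) (integrable_slice c3 hl)).trans (congrArg _
    (integral_finsetSum _ fun i _ => integrable_slice (Φ.ev_update_cont R i) hl))

lemma ev_quad_insertNth {l : ℝ} (hl : l ∈ paramSet) (i : Fin (n + 1)) {s : ℝ} (hs : s ∈ 𝕀)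
    {τ : Fin n → ℝ} (hτ : τ ∈ cube n) (A : ℳ (Fin D)) :
    Φ.ev l (ins i s τ) (pt (update (fun _ => A) i Φ.quad)) = Φ.scalar l s * Φ.ev l τ (pt fun _ => A)
        + (∑ p, Φ.meanInt l τ s p * Φ.ev l τ (pderiv p (pt fun _ => A)))
        + 1 / 2 * ∑ p, ∑ q, Φ.covInt l τ s p q
          * Φ.ev l τ (pderiv p (pderiv q (pt fun _ => A))) := by
  have hm := mem_cube.1 (insertNth_mem_cube (i := i).2 ⟨hs, hτ⟩)
  rw [pt_succAbove i]
  simp only [update_self, ne_eq, Fin.succAbove_ne, not_false_eq_true, update_of_ne]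
  have hs : ∀ α β, Φ.cov l (ins i s τ) α β = Φ.cov l (ins i s τ) β α :=
    fun α β => Φ.C_symm l hl _ (hm _) _ (hm _) _ _
  rw [ev, quad, W_quadratic_mul hs _ _ _ _ _ Φ.H_symm]
  have e1 : (fun p q : 𝕁 n => Φ.cov l (ins i s τ) (skip i p) (skip i q)) = Φ.cov l τ := by
    funext p q; simp [cov, skip]
  have e2 : Φ.mean l (ins i s τ) ∘ skip i = Φ.mean l τ := by funext p; simp [mean, skip]
  rw [e1, e2]
  simp only [ev, scalar, cov, mean, covInt, meanInt, skip, Fin.insertNth_apply_same, Prod.map_fst, Prod.map_snd,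
    Fin.insertNth_apply_succAbove, id_eq]

lemma integral_add_add_const_mul {X : Type*} [MeasurableSpace X] {m : Measure X} {f g h : X → ℝ}
    {c : ℝ} (hf : Integrable f m) (hg : Integrable g m) (hh : Integrable h m) :
    ∫ x, (f x + g x + c * h x) ∂m = (∫ x, f x ∂m) + (∫ x, g x ∂m) + c * ∫ x, h x ∂m := by
  have := integral_add (hf.add hg) (hh.const_mul c)
  have h2 := integral_add hf hg
  simp only [Pi.add_apply] at this h2
  rw [this, h2, integral_const_mul]

lemma integral_ev_quad {l : ℝ} (hl : l ∈ paramSet) (i : Fin (n + 1)) :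
    -Φ.T * ∫ τ in cube (n + 1), Φ.ev l τ (𝒬 l i) = (-Φ.T * ∫ u in 𝕀, Φ.scalar l u) * Φ.vInt R n l
        + ∫ τ in cube n, Φ.evDeriv l τ (𝒱 l) := by
  rw [integral_cube_succ' i (slice (Φ.ev_update_cont R i) hl), vInt, ← integral_const_mul,
    ← integral_const_mul, ← integral_add ((integrable_slice (Φ.ev_vert_cont R) hl).const_mul _)
      (integrable_slice (Φ.evDeriv_vert_cont R) hl)]
  refine setIntegral_congr_fun measurableSet_cube fun τ hτ => ?_
  simp only
  rw [setIntegral_congr_fun measurableSet_Icc fun s hs => Φ.ev_quad_insertNth hl i hs hτ _]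
  have hCc : ∀ j μ ν, ContinuousOn (fun s => Φ.C l s (τ j) μ ν) 𝕀 := fun j μ ν =>
    Φ.C_comp continuousOn_const continuousOn_id continuousOn_const (fun _ _ => hl) (fun _ h => h)
      (fun _ _ => mem_cube.1 hτ j) μ ν
  have hbc : ∀ μ, ContinuousOn (fun s => Φ.b l s μ) 𝕀 := fun μ =>
    Φ.b_comp continuousOn_const continuousOn_id (fun _ _ => hl) (fun _ h => h) μ
  have i0 : IntegrableOn (fun s => Φ.scalar l s * Φ.ev l τ (𝒱 l)) 𝕀 :=
    ((Φ.scalar_cont hl).mul continuousOn_const).integrableOn_compact isCompact_Icc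
  have i1 : ∀ p, IntegrableOn (fun s => Φ.meanInt l τ s p * Φ.ev l τ (pderiv p (𝒱 l))) 𝕀 := by
    intro p
    refine ContinuousOn.integrableOn_compact isCompact_Icc ?_
    unfold meanInt
    fun_prop
  have i2 : ∀ p q, IntegrableOn (fun s => Φ.covInt l τ s p q
      * Φ.ev l τ (pderiv p (pderiv q (𝒱 l)))) 𝕀 := by
    intro p q
    refine ContinuousOn.integrableOn_compact isCompact_Icc ?_
    unfold covInt
    fun_prop
  have i3 := fun p => integrable_finsetSum Finset.univ fun q _ => i2 p q
  rw [integral_add_add_const_mul i0 (integrable_finsetSum _ fun p _ => i1 p)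
    (integrable_finsetSum _ fun p _ => i3 p),
    integral_finsetSum _ fun p _ => i1 p, integral_finsetSum _ fun p _ => i3 p]
  simp only [integral_finsetSum _ fun q _ => i2 _ q, integral_mul_const, evDeriv, covDeriv, meanDeriv]
  simp only [mul_assoc, ← mul_sum]
  ring

lemma qInt_succ {l : ℝ} (hl : l ∈ paramSet) :
    -Φ.T * Φ.qInt R (n + 1) l = ((n : ℝ) + 1) * ((-Φ.T * ∫ u in 𝕀, Φ.scalar l u) * Φ.vInt R n l
        + ∫ τ in cube n, Φ.evDeriv l τ (𝒱 l)) := by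
  rw [qInt, mul_sum]
  simp only [Φ.integral_ev_quad R hl]
  rw [sum_const, Finset.card_univ, Fintype.card_fin, nsmul_eq_mul, Nat.cast_succ]

/-- The partial sum over at most `M` vertices. -/
def total (M : ℕ) (l : ℝ) : ℝ :=
  Φ.N l * ∑ n ∈ ℛ (M + 1), (-Φ.T) ^ n / (n.factorial : ℝ) * Φ.vInt R n l

lemma hasDerivAt_total (M : ℕ) {l : ℝ} (hl : l ∈ paramSet) :
    HasDerivAt (Φ.total R M)
      (Φ.N l * ((-Φ.T) ^ (M + 1) / ((M + 1).factorial : ℝ) * Φ.qInt R (M + 1) l)) l := by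
  have h := (Φ.N_deriv l hl).mul (HasDerivAt.fun_sum (u := ℛ (M + 1)) fun n _ =>
    (Φ.hasDerivAt_vInt R (n := n) hl).const_mul ((-Φ.T) ^ n / (n.factorial : ℝ)))
  refine h.congr_deriv ?_
  have key : ∀ M : ℕ, (-Φ.T * ∫ u in 𝕀, Φ.scalar l u)
      * (∑ n ∈ ℛ (M + 1), (-Φ.T) ^ n / (n.factorial : ℝ) * Φ.vInt R n l)
      + ∑ n ∈ ℛ (M + 1), (-Φ.T) ^ n / (n.factorial : ℝ) *
        ((∫ τ in cube n, Φ.evDeriv l τ (𝒱 l)) - Φ.qInt R n l)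
      = (-Φ.T) ^ (M + 1) / ((M + 1).factorial : ℝ) * Φ.qInt R (M + 1) l := by
    have step : ∀ n : ℕ, (-Φ.T) ^ (n + 1) / ((n + 1).factorial : ℝ) * Φ.qInt R (n + 1) l
        = (-Φ.T) ^ n / (n.factorial : ℝ) * ((-Φ.T * ∫ u in 𝕀, Φ.scalar l u) * Φ.vInt R n l
        + ∫ τ in cube n, Φ.evDeriv l τ (𝒱 l)) := by
      intro n
      have := Φ.qInt_succ R (n := n) hl
      have h1 : (n.factorial : ℝ) ≠ 0 := by positivity
      have h2 : (n : ℝ) + 1 ≠ 0 := by positivity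
      rw [pow_succ, Nat.factorial_succ, Nat.cast_mul, Nat.cast_succ, mul_div_assoc,
        mul_assoc, div_mul_eq_mul_div, this]
      field_simp
    intro M
    induction M with
    | zero =>
      rw [step 0]
      simp [qInt]
    | succ M ih =>
      rw [sum_range_succ, sum_range_succ (fun n => (-Φ.T) ^ n / (n.factorial : ℝ) *
        ((∫ τ in cube n, Φ.evDeriv l τ (𝒱 l)) - Φ.qInt R n l)), step (M + 1)]
      linear_combination ih
  rw [← key M]
  simp only [scalar]
  ring

end Interpolation

end

section

open MvPolynomial

/-! ### The Gaussian weights of a kernel datum -/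

namespace KernelDatum

variable (𝒦 : KernelDatum)

def g (z s : ℝ) : ℝ := ∫ u in 𝕀, 𝒦.k z s u

def Q (z : ℝ) : ℝ := ∫ s in 𝕀, 𝒦.g z s

lemma g_cont_joint : ContinuousOn (fun p : ℝ × ℝ => 𝒦.g p.1 p.2) ({z | |z| < 𝒦.r} ×ˢ 𝕀) := by
  refine continuousOn_setIntegral isCompact_Icc ?_
  exact 𝒦.cont_joint.comp (f := fun q : (ℝ × ℝ) × ℝ => (q.1.1, q.1.2, q.2)) (by fun_prop)
    fun q hq => ⟨hq.1.1, hq.1.2, hq.2⟩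

lemma g_cont {z : ℝ} (hz : |z| < 𝒦.r) : ContinuousOn (𝒦.g z) 𝕀 :=
  𝒦.g_cont_joint.comp (f := fun s => (z, s)) (by fun_prop) fun _ hs => ⟨hz, hs⟩

lemma g_bound {z : ℝ} (hz : |z| < 𝒦.r) : ∀ s ∈ 𝕀, |𝒦.g z s| ≤ 2 := fun s hs =>
  setIntegral_abs_le fun u hu => 𝒦.bound hz s hs u hu

lemma Q_bound {z : ℝ} (hz : |z| < 𝒦.r) : |𝒦.Q z| ≤ 2 :=
  setIntegral_abs_le fun s hs => 𝒦.g_bound hz s hs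

lemma kk_cont (s : ℝ) (hs : s ∈ 𝕀) : ContinuousOn (fun q : (ℝ × ℝ) × ℝ =>
    𝒦.k q.1.1 s q.2 * 𝒦.k q.1.1 q.2 q.1.2) (({z | |z| < 𝒦.r} ×ˢ 𝕀) ×ˢ 𝕀) :=
  (𝒦.cont_joint.comp (f := fun q : (ℝ × ℝ) × ℝ => (q.1.1, s, q.2)) (by fun_prop)
    fun q hq => ⟨hq.1.1, hs, hq.2⟩).mul
  (𝒦.cont_joint.comp (f := fun q : (ℝ × ℝ) × ℝ => (q.1.1, q.2, q.1.2)) (by fun_prop)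
    fun q hq => ⟨hq.1.1, hq.2, hq.1.2⟩)

lemma integral_integral_swap_of_continuousOn {f : ℝ → ℝ → ℝ}
    (hf : ContinuousOn (Function.uncurry f) (𝕀 ×ˢ 𝕀)) :
    ∫ s in 𝕀, ∫ t in 𝕀, f s t = ∫ t in 𝕀, ∫ s in 𝕀, f s t := by
  refine integral_integral_swap ?_
  have := hf.integrableOn_compact (μ := volume) (isCompact_Icc.prod isCompact_Icc)
  rwa [IntegrableOn, Measure.volume_eq_prod, ← Measure.prod_restrict] at this

lemma hasDerivAt_g {z : ℝ} (hz : |z| < 𝒦.r) {s : ℝ} (hs : s ∈ 𝕀) :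
    HasDerivAt (fun z => 𝒦.g z s) (-∫ v in 𝕀, 𝒦.k z s v * 𝒦.g z v) z := by
  have h := hasDerivAt_setIntegral (μ := volume) (isCompact_Icc (a := (0 : ℝ)) (b := 1)) 𝒦.isOpen_r
    (ψ := fun z u => 𝒦.k z s u) (ψ' := fun z u => -∫ v in 𝕀, 𝒦.k z s v * 𝒦.k z v u)
    (fun z hz => cont_right (𝒦.cont z hz) hs)
    (continuousOn_setIntegral isCompact_Icc (𝒦.kk_cont s hs)).neg
    (fun z hz u hu => 𝒦.hasDerivAt_k hz hs hu) hz
  refine h.congr_deriv ?_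
  rw [integral_neg, integral_integral_swap_of_continuousOn]
  · simp only [integral_const_mul, g]
  · exact (𝒦.kk_cont s hs).comp (f := fun q : ℝ × ℝ => ((z, q.1), q.2)) (by fun_prop)
      fun q hq => ⟨⟨hz, hq.1⟩, hq.2⟩

lemma kg_cont : ContinuousOn (fun q : (ℝ × ℝ) × ℝ => 𝒦.k q.1.1 q.1.2 q.2 * 𝒦.g q.1.1 q.2)
    (({z | |z| < 𝒦.r} ×ˢ 𝕀) ×ˢ 𝕀) :=
  (𝒦.cont_joint.comp (f := fun q : (ℝ × ℝ) × ℝ => (q.1.1, q.1.2, q.2)) (by fun_prop)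
    fun q hq => ⟨hq.1.1, hq.1.2, hq.2⟩).mul
  (𝒦.g_cont_joint.comp (f := fun q : (ℝ × ℝ) × ℝ => (q.1.1, q.2)) (by fun_prop)
    fun q hq => ⟨hq.1.1, hq.2⟩)

lemma hasDerivAt_Q {z : ℝ} (hz : |z| < 𝒦.r) :
    HasDerivAt 𝒦.Q (-∫ v in 𝕀, 𝒦.g z v * 𝒦.g z v) z := by
  have h := hasDerivAt_setIntegral (μ := volume) (isCompact_Icc (a := (0 : ℝ)) (b := 1)) 𝒦.isOpen_r
    (ψ := fun z s => 𝒦.g z s) (ψ' := fun z s => -∫ v in 𝕀, 𝒦.k z s v * 𝒦.g z v)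
    (fun z hz => 𝒦.g_cont hz) (continuousOn_setIntegral isCompact_Icc 𝒦.kg_cont).neg
    (fun z hz u hu => 𝒦.hasDerivAt_g hz hu) hz
  refine h.congr_deriv ?_
  rw [integral_neg, integral_integral_swap_of_continuousOn]
  · simp only [integral_mul_const]
    congr 1
    refine setIntegral_congr_fun measurableSet_Icc fun v hv => ?_
    congr 1
    exact setIntegral_congr_fun measurableSet_Icc fun s hs => 𝒦.symm z hz s hs v hv
  · exact 𝒦.kg_cont.comp (f := fun q : ℝ × ℝ => ((z, q.1), q.2)) (by fun_prop)
      fun q hq => ⟨⟨hz, hq.1⟩, hq.2⟩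

end KernelDatum

/-- An orthonormal frame of eigenvectors, with eigenvalues. -/
structure Spectrum (D : ℕ) where
  U : Fin D → Fin D → ℝ
  η : Fin D → ℝ
  orth : ∀ i j, ∑ ρ, U ρ i * U ρ j = if i = j then 1 else 0
  complete : ∀ μ ν, ∑ j, U μ j * U ν j = if μ = ν then 1 else 0

namespace Spectrum

variable {D : ℕ} (S : Spectrum D)

def mat (f : Fin D → ℝ) (μ ν : Fin D) : ℝ := ∑ j, S.U μ j * S.U ν j * f j

lemma mat_symm (f : Fin D → ℝ) (μ ν : Fin D) : S.mat f μ ν = S.mat f ν μ := by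
  simp only [mat, mul_comm (S.U μ _)]

def coord (a : Fin D → ℝ) (j : Fin D) : ℝ := ∑ μ, S.U μ j * a μ

lemma coord_sum (p : Fin D → ℝ) (j : Fin D) : S.coord (fun ρ => ∑ i, S.U ρ i * p i) j = p j := by
  simp only [coord, mul_sum, ← mul_assoc]
  rw [sum_comm]
  simp only [← sum_mul, S.orth]
  simp

lemma _root_.Finset.sum_rotate {α β γ : Type*} [Fintype α] [Fintype β] [Fintype γ]
    (f : α → β → γ → ℝ) : ∑ a, ∑ b, ∑ c, f a b c = ∑ c, ∑ a, ∑ b, f a b c :=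
  (sum_congr rfl fun _ _ => sum_comm).trans sum_comm

lemma contract (f p q : Fin D → ℝ) :
    ∑ ρ, ∑ σ, S.mat f ρ σ * (∑ i, S.U ρ i * p i) * (∑ l, S.U σ l * q l) = ∑ j, f j * p j * q j := by
  have h : ∀ ρ σ, S.mat f ρ σ * (∑ i, S.U ρ i * p i) * (∑ l, S.U σ l * q l)
      = ∑ j, f j * ((S.U ρ j * (∑ i, S.U ρ i * p i)) * (S.U σ j * (∑ l, S.U σ l * q l))) := by
    intro ρ σ
    rw [mat, sum_mul, sum_mul]
    grind
  simp only [h]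
  rw [Finset.sum_rotate]
  refine sum_congr rfl fun j _ => ?_
  simp only [← mul_sum, ← sum_mul]
  have h1 := S.coord_sum p j
  have h2 := S.coord_sum q j
  simp only [coord] at h1 h2
  rw [h1, h2]; ring

lemma contract_vec (a p : Fin D → ℝ) :
    ∑ ρ, a ρ * (∑ i, S.U ρ i * p i) = ∑ j, S.coord a j * p j := by
  simp only [coord, mul_sum, sum_mul]
  rw [sum_comm]
  grind

lemma contract_mat (f q : Fin D → ℝ) : ∑ μ, ∑ ν, S.mat f μ ν * S.mat q μ ν = ∑ j, f j * q j := by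
  have h : ∀ μ ν, S.mat f μ ν * S.mat q μ ν = ∑ j, q j *
      (S.mat f μ ν * (∑ i, S.U μ i * (Pi.single j 1 : Fin D → ℝ) i)
        * (∑ i, S.U ν i * (Pi.single j 1 : Fin D → ℝ) i)) := by
    intro μ ν
    conv_lhs => rw [show S.mat q μ ν = ∑ j, S.U μ j * S.U ν j * q j from rfl]
    rw [mul_sum]
    refine sum_congr rfl fun j _ => ?_
    simp [Pi.single_apply]
    ring
  simp only [h]
  rw [Finset.sum_rotate]
  refine sum_congr rfl fun j _ => ?_
  simp only [← mul_sum]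
  rw [S.contract]
  simp [Pi.single_apply, mul_comm]

end Spectrum

/-! ### The interpolation between the free and the full Gaussian weight -/

section Construction

variable {D : ℕ} (𝒦 : KernelDatum) (S : Spectrum D)

/-- The matrix Green function on `[0,1]`, for the parameter `z`. -/
def covMat (z s t : ℝ) : Fin D → Fin D → ℝ := S.mat fun j => 𝒦.k (z * S.η j) s t

def meanVec (a : Fin D → ℝ) (z s : ℝ) (μ : Fin D) : ℝ :=
  ∑ j, S.U μ j * (S.coord a j * 𝒦.g (z * S.η j) s)

def quadForm (a : Fin D → ℝ) (z : ℝ) : ℝ := ∑ j, S.coord a j ^ 2 * 𝒦.Q (z * S.η j)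

def detFn (z : ℝ) : ℝ := ∏ j, 𝒦.φ (z * S.η j)

def normFn (v₀ : ℝ) (a : Fin D → ℝ) (T l : ℝ) : ℝ :=
  exp (-l * T * v₀ + 1 / 2 * l ^ 2 * T ^ 3 * quadForm 𝒦 S a (l * T ^ 2))
    * detFn 𝒦 S (l * T ^ 2) ^ (-(1 / 2) : ℝ)

def Admissible (T : ℝ) : Prop := ∀ j, 2 * (T ^ 2 * |S.η j|) < 𝒦.r

variable {𝒦 S} {T : ℝ}

lemma Admissible.abs_lt (hT : Admissible 𝒦 S T) {l : ℝ} (hl : l ∈ paramSet) (j : Fin D) :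
    |l * T ^ 2 * S.η j| < 𝒦.r := by
  have h1 : |l| ≤ 2 := abs_le.2 ⟨by linarith [hl.1], hl.2.le⟩
  have := hT j
  rw [abs_mul, abs_mul, abs_of_nonneg (sq_nonneg T)]
  have h3 : 0 ≤ T ^ 2 * |S.η j| := by positivity
  nlinarith

lemma hasDerivAt_arg (l : ℝ) (j : Fin D) :
    HasDerivAt (fun l => l * T ^ 2 * S.η j) (T ^ 2 * S.η j) l := by
  simpa [mul_assoc] using (hasDerivAt_id l).mul_const (T ^ 2 * S.η j)

lemma covMat_cont (hT : Admissible 𝒦 S T) (μ ν : Fin D) :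
    ContinuousOn (fun p : ℝ × ℝ × ℝ => covMat 𝒦 S (p.1 * T ^ 2) p.2.1 p.2.2 μ ν)
      (paramSet ×ˢ 𝕀 ×ˢ 𝕀) := by
  simp only [covMat, Spectrum.mat]
  refine continuousOn_finsetSum _ fun j _ => continuousOn_const.mul ?_
  exact 𝒦.cont_joint.comp (f := fun p : ℝ × ℝ × ℝ => (p.1 * T ^ 2 * S.η j, p.2)) (by fun_prop)
    fun p hp => ⟨hT.abs_lt hp.1 j, hp.2⟩

lemma meanVec_cont (hT : Admissible 𝒦 S T) (a : Fin D → ℝ) (μ : Fin D) :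
    ContinuousOn (fun p : ℝ × ℝ => meanVec 𝒦 S a (p.1 * T ^ 2) p.2 μ) (paramSet ×ˢ 𝕀) := by
  refine continuousOn_finsetSum _ fun j _ => continuousOn_const.mul (continuousOn_const.mul ?_)
  exact 𝒦.g_cont_joint.comp (f := fun p : ℝ × ℝ => (p.1 * T ^ 2 * S.η j, p.2)) (by fun_prop)
    fun p hp => ⟨hT.abs_lt hp.1 j, hp.2⟩

lemma mul_covMat (c z s t : ℝ) (μ ν : Fin D) : c * covMat 𝒦 S z s t μ ν
    = ∑ j, S.U μ j * (S.U ν j * (c * 𝒦.k (z * S.η j) s t)) := by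
  simp only [covMat, Spectrum.mat, mul_sum, mul_assoc, mul_left_comm c]

lemma mul_meanVec (c : ℝ) (a : Fin D → ℝ) (z s : ℝ) (μ : Fin D) : c * meanVec 𝒦 S a z s μ
    = ∑ j, S.U μ j * (c * (S.coord a j * 𝒦.g (z * S.η j) s)) := by
  simp only [meanVec, mul_sum, mul_left_comm c]

variable (𝒦 S)

set_option hygiene false in
local notation:max "𝔨" j:max => 𝒦.k (l * T ^ 2 * S.η j)

set_option hygiene false in
local notation:max "𝔤" j:max => 𝒦.g (l * T ^ 2 * S.η j)

def interpolation (hT : Admissible 𝒦 S T) (v₀ : ℝ) (a : Fin D → ℝ) : Interpolation D where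
  T := T
  v₀ := v₀
  a := a
  H := S.mat S.η
  C l s t μ ν := T * covMat 𝒦 S (l * T ^ 2) s t μ ν
  b l s μ := -(l * T ^ 2) * meanVec 𝒦 S a (l * T ^ 2) s μ
  N := normFn 𝒦 S v₀ a T
  H_symm := S.mat_symm _
  C_symm l hl s hs t ht μ ν := by
    rw [covMat, S.mat_symm, covMat]
    simp only [𝒦.symm _ (hT.abs_lt hl _) s hs t ht]
  C_cont μ ν := continuousOn_const.mul (covMat_cont hT μ ν)
  b_cont μ := by
    have h := meanVec_cont hT a μ
    fun_prop
  C_deriv l hl s hs t ht μ ν := by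
    have hk := fun j => (𝒦.hasDerivAt_k (hT.abs_lt hl j) hs ht).comp l (hasDerivAt_arg l j)
    have h := (HasDerivAt.fun_sum (u := Finset.univ) fun j _ =>
      (hk j).const_mul (S.U μ j * S.U ν j)).const_mul T
    refine h.congr_deriv ?_
    have e : ∀ u ∈ 𝕀, ∑ ρ, ∑ σ, S.mat S.η ρ σ * (T * covMat 𝒦 S (l * T ^ 2) u s ρ μ)
        * (T * covMat 𝒦 S (l * T ^ 2) u t σ ν) = ∑ j, (T ^ 2 * S.η j * S.U μ j * S.U ν j)
          * (𝔨 j s u * 𝔨 j u t) := by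
      intro u hu
      simp only [mul_covMat]
      rw [S.contract]
      refine sum_congr rfl fun j _ => ?_
      rw [𝒦.symm _ (hT.abs_lt hl j) s hs u hu]; ring
    rw [setIntegral_congr_fun measurableSet_Icc e, integral_finsetSum]
    · simp only [integral_const_mul, mul_sum]
      grind
    · exact fun j _ => (KernelDatum.int_comp (𝒦.cont _ (hT.abs_lt hl j)) (𝒦.cont _ (hT.abs_lt hl j))
        hs ht).const_mul _
  b_deriv l hl s hs μ := by
    have hg := fun j => (𝒦.hasDerivAt_g (hT.abs_lt hl j) hs).comp l (hasDerivAt_arg l j)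
    have h := (((hasDerivAt_id l).mul_const (T ^ 2)).neg).mul
      (HasDerivAt.fun_sum (u := Finset.univ) fun j _ =>
        ((hg j).const_mul (S.coord a j)).const_mul (S.U μ j))
    refine h.congr_deriv ?_
    have e : ∀ u, u ∈ 𝕀 → ∑ ρ, (a ρ + ∑ σ, S.mat S.η ρ σ * (-(l * T ^ 2) *
          meanVec 𝒦 S a (l * T ^ 2) u σ)) * (T * covMat 𝒦 S (l * T ^ 2) u s ρ μ)
        = ∑ j, ((T * S.U μ j * S.coord a j) * 𝔨 j s u
          + (-(l * T ^ 3) * S.η j * S.U μ j * S.coord a j)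
          * (𝔨 j s u * 𝔤 j u)) := by
      intro u hu
      have h := S.contract S.η (fun i => S.U μ i * (T * 𝔨 i u s))
        fun i => -(l * T ^ 2) * (S.coord a i * 𝔤 i u)
      simp only [mul_right_comm (S.mat _ _ _)] at h
      simp only [mul_covMat, mul_meanVec, add_mul, sum_add_distrib, sum_mul]
      rw [S.contract_vec, h, ← sum_add_distrib, ← sum_add_distrib]
      refine sum_congr rfl fun j _ => ?_
      rw [𝒦.symm _ (hT.abs_lt hl j) s hs u hu]; ring
    have i1 : ∀ j : Fin D, IntegrableOn (fun u => 𝔨 j s u) 𝕀 := fun j =>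
      (KernelDatum.cont_right (𝒦.cont _ (hT.abs_lt hl j)) hs).integrableOn_compact isCompact_Icc
    have i2 : ∀ j : Fin D, IntegrableOn (fun u => 𝔨 j s u * 𝔤 j u) 𝕀 := fun j =>
      ((KernelDatum.cont_right (𝒦.cont _ (hT.abs_lt hl j)) hs).mul
        (𝒦.g_cont (hT.abs_lt hl j))).integrableOn_compact isCompact_Icc
    rw [setIntegral_congr_fun measurableSet_Icc e, integral_finsetSum]
    · rw [mul_sum, mul_sum, mul_sum, ← sum_add_distrib]
      refine sum_congr rfl fun j _ => ?_
      rw [integral_add ((i1 j).const_mul _) ((i2 j).const_mul _), integral_const_mul,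
        integral_const_mul]
      simp only [KernelDatum.g, Function.comp_apply, id, Pi.neg_apply]
      ring
    · exact fun j _ => ((i1 j).const_mul _).add ((i2 j).const_mul _)
  N_deriv l hl := by
    have hz := fun j => hT.abs_lt hl j
    have hQ := fun j => (𝒦.hasDerivAt_Q (hz j)).comp l (hasDerivAt_arg l j)
    have hφ := fun j => (𝒦.hasDerivAt_φ (hz j)).comp l (hasDerivAt_arg l j)
    have hq : HasDerivAt (fun l => quadForm 𝒦 S a (l * T ^ 2)) _ l :=
      HasDerivAt.fun_sum (u := Finset.univ) fun j _ => (hQ j).const_mul (S.coord a j ^ 2)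
    have hpos : 0 < detFn 𝒦 S (l * T ^ 2) := Finset.prod_pos fun j _ => 𝒦.φ_pos _ (hz j)
    have hd : HasDerivAt (fun l => detFn 𝒦 S (l * T ^ 2)) (detFn 𝒦 S (l * T ^ 2) *
        ∑ j, T ^ 2 * S.η j * ∫ s in 𝕀, 𝔨 j s s) l := by
      have := HasDerivAt.fun_finsetProd (u := Finset.univ) fun j _ => hφ j
      refine this.congr_deriv ?_
      rw [mul_sum]
      refine sum_congr rfl fun j _ => ?_
      rw [detFn, ← mul_prod_erase _ _ (Finset.mem_univ j), smul_eq_mul]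
      grind
    set q' := ∑ j, S.coord a j ^ 2 * ((-∫ v in 𝕀, 𝔤 j v * 𝔤 j v) * (T ^ 2 * S.η j)) with hq'
    have hE : HasDerivAt (fun l => -l * T * v₀ + 1 / 2 * l ^ 2 * T ^ 3 * quadForm 𝒦 S a (l * T ^ 2))
        (-T * v₀ + (l * T ^ 3 * quadForm 𝒦 S a (l * T ^ 2) + 1 / 2 * l ^ 2 * T ^ 3 * q')) l := by
      refine ((((hasDerivAt_id' l).neg.mul_const T).mul_const v₀).add
        (((((hasDerivAt_id' l).pow 2).const_mul (1 / 2)).mul_const (T ^ 3)).mul hq)).congr_deriv ?_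
      simp
    have hexp := hE.exp
    have h := hexp.mul (hd.rpow_const (p := -(1 / 2)) (Or.inl hpos.ne'))
    refine h.congr_deriv ?_
    set f : Fin D → ℝ → ℝ := fun j u => -(l * T ^ 2) * S.coord a j ^ 2 * 𝔤 j u
      + 1 / 2 * (l * T ^ 2) ^ 2 * S.coord a j ^ 2 * S.η j * (𝔤 j u * 𝔤 j u)
      + 1 / 2 * T * S.η j * 𝔨 j u u with hf
    have e : ∀ u ∈ 𝕀, v₀ + ∑ μ, a μ * (-(l * T ^ 2) * meanVec 𝒦 S a (l * T ^ 2) u μ)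
        + 1 / 2 * (∑ μ, ∑ ν, S.mat S.η μ ν * ((-(l * T ^ 2) * meanVec 𝒦 S a (l * T ^ 2) u μ)
          * (-(l * T ^ 2) * meanVec 𝒦 S a (l * T ^ 2) u ν)))
        + 1 / 2 * (∑ μ, ∑ ν, S.mat S.η μ ν * (T * covMat 𝒦 S (l * T ^ 2) u u μ ν))
        = v₀ + ∑ j, f j u := by
      intro u _
      simp only [mul_meanVec, ← mul_assoc (S.mat _ _ _)]
      rw [S.contract_vec, S.contract]
      simp only [mul_right_comm _ T, ← sum_mul, covMat, S.contract_mat]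
      simp only [mul_sum, sum_mul, add_assoc, ← sum_add_distrib]
      congr 1
      exact sum_congr rfl fun j _ => by ring
    have i1 : ∀ j : Fin D, IntegrableOn (fun u => 𝔤 j u) 𝕀 := fun j =>
      (𝒦.g_cont (hz j)).integrableOn_compact isCompact_Icc
    have i2 : ∀ j : Fin D, IntegrableOn (fun u => 𝔤 j u * 𝔤 j u) 𝕀 := fun j =>
      ((𝒦.g_cont (hz j)).mul (𝒦.g_cont (hz j))).integrableOn_compact isCompact_Icc
    have i3 : ∀ j : Fin D, IntegrableOn (fun u => 𝔨 j u u) 𝕀 := fun j =>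
      ((𝒦.cont _ (hz j)).comp (f := fun u : ℝ => (u, u)) (by fun_prop)
        fun _ h => ⟨h, h⟩).integrableOn_compact isCompact_Icc
    have i4 : ∀ j, IntegrableOn (f j) 𝕀 := fun j =>
      (((i1 j).const_mul _).add ((i2 j).const_mul _)).add ((i3 j).const_mul _)
    have e3 := fun j => Interpolation.integral_add_add_const_mul
      ((i1 j).const_mul (-(l * T ^ 2) * S.coord a j ^ 2))
      ((i2 j).const_mul (1 / 2 * (l * T ^ 2) ^ 2 * S.coord a j ^ 2 * S.η j)) (i3 j)
      (c := 1 / 2 * T * S.η j)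
    rw [setIntegral_congr_fun measurableSet_Icc e, integral_add (by simp)
      (integrable_finsetSum _ fun j _ => i4 j), integral_finsetSum _ fun j _ => i4 j]
    simp only [hf, e3, integral_const_mul]
    have e4 : detFn 𝒦 S (l * T ^ 2) ^ (-(1 / 2) - 1 : ℝ) * detFn 𝒦 S (l * T ^ 2)
        = detFn 𝒦 S (l * T ^ 2) ^ (-(1 / 2) : ℝ) := by
      rw [Real.rpow_sub_one hpos.ne', div_mul_cancel₀ _ hpos.ne']
    have e5 : ∫ _ in 𝕀, v₀ = v₀ := by simp
    rw [normFn, e5]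
    set X := exp (-l * T * v₀ + 1 / 2 * l ^ 2 * T ^ 3 * quadForm 𝒦 S a (l * T ^ 2))
    simp only [sum_add_distrib, quadForm, hq', ← e4, mul_sum, sum_mul, mul_add, add_mul,
      KernelDatum.Q]
    ring_nf

end Construction

end

section

open MvPolynomial

/-! ### Bounds and elementary asymptotics -/

lemma wk_bounded {ι : Type*} [Fintype ι] (k : ℕ) (F : ℳ ι) (B : ℝ) :
    ∃ M, 0 ≤ M ∧ ∀ (C : ι → ι → ℝ) (b : ι → ℝ), (∀ α β, |C α β| ≤ B) → (∀ α, |b α| ≤ B) →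
      |wk C b k F| ≤ M := by
  have hK : IsCompact ((univ.pi fun _ : ι => univ.pi fun _ : ι => Icc (-B) B) ×ˢ
      (univ.pi fun _ : ι => Icc (-B) B)) :=
    (isCompact_univ_pi fun _ => isCompact_univ_pi fun _ => isCompact_Icc).prod
      (isCompact_univ_pi fun _ => isCompact_Icc)
  have hc : ContinuousOn (fun p : (ι → ι → ℝ) × (ι → ℝ) => wk p.1 p.2 k F)
      ((univ.pi fun _ : ι => univ.pi fun _ : ι => Icc (-B) B) ×ˢ
      (univ.pi fun _ : ι => Icc (-B) B)) :=
    wk_continuousOn (C := fun p : (ι → ι → ℝ) × (ι → ℝ) => p.1) (b := fun p => p.2)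
      (fun α β => by fun_prop) (fun α => by fun_prop) k F
  obtain ⟨M, hM⟩ := hK.exists_bound_of_continuousOn hc
  refine ⟨max M 0, le_max_right _ _, fun C b hC hb => (hM (C, b) ⟨?_, ?_⟩).trans (le_max_left _ _)⟩
  · grind
  grind

lemma W_bounded {ι : Type*} [Fintype ι] (F : ℳ ι) (B : ℝ) :
    ∃ M, 0 ≤ M ∧ ∀ (C : ι → ι → ℝ) (b : ι → ℝ), (∀ α β, |C α β| ≤ B) → (∀ α, |b α| ≤ B) →
      |W C b F| ≤ M := by
  choose M hM0 hM using fun k => wk_bounded k F B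
  refine ⟨∑ k ∈ ℛ (F.totalDegree + 1), M k, sum_nonneg fun k _ => hM0 k, fun C b hC hb => ?_⟩
  rw [W_eq_sum (K := F.totalDegree + 1) _ _ (by omega)]
  exact (abs_sum_le_sum_abs _ _).trans (sum_le_sum fun k _ => hM k C b hC hb)

lemma W_polynomial_bounded {ι : Type*} [Fintype ι] (p : Polynomial (ℳ ι)) (B : ℝ) :
    ∃ M, 0 ≤ M ∧ ∀ (C : ι → ι → ℝ) (b : ι → ℝ) (c : ℝ), (∀ α β, |C α β| ≤ B) → (∀ α, |b α| ≤ B) →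
      |c| ≤ 1 → |W C b (p.eval (MvPolynomial.C c))| ≤ M := by
  choose M hM0 hM using fun k => W_bounded (p.coeff k) B
  refine ⟨∑ k ∈ ℛ (p.natDegree + 1), M k, sum_nonneg fun k _ => hM0 k, fun C b c hC hb hc => ?_⟩
  rw [Polynomial.eval_eq_sum_range, map_sum]
  refine (abs_sum_le_sum_abs _ _).trans (sum_le_sum fun k _ => ?_)
  rw [← map_pow, mul_comm, MvPolynomial.C_mul', map_smul, smul_eq_mul, abs_mul, abs_pow]
  calc _ ≤ 1 * M k := mul_le_mul (pow_le_one₀ (abs_nonneg _) hc) (hM k C b hC hb) (abs_nonneg _)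
        zero_le_one
    _ = M k := one_mul _

lemma isBigO_const_mul_pow (c : ℝ) {m N : ℕ} (h : N ≤ m) : (fun T : ℝ => c * T ^ m) =O₀ N := by
  refine IsBigO.of_bound |c| ?_
  filter_upwards [Ioc_mem_nhdsGT (show (0 : ℝ) < 1 by norm_num)] with T hT
  rw [norm_mul, norm_eq_abs, norm_pow, norm_pow]
  have : ‖T‖ ≤ 1 := by rw [norm_eq_abs, abs_of_pos hT.1]; exact hT.2
  exact mul_le_mul_of_nonneg_left (pow_le_pow_of_le_one (norm_nonneg _) this h) (abs_nonneg _)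

lemma isBigO_truncate (N : ℕ) (K : ℕ → ℕ) (hK : ∀ n, N + 1 ≤ K n) (c : ℕ → ℕ → ℝ) :
    (fun T : ℝ => ∑ n ∈ ℛ (N + 1), ∑ k ∈ ℛ (K n), c n k * T ^ (n + k)
      - ∑ m ∈ ℛ (N + 1), (∑ p ∈ antidiagonal m, c p.1 p.2) * T ^ m)
      =O₀ (N + 1) := by
  have e : ∀ T : ℝ, ∑ n ∈ ℛ (N + 1), ∑ k ∈ ℛ (K n), c n k * T ^ (n + k)
      - ∑ m ∈ ℛ (N + 1), (∑ p ∈ antidiagonal m, c p.1 p.2) * T ^ m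
      = ∑ n ∈ ℛ (N + 1), ∑ k ∈ Finset.Ico (N + 1 - n) (K n), c n k * T ^ (n + k) := by
    intro T
    have h1 : ∑ m ∈ ℛ (N + 1), (∑ p ∈ antidiagonal m, c p.1 p.2) * T ^ m
        = ∑ n ∈ ℛ (N + 1), ∑ k ∈ ℛ (N + 1 - n), c n k * T ^ (n + k) := by
      rw [← Finset.sum_range_diag_flip]
      refine sum_congr rfl fun m _ => ?_
      rw [Finset.Nat.sum_antidiagonal_eq_sum_range_succ fun i j => c i j, sum_mul]
      refine sum_congr rfl fun k hk => ?_
      simp_all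
    rw [h1, ← sum_sub_distrib]
    refine sum_congr rfl fun n _ => ?_
    rw [Finset.sum_Ico_eq_sub _ (by have := hK n; omega)]
  simp only [e]
  refine IsBigO.fun_sum fun n _ => IsBigO.fun_sum fun k hk => isBigO_const_mul_pow _ ?_
  grind

/-! ### The coefficients of the heat kernel -/

variable {D n : ℕ}

/-- The covariance `κ (τ i) (τ j) δ_{μν}`. -/
def freeCov (κ : ℝ → ℝ → ℝ) (τ : Fin n → ℝ) (p q : 𝕁 n) : ℝ :=
  if p.2 = q.2 then κ (τ p.1) (τ q.1) else 0

/-- The `m`-th coefficient of the expansion in powers of `T`, for the free Green function `κ`. -/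
def heatCoef (κ : ℝ → ℝ → ℝ) (m : ℕ) (v : Jet D) : ℝ :=
  ∑ p ∈ antidiagonal m, (-1) ^ p.1 / (p.1.factorial : ℝ) *
    ∫ τ in cube p.1, wj (freeCov κ τ) p.2 fun _ : Fin p.1 => v

def Jet.grad (v : Jet D) (μ : Fin D) : ℝ := v ⟨1, ![μ]⟩

lemma piece_one (v : Jet D) : piece v 1 = ∑ μ, MvPolynomial.C (v.grad μ) * X μ := by
  rw [piece]
  refine Fintype.sum_equiv (Equiv.funUnique (Fin 1) (Fin D)) _ _ fun μ => ?_
  have : μ = ![μ 0] := by funext i; fin_cases i; rfl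
  rw [this]
  simp [Jet.grad]

lemma piece_two (v : Jet D) :
    piece v 2 = ∑ μ, ∑ ν, MvPolynomial.C (v ⟨2, ![μ, ν]⟩ / 2) * (X μ * X ν) := by
  rw [piece, ← Fintype.sum_prod_type' fun μ ν => MvPolynomial.C (v ⟨2, ![μ, ν]⟩ / 2) * (X μ * X ν)]
  refine Fintype.sum_equiv (finTwoArrowEquiv (Fin D)) _ _ fun μ => ?_
  have : μ = ![μ 0, μ 1] := by funext i; fin_cases i <;> rfl
  rw [this]
  simp

def higherP (v : Jet D) (N : ℕ) : ℳ (Fin D) := ∑ k ∈ Finset.Icc 3 (2 * N), piece v k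

lemma higherP_add (v : Jet D) (N : ℕ) :
    higherP v N + (MvPolynomial.C v.val0 + ∑ μ, MvPolynomial.C (v.grad μ) * X μ
      + ∑ μ, ∑ ν, MvPolynomial.C (v ⟨2, ![μ, ν]⟩ / 2) * (X μ * X ν)) = taylorP v (max 2 (2 * N)) := by
  rw [← piece_zero, ← piece_one, ← piece_two, taylorP, higherP]
  have : ℛ (max 2 (2 * N) + 1) = Finset.Icc 3 (2 * N) ∪ {0, 1, 2} := by ext k; simp; omega
  grind

lemma pt_sum {ι : Type*} [DecidableEq ι] (s : Finset ι) (A : ι → ℳ (Fin D)) :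
    pt (fun _ : Fin n => ∑ k ∈ s, A k)
      = ∑ k ∈ Fintype.piFinset fun _ : Fin n => s, pt fun i => A (k i) := by
  simp only [pt, vtx, map_sum]
  exact Finset.prod_univ_sum _ _

lemma pt_isHomogeneous (A : Fin n → ℳ (Fin D)) (d : Fin n → ℕ)
    (h : ∀ i, (A i).IsHomogeneous (d i)) : (pt A).IsHomogeneous (∑ i, d i) :=
  IsHomogeneous.prod _ _ _ fun i _ => (h i).rename_isHomogeneous

section Resummation

variable (𝒦 : KernelDatum) (S : Spectrum D)

/-- The contribution of `n` vertices of orders `k`, without the factor `e^{S/2}`. -/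
def redTerm (v : Jet D) (T : ℝ) (n : ℕ) (k : Fin n → ℕ) : ℝ :=
  (-T) ^ n / (n.factorial : ℝ) * ∫ τ in cube n,
    W (fun p q : 𝕁 n => T * covMat 𝒦 S (T ^ 2) (τ p.1) (τ q.1) p.2 q.2)
      (fun p => -T ^ 2 * meanVec 𝒦 S v.grad (T ^ 2) (τ p.1) p.2) (pt fun i => piece v (k i))

def redSum (v : Jet D) (N : ℕ) (T : ℝ) : ℝ := ∑ n ∈ ℛ (N + 1),
    ∑ k ∈ (Fintype.piFinset fun _ : Fin n => Finset.Icc 3 (2 * N)).filter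
        (fun k => 2 * n + ∑ i, k i ≤ 2 * N), redTerm 𝒦 S v T n k

variable {S} in
lemma Spectrum.abs_U_le (μ j : Fin D) : |S.U μ j| ≤ 1 := by
  have h := S.complete μ μ
  rw [if_pos rfl] at h
  have h2 : S.U μ j * S.U μ j ≤ 1 := by
    rw [← h]
    exact single_le_sum (f := fun j => S.U μ j * S.U μ j) (fun i _ => mul_self_nonneg _)
      (Finset.mem_univ j)
  exact abs_le_one_iff_mul_self_le_one.2 h2

lemma covMat_bound {z : ℝ} (hz : ∀ j, |z * S.η j| < 𝒦.r) {s t : ℝ} (hs : s ∈ 𝕀) (ht : t ∈ 𝕀)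
    (μ ν : Fin D) : |covMat 𝒦 S z s t μ ν| ≤ 2 * D := by
  rw [covMat, Spectrum.mat]
  refine (abs_sum_le_sum_abs _ _).trans ?_
  refine (Finset.sum_le_card_nsmul _ _ 2 fun j _ => ?_).trans (by simp [mul_comm])
  rw [abs_mul, abs_mul]
  have h1 := S.abs_U_le μ j
  have h2 := S.abs_U_le ν j
  have h3 := 𝒦.bound (hz j) s hs t ht
  calc _ ≤ (1 : ℝ) * 1 * 2 := by gcongr
    _ = 2 := by norm_num

lemma meanVec_bound (a : Fin D → ℝ) {z : ℝ} (hz : ∀ j, |z * S.η j| < 𝒦.r) {s : ℝ} (hs : s ∈ 𝕀)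
    (μ : Fin D) : |meanVec 𝒦 S a z s μ| ≤ ∑ j, |S.coord a j| * 2 := by
  refine (abs_sum_le_sum_abs _ _).trans (sum_le_sum fun j _ => ?_)
  rw [abs_mul, abs_mul]
  have h1 := S.abs_U_le μ j
  have h3 := 𝒦.g_bound (hz j) s hs
  calc _ ≤ (1 : ℝ) * (|S.coord a j| * 2) := by gcongr
    _ = _ := one_mul _

lemma quadForm_bound (a : Fin D → ℝ) {z : ℝ} (hz : ∀ j, |z * S.η j| < 𝒦.r) :
    |quadForm 𝒦 S a z| ≤ ∑ j, S.coord a j ^ 2 * 2 := by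
  refine (abs_sum_le_sum_abs _ _).trans (sum_le_sum fun j _ => ?_)
  rw [abs_mul, abs_of_nonneg (sq_nonneg _)]
  exact mul_le_mul_of_nonneg_left (𝒦.Q_bound (hz j)) (sq_nonneg _)

lemma detFn_zero : detFn 𝒦 S 0 = 1 := by simp [detFn, 𝒦.φ_zero]

lemma detFn_tendsto : Tendsto (detFn 𝒦 S) (𝓝 0) (𝓝 1) := by
  rw [← detFn_zero 𝒦 S]
  refine tendsto_finsetProd _ fun j _ => ?_
  have h : Tendsto (fun z => z * S.η j) (𝓝 0) (𝓝 0) := by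
    simpa using (continuous_mul_const (S.η j)).tendsto 0
  have h2 := 𝒦.φ_cont.tendsto.comp h
  rwa [zero_mul]

lemma eventually_admissible : ∀ᶠ T in 𝓝[>] (0 : ℝ), Admissible 𝒦 S T := by
  refine nhdsWithin_le_nhds (eventually_all.2 fun j => ?_)
  have h : Tendsto (fun T : ℝ => 2 * (T ^ 2 * |S.η j|)) (𝓝 0) (𝓝 (2 * (0 ^ 2 * |S.η j|))) :=
    (by fun_prop : Continuous fun T : ℝ => 2 * (T ^ 2 * |S.η j|)).tendsto 0
  refine h.eventually_lt_const ?_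
  simpa using 𝒦.r_pos

lemma exists_normFn_bound (v₀ : ℝ) (a : Fin D → ℝ) : ∃ M, ∀ᶠ T in 𝓝[>] (0 : ℝ),
    ∀ l ∈ 𝕀, |normFn 𝒦 S v₀ a T l| ≤ M := by
  refine ⟨exp (|v₀| + ∑ j, S.coord a j ^ 2 * 2) * (1 / 2 : ℝ) ^ (-(1 / 2) : ℝ), ?_⟩
  have h1 : ∀ᶠ z in 𝓝 (0 : ℝ), 1 / 2 < detFn 𝒦 S z :=
    (detFn_tendsto 𝒦 S).eventually_const_lt (by norm_num)
  obtain ⟨δ, hδ, hball⟩ := Metric.eventually_nhds_iff.1 h1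
  have h2 : ∀ᶠ T in 𝓝[>] (0 : ℝ), T ^ 2 < δ := by
    refine nhdsWithin_le_nhds ?_
    have h : Tendsto (fun T : ℝ => T ^ 2) (𝓝 0) (𝓝 (0 ^ 2)) := (continuous_pow 2).tendsto 0
    exact h.eventually_lt_const (by simpa using hδ)
  filter_upwards [h2, eventually_admissible 𝒦 S, Ioc_mem_nhdsGT (show (0 : ℝ) < 1 by norm_num)]
    with T hT hA hT1 l hl
  have hlp : l ∈ paramSet := ⟨by linarith [hl.1], by linarith [hl.2]⟩
  rw [normFn, abs_mul, Real.abs_exp]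
  have hd : 1 / 2 < detFn 𝒦 S (l * T ^ 2) := by
    refine hball ?_
    rw [Real.dist_eq, sub_zero, abs_of_nonneg (mul_nonneg hl.1 (sq_nonneg T))]
    nlinarith [sq_nonneg T, hl.2]
  rw [abs_of_pos (Real.rpow_pos_of_pos (by linarith) _)]
  have hq := quadForm_bound 𝒦 S a (fun j => hA.abs_lt hlp j)
  refine mul_le_mul (Real.exp_le_exp.2 ?_) ?_ (Real.rpow_nonneg (by linarith) _) (Real.exp_nonneg _)
  · refine add_le_add ?_ ?_
    · refine (le_abs_self _).trans ?_
      rw [abs_mul, abs_mul, abs_neg, abs_of_nonneg hl.1, abs_of_pos hT1.1]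
      have := abs_nonneg v₀
      have h3 : l * T ≤ 1 := mul_le_one₀ hl.2 hT1.1.le hT1.2
      nlinarith
    · refine (le_abs_self _).trans ?_
      rw [abs_mul]
      have h3 : |1 / 2 * l ^ 2 * T ^ 3| ≤ 1 := by
        have h4 : 0 ≤ l ^ 2 := sq_nonneg l
        have h5 : 0 ≤ T ^ 3 := pow_nonneg hT1.1.le 3
        rw [abs_of_nonneg (by positivity)]
        have h6 : l ^ 2 ≤ 1 := pow_le_one₀ hl.1 hl.2
        have h7 : T ^ 3 ≤ 1 := pow_le_one₀ hT1.1.le hT1.2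
        nlinarith
      calc _ ≤ 1 * ∑ j, S.coord a j ^ 2 * 2 := mul_le_mul h3 hq (abs_nonneg _) zero_le_one
        _ = _ := one_mul _
  · exact Real.rpow_le_rpow_of_nonpos (by norm_num) hd.le (by norm_num)

end Resummation

end

section

open MvPolynomial

/-! ### The resummation theorem -/

section Resummation

variable {D : ℕ} (𝒦 : KernelDatum) (S : Spectrum D)

lemma integral_cube_abs_le {n : ℕ} {f : (Fin n → ℝ) → ℝ} {M : ℝ} (h : ∀ τ ∈ cube n, |f τ| ≤ M) :
    |∫ τ in cube n, f τ| ≤ M := by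
  have hv : volume (cube n) = 1 := by simp [cube, Real.volume_Icc_pi]
  have := norm_setIntegral_le_of_norm_le_const (μ := volume) (s := cube n) (f := f) (C := M)
    (by simp [hv]) h
  simpa [Measure.real, hv] using this

lemma paramSet_of_mem {l : ℝ} (hl : l ∈ 𝕀) : l ∈ paramSet :=
  ⟨by linarith [hl.1], by linarith [hl.2]⟩

lemma exists_qInt_bound (v₀ : ℝ) (a : Fin D → ℝ) (R : ℳ (Fin D)) (n : ℕ) :
    ∃ M, ∀ T ∈ Ioc (0 : ℝ) 1, ∀ hT : Admissible 𝒦 S T, ∀ l ∈ 𝕀,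
      |(interpolation 𝒦 S hT v₀ a).qInt R n l| ≤ M := by
  set B : ℝ := 2 * D + ∑ j, |S.coord a j| * 2 with hB
  have hB1 : 0 ≤ ∑ j, |S.coord a j| * 2 := sum_nonneg fun j _ => by positivity
  choose M hM0 hM using fun i : Fin n => W_polynomial_bounded (updPoly R
    (MvPolynomial.C v₀ + ∑ μ, MvPolynomial.C (a μ) * X μ
      + ∑ μ, ∑ ν, MvPolynomial.C (S.mat S.η μ ν / 2) * (X μ * X ν)) i) B
  refine ⟨∑ i, M i, fun T hT1 hT l hl => ?_⟩
  have hz := fun j => hT.abs_lt (paramSet_of_mem hl) j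
  rw [Interpolation.qInt]
  refine (abs_sum_le_sum_abs _ _).trans (sum_le_sum fun i _ => ?_)
  refine integral_cube_abs_le fun τ hτ => ?_
  have hτ' := mem_cube.1 hτ
  rw [Interpolation.ev, ← Interpolation.eval_updPoly]
  refine hM i _ _ _ ?_ ?_ ?_
  · intro p q
    change |T * covMat 𝒦 S (l * T ^ 2) _ _ _ _| ≤ B
    rw [abs_mul, abs_of_pos hT1.1]
    have := covMat_bound 𝒦 S hz (hτ' p.1) (hτ' q.1) p.2 q.2
    calc _ ≤ 1 * (2 * (D : ℝ)) := mul_le_mul hT1.2 this (abs_nonneg _) zero_le_one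
      _ ≤ B := by linarith
  · intro p
    change |-(l * T ^ 2) * meanVec 𝒦 S a (l * T ^ 2) _ _| ≤ B
    rw [abs_mul, abs_neg, abs_of_nonneg (mul_nonneg hl.1 (sq_nonneg T))]
    have := meanVec_bound 𝒦 S a hz (hτ' p.1) p.2
    have h1 : l * T ^ 2 ≤ 1 := mul_le_one₀ hl.2 (sq_nonneg T) (pow_le_one₀ hT1.1.le hT1.2)
    calc _ ≤ 1 * ∑ j, |S.coord a j| * 2 := mul_le_mul h1 this (abs_nonneg _) zero_le_one
      _ ≤ B := by linarith
  grind

lemma total_sub_total (v₀ : ℝ) (a : Fin D → ℝ) (R : ℳ (Fin D)) (N : ℕ) :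
    ∃ M, ∀ᶠ T in 𝓝[>] (0 : ℝ), ∀ hT : Admissible 𝒦 S T,
      |(interpolation 𝒦 S hT v₀ a).total R N 1 - (interpolation 𝒦 S hT v₀ a).total R N 0|
        ≤ M * T ^ (N + 1) := by
  obtain ⟨M₁, hM₁⟩ := exists_normFn_bound 𝒦 S v₀ a
  obtain ⟨M₂, hM₂⟩ := exists_qInt_bound 𝒦 S v₀ a R (N + 1)
  refine ⟨|M₁| * |M₂|, ?_⟩
  filter_upwards [hM₁, Ioc_mem_nhdsGT (show (0 : ℝ) < 1 by norm_num)] with T h1 hT1 hT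
  set Φ := interpolation 𝒦 S hT v₀ a
  have := norm_image_sub_le_of_norm_deriv_le_segment_01' (f := Φ.total R N)
    (C := |M₁| * |M₂| * T ^ (N + 1))
    (fun l hl => (Φ.hasDerivAt_total R N (paramSet_of_mem hl)).hasDerivWithinAt) ?_
  · exact this
  intro l hl
  have hl' : l ∈ 𝕀 := ⟨hl.1, hl.2.le⟩
  rw [norm_mul, norm_mul, norm_eq_abs, norm_eq_abs, norm_eq_abs]
  have e1 : |Φ.N l| ≤ |M₁| := (h1 l hl').trans (le_abs_self _)
  have e2 : |Φ.qInt R (N + 1) l| ≤ |M₂| := (hM₂ T hT1 hT l hl').trans (le_abs_self _)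
  have e3 : |(-Φ.T) ^ (N + 1) / ((N + 1).factorial : ℝ)| ≤ T ^ (N + 1) := by
    change |(-T) ^ (N + 1) / ((N + 1).factorial : ℝ)| ≤ T ^ (N + 1)
    rw [abs_div, abs_pow, abs_neg, abs_of_pos hT1.1, Nat.abs_cast]
    refine div_le_self (pow_nonneg hT1.1.le _) ?_
    exact_mod_cast Nat.one_le_iff_ne_zero.2 (Nat.factorial_ne_zero _)
  calc _ ≤ |M₁| * (T ^ (N + 1) * |M₂|) := by
        refine mul_le_mul e1 (mul_le_mul e3 e2 (abs_nonneg _) (pow_nonneg hT1.1.le _)) ?_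
          (abs_nonneg _)
        positivity
    _ = _ := by ring

variable (v : Jet D)

lemma covMat_zero (s t : ℝ) (μ ν : Fin D) :
    covMat 𝒦 S 0 s t μ ν = if μ = ν then 𝒦.k 0 s t else 0 := by
  simp only [covMat, Spectrum.mat, zero_mul, ← sum_mul, S.complete]
  split_ifs <;> simp

lemma freeCov_continuous {κ : ℝ → ℝ → ℝ} (hκ : 𝒞₂ κ) {n : ℕ}
    (p q : 𝕁 n) : Continuous fun τ : Fin n → ℝ => freeCov κ τ p q := by
  unfold freeCov
  split_ifs
  · fun_prop
  fun_prop

lemma total_zero {T : ℝ} (hT : Admissible 𝒦 S T) (hH : ∀ μ ν, v ⟨2, ![μ, ν]⟩ = S.mat S.η μ ν)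
    (N : ℕ) (K : ℕ → ℕ)
    (hK : ∀ n, (pt (fun _ : Fin n => taylorP v (max 2 (2 * N)))).totalDegree < 2 * K n) :
    (interpolation 𝒦 S hT v.val0 v.grad).total (higherP v N) N 0
      = ∑ n ∈ ℛ (N + 1), ∑ k ∈ ℛ (K n), ((-1) ^ n / (n.factorial : ℝ) *
        ∫ τ in cube n, wk (freeCov (𝒦.k 0) τ) 0 k (pt fun _ => taylorP v (max 2 (2 * N))))
          * T ^ (n + k) := by
  set Φ := interpolation 𝒦 S hT v.val0 v.grad with hΦ
  have hN : Φ.N 0 = 1 := by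
    change normFn 𝒦 S v.val0 v.grad T 0 = 1
    simp [normFn, detFn_zero]
  rw [Interpolation.total, hN, one_mul]
  refine sum_congr rfl fun n _ => ?_
  have hv : Φ.vert (higherP v N) 0 = taylorP v (max 2 (2 * N)) := by
    rw [← higherP_add]
    simp only [hH]
    change higherP v N + MvPolynomial.C (1 - 0) * _ = _
    rw [sub_zero, map_one, one_mul]
    rfl
  have hC : ∀ τ : Fin n → ℝ, Φ.cov 0 τ = fun p q => T * freeCov (𝒦.k 0) τ p q := by
    intro τ
    funext p q
    change T * covMat 𝒦 S (0 * T ^ 2) _ _ _ _ = _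
    rw [zero_mul, covMat_zero, freeCov]
  have hb : ∀ τ : Fin n → ℝ, Φ.mean 0 τ = 0 := by
    intro τ
    funext p
    change -(0 * T ^ 2) * _ = _
    simp
  rw [Interpolation.vInt]
  simp only [Interpolation.ev, hv, hC, hb, W_eq_sum _ _ (hK n), wk_smul_cov]
  rw [integral_finsetSum]
  · simp only [integral_const_mul, mul_sum]
    refine sum_congr rfl fun k _ => ?_
    rw [show Φ.T = T from rfl, neg_pow, pow_add]; ring
  · intro k _
    refine Integrable.const_mul (IntegrableOn.integrable
      (ContinuousOn.integrableOn_compact isCompact_cube ?_)) _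
    exact wk_continuousOn (fun p q => (freeCov_continuous 𝒦.cont_zero p q).continuousOn)
      (fun _ => continuousOn_const) _ _

lemma total_one {T : ℝ} (hT : Admissible 𝒦 S T) (N : ℕ) :
    (interpolation 𝒦 S hT v.val0 v.grad).total (higherP v N) N 1
      = normFn 𝒦 S v.val0 v.grad T 1 * ∑ n ∈ ℛ (N + 1),
        ∑ k ∈ Fintype.piFinset fun _ : Fin n => Finset.Icc 3 (2 * N), redTerm 𝒦 S v T n k := by
  set Φ := interpolation 𝒦 S hT v.val0 v.grad with hΦ
  rw [Interpolation.total]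
  congr 1
  refine sum_congr rfl fun n _ => ?_
  have hv : Φ.vert (higherP v N) 1 = higherP v N := by simp [Interpolation.vert]
  have h1 : (1 : ℝ) ∈ paramSet := paramSet_of_mem ⟨zero_le_one, le_rfl⟩
  rw [Interpolation.vInt]
  rw [hv]
  simp only [higherP, pt_sum, Interpolation.ev, map_sum]
  rw [integral_finsetSum, mul_sum]
  · refine sum_congr rfl fun k _ => ?_
    have hC : ∀ τ : Fin n → ℝ, Φ.cov 1 τ
        = fun p q => T * covMat 𝒦 S (T ^ 2) (τ p.1) (τ q.1) p.2 q.2 := by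
      intro τ
      funext p q
      change T * covMat 𝒦 S (1 * T ^ 2) _ _ _ _ = _
      rw [one_mul]
    have hb : ∀ τ : Fin n → ℝ, Φ.mean 1 τ
        = fun p => -T ^ 2 * meanVec 𝒦 S v.grad (T ^ 2) (τ p.1) p.2 := by
      intro τ
      funext p
      change -(1 * T ^ 2) * meanVec 𝒦 S v.grad (1 * T ^ 2) _ _ = _
      rw [one_mul]
    simp only [hC, hb, redTerm]
    rfl
  · intro k _
    refine ContinuousOn.integrableOn_compact isCompact_cube ?_
    exact W_continuousOn (fun p q => Interpolation.slice (Φ.cov_cont p q) h1)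
      (fun p => Interpolation.slice (Φ.mean_cont p) h1) _

lemma redTerm_isBigO {n N : ℕ} (k : Fin n → ℕ) (h : 2 * N < 2 * n + ∑ i, k i) :
    (fun T => redTerm 𝒦 S v T n k) =O₀ (N + 1) := by
  set d := ∑ i, k i with hd
  set F : ℳ (𝕁 n) := pt fun i => piece v (k i) with hF
  have hFh : F.IsHomogeneous d := pt_isHomogeneous _ _ fun i => piece_isHomogeneous v (k i)
  set B : ℝ := 2 * D + ∑ j, |S.coord v.grad j| * 2 with hB
  have hB1 : 0 ≤ ∑ j, |S.coord v.grad j| * 2 := sum_nonneg fun j _ => by positivity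
  have hB2 : (0 : ℝ) ≤ 2 * D := by positivity
  choose M hM0 hM using fun j => wk_bounded j F B
  refine IsBigO.of_bound (∑ j ∈ ℛ (F.totalDegree + 1), M j) ?_
  filter_upwards [eventually_admissible 𝒦 S, Ioc_mem_nhdsGT (show (0 : ℝ) < 1 by norm_num)]
    with T hT hT1
  have hz : ∀ j, |T ^ 2 * S.η j| < 𝒦.r := fun j => by
    simpa using hT.abs_lt (paramSet_of_mem ⟨zero_le_one, le_rfl⟩) j
  rw [norm_eq_abs, norm_eq_abs, abs_of_nonneg (pow_nonneg hT1.1.le _), redTerm, abs_mul]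
  have e1 : |(-T) ^ n / (n.factorial : ℝ)| ≤ T ^ n := by
    rw [abs_div, abs_pow, abs_neg, abs_of_pos hT1.1, Nat.abs_cast]
    refine div_le_self (pow_nonneg hT1.1.le _) ?_
    exact_mod_cast Nat.one_le_iff_ne_zero.2 (Nat.factorial_ne_zero _)
  refine (mul_le_mul_of_nonneg_right e1 (abs_nonneg _)).trans ?_
  rw [← abs_of_nonneg (pow_nonneg hT1.1.le n), ← abs_mul, ← integral_const_mul]
  refine integral_cube_abs_le fun τ hτ => ?_
  have hτ' := mem_cube.1 hτ
  rw [W_eq_sum (F := F) (K := F.totalDegree + 1) _ _ (by omega), mul_sum, sum_mul]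
  refine (abs_sum_le_sum_abs _ _).trans (sum_le_sum fun j _ => ?_)
  rw [abs_mul, abs_of_nonneg (pow_nonneg hT1.1.le n), wk_smul_cov]
  rcases lt_or_ge d (2 * j) with hj | hj
  · have : wk (fun p q : 𝕁 n => covMat 𝒦 S (T ^ 2) (τ p.1) (τ q.1) p.2 q.2)
        (fun p => -T ^ 2 * meanVec 𝒦 S v.grad (T ^ 2) (τ p.1) p.2) j F = 0 := by
      refine wk_eq_zero_of_totalDegree _ _ (lt_of_le_of_lt ?_ hj)
      exact hFh.totalDegree_le
    rw [this, mul_zero, abs_zero, mul_zero]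
    exact mul_nonneg (hM0 j) (pow_nonneg hT1.1.le _)
  · obtain ⟨e, he⟩ := Nat.exists_eq_add_of_le' hj
    rw [wk_smul_mean (d := e) _ _ _ _ (by rw [← he]; exact hFh)]
    have hw := hM j (fun p q : 𝕁 n => covMat 𝒦 S (T ^ 2) (τ p.1) (τ q.1) p.2 q.2)
      (fun p => meanVec 𝒦 S v.grad (T ^ 2) (τ p.1) p.2)
      (fun p q => (covMat_bound 𝒦 S hz (hτ' p.1) (hτ' q.1) p.2 q.2).trans (by linarith))
      (fun p => (meanVec_bound 𝒦 S v.grad hz (hτ' p.1) p.2).trans (by linarith))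
    rw [abs_mul, abs_mul, abs_of_nonneg (pow_nonneg hT1.1.le j), abs_pow, abs_neg, abs_pow,
      abs_of_pos hT1.1, ← pow_mul, ← mul_assoc, ← mul_assoc, ← pow_add, ← pow_add, mul_comm]
    exact mul_le_mul hw (pow_le_pow_of_le_one hT1.1.le hT1.2 (by omega))
      (pow_nonneg hT1.1.le _) (hM0 j)

lemma isBigO_of_eventually_le {f : ℝ → ℝ} {M : ℝ} {N : ℕ}
    (h : ∀ᶠ T in 𝓝[>] (0 : ℝ), |f T| ≤ M * T ^ N) : f =O₀ N := by
  refine IsBigO.of_bound M ?_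
  filter_upwards [h, self_mem_nhdsWithin] with T hT hpos
  rwa [norm_eq_abs, norm_pow, Real.norm_of_nonneg (le_of_lt hpos)]

/-- The perturbative expansion around the free Green function agrees with the one around the full
Green function. -/
lemma resummation (hv : v.Sym) (hH : ∀ μ ν, v ⟨2, ![μ, ν]⟩ = S.mat S.η μ ν) (N : ℕ) :
    (fun T => normFn 𝒦 S v.val0 v.grad T 1 * redSum 𝒦 S v N T
      - ∑ m ∈ ℛ (N + 1), heatCoef (𝒦.k 0) m v * T ^ m)
      =O₀ (N + 1) := by
  set P := taylorP v (max 2 (2 * N)) with hP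
  set K : ℕ → ℕ := fun n => max ((pt (fun _ : Fin n => P)).totalDegree + 1) (N + 1) with hKdef
  have hK1 : ∀ n, (pt (fun _ : Fin n => P)).totalDegree < 2 * K n := fun n => by grind
  have hK2 : ∀ n, N + 1 ≤ K n := fun n => le_max_right _ _
  set c : ℕ → ℕ → ℝ := fun n k => (-1) ^ n / (n.factorial : ℝ) *
        ∫ τ in cube n, wk (freeCov (𝒦.k 0) τ) 0 k (pt fun _ => P) with hc
  have b1 := isBigO_truncate N K hK2 c
  have hcoef : ∀ m ∈ ℛ (N + 1), ∑ p ∈ antidiagonal m, c p.1 p.2 = heatCoef (𝒦.k 0) m v := by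
    intro m hm
    refine sum_congr rfl fun p hp => ?_
    have := Finset.HasAntidiagonal.mem_antidiagonal.1 hp
    have h2 := Finset.mem_range.1 hm
    simp only [hc, hP]
    congr 2
    funext τ
    exact wk_taylorP _ _ (fun _ => v) (fun _ => hv) (fun _ => max 2 (2 * N))
      fun _ => le_max_of_le_right (by omega)
  obtain ⟨M, hM⟩ := total_sub_total 𝒦 S v.val0 v.grad (higherP v N) N
  obtain ⟨M', hM'⟩ := exists_normFn_bound 𝒦 S v.val0 v.grad
  have b2 : (fun T => normFn 𝒦 S v.val0 v.grad T 1 * ∑ n ∈ ℛ (N + 1),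
        ∑ k ∈ Fintype.piFinset fun _ : Fin n => Finset.Icc 3 (2 * N), redTerm 𝒦 S v T n k
      - ∑ n ∈ ℛ (N + 1), ∑ k ∈ ℛ (K n), c n k * T ^ (n + k))
      =O₀ (N + 1) := by
    refine isBigO_of_eventually_le (M := M) ?_
    filter_upwards [hM, eventually_admissible 𝒦 S] with T h1 hT
    have := h1 hT
    rwa [total_one, total_zero 𝒦 S v hT hH N K hK1] at this
  have b3 : (fun T => ∑ n ∈ ℛ (N + 1),
      ∑ k ∈ (Fintype.piFinset fun _ : Fin n => Finset.Icc 3 (2 * N)).filter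
        (fun k => ¬ 2 * n + ∑ i, k i ≤ 2 * N), redTerm 𝒦 S v T n k)
      =O₀ (N + 1) :=
    IsBigO.fun_sum fun n _ => IsBigO.fun_sum fun k hk => redTerm_isBigO 𝒦 S v k
      (not_le.1 (Finset.mem_filter.1 hk).2)
  have b4 : (fun T => normFn 𝒦 S v.val0 v.grad T 1) =O[𝓝[>] 0] fun _ => (1 : ℝ) := by
    refine IsBigO.of_bound M' ?_
    filter_upwards [hM'] with T h
    simpa using h 1 ⟨zero_le_one, le_rfl⟩
  have b5 := b4.mul b3
  simp only [one_mul] at b5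
  refine ((b2.add b1).sub b5).congr_left fun T => ?_
  have hs : ∑ n ∈ ℛ (N + 1),
        ∑ k ∈ Fintype.piFinset fun _ : Fin n => Finset.Icc 3 (2 * N), redTerm 𝒦 S v T n k
      = redSum 𝒦 S v N T + ∑ n ∈ ℛ (N + 1),
      ∑ k ∈ (Fintype.piFinset fun _ : Fin n => Finset.Icc 3 (2 * N)).filter
        (fun k => ¬ 2 * n + ∑ i, k i ≤ 2 * N), redTerm 𝒦 S v T n k := by
    rw [redSum, ← sum_add_distrib]
    exact sum_congr rfl fun n _ => (Finset.sum_filter_add_sum_filter_not _ _ _).symm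
  have hs2 : ∑ m ∈ ℛ (N + 1), heatCoef (𝒦.k 0) m v * T ^ m = ∑ m ∈ ℛ (N + 1),
        (∑ p ∈ antidiagonal m, c p.1 p.2) * T ^ m :=
    sum_congr rfl fun m hm => by rw [hcoef m hm]
  rw [hs, hs2]
  ring

end Resummation

end

section

open MvPolynomial

/-! ### Functional derivatives of Gaussians -/

section Vertices

variable {D n : ℕ}

def gauss (C : 𝕁 n → 𝕁 n → ℝ) (b : 𝕁 n → ℝ) (S₀ : ℝ) (F : ℳ (𝕁 n)) (p : Fin n → Fin D → ℝ) : ℝ :=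
  exp (S₀ + ∑ α, p α.1 α.2 * b α + 1 / 2 * ∑ α, ∑ β, C α β * (p α.1 α.2 * p β.1 β.2))
    * W C (fun α => b α + ∑ β, C α β * p β.1 β.2) F

lemma funDeriv_gauss {C : 𝕁 n → 𝕁 n → ℝ} (hC : ∀ α β, C α β = C β α)
    (b : 𝕁 n → ℝ) (S₀ : ℝ) (F : ℳ (𝕁 n)) (i : Fin n) (μ : Fin D) :
    funDeriv i μ (gauss C b S₀ F) = gauss C b S₀ (X (i, μ) * F) := by
  funext p
  rw [funDeriv, lineDeriv]
  set y : ℝ → 𝕁 n → ℝ := fun t α => p α.1 α.2 + if α = (i, μ) then t else 0 with hy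
  have hyp : ∀ t (α : 𝕁 n), (p + t • (Pi.single i (Pi.single μ 1) : Fin n → Fin D → ℝ)) α.1 α.2 = y t α := by
    rintro t ⟨j, ν⟩
    simp only [Pi.add_apply, Pi.smul_apply, smul_eq_mul, hy, Prod.mk.injEq]
    by_cases h : j = i
    · subst h
      by_cases h2 : ν = μ
      · subst h2; simp
      · simp [h2]
    · simp [h]
  have hyd : ∀ α, HasDerivAt (fun t => y t α) (if α = (i, μ) then 1 else 0) 0 := by
    intro α
    simp only [hy]
    split_ifs
    · simpa using (hasDerivAt_id (0 : ℝ)).const_add _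
    · simpa using hasDerivAt_const (0 : ℝ) (p α.1 α.2)
  have hy0 : ∀ α, y 0 α = p α.1 α.2 := fun α => by simp [hy]
  have hb : ∀ α, HasDerivAt (fun t => b α + ∑ β, C α β * y t β) (C α (i, μ)) 0 := by
    intro α
    have h := (HasDerivAt.fun_sum (u := Finset.univ) fun β _ =>
      (hyd β).const_mul (C α β)).const_add (b α)
    simpa using h
  have hW := hasDerivAt_W (C := fun _ => C) (C' := 0) (fun α β => hasDerivAt_const _ _) hb F
  have hE : HasDerivAt (fun t => S₀ + ∑ α, y t α * b α + 1 / 2 * ∑ α, ∑ β, C α β * (y t α * y t β))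
      (b (i, μ) + ∑ β, C (i, μ) β * p β.1 β.2) 0 := by
    have h1 := (HasDerivAt.fun_sum (u := Finset.univ) fun α _ =>
      (hyd α).mul_const (b α)).const_add S₀
    have h2 := (HasDerivAt.fun_sum (u := Finset.univ) fun α _ =>
      HasDerivAt.fun_sum (u := Finset.univ) fun β _ =>
        ((hyd α).mul (hyd β)).const_mul (C α β)).const_mul (1 / 2)
    refine (h1.add h2).congr_deriv ?_
    simp only [hy0, ite_mul, one_mul, zero_mul, mul_ite, mul_one, mul_zero, mul_add,
      sum_add_distrib, Finset.sum_ite_eq', Finset.mem_univ, if_true]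
    rw [sum_comm]
    simp only [Finset.sum_ite_eq', Finset.mem_univ, if_true]
    simp only [hC _ (i, μ)]
    ring
  have h := hE.exp.mul hW
  have e : (fun t => gauss C b S₀ F (p + t • (Pi.single i (Pi.single μ 1) : Fin n → Fin D → ℝ)))
      = ((fun t => exp (S₀ + ∑ α, y t α * b α + 1 / 2 * ∑ α, ∑ β, C α β * (y t α * y t β)))
        * fun t => W C (fun α => b α + ∑ β, C α β * y t β) F) := by
    funext t
    simp only [gauss, hyp, Pi.mul_apply]
  rw [e, h.deriv, gauss, W_X_mul hC]
  simp only [hy0, Pi.zero_apply, zero_mul, Finset.sum_const_zero, mul_zero, zero_add, hC _ (i, μ)]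
  ring

lemma foldr_funDeriv_gauss {C : 𝕁 n → 𝕁 n → ℝ} (hC : ∀ α β, C α β = C β α)
    (b : 𝕁 n → ℝ) (S₀ : ℝ) (F : ℳ (𝕁 n)) (i : Fin n)
    (L : List (Fin D)) :
    L.foldr (fun m F' => funDeriv i m F') (gauss C b S₀ F)
      = gauss C b S₀ ((L.map fun m => X (i, m)).prod * F) := by
  induction L with
  | nil => simp
  | cons m L ih => rw [List.foldr_cons, ih, funDeriv_gauss hC, List.map_cons, List.prod_cons, mul_assoc]

lemma vertexOp_gauss {C : 𝕁 n → 𝕁 n → ℝ} (hC : ∀ α β, C α β = C β α)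
    (b : 𝕁 n → ℝ) (S₀ : ℝ) (F : ℳ (𝕁 n)) (V : E D → ℝ) (x : E D)
    (k : ℕ) (i : Fin n) :
    vertexOp V x k i (gauss C b S₀ F)
      = gauss C b S₀ (MvPolynomial.C ((-1) ^ k) * vtx i (piece 𝒿 k) * F) := by
  have h : MvPolynomial.C ((-1) ^ k) * vtx i (piece 𝒿 k) * F
      = ∑ μ : Fin k → Fin D, (((-1) ^ k / (k.factorial : ℝ)) * pd V x μ) •
        (((List.ofFn μ).map fun m => (X (i, m) : ℳ (𝕁 n))).prod * F) := by
    rw [vtx, piece, map_sum, mul_sum, sum_mul]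
    refine sum_congr rfl fun μ _ => ?_
    rw [map_mul, rename_C, map_prod, List.map_ofFn, List.prod_ofFn, MvPolynomial.smul_eq_C_mul]
    simp only [rename_X, Function.comp_apply, jetAt]
    grind
  funext p
  simp only [vertexOp, foldr_funDeriv_gauss hC]
  rw [h]
  simp only [gauss, map_sum, map_smul, smul_eq_mul, mul_sum]
  grind

lemma foldr_vertexOp_gauss {C : 𝕁 n → 𝕁 n → ℝ} (hC : ∀ α β, C α β = C β α)
    (b : 𝕁 n → ℝ) (S₀ : ℝ) (V : E D → ℝ) (x : E D) (k : Fin n → ℕ) :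
    (List.finRange n).foldr (fun i F => vertexOp V x (k i) i F) (gauss C b S₀ 1) 0
      = exp S₀ * ((-1) ^ (∑ i, k i) * W C b (pt fun i => piece 𝒿 (k i))) := by
  have h : ∀ L : List (Fin n), L.foldr (fun i F => vertexOp V x (k i) i F) (gauss C b S₀ 1)
      = gauss C b S₀ ((L.map fun i => MvPolynomial.C ((-1) ^ k i)
        * vtx i (piece 𝒿 (k i))).prod) := by
    intro L
    induction L with
    | nil => simp
    | cons m L ih => rw [List.foldr_cons, ih, vertexOp_gauss hC, List.map_cons, List.prod_cons]
  rw [h, ← List.ofFn_eq_map, List.prod_ofFn, Finset.prod_mul_distrib, ← map_prod,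
    Finset.prod_pow_eq_pow_sum, gauss]
  simp only [Pi.zero_apply, zero_mul, mul_zero, Finset.sum_const_zero, add_zero]
  rw [MvPolynomial.C_mul', map_smul, smul_eq_mul, pt]

lemma W_neg_mean {ι : Type*} [Fintype ι] (C : ι → ι → ℝ) (b : ι → ℝ) {d : ℕ}
    {F : ℳ ι} (hF : F.IsHomogeneous d) :
    W C (fun α => -b α) F = (-1) ^ d * W C b F := by
  rw [W_eq_sum (F := F) (K := F.totalDegree + 1) _ _ (by omega),
    W_eq_sum (F := F) (K := F.totalDegree + 1) _ _ (by omega), mul_sum]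
  refine sum_congr rfl fun j _ => ?_
  rcases lt_or_ge d (2 * j) with hj | hj
  · rw [wk_eq_zero_of_totalDegree _ _ (lt_of_le_of_lt hF.totalDegree_le hj),
      wk_eq_zero_of_totalDegree _ _ (lt_of_le_of_lt hF.totalDegree_le hj), mul_zero]
  · obtain ⟨e, he⟩ := Nat.exists_eq_add_of_le' hj
    have := wk_smul_mean (d := e) (-1) C b j (by rw [← he]; exact hF)
    simp only [neg_one_mul] at this
    rw [this, he, pow_add, pow_mul]
    norm_num

/-! ### The worldline expansion as a sum of Gaussian integrals -/

lemma bosAction_eq {T : ℝ} (hT : 0 ≤ T) {G : ℝ → ℝ → Matrix (Fin D) (Fin D) ℝ}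
    (hs : ∀ s ∈ Icc 0 T, ∀ t ∈ Icc 0 T, ∀ μ ν, G s t μ ν = G t s ν μ)
    (hc : ∀ s ∈ Icc 0 T, ∀ μ ν, ContinuousOn (fun u => G s u μ ν) (Icc 0 T)) (a : Fin D → ℝ)
    {t : Fin n → ℝ} (ht : ∀ i, t i ∈ Icc 0 T) (p : Fin n → Fin D → ℝ) :
    exp (bosAction T G a t p / 2) = gauss (fun α β => G (t α.1) (t β.1) α.2 β.2)
        (fun α => ∫ s in (0 : ℝ)..T, (G (t α.1) s *ᵥ a) α.2)
        ((∫ s in (0 : ℝ)..T, ∫ s' in (0 : ℝ)..T, a ⬝ᵥ (G s s' *ᵥ a)) / 2) 1 p := by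
  have hi : ∀ i μ, IntervalIntegrable (fun s => (G (t i) s *ᵥ a) μ) volume 0 T := by
    intro i μ
    refine ContinuousOn.intervalIntegrable ?_
    rw [uIcc_of_le hT]
    simp only [mulVec, dotProduct]
    exact continuousOn_finsetSum _ fun ν _ => (hc _ (ht i) μ ν).mul continuousOn_const
  have e1 : ∀ i, ∫ s in (0 : ℝ)..T, p i ⬝ᵥ (G (t i) s *ᵥ a)
      = ∑ μ, p i μ * ∫ s in (0 : ℝ)..T, (G (t i) s *ᵥ a) μ := by
    intro i
    simp only [← intervalIntegral.integral_const_mul]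
    rw [← intervalIntegral.integral_finsetSum]
    · rfl
    · exact fun μ _ => (hi i μ).const_mul _
  have e2 : ∀ i, ∫ s in (0 : ℝ)..T, a ⬝ᵥ (G s (t i) *ᵥ p i)
      = ∫ s in (0 : ℝ)..T, p i ⬝ᵥ (G (t i) s *ᵥ a) := by
    intro i
    refine integral_congr fun s hs' => ?_
    rw [uIcc_of_le hT] at hs'
    simp only [dotProduct, mulVec, mul_sum]
    rw [sum_comm]
    grind
  have e3 : ∑ i, ∑ j, p i ⬝ᵥ (G (t i) (t j) *ᵥ p j)
      = ∑ α : 𝕁 n, ∑ β : 𝕁 n, G (t α.1) (t β.1) α.2 β.2 * (p α.1 α.2 * p β.1 β.2) := by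
    simp only [Fintype.sum_prod_type, dotProduct, mulVec, mul_sum]
    refine sum_congr rfl fun i _ => ?_
    rw [sum_comm]
    grind
  rw [gauss, W_one, mul_one, bosAction]
  simp only [e2, e1, e3]
  rw [Fintype.sum_prod_type (f := fun α : 𝕁 n =>
    p α.1 α.2 * ∫ s in (0 : ℝ)..T, (G (t α.1) s *ᵥ a) α.2)]
  congr 1
  ring

end Vertices

section

variable {D : ℕ} (𝒦 : KernelDatum) (S : Spectrum D)

lemma integral_eq_setIntegral_unit {T : ℝ} (hT : 0 < T) (f : ℝ → ℝ) :
    ∫ s in (0 : ℝ)..T, f s = T * ∫ s in 𝕀, f (T * s) := by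
  rw [integral_Icc_eq_integral_Ioc, ← integral_of_le zero_le_one,
    intervalIntegral.integral_comp_mul_left _ hT.ne']
  simp [hT.ne']

lemma worldlineTerm_eq (V : E D → ℝ) (x : E D) (G : ℝ → ℝ → ℝ → Matrix (Fin D) (Fin D) ℝ) {T : ℝ}
    (hT : 0 < T) (hA : Admissible 𝒦 S T)
    (hG : ∀ s ∈ 𝕀, ∀ t ∈ 𝕀, ∀ μ ν, G T (T * s) (T * t) μ ν = T * covMat 𝒦 S (T ^ 2) s t μ ν)
    (n : ℕ) (k : Fin n → ℕ) :
    worldlineTerm V x G T n k = exp (1 / 2 * T ^ 3 * quadForm 𝒦 S (grad V x) (T ^ 2))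
      * redTerm 𝒦 S 𝒿 T n k := by
  have hz : ∀ j, |T ^ 2 * S.η j| < 𝒦.r := fun j => by
    simpa using hA.abs_lt (paramSet_of_mem ⟨zero_le_one, le_rfl⟩) j
  have hmem : ∀ s ∈ Icc 0 T, s / T ∈ 𝕀 := fun s hs =>
    ⟨div_nonneg hs.1 hT.le, div_le_one_of_le₀ hs.2 hT.le⟩
  have hG' : ∀ s ∈ Icc 0 T, ∀ t ∈ Icc 0 T, ∀ μ ν,
      G T s t μ ν = T * covMat 𝒦 S (T ^ 2) (s / T) (t / T) μ ν := by grind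
  have hsym : ∀ s ∈ Icc 0 T, ∀ t ∈ Icc 0 T, ∀ μ ν, G T s t μ ν = G T t s ν μ := by
    intro s hs t ht μ ν
    rw [hG' s hs t ht, hG' t ht s hs, covMat, S.mat_symm, covMat]
    simp only [𝒦.symm _ (hz _) _ (hmem s hs) _ (hmem t ht)]
  have hcont : ∀ s ∈ Icc 0 T, ∀ μ ν, ContinuousOn (fun u => G T s u μ ν) (Icc 0 T) := by
    intro s hs μ ν
    refine ContinuousOn.congr (f := fun u => T * covMat 𝒦 S (T ^ 2) (s / T) (u / T) μ ν) ?_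
      fun u hu => hG' s hs u hu μ ν
    simp only [covMat, Spectrum.mat]
    refine continuousOn_const.mul (continuousOn_finsetSum _ fun j _ => continuousOn_const.mul ?_)
    exact (𝒦.cont _ (hz j)).comp (f := fun u => (s / T, u / T)) (by fun_prop)
      fun u hu => ⟨hmem s hs, hmem u hu⟩
  have hmean : ∀ s ∈ 𝕀, ∀ μ, ∫ u in (0 : ℝ)..T, (G T (T * s) u *ᵥ grad V x) μ
      = T ^ 2 * meanVec 𝒦 S (grad V x) (T ^ 2) s μ := by
    intro s hs μ
    rw [integral_eq_setIntegral_unit hT]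
    have e : ∀ u ∈ 𝕀, (G T (T * s) (T * u) *ᵥ grad V x) μ
        = ∑ j, (T * S.U μ j * S.coord (grad V x) j) * 𝒦.k (T ^ 2 * S.η j) s u := by
      intro u hu
      simp only [mulVec, dotProduct, hG s hs u hu, mul_covMat, Spectrum.coord, mul_sum, sum_mul]
      rw [sum_comm]
      grind
    rw [setIntegral_congr_fun measurableSet_Icc e, integral_finsetSum]
    · simp only [integral_const_mul, meanVec, KernelDatum.g, mul_sum]
      ring
    · exact fun j _ => ((KernelDatum.cont_right (𝒦.cont _ (hz j)) hs).integrableOn_compact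
        isCompact_Icc).integrable.const_mul _
  have hS0 : (∫ s in (0 : ℝ)..T, ∫ s' in (0 : ℝ)..T, grad V x ⬝ᵥ (G T s s' *ᵥ grad V x)) / 2
      = 1 / 2 * T ^ 3 * quadForm 𝒦 S (grad V x) (T ^ 2) := by
    rw [integral_eq_setIntegral_unit hT]
    have e : ∀ s ∈ 𝕀, ∫ s' in (0 : ℝ)..T, grad V x ⬝ᵥ (G T (T * s) s' *ᵥ grad V x)
        = ∑ j, (T ^ 2 * S.coord (grad V x) j ^ 2) * 𝒦.g (T ^ 2 * S.η j) s := by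
      intro s hs
      have h1 : ∫ s' in (0 : ℝ)..T, grad V x ⬝ᵥ (G T (T * s) s' *ᵥ grad V x)
          = ∑ μ, grad V x μ * ∫ s' in (0 : ℝ)..T, (G T (T * s) s' *ᵥ grad V x) μ := by
        simp only [← intervalIntegral.integral_const_mul]
        rw [← intervalIntegral.integral_finsetSum]
        · rfl
        · intro μ _
          refine (ContinuousOn.intervalIntegrable ?_).const_mul _
          rw [uIcc_of_le hT.le]
          simp only [mulVec, dotProduct]
          exact continuousOn_finsetSum _ fun ν _ => (hcont _ ⟨mul_nonneg hT.le hs.1,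
            mul_le_of_le_one_right hT.le hs.2⟩ μ ν).mul continuousOn_const
      rw [h1]
      have h2 := S.contract_vec (grad V x) fun j => S.coord (grad V x) j * 𝒦.g (T ^ 2 * S.η j) s
      simp only [hmean s hs, meanVec, mul_left_comm _ (T ^ 2), ← mul_sum]
      rw [h2, mul_sum]
      ring
    rw [setIntegral_congr_fun measurableSet_Icc e, integral_finsetSum]
    · simp only [integral_const_mul, quadForm, KernelDatum.Q, mul_sum, sum_div]
      ring
    · exact fun j _ => ((𝒦.g_cont (hz j)).integrableOn_compact isCompact_Icc).integrable.const_mul _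
  rw [worldlineTerm, setIntegral_Icc_smul T hT, redTerm, neg_pow]
  have e : ∀ τ ∈ cube n, (List.finRange n).foldr (fun i F => vertexOp V x (k i) i F)
      (fun p => exp (bosAction T (G T) (grad V x) (T • τ) p / 2)) 0
      = exp (1 / 2 * T ^ 3 * quadForm 𝒦 S (grad V x) (T ^ 2)) *
        W (fun p q : 𝕁 n => T * covMat 𝒦 S (T ^ 2) (τ p.1) (τ q.1) p.2 q.2)
      (fun p => -T ^ 2 * meanVec 𝒦 S (𝒿).grad (T ^ 2) (τ p.1) p.2) (pt fun i => piece 𝒿 (k i)) := by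
    intro τ hτ
    have hτ' := mem_cube.1 hτ
    have hm : ∀ i, (T • τ) i ∈ Icc 0 T := fun i =>
      ⟨mul_nonneg hT.le (hτ' i).1, mul_le_of_le_one_right hT.le (hτ' i).2⟩
    have e1 := funext fun p => bosAction_eq hT.le hsym hcont (grad V x) hm p
    rw [e1, foldr_vertexOp_gauss (fun α β => hsym _ (hm _) _ (hm _) _ _), hS0]
    congr 1
    simp only [Pi.smul_apply, smul_eq_mul]
    have e2 : (fun α β : 𝕁 n => G T (T * τ α.1) (T * τ β.1) α.2 β.2)
        = fun p q => T * covMat 𝒦 S (T ^ 2) (τ p.1) (τ q.1) p.2 q.2 := by grind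
    have e3 : (fun α : 𝕁 n => ∫ s in (0 : ℝ)..T, (G T (T * τ α.1) s *ᵥ grad V x) α.2)
        = fun p => T ^ 2 * meanVec 𝒦 S (grad V x) (T ^ 2) (τ p.1) p.2 := by grind
    rw [e2, e3, ← W_neg_mean _ _ (pt_isHomogeneous _ _ fun i => piece_isHomogeneous _ _)]
    simp only [neg_mul]
    rfl
  rw [setIntegral_congr_fun measurableSet_cube e, integral_const_mul]
  ring

lemma worldlineSum_eq (V : E D → ℝ) (x : E D) (G : ℝ → ℝ → ℝ → Matrix (Fin D) (Fin D) ℝ) {T : ℝ}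
    (hT : 0 < T) (hA : Admissible 𝒦 S T)
    (hG : ∀ s ∈ 𝕀, ∀ t ∈ 𝕀, ∀ μ ν, G T (T * s) (T * t) μ ν = T * covMat 𝒦 S (T ^ 2) s t μ ν)
    (N : ℕ) :
    worldlineSum V x G N T = exp (1 / 2 * T ^ 3 * quadForm 𝒦 S (grad V x) (T ^ 2))
      * redSum 𝒦 S 𝒿 N T := by
  rw [worldlineSum, redSum, mul_sum]
  refine sum_congr rfl fun n _ => ?_
  rw [mul_sum]
  exact sum_congr rfl fun k _ => worldlineTerm_eq 𝒦 S V x G hT hA hG n k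

end

end

section

/-! ### Hyperbolic functions of `Ω` as functions of `Ω²` -/

/-- `sinh(2ωt)/(2ω)` with `ω² = w`. -/
def hS (w t : ℝ) : ℝ := if w = 0 then t else if 0 < w then Real.sinh (2 * √w * t) / (2 * √w)
    else Real.sin (2 * √(-w) * t) / (2 * √(-w))

/-- `cosh(2ωt)` with `ω² = w`. -/
def hC (w t : ℝ) : ℝ :=
  if w = 0 then 1 else if 0 < w then Real.cosh (2 * √w * t) else Real.cos (2 * √(-w) * t)

lemma hS_of_zero (t : ℝ) : hS 0 t = t := by simp [hS]

lemma hC_of_zero (t : ℝ) : hC 0 t = 1 := by simp [hC]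

lemma hS_of_pos {w : ℝ} (hw : 0 < w) (t : ℝ) : hS w t = Real.sinh (2 * √w * t) / (2 * √w) := by
  simp [hS, hw, hw.ne']

lemma hC_of_pos {w : ℝ} (hw : 0 < w) (t : ℝ) : hC w t = Real.cosh (2 * √w * t) := by
  simp [hC, hw, hw.ne']

lemma hS_of_neg {w : ℝ} (hw : w < 0) (t : ℝ) : hS w t = Real.sin (2 * √(-w) * t) / (2 * √(-w)) := by
  simp [hS, hw.ne, hw.le]

lemma hC_of_neg {w : ℝ} (hw : w < 0) (t : ℝ) : hC w t = Real.cos (2 * √(-w) * t) := by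
  simp [hC, hw.ne, hw.le]

lemma hS_zero (w : ℝ) : hS w 0 = 0 := by
  rcases lt_trichotomy w 0 with h | h | h
  · simp [hS_of_neg h]
  · subst h; exact hS_of_zero 0
  · simp [hS_of_pos h]

lemma hC_zero (w : ℝ) : hC w 0 = 1 := by
  rcases lt_trichotomy w 0 with h | h | h
  · simp [hC_of_neg h]
  · subst h; exact hC_of_zero 0
  · simp [hC_of_pos h]

lemma hS_neg (w t : ℝ) : hS w (-t) = -hS w t := by
  rcases lt_trichotomy w 0 with h | h | h
  · simp [hS_of_neg h, neg_div]
  · subst h; simp [hS_of_zero]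
  · simp [hS_of_pos h, neg_div]

lemma hC_neg (w t : ℝ) : hC w (-t) = hC w t := by
  rcases lt_trichotomy w 0 with h | h | h
  · simp [hC_of_neg h]
  · subst h; simp [hC_of_zero]
  · simp [hC_of_pos h]

lemma hasDerivAt_hS (w t : ℝ) : HasDerivAt (hS w) (hC w t) t := by
  rcases lt_trichotomy w 0 with h | h | h
  · have hs : √(-w) ≠ 0 := (sqrt_pos.2 (neg_pos.2 h)).ne'
    rw [hC_of_neg h, show hS w = _ from funext (hS_of_neg h)]
    refine ((((hasDerivAt_id t).const_mul (2 * √(-w))).sin).div_const (2 * √(-w))).congr_deriv ?_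
    simp_all
  · subst h
    rw [hC_of_zero, show hS 0 = _ from funext hS_of_zero]
    exact hasDerivAt_id t
  · have hs : √w ≠ 0 := (sqrt_pos.2 h).ne'
    rw [hC_of_pos h, show hS w = _ from funext (hS_of_pos h)]
    refine ((((hasDerivAt_id t).const_mul (2 * √w)).sinh).div_const (2 * √w)).congr_deriv ?_
    simp_all

lemma hasDerivAt_hC (w t : ℝ) : HasDerivAt (hC w) (4 * w * hS w t) t := by
  rcases lt_trichotomy w 0 with h | h | h
  · have hs : √(-w) ≠ 0 := (sqrt_pos.2 (neg_pos.2 h)).ne'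
    have hq : √(-w) ^ 2 = -w := sq_sqrt (neg_pos.2 h).le
    rw [hS_of_neg h, show hC w = _ from funext (hC_of_neg h)]
    refine (((hasDerivAt_id t).const_mul (2 * √(-w))).cos).congr_deriv ?_
    grind
  · subst h
    rw [show hC 0 = _ from funext hC_of_zero]
    simpa using hasDerivAt_const t (1 : ℝ)
  · have hs : √w ≠ 0 := (sqrt_pos.2 h).ne'
    have hq : √w ^ 2 = w := sq_sqrt h.le
    rw [hS_of_pos h, show hC w = _ from funext (hC_of_pos h)]
    refine (((hasDerivAt_id t).const_mul (2 * √w)).cosh).congr_deriv ?_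
    grind

lemma hS_add (w a b : ℝ) : hS w (a + b) = hS w a * hC w b + hC w a * hS w b := by
  rcases lt_trichotomy w 0 with h | h | h
  · simp only [hS_of_neg h, hC_of_neg h, mul_add, Real.sin_add]; ring
  · subst h; simp [hS_of_zero, hC_of_zero]
  · simp only [hS_of_pos h, hC_of_pos h, mul_add, Real.sinh_add]; ring

lemma hC_add (w a b : ℝ) : hC w (a + b) = hC w a * hC w b + 4 * w * hS w a * hS w b := by
  rcases lt_trichotomy w 0 with h | h | h
  · have hs : √(-w) ≠ 0 := (sqrt_pos.2 (neg_pos.2 h)).ne'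
    have hq : √(-w) ^ 2 = -w := sq_sqrt (neg_pos.2 h).le
    simp only [hS_of_neg h, hC_of_neg h, mul_add, Real.cos_add]; grind
  · subst h; simp [hC_of_zero]
  · have hs : √w ≠ 0 := (sqrt_pos.2 h).ne'
    have hq : √w ^ 2 = w := sq_sqrt h.le
    simp only [hS_of_pos h, hC_of_pos h, mul_add, Real.cosh_add]; grind

lemma hS_sub (w a b : ℝ) : hS w (a - b) = hS w a * hC w b - hC w a * hS w b := by
  rw [sub_eq_add_neg, hS_add, hS_neg, hC_neg]; ring

lemma hC_sub (w a b : ℝ) : hC w (a - b) = hC w a * hC w b - 4 * w * hS w a * hS w b := by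
  rw [sub_eq_add_neg, hC_add, hS_neg, hC_neg]; ring

lemma hC_sq (w t : ℝ) : hC w t ^ 2 = 1 + 4 * w * hS w t ^ 2 := by
  have := hC_sub w t t
  rw [sub_self, hC_zero] at this
  linarith

lemma continuous_hS (w : ℝ) : Continuous (hS w) :=
  continuous_iff_continuousAt.2 fun t => (hasDerivAt_hS w t).continuousAt

lemma continuous_hC (w : ℝ) : Continuous (hC w) :=
  continuous_iff_continuousAt.2 fun t => (hasDerivAt_hC w t).continuousAt

lemma hS_scale {T : ℝ} (hT : 0 < T) (w t : ℝ) : hS w (T * t) = T * hS (w * T ^ 2) t := by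
  have hT2 : 0 < T ^ 2 := by positivity
  rcases lt_trichotomy w 0 with h | h | h
  · have hs : √(-w) ≠ 0 := (sqrt_pos.2 (neg_pos.2 h)).ne'
    rw [hS_of_neg h, hS_of_neg (mul_neg_of_neg_of_pos h hT2), ← neg_mul,
      Real.sqrt_mul (neg_pos.2 h).le, Real.sqrt_sq hT.le]
    field_simp
  · subst h; simp [hS_of_zero]
  · have hs : √w ≠ 0 := (sqrt_pos.2 h).ne'
    rw [hS_of_pos h, hS_of_pos (mul_pos h hT2), Real.sqrt_mul h.le, Real.sqrt_sq hT.le]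
    field_simp

lemma hC_scale {T : ℝ} (hT : 0 < T) (w t : ℝ) : hC w (T * t) = hC (w * T ^ 2) t := by
  have hT2 : 0 < T ^ 2 := by positivity
  rcases lt_trichotomy w 0 with h | h | h
  · rw [hC_of_neg h, hC_of_neg (mul_neg_of_neg_of_pos h hT2), ← neg_mul,
      Real.sqrt_mul (neg_pos.2 h).le, Real.sqrt_sq hT.le]
    ring_nf
  · subst h; simp [hC_of_zero]
  · rw [hC_of_pos h, hC_of_pos (mul_pos h hT2), Real.sqrt_mul h.le, Real.sqrt_sq hT.le]
    ring_nf

def om (w : ℝ) : ℂ := (w : ℂ) ^ (1 / 2 : ℂ)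

lemma om_of_nonneg {w : ℝ} (hw : 0 ≤ w) : om w = (√w : ℝ) := by
  rw [om, Real.sqrt_eq_rpow, Complex.ofReal_cpow hw]
  norm_num

lemma om_of_neg {w : ℝ} (hw : w < 0) : om w = (√(-w) : ℝ) * Complex.I := by
  rw [om, Complex.ofReal_cpow_of_nonpos hw.le]
  congr 1
  · rw [← om_of_nonneg (neg_pos.2 hw).le, om, Complex.ofReal_neg]
  · rw [show (Real.pi : ℂ) * Complex.I * (1 / 2) = Real.pi / 2 * Complex.I by ring,
      Complex.exp_pi_div_two_mul_I]

lemma om_sq (w : ℝ) : om w ^ 2 = w := by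
  rcases lt_or_ge w 0 with h | h
  · rw [om_of_neg h, mul_pow, Complex.I_sq, ← Complex.ofReal_pow, sq_sqrt (neg_pos.2 h).le]
    simp
  · rw [om_of_nonneg h, ← Complex.ofReal_pow, sq_sqrt h]

lemma om_ne_zero {w : ℝ} (hw : w ≠ 0) : om w ≠ 0 := by
  intro h
  have := om_sq w
  rw [h] at this
  exact hw (by exact_mod_cast (by simpa using this.symm : (w : ℂ) = 0))

lemma sinh_om {w : ℝ} (hw : w ≠ 0) (t : ℝ) :
    Complex.sinh (2 * om w * t) = 2 * om w * (hS w t : ℝ) := by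
  rcases lt_or_gt_of_ne hw with h | h
  · have hs : (√(-w) : ℂ) ≠ 0 := by exact_mod_cast (sqrt_pos.2 (neg_pos.2 h)).ne'
    rw [om_of_neg h, hS_of_neg h]
    rw [show 2 * ((√(-w) : ℝ) * Complex.I) * t = ((2 * √(-w) * t : ℝ) : ℂ) * Complex.I by
      push_cast; ring, Complex.sinh_mul_I]
    push_cast
    field_simp
  · have hs : (√w : ℂ) ≠ 0 := by exact_mod_cast (sqrt_pos.2 h).ne'
    rw [om_of_nonneg h.le, hS_of_pos h]
    push_cast
    field_simp

lemma cosh_om {w : ℝ} (hw : w ≠ 0) (t : ℝ) : Complex.cosh (2 * om w * t) = (hC w t : ℝ) := by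
  rcases lt_or_gt_of_ne hw with h | h
  · rw [om_of_neg h, hC_of_neg h]
    rw [show 2 * ((√(-w) : ℝ) * Complex.I) * t = ((2 * √(-w) * t : ℝ) : ℂ) * Complex.I by
      push_cast; ring, Complex.cosh_mul_I]
    push_cast
    rfl
  · rw [om_of_nonneg h.le, hC_of_pos h]
    push_cast
    rfl

lemma evenFn_of_ne {f : ℂ → ℂ} {f₀ w : ℝ} (hw : w ≠ 0) {r : ℝ} (h : f (om w) = (r : ℝ)) :
    evenFn f f₀ w = r := by
  rw [evenFn, if_neg hw]
  change (f (om w)).re = r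
  simp_all

/-! ### The scalar Green functions -/

/-- The scalar Green function with Dirichlet boundary conditions. -/
def gD (w T t s : ℝ) : ℝ :=
  2 * (hS w t * hS w (T - s) - if s ≤ t then hS w T * hS w (t - s) else 0) / hS w T

def pSI (w T u : ℝ) : ℝ := if w = 0 then u + u ^ 2 / T + T / 6
  else -(1 / (2 * T * w)) + hC w (T / 2 + u) / (4 * w * hS w (T / 2))

/-- The scalar string-inspired Green function. -/
def gSI (w T t s : ℝ) : ℝ := pSI w T (t - s) - if s ≤ t then 2 * hS w (t - s) else 0

lemma evenFn_detD {T : ℝ} (hT : 0 < T) (w : ℝ) :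
    evenFn (fun om => Complex.sinh (2 * om * T) / (2 * om * T)) 1 w = hS w T / T := by
  by_cases hw : w = 0
  · subst hw; simp [evenFn, hS_of_zero, hT.ne']
  · refine evenFn_of_ne hw ?_
    rw [sinh_om hw]
    have := om_ne_zero hw
    have hT' : (T : ℂ) ≠ 0 := by exact_mod_cast hT.ne'
    push_cast
    field_simp

lemma sinh_half {w : ℝ} (hw : w ≠ 0) (T : ℝ) :
    Complex.sinh (om w * T) = 2 * om w * (hS w (T / 2) : ℝ) := by
  rw [← sinh_om hw]; push_cast; ring_nf

lemma cosh_half {w : ℝ} (hw : w ≠ 0) (T : ℝ) :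
    Complex.cosh (om w * T) = (hC w (T / 2) : ℝ) := by
  rw [← cosh_om hw]; push_cast; ring_nf

lemma evenFn_detSI {T : ℝ} (hT : 0 < T) (w : ℝ) :
    evenFn (fun om => Complex.sinh (om * T) ^ 2 / (om ^ 2 * T ^ 2)) 1 w
      = (2 * hS w (T / 2) / T) ^ 2 := by
  by_cases hw : w = 0
  · subst hw; simp [evenFn, hS_of_zero]; field_simp
  · refine evenFn_of_ne hw ?_
    rw [sinh_half hw]
    have := om_ne_zero hw
    have hT' : (T : ℂ) ≠ 0 := by exact_mod_cast hT.ne'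
    push_cast
    field_simp

lemma evenFn_exp {w : ℝ} (hw : w ≠ 0) (T : ℝ) :
    evenFn (fun om => (om * T - Complex.tanh (om * T)) / (4 * om ^ 3)) (T ^ 3 / 12) w
      = (T - 2 * (hS w (T / 2) / hC w (T / 2))) / (4 * w) := by
  refine evenFn_of_ne hw ?_
  rw [Complex.tanh_eq_sinh_div_cosh, sinh_half hw, cosh_half hw, pow_succ, om_sq]
  have := om_ne_zero hw
  have hw' : (w : ℂ) ≠ 0 := by exact_mod_cast hw
  push_cast
  grind

lemma evenFn_gD {T : ℝ} (hT : 0 < T) (w t s : ℝ) :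
    evenFn (fun om => (Complex.sinh (2 * om * t) * Complex.sinh (2 * om * (T - s))
        - (if s ≤ t then Complex.sinh (2 * om * T) * Complex.sinh (2 * om * (t - s)) else 0))
      / (om * Complex.sinh (2 * om * T))) (-|t - s| + (t + s) - 2 * t * s / T) w = gD w T t s := by
  by_cases hw : w = 0
  · subst hw
    simp only [evenFn, if_true, gD, hS_of_zero]
    split_ifs with h
    · rw [abs_of_nonneg (by linarith)]; field_simp; ring
    grind
  · refine evenFn_of_ne hw ?_
    have h0 := om_ne_zero hw
    rw [sinh_om hw, sinh_om hw, show (T : ℂ) - s = ((T - s : ℝ) : ℂ) by push_cast; rfl, sinh_om hw,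
      show (t : ℂ) - s = ((t - s : ℝ) : ℂ) by push_cast; rfl, sinh_om hw, gD]
    by_cases hz : hS w T = 0
    · simp [hz]
    have hz' : (hS w T : ℂ) ≠ 0 := by exact_mod_cast hz
    split_ifs
    · push_cast
      field_simp
    · push_cast
      field_simp
      ring

lemma evenFn_gSI (T w t s : ℝ) :
    evenFn (fun om => -(1 / (2 * T * om ^ 2))
      + Complex.cosh (om * (T + 2 * t - 2 * s)) / (2 * om * Complex.sinh (om * T))
      - (if s ≤ t then Complex.sinh (2 * om * (t - s)) / om else 0))
    (-|t - s| + (t - s) ^ 2 / T + T / 6) w = gSI w T t s := by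
  by_cases hw : w = 0
  · subst hw
    simp only [evenFn, if_true, gSI, pSI, hS_of_zero]
    grind
  · refine evenFn_of_ne hw ?_
    have h0 := om_ne_zero hw
    have hw' : (w : ℂ) ≠ 0 := by exact_mod_cast hw
    rw [om_sq, sinh_half hw, show (T : ℂ) + 2 * t - 2 * s = ((T + 2 * t - 2 * s : ℝ) : ℂ) by
      push_cast; rfl, cosh_half hw, show (t : ℂ) - s = ((t - s : ℝ) : ℂ) by push_cast; rfl,
      sinh_om hw, gSI, pSI, if_neg hw, show (T + 2 * t - 2 * s) / 2 = T / 2 + (t - s) by ring]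
    have e : 2 * om w * (2 * om w * (hS w (T / 2) : ℂ)) = 4 * w * (hS w (T / 2) : ℂ) := by
      linear_combination (4 * (hS w (T / 2) : ℂ)) * om_sq w
    rw [e]
    split_ifs
    · push_cast
      grind
    · push_cast
      rfl

end

section

/-! ### The boundary value problems -/

lemma integral_sub_ite_le {p q : ℝ → ℝ} (hp : Continuous p) (hq : Continuous q) {t T : ℝ}
    (ht : t ∈ Icc 0 T) : ∫ s in (0 : ℝ)..T, (p s - 2 * if s ≤ t then q s else 0)
      = (∫ s in (0 : ℝ)..T, p s) - 2 * ∫ s in (0 : ℝ)..t, q s := by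
  have e : ∀ s, (if s ≤ t then q s else 0) = (Iic t).indicator q s := by simp [indicator]
  have hi := hq.intervalIntegrable (μ := volume) 0 T
  simp only [e]
  rw [intervalIntegral.integral_sub (hp.intervalIntegrable _ _) (IntervalIntegrable.const_mul
    ⟨hi.1.indicator measurableSet_Iic, hi.2.indicator measurableSet_Iic⟩ 2),
    intervalIntegral.integral_const_mul,
    integral_of_le (f := (Iic t).indicator q) (ht.1.trans ht.2), integral_of_le ht.1,
    setIntegral_indicator measurableSet_Iic, Ioc_inter_Iic, min_eq_right ht.2]

def duhamel (w : ℝ) (f : ℝ → ℝ) (t : ℝ) : ℝ := ∫ s in (0 : ℝ)..t, hS w (t - s) * f s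

lemma exists_hasDerivAt_duhamel {f : ℝ → ℝ} (hf : Continuous f) (w : ℝ) : ∃ g : ℝ → ℝ, ∀ t,
    HasDerivAt (duhamel w f) (g t) t ∧ HasDerivAt g (4 * w * duhamel w f t + f t) t := by
  have h1 : Continuous fun s => hC w s * f s := (continuous_hC w).mul hf
  have h2 : Continuous fun s => hS w s * f s := (continuous_hS w).mul hf
  have e : duhamel w f = fun t => hS w t * (∫ s in (0 : ℝ)..t, hC w s * f s)
      - hC w t * ∫ s in (0 : ℝ)..t, hS w s * f s := by
    ext t
    rw [duhamel, ← intervalIntegral.integral_const_mul, ← intervalIntegral.integral_const_mul,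
      ← intervalIntegral.integral_sub ((h1.const_mul _).intervalIntegrable _ _)
        ((h2.const_mul _).intervalIntegrable _ _)]
    congr 1; ext s; rw [hS_sub]; ring
  have d1 := fun t => (h1.integral_hasStrictDerivAt 0 t).hasDerivAt
  have d2 := fun t => (h2.integral_hasStrictDerivAt 0 t).hasDerivAt
  refine ⟨fun t => hC w t * (∫ s in (0 : ℝ)..t, hC w s * f s)
    - 4 * w * hS w t * ∫ s in (0 : ℝ)..t, hS w s * f s, fun t => ⟨?_, ?_⟩⟩ <;> rw [e]
  · refine (((hasDerivAt_hS w t).mul (d1 t)).sub ((hasDerivAt_hC w t).mul (d2 t))).congr_deriv ?_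
    ring
  · refine (((hasDerivAt_hC w t).mul (d1 t)).sub
      (((hasDerivAt_hS w t).const_mul (4 * w)).mul (d2 t))).congr_deriv ?_
    linear_combination f t * hC_sq w t

lemma duhamel_zero (w : ℝ) (f : ℝ → ℝ) : duhamel w f 0 = 0 := by simp [duhamel]

lemma integral_gD_mul {w T : ℝ} (h : hS w T ≠ 0) {f : ℝ → ℝ} (hf : Continuous f) {t : ℝ} (ht : t ∈ Icc 0 T) :
    ∫ s in (0 : ℝ)..T, gD w T t s * f s
      = 2 * duhamel w f T / hS w T * hS w t - 2 * duhamel w f t := by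
  have := continuous_hS w
  rw [integral_congr (g := fun s => 2 * hS w t / hS w T * (hS w (T - s) * f s)
      - 2 * if s ≤ t then hS w (t - s) * f s else 0) fun s _ => by
    simp only [gD]; split_ifs <;> field_simp; ring, integral_sub_ite_le (by fun_prop) (by fun_prop) ht,
    intervalIntegral.integral_const_mul, duhamel, duhamel]
  ring

lemma green_dirichlet {w T : ℝ} (h : hS w T ≠ 0) {f : ℝ → ℝ} (hf : Continuous f) :
    ∃ u u' : ℝ → ℝ, (∀ t ∈ Icc 0 T, u t = ∫ s in (0 : ℝ)..T, gD w T t s * f s) ∧ Continuous u ∧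
      (∀ t, HasDerivAt u (u' t) t ∧ HasDerivAt u' (4 * w * u t - 2 * f t) t) ∧
      u 0 = 0 ∧ u T = 0 := by
  obtain ⟨g, hg⟩ := exists_hasDerivAt_duhamel hf w
  have hu : ∀ t, HasDerivAt (fun t => 2 * duhamel w f T / hS w T * hS w t - 2 * duhamel w f t)
      (2 * duhamel w f T / hS w T * hC w t - 2 * g t) t := fun t =>
    ((hasDerivAt_hS w t).const_mul _).sub ((hg t).1.const_mul 2)
  refine ⟨_, _, fun t ht => (integral_gD_mul h hf ht).symm, continuous_iff_continuousAt.2 fun t =>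
    (hu t).continuousAt, fun t => ⟨hu t, ?_⟩, ?_, ?_⟩
  · refine (((hasDerivAt_hC w t).const_mul _).sub ((hg t).2.const_mul 2)).congr_deriv ?_
    ring
  · simp [hS_zero, duhamel_zero]
  · field_simp; ring

lemma continuous_pSI (w T : ℝ) : Continuous (pSI w T) := by
  have := continuous_hC w
  by_cases hw : w = 0
  · subst hw
    rw [show pSI 0 T = fun u => u + u ^ 2 / T + T / 6 by ext; simp [pSI]]
    fun_prop
  · rw [show pSI w T = fun u => -(1 / (2 * T * w)) + hC w (T / 2 + u) / (4 * w * hS w (T / 2)) by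
      ext; simp [pSI, hw]]
    fun_prop

def pSI' (w T u : ℝ) : ℝ := if w = 0 then 1 + 2 * u / T else hS w (T / 2 + u) / hS w (T / 2)

lemma hasDerivAt_pSI {w T : ℝ} (u : ℝ) : HasDerivAt (pSI w T) (pSI' w T u) u := by
  by_cases hw : w = 0
  · subst hw
    rw [show pSI 0 T = fun u => u + u ^ 2 / T + T / 6 by ext; simp [pSI], pSI', if_pos rfl]
    refine (((hasDerivAt_id u).add ((hasDerivAt_pow 2 u).div_const T)).add_const _).congr_deriv ?_
    simp
  · rw [show pSI w T = fun u => -(1 / (2 * T * w)) + hC w (T / 2 + u) / (4 * w * hS w (T / 2)) by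
      ext; simp [pSI, hw], pSI', if_neg hw]
    refine ((((hasDerivAt_hC w (T / 2 + u)).comp_const_add (T / 2) u).div_const _).const_add
      _).congr_deriv ?_
    grind

lemma hasDerivAt_pSI' {w T : ℝ} (hT : T ≠ 0) (h : hS w (T / 2) ≠ 0) (u : ℝ) :
    HasDerivAt (pSI' w T) (4 * w * pSI w T u + 2 / T) u := by
  by_cases hw : w = 0
  · subst hw
    rw [show pSI' 0 T = fun u => 1 + 2 * u / T by ext; simp [pSI']]
    refine ((((hasDerivAt_id u).const_mul 2).div_const T).const_add 1).congr_deriv ?_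
    simp
  · rw [show pSI' w T = fun u => hS w (T / 2 + u) / hS w (T / 2) by
      ext; simp [pSI', hw], pSI, if_neg hw]
    refine (((hasDerivAt_hS w (T / 2 + u)).comp_const_add (T / 2) u).div_const _).congr_deriv ?_
    field_simp
    ring

lemma pSI_neg {w T : ℝ} (h : hS w (T / 2) ≠ 0) (u : ℝ) : pSI w T u - 2 * hS w u = pSI w T (-u) := by
  by_cases hw : w = 0
  · subst hw; simp [pSI, hS_of_zero]; ring
  · simp only [pSI, if_neg hw, hC_add, hC_neg, hS_neg]
    field_simp
    ring

lemma pSI_sub_period {w T : ℝ} (hT : T ≠ 0) (s : ℝ) : pSI w T (s - T) = pSI w T (-s) := by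
  by_cases hw : w = 0
  · subst hw; simp only [pSI, if_pos]; field_simp; ring
  · simp only [pSI, if_neg hw]
    rw [← hC_neg w (T / 2 + -s)]
    ring_nf

lemma continuous_gSI {w T : ℝ} : 𝒞₂ (gSI w T) := by
  have h : ∀ t s, gSI w T t s = pSI w T (t - s) - 2 * hS w (max (t - s) 0) := by
    intro t s
    rw [gSI]
    split_ifs with h
    · simp_all
    · rw [max_eq_right (by linarith), hS_zero]; ring
  simp only [h]
  have := continuous_hS w
  have := continuous_pSI w T
  fun_prop

lemma intervalIntegral_swap_of_continuous {T : ℝ} {F : ℝ → ℝ → ℝ} (hF : 𝒞₂ F) :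
    ∫ t in (0 : ℝ)..T, ∫ s in (0 : ℝ)..T, F t s = ∫ s in (0 : ℝ)..T, ∫ t in (0 : ℝ)..T, F t s := by
  simp only [intervalIntegral.intervalIntegral_eq_integral_uIoc, integral_smul]
  congr 2
  refine integral_integral_swap ?_
  rw [Measure.prod_restrict, ← Measure.volume_eq_prod]
  exact (hF.continuousOn.integrableOn_compact (isCompact_uIcc.prod isCompact_uIcc)).mono_set
    (prod_mono uIoc_subset_uIcc uIoc_subset_uIcc)

lemma integral_pSI {w T : ℝ} (hT : T ≠ 0) (h : hS w (T / 2) ≠ 0) : ∫ u in -T..0, pSI w T u = 0 := by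
  have hc := (continuous_pSI w T).intervalIntegrable (μ := volume) (-T) 0
  by_cases hw : w = 0
  · subst hw
    rw [integral_eq_sub_of_hasDerivAt (f := fun u => u ^ 2 / 2 + u ^ 3 / (3 * T) + T / 6 * u)
      (fun u _ => ?_) hc]
    · field_simp; ring
    · refine ((((hasDerivAt_pow 2 u).div_const 2).add ((hasDerivAt_pow 3 u).div_const (3 * T))).add
        ((hasDerivAt_id u).const_mul (T / 6))).congr_deriv ?_
      simp [pSI]; field_simp
  · rw [integral_eq_sub_of_hasDerivAt (f := fun u => -(1 / (2 * T * w)) * u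
      + hS w (T / 2 + u) / (4 * w * hS w (T / 2))) (fun u _ => ?_) hc]
    · rw [show T / 2 + -T = -(T / 2) by ring, hS_neg]; field_simp; ring_nf
    · refine (((hasDerivAt_id u).const_mul _).add (((hasDerivAt_hS w (T / 2 + u)).comp_const_add
        (T / 2) u).div_const _)).congr_deriv ?_
      simp [pSI, hw]

lemma integral_gSI {w T : ℝ} (hT : T ≠ 0) (h : hS w (T / 2) ≠ 0) {s : ℝ} (hs : s ∈ Icc 0 T) :
    ∫ t in (0 : ℝ)..T, gSI w T t s = 0 := by
  have h1 : Continuous fun t => gSI w T t s :=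
    continuous_gSI.comp (f := fun t => (t, s)) (by fun_prop)
  have h2 := fun a b => (continuous_pSI w T).intervalIntegrable (μ := volume) a b
  rw [← intervalIntegral.integral_add_adjacent_intervals (b := s) (h1.intervalIntegrable _ _)
    (h1.intervalIntegrable _ _), integral_congr (g := fun t => pSI w T (t - s)),
    integral_congr (a := s) (g := fun t => pSI w T (t - (s + T))),
    intervalIntegral.integral_comp_sub_right, intervalIntegral.integral_comp_sub_right, add_comm,
    show s - (s + T) = -T by ring, show T - (s + T) = 0 - s by ring,
    intervalIntegral.integral_add_adjacent_intervals (h2 _ _) (h2 _ _), sub_self, integral_pSI hT h]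
  · intro t ht
    rw [uIcc_of_le hs.2] at ht
    simp only [gSI, if_pos ht.1]
    rw [pSI_neg h, ← pSI_sub_period hT, sub_sub]
  · intro t ht
    rw [uIcc_of_le hs.1] at ht
    simp only [gSI]
    split_ifs with h
    · simp [le_antisymm ht.2 h, hS_zero]
    · ring

lemma hasDerivAt_convolution {p p' : ℝ → ℝ} (hp : ∀ u, HasDerivAt p (p' u) u) (hp' : Continuous p')
    {f : ℝ → ℝ} (hf : Continuous f) {T : ℝ} (hT : 0 ≤ T) (t : ℝ) :
    HasDerivAt (fun t => ∫ s in (0 : ℝ)..T, p (t - s) * f s)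
      (∫ s in (0 : ℝ)..T, p' (t - s) * f s) t := by
  have hc : Continuous p := continuous_iff_continuousAt.2 fun u => (hp u).continuousAt
  simp only [integral_of_le hT, ← integral_Icc_eq_integral_Ioc]
  exact hasDerivAt_setIntegral isCompact_Icc isOpen_univ
    (ψ := fun t s => p (t - s) * f s) (ψ' := fun t s => p' (t - s) * f s)
    (fun t _ => by fun_prop) (by fun_prop)
    (fun t _ s _ => ((hp (t - s)).comp_sub_const t s).mul_const _) (mem_univ t)

lemma green_periodic {w T : ℝ} (hT : 0 < T) (h : hS w (T / 2) ≠ 0) {f : ℝ → ℝ} (hf : Continuous f) :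
    ∃ u u' : ℝ → ℝ, (∀ t ∈ Icc 0 T, u t = ∫ s in (0 : ℝ)..T, gSI w T t s * f s) ∧ Continuous u ∧
      (∀ t, HasDerivAt u (u' t) t ∧
        HasDerivAt u' (4 * w * u t - 2 * (f t - T⁻¹ * ∫ s in (0 : ℝ)..T, f s)) t) ∧
      u 0 = u T ∧ ∫ s in (0 : ℝ)..T, u s = 0 := by
  have hP0 := continuous_pSI w T
  have hP1 : Continuous (pSI' w T) :=
    continuous_iff_continuousAt.2 fun u => (hasDerivAt_pSI' hT.ne' h u).continuousAt
  obtain ⟨g, hg⟩ := exists_hasDerivAt_duhamel hf w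
  set u : ℝ → ℝ := fun t => (∫ s in (0 : ℝ)..T, pSI w T (t - s) * f s) - 2 * duhamel w f t with hu_def
  have hu : ∀ t, HasDerivAt u ((∫ s in (0 : ℝ)..T, pSI' w T (t - s) * f s) - 2 * g t) t := fun t =>
    (hasDerivAt_convolution hasDerivAt_pSI hP1 hf hT.le t).sub ((hg t).1.const_mul 2)
  have hval : ∀ t ∈ Icc 0 T, u t = ∫ s in (0 : ℝ)..T, gSI w T t s * f s := by
    intro t ht
    have := continuous_hS w
    simp only [hu_def, duhamel]
    rw [← integral_sub_ite_le (by fun_prop) (by fun_prop) ht]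
    refine integral_congr fun s _ => ?_
    simp only [gSI]; split_ifs <;> ring
  refine ⟨u, _, hval, continuous_iff_continuousAt.2 fun t => (hu t).continuousAt,
    fun t => ⟨hu t, ?_⟩, ?_, ?_⟩
  · refine ((hasDerivAt_convolution (hasDerivAt_pSI' hT.ne' h) (by fun_prop) hf hT.le t).sub
      ((hg t).2.const_mul 2)).congr_deriv ?_
    simp only [add_mul, mul_assoc]
    rw [intervalIntegral.integral_add (Continuous.intervalIntegrable (by fun_prop) _ _)
      (Continuous.intervalIntegrable (by fun_prop) _ _)]
    simp only [intervalIntegral.integral_const_mul, hu_def]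
    ring
  · rw [hval T ⟨hT.le, le_rfl⟩]
    simp only [hu_def, duhamel_zero, mul_zero, sub_zero, zero_sub]
    refine integral_congr fun s hs => ?_
    rw [uIcc_of_le hT.le] at hs
    simp only [gSI, if_pos hs.2]
    rw [pSI_neg h, neg_sub, pSI_sub_period hT.ne']
  · have := continuous_gSI (w := w) (T := T)
    rw [integral_congr (g := fun t => ∫ s in (0 : ℝ)..T, gSI w T t s * f s)
      fun t ht => hval t (by rwa [uIcc_of_le hT.le] at ht),
      intervalIntegral_swap_of_continuous (by fun_prop)]
    refine (integral_congr fun s hs => ?_).trans (intervalIntegral.integral_zero (a := 0) (b := T))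
    rw [uIcc_of_le hT.le] at hs
    simp only [intervalIntegral.integral_mul_const, integral_gSI hT.ne' h hs, zero_mul]

end

section

/-! ### The two kernel data -/

lemma eq_affine {d d' : ℝ → ℝ} (h : ∀ t, HasDerivAt d (d' t) t) (h' : ∀ t, HasDerivAt d' 0 t)
    (t : ℝ) : d t = d 0 + d' 0 * t := by
  have h1 : ∀ s, d' s = d' 0 := fun s =>
    is_const_of_deriv_eq_zero (fun x => (h' x).differentiableAt) (fun x => (h' x).deriv) s 0
  have h2 := is_const_of_deriv_eq_zero (f := fun t => d t - d' 0 * t)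
    (fun x => ((h x).sub ((hasDerivAt_id x).const_mul _)).differentiableAt)
    (fun x => (((h x).sub ((hasDerivAt_id x).const_mul (d' 0))).congr_deriv (by
      rw [h1 x]; ring)).deriv) t 0
  linarith

lemma resolvent_of_forall {k₀ k₁ : ℝ → ℝ → ℝ} (hk₀ : 𝒞₂ k₀) (hk₁ : 𝒞₂ k₁) {z t : ℝ}
    (h : ∀ f : ℝ → ℝ, Continuous f → ∫ s in (0 : ℝ)..1, k₁ t s * f s
      = (∫ s in (0 : ℝ)..1, k₀ t s * f s)
        - z * ∫ u in (0 : ℝ)..1, k₀ t u * ∫ s in (0 : ℝ)..1, k₁ u s * f s) {s : ℝ}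
    (hs : s ∈ 𝕀) :
    k₁ t s = k₀ t s - z * ∫ u in 𝕀, k₀ t u * k₁ u s := by
  have c0 : Continuous fun s => k₀ t s := hk₀.comp (f := fun s => (t, s)) (by fun_prop)
  have c1 : Continuous fun s => k₁ t s := hk₁.comp (f := fun s => (t, s)) (by fun_prop)
  have c2 : Continuous fun p : ℝ × ℝ => k₁ p.2 p.1 := hk₁.comp (f := fun p : ℝ × ℝ => (p.2, p.1))
    (by fun_prop)
  have c3 : Continuous fun s => ∫ u in (0 : ℝ)..1, k₀ t u * k₁ u s :=
    intervalIntegral.continuous_parametric_intervalIntegral_of_continuous' (by fun_prop) _ _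
  set d : ℝ → ℝ := fun s => k₁ t s - k₀ t s + z * ∫ u in (0 : ℝ)..1, k₀ t u * k₁ u s with hd
  have hdc : Continuous d := by fun_prop
  have key : ∫ s in (0 : ℝ)..1, d s * d s = 0 := by
    have hh := h d hdc
    have c4 : Continuous fun p : ℝ × ℝ => k₀ t p.1 * (k₁ p.1 p.2 * d p.2) := by fun_prop
    have hsw := intervalIntegral_swap_of_continuous (T := 1) (F := fun u s => k₀ t u * (k₁ u s * d s)) c4
    simp only [intervalIntegral.integral_const_mul] at hsw
    rw [hsw] at hh
    have e : ∀ s, d s * d s = k₁ t s * d s - k₀ t s * d s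
        + z * ∫ u in (0 : ℝ)..1, k₀ t u * (k₁ u s * d s) := by
      intro s
      simp only [← mul_assoc, intervalIntegral.integral_mul_const]
      ring
    have c5 : Continuous fun s => ∫ u in (0 : ℝ)..1, k₀ t u * (k₁ u s * d s) :=
      intervalIntegral.continuous_parametric_intervalIntegral_of_continuous' (by fun_prop) _ _
    simp_rw [e]
    rw [intervalIntegral.integral_add, intervalIntegral.integral_sub,
      intervalIntegral.integral_const_mul]
    · linarith
    all_goals exact Continuous.intervalIntegrable (by fun_prop) _ _
  have hz : d s = 0 := by
    by_contra hne
    have := intervalIntegral.integral_pos (f := fun s => d s * d s) zero_lt_one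
      (by fun_prop) (fun x _ => mul_self_nonneg _) ⟨s, hs, mul_self_pos.2 hne⟩
    exact this.ne' key
  rw [integral_Icc_eq_integral_Ioc, ← integral_of_le zero_le_one]
  linarith

lemma gD_symm (w T t s : ℝ) : gD w T t s = gD w T s t := by
  rcases lt_trichotomy s t with h | h | h
  · rw [gD, gD, if_pos h.le, if_neg h.not_ge]
    congr 1
    rw [hS_sub, hS_sub, hS_sub]
    ring
  · rw [h]
  · rw [gD, gD, if_pos h.le, if_neg h.not_ge]
    congr 1
    rw [hS_sub, hS_sub, hS_sub]
    ring

lemma gSI_symm {w T : ℝ} (h : hS w (T / 2) ≠ 0) (t s : ℝ) : gSI w T t s = gSI w T s t := by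
  rcases lt_trichotomy s t with hl | hl | hl
  · rw [gSI, gSI, if_pos hl.le, if_neg hl.not_ge, pSI_neg h, neg_sub, sub_zero]
  · rw [hl]
  · rw [gSI, gSI, if_pos hl.le, if_neg hl.not_ge, pSI_neg h, neg_sub, sub_zero]

lemma continuous_gD (w T : ℝ) : 𝒞₂ (gD w T) := by
  have h : ∀ t s, gD w T t s
      = 2 * (hS w t * hS w (T - s) - hS w T * hS w (max (t - s) 0)) / hS w T := by
    intro t s
    rw [gD]
    split_ifs with h
    · simp_all
    · rw [max_eq_right (by linarith), hS_zero]; ring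
  simp only [h]
  have := continuous_hS w
  fun_prop

lemma gD_zero (t s : ℝ) : gD 0 1 t s = t + s - |t - s| - 2 * t * s := by
  rw [← evenFn_gD one_pos]; simp [evenFn]; ring

lemma gSI_zero (t s : ℝ) : gSI 0 1 t s = 1 / 6 - |t - s| + (t - s) ^ 2 := by
  rw [← evenFn_gSI]; simp [evenFn]; ring

lemma hS_pos_of_abs_lt {w : ℝ} (hw : |w| < 1) {t : ℝ} (ht : 0 < t) (ht1 : t ≤ 1) : 0 < hS w t := by
  rcases lt_trichotomy w 0 with h | h | h
  · rw [hS_of_neg h]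
    have hs : 0 < √(-w) := sqrt_pos.2 (neg_pos.2 h)
    have hs1 : √(-w) < 1 := by rw [Real.sqrt_lt' one_pos]; grind
    have : 2 * √(-w) * t < Real.pi := by nlinarith [Real.pi_gt_three]
    exact div_pos (Real.sin_pos_of_pos_of_lt_pi (by positivity) this) (by positivity)
  · rw [h, hS_of_zero]; exact ht
  · rw [hS_of_pos h]
    positivity

lemma hasDerivAt_hS_param {w : ℝ} (hw : w ≠ 0) (t : ℝ) :
    HasDerivAt (fun w => hS w t) ((t * hC w t - hS w t) / (2 * w)) w := by
  rcases lt_or_gt_of_ne hw with h | h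
  · have hs : √(-w) ≠ 0 := (sqrt_pos.2 (neg_pos.2 h)).ne'
    have hq : √(-w) ^ 2 = -w := sq_sqrt (neg_pos.2 h).le
    have h1 : HasDerivAt (fun w : ℝ => √(-w)) (-(1 / (2 * √(-w)))) w := by
      refine ((hasDerivAt_neg w).sqrt (by simpa using hw)).congr_deriv ?_
      ring
    have h2 := (((h1.const_mul 2).mul_const t).sin).div (h1.const_mul 2) (by simpa using hs)
    refine (h2.congr_of_eventuallyEq ?_).congr_deriv ?_
    · filter_upwards [Iio_mem_nhds h] with y hy
      exact hS_of_neg hy t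
    · rw [hS_of_neg h, hC_of_neg h]
      grind
  · have hs : √w ≠ 0 := (sqrt_pos.2 h).ne'
    have hq : √w ^ 2 = w := sq_sqrt h.le
    have h1 : HasDerivAt (fun w : ℝ => √w) (1 / (2 * √w)) w := Real.hasDerivAt_sqrt hw
    have h2 := (((h1.const_mul 2).mul_const t).sinh).div (h1.const_mul 2) (by simpa using hs)
    refine (h2.congr_of_eventuallyEq ?_).congr_deriv ?_
    · filter_upwards [Ioi_mem_nhds h] with y hy
      exact hS_of_pos hy t
    · rw [hS_of_pos h, hC_of_pos h]
      grind

lemma continuousAt_hS_param {t : ℝ} (ht : 0 < t) : ContinuousAt (fun w => hS w t) 0 := by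
  have hs := hasDerivAt_iff_tendsto_slope.1 (Real.hasDerivAt_sinh 0)
  have hn := hasDerivAt_iff_tendsto_slope.1 (Real.hasDerivAt_sin 0)
  rw [Real.cosh_zero] at hs
  rw [Real.cos_zero] at hn
  have hq : ∀ c : ℝ → ℝ, ContinuousAt c 0 → c 0 = 0 → ∀ S : Set ℝ, (∀ w ∈ S, 0 < c w) →
      Tendsto (fun w => 2 * √(c w) * t) (𝓝[S] 0) (𝓝[≠] 0) := by
    intro c hc h0 S hS
    refine tendsto_nhdsWithin_iff.2 ⟨?_, ?_⟩
    · have : ContinuousAt (fun w => 2 * √(c w) * t) 0 := by fun_prop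
      have h := this.tendsto
      rw [h0, Real.sqrt_zero, mul_zero, zero_mul] at h
      exact h.mono_left nhdsWithin_le_nhds
    · filter_upwards [self_mem_nhdsWithin] with w hw
      have := sqrt_pos.2 (hS w hw)
      exact (by positivity : 2 * √(c w) * t ≠ 0)
  rw [continuousAt_iff_continuous_left'_right', ContinuousWithinAt, ContinuousWithinAt, hS_of_zero]
  constructor
  · have := (hn.comp (hq (fun w => -w) (by fun_prop) (by simp) (Iio 0) (by simp))).const_mul t
    rw [mul_one] at this
    refine this.congr' ?_
    filter_upwards [self_mem_nhdsWithin] with w hw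
    have := sqrt_pos.2 (neg_pos.2 hw)
    rw [hS_of_neg hw, Function.comp_apply, slope_def_field, Real.sin_zero, sub_zero, sub_zero]
    field_simp
  · have := (hs.comp (hq (fun w => w) (by fun_prop) (by simp) (Ioi 0) (by simp))).const_mul t
    rw [mul_one] at this
    refine this.congr' ?_
    filter_upwards [self_mem_nhdsWithin] with w hw
    have := sqrt_pos.2 hw
    rw [hS_of_pos hw, Function.comp_apply, slope_def_field, Real.sinh_zero, sub_zero, sub_zero]
    field_simp

/-- The trace of the Dirichlet Green function. -/
lemma integral_gD_diag {w : ℝ} (hw : w ≠ 0) :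
    ∫ s in 𝕀, gD w 1 s s = (hC w 1 - hS w 1) / (4 * w * hS w 1) := by
  have h : ∀ s, gD w 1 s s = (hC w 1 - hC w (2 * s - 1)) / (4 * w * hS w 1) := by
    intro s
    have e1 := hC_add w s (1 - s)
    have e2 := hC_sub w s (1 - s)
    rw [show s + (1 - s) = 1 by ring] at e1
    rw [show s - (1 - s) = 2 * s - 1 by ring] at e2
    rw [gD, if_pos le_rfl, sub_self, hS_zero, e1, e2, mul_zero, sub_zero]
    grind
  have hd : ∀ s, HasDerivAt (fun s => (hC w 1 * s - hS w (2 * s - 1) / 2) / (4 * w * hS w 1))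
      ((hC w 1 - hC w (2 * s - 1)) / (4 * w * hS w 1)) s := by
    intro s
    have h2 : HasDerivAt (fun s : ℝ => 2 * s - 1) 2 s := by
      simpa using ((hasDerivAt_id s).const_mul 2).sub_const 1
    have h3 : HasDerivAt (fun s => hS w (2 * s - 1)) (hC w (2 * s - 1) * 2) s :=
      HasDerivAt.comp (h₂ := hS w) s (hasDerivAt_hS w (2 * s - 1)) h2
    refine ((((hasDerivAt_id s).const_mul _).sub (h3.div_const 2)).div_const _).congr_deriv ?_
    ring
  have hc : Continuous fun s => (hC w 1 - hC w (2 * s - 1)) / (4 * w * hS w 1) := by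
    have := continuous_hC w
    fun_prop
  simp only [h]
  rw [integral_Icc_eq_integral_Ioc, ← integral_of_le zero_le_one,
    integral_eq_sub_of_hasDerivAt (fun s _ => hd s) (hc.intervalIntegrable _ _)]
  norm_num [hS_neg]
  ring

def dirichlet : KernelDatum where
  k z := gD (z / 2) 1
  φ z := hS (z / 2) 1
  r := 1 / 2
  r_pos := by norm_num
  r_le := le_rfl
  symm z _ s _ t _ := gD_symm _ _ _ _
  cont_zero := continuous_gD _ _
  bound_zero s hs t ht := by
    rw [zero_div, gD_zero, abs_le]
    obtain ⟨h1, h2⟩ := hs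
    obtain ⟨h3, h4⟩ := ht
    rcases abs_cases (s - t) with ⟨h, _⟩ | ⟨h, _⟩ <;> rw [h] <;> constructor <;> nlinarith
  cont z _ := (continuous_gD _ _).continuousOn
  eqn z hz t ht s hs := by
    refine resolvent_of_forall (continuous_gD _ _) (continuous_gD _ _) (fun f hf => ?_) hs
    have hw : |z / 2| < 1 := by grind
    obtain ⟨u, u', hu, huc, hu', hu0, hu1⟩ :=
      green_dirichlet (hS_pos_of_abs_lt hw one_pos le_rfl).ne' hf
    have h0 : hS (0 / 2) 1 ≠ 0 := by simp [hS_of_zero]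
    obtain ⟨v, v', hv, -, hv', hv0, hv1⟩ := green_dirichlet h0 hf
    obtain ⟨y, y', hy, -, hy', hy0, hy1⟩ := green_dirichlet h0 huc
    have hd := eq_affine (d := fun t => u t - v t + z * y t) (d' := fun t => u' t - v' t + z * y' t)
      (fun t => (((hu' t).1.sub (hv' t).1).add ((hy' t).1.const_mul z)))
      (fun t => (((hu' t).2.sub (hv' t).2).add ((hy' t).2.const_mul z)).congr_deriv (by ring))
    have h1 := hd 1
    have ht' := hd t
    simp only [hu0, hu1, hv0, hv1, hy0, hy1] at h1 ht'
    have hc : u' 0 - v' 0 + z * y' 0 = 0 := by linarith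
    rw [hc] at ht'
    have e : ∫ x in (0 : ℝ)..1, gD (0 / 2) 1 t x * ∫ s in (0 : ℝ)..1, gD (z / 2) 1 x s * f s = y t := by
      rw [hy t ht]
      refine integral_congr fun x hx => ?_
      rw [uIcc_of_le zero_le_one] at hx
      simp only [hu x hx]
    grind
  φ_zero := by simp [hS_of_zero]
  φ_pos z hz := hS_pos_of_abs_lt (by grind) one_pos le_rfl
  φ_cont := by
    refine ContinuousAt.comp (g := fun w => hS w 1) ?_ (by fun_prop)
    rw [zero_div]; exact continuousAt_hS_param one_pos
  φ_deriv z hz h0 := by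
    have hw : |z / 2| < 1 := by grind
    have hp := (hS_pos_of_abs_lt hw one_pos le_rfl).ne'
    have h2 : z / 2 ≠ 0 := by simpa using h0
    refine ((hasDerivAt_hS_param h2 1).comp z ((hasDerivAt_id z).div_const 2)).congr_deriv ?_
    rw [integral_gD_diag h2]
    field_simp
    ring

def periodic : KernelDatum where
  k z := gSI (z / 2) 1
  φ z := (2 * hS (z / 2) (1 / 2)) ^ 2
  r := 1 / 2
  r_pos := by norm_num
  r_le := le_rfl
  symm z hz s _ t _ := gSI_symm (hS_pos_of_abs_lt (by grind) (by norm_num) (by norm_num)).ne' _ _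
  cont_zero := continuous_gSI
  bound_zero s hs t ht := by
    rw [zero_div, gSI_zero, abs_le]
    obtain ⟨h1, h2⟩ := hs
    obtain ⟨h3, h4⟩ := ht
    rcases abs_cases (s - t) with ⟨h, _⟩ | ⟨h, _⟩ <;> rw [h] <;> constructor <;> nlinarith
  cont z _ := continuous_gSI.continuousOn
  eqn z hz t ht s hs := by
    refine resolvent_of_forall continuous_gSI continuous_gSI (fun f hf => ?_) hs
    have hw : |z / 2| < 1 := by grind
    obtain ⟨u, u', hu, huc, hu', hu0, hu1⟩ := green_periodic one_pos
      (hS_pos_of_abs_lt hw (t := 1 / 2) (by norm_num) (by norm_num)).ne' hf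
    have h0 : hS (0 / 2) (1 / 2) ≠ 0 := by simp [hS_of_zero]
    obtain ⟨v, v', hv, hvc, hv', hv0, hv1⟩ := green_periodic one_pos h0 hf
    obtain ⟨y, y', hy, hyc, hy', hy0, hy1⟩ := green_periodic one_pos h0 huc
    have hd := eq_affine (d := fun t => u t - v t + z * y t) (d' := fun t => u' t - v' t + z * y' t)
      (fun t => (((hu' t).1.sub (hv' t).1).add ((hy' t).1.const_mul z)))
      (fun t => (((hu' t).2.sub (hv' t).2).add ((hy' t).2.const_mul z)).congr_deriv (by
        rw [hu1]; ring))
    have h1 := hd 1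
    have ht' := hd t
    have hc : u' 0 - v' 0 + z * y' 0 = 0 := by grind
    simp only [hc, zero_mul, add_zero] at hd ht'
    have hint : ∫ t in (0 : ℝ)..1, (u t - v t + z * y t) = 0 := by
      rw [intervalIntegral.integral_add, intervalIntegral.integral_sub,
        intervalIntegral.integral_const_mul, hu1, hv1, hy1]
      · ring
      all_goals exact Continuous.intervalIntegrable (by fun_prop) _ _
    simp only [hd, intervalIntegral.integral_const, sub_zero, one_smul] at hint
    rw [hint] at ht'
    have e : ∫ x in (0 : ℝ)..1, gSI (0 / 2) 1 t x * ∫ s in (0 : ℝ)..1, gSI (z / 2) 1 x s * f s = y t := by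
      rw [hy t ht]
      refine integral_congr fun x hx => ?_
      rw [uIcc_of_le zero_le_one] at hx
      simp only [hu x hx]
    grind
  φ_zero := by simp [hS_of_zero]
  φ_pos z hz := by
    have := hS_pos_of_abs_lt (w := z / 2) (by grind) (t := 1 / 2) (by norm_num) (by norm_num)
    positivity
  φ_cont := by
    have : ContinuousAt (fun z : ℝ => hS (z / 2) (1 / 2)) 0 := by
      refine ContinuousAt.comp (g := fun w => hS w (1 / 2)) ?_ (by fun_prop)
      rw [zero_div]; exact continuousAt_hS_param (by norm_num)
    fun_prop
  φ_deriv z hz h0 := by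
    have hw : |z / 2| < 1 := by grind
    have hp := (hS_pos_of_abs_lt hw (t := 1 / 2) (by norm_num) (by norm_num)).ne'
    have h2 : z / 2 ≠ 0 := by simpa using h0
    have h3 := (hasDerivAt_hS_param h2 (1 / 2)).comp z ((hasDerivAt_id z).div_const 2)
    refine ((h3.const_mul 2).pow 2).congr_deriv ?_
    have e : ∀ s, gSI (z / 2) 1 s s = -(1 / (2 * (z / 2))) + hC (z / 2) (1 / 2) / (4 * (z / 2) *
        hS (z / 2) (1 / 2)) := by
      intro s
      rw [gSI, if_pos le_rfl, sub_self, hS_zero, pSI, if_neg h2]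
      simp
    simp only [e, Function.comp_apply, id]
    rw [setIntegral_const]
    simp only [Real.volume_real_Icc_of_le zero_le_one, sub_zero, one_smul]
    field_simp
    ring

end

section

/-! ### Spectral decomposition of the Hessian -/

lemma hess_isHermitian {D : ℕ} {V : E D → ℝ} (hV : Smooth V) (x : E D) :
    ((1 / 2 : ℝ) • hess V x).IsHermitian := by
  ext μ ν
  have h := jetAt_sym hV x 2 ![μ, ν] (Equiv.swap 0 1)
  rw [show (![μ, ν] : Fin 2 → Fin D) ∘ (Equiv.swap 0 1) = ![ν, μ] by simp] at h
  have h' : pd V x ![ν, μ] = pd V x ![μ, ν] := h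
  simpa [hess] using h'

def hessSpectrum {D : ℕ} {V : E D → ℝ} (hV : Smooth V) (x : E D) : Spectrum D where
  U μ j := (hess_isHermitian hV x).eigenvectorUnitary.1 μ j
  η j := 2 * (hess_isHermitian hV x).eigenvalues j
  orth i j := by
    have h := congrFun (congrFun (Unitary.coe_star_mul_self
      (hess_isHermitian hV x).eigenvectorUnitary) i) j
    simpa [Matrix.mul_apply, Matrix.one_apply, Matrix.star_apply] using h
  complete i j := by
    have h := congrFun (congrFun (Unitary.coe_mul_star_self
      (hess_isHermitian hV x).eigenvectorUnitary) i) j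
    simpa [Matrix.mul_apply, Matrix.one_apply, Matrix.star_apply] using h

section
variable {D : ℕ} {V : E D → ℝ} (hV : Smooth V) (x : E D)

lemma ofOmega_apply (f : ℂ → ℂ) (f₀ : ℝ) (μ ν : Fin D) :
    ofOmega V x f f₀ μ ν
      = (hessSpectrum hV x).mat (fun j => evenFn f f₀ ((hessSpectrum hV x).η j / 2)) μ ν := by
  rw [ofOmega, (hess_isHermitian hV x).cfc_eq, Matrix.IsHermitian.cfc, Unitary.conjStarAlgAut_apply]
  simp [Matrix.mul_apply, Matrix.diagonal_apply, Spectrum.mat, hessSpectrum, Matrix.star_apply]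
  grind

lemma det_ofOmega (f : ℂ → ℂ) (f₀ : ℝ) :
    (ofOmega V x f f₀).det = ∏ j, evenFn f f₀ ((hessSpectrum hV x).η j / 2) := by
  rw [ofOmega, (hess_isHermitian hV x).cfc_eq, Matrix.IsHermitian.cfc, Unitary.conjStarAlgAut_apply,
    Matrix.det_mul_right_comm,
    Unitary.mul_star_self_of_mem (hess_isHermitian hV x).eigenvectorUnitary.2, one_mul, Matrix.det_diagonal]
  simp [hessSpectrum]

lemma hess_eq (μ ν : Fin D) : hess V x μ ν = (hessSpectrum hV x).mat (hessSpectrum hV x).η μ ν := by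
  have h := congrFun (congrFun (hess_isHermitian hV x).spectral_theorem μ) ν
  rw [Unitary.conjStarAlgAut_apply] at h
  simp [Matrix.mul_apply, Matrix.diagonal_apply, Matrix.star_apply] at h
  simp only [Spectrum.mat, hessSpectrum, Matrix.IsHermitian.eigenvectorUnitary_apply]
  have : hess V x μ ν = 2 * (2⁻¹ * hess V x μ ν) := by ring
  rw [this, h, mul_sum]
  grind


end


/-! ### Green functions in the eigenframe -/

namespace Spectrum

variable {D : ℕ} (S : Spectrum D)

def vec (p : Fin D → ℝ) (μ : Fin D) : ℝ := ∑ j, S.U μ j * p j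

lemma coord_vec (p : Fin D → ℝ) : S.coord (S.vec p) = p := funext (S.coord_sum p)

lemma vec_coord (a : Fin D → ℝ) : S.vec (S.coord a) = a := by
  ext μ
  simp only [vec, coord, mul_sum, ← mul_assoc]
  rw [sum_comm]
  simp only [← sum_mul, S.complete]
  simp

lemma of_mat_mulVec (f a : Fin D → ℝ) :
    Matrix.of (S.mat f) *ᵥ a = S.vec fun j => f j * S.coord a j := by
  ext μ
  simp only [Matrix.mulVec, dotProduct, Matrix.of_apply, mat, vec, coord, sum_mul, mul_sum]
  rw [sum_comm]
  grind

lemma dotProduct_vec (a p : Fin D → ℝ) : a ⬝ᵥ S.vec p = ∑ j, S.coord a j * p j := by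
  simp only [dotProduct, vec, coord, mul_sum, sum_mul]
  rw [sum_comm]
  grind

lemma vec_zero : S.vec 0 = 0 := by ext; simp [vec]

lemma continuous_coord {f : ℝ → Fin D → ℝ} (hf : Continuous f) (j : Fin D) :
    Continuous fun t => S.coord (f t) j := by
  have h : ∀ i, Continuous fun t => f t i := fun i => (continuous_apply i).comp hf
  simp only [coord]
  fun_prop

lemma continuous_vec {p : ℝ → Fin D → ℝ} (hp : ∀ j, Continuous fun t => p t j) :
    Continuous fun t => S.vec (p t) := by
  refine continuous_pi fun μ => ?_
  simp only [vec]
  fun_prop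

lemma hasDerivAt_vec {p p' : ℝ → Fin D → ℝ} {t : ℝ}
    (h : ∀ j, HasDerivAt (fun t => p t j) (p' t j) t) :
    HasDerivAt (fun t => S.vec (p t)) (S.vec (p' t)) t :=
  hasDerivAt_pi.2 fun μ => HasDerivAt.fun_sum fun j _ => (h j).const_mul (S.U μ j)

lemma integral_vec {p : ℝ → Fin D → ℝ} {T : ℝ} (h : ∀ j, Continuous fun t => p t j) :
    ∫ t in (0 : ℝ)..T, S.vec (p t) = S.vec fun j => ∫ t in (0 : ℝ)..T, p t j := by
  ext μ
  have := ((ContinuousLinearMap.proj μ : (Fin D → ℝ) →L[ℝ] ℝ).intervalIntegral_comp_comm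
    ((S.continuous_vec h).intervalIntegrable (μ := volume) 0 T))
  simp only [ContinuousLinearMap.proj_apply] at this
  rw [← this]
  simp only [vec]
  rw [intervalIntegral.integral_finsetSum fun j _ =>
    (Continuous.intervalIntegrable ((h j).const_mul _) _ _)]
  simp

lemma coord_integral {f : ℝ → Fin D → ℝ} (hf : Continuous f) {T : ℝ} (j : Fin D) :
    S.coord (∫ t in (0 : ℝ)..T, f t) j = ∫ t in (0 : ℝ)..T, S.coord (f t) j := by
  have := S.integral_vec (p := fun t => S.coord (f t)) (T := T) (S.continuous_coord hf)
  simp only [S.vec_coord] at this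
  rw [this, S.coord_vec]

end Spectrum

section
variable {D : ℕ} (S : Spectrum D)

lemma solution_of_scalar {T : ℝ} (g : Fin D → ℝ → ℝ → ℝ)
    (hg : ∀ j, 𝒞₂ (g j)) {f : ℝ → Fin D → ℝ} (hf : Continuous f)
    (c : Fin D → ℝ) {u u' : Fin D → ℝ → ℝ}
    (hu : ∀ j, ∀ t ∈ Icc 0 T, u j t = ∫ s in (0 : ℝ)..T, g j t s * S.coord (f s) j)
    (hu' : ∀ j t, HasDerivAt (u j) (u' j t) t ∧
      HasDerivAt (u' j) (4 * (S.η j / 2) * u j t - 2 * (S.coord (f t) j - S.coord c j)) t) :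
    (∀ t ∈ Icc 0 T, S.vec (fun j => u j t)
      = ∫ s in (0 : ℝ)..T, Matrix.of (S.mat fun j => g j t s) *ᵥ f s) ∧
    ∀ t, HasDerivAt (fun t => S.vec fun j => u j t) (S.vec fun j => u' j t) t ∧
      HasDerivAt (fun t => S.vec fun j => u' j t)
        ((2 : ℝ) • (Matrix.of (S.mat S.η) *ᵥ S.vec (fun j => u j t) - (f t - c))) t := by
  refine ⟨fun t ht => ?_, fun t => ⟨S.hasDerivAt_vec (p := fun t j => u j t)
      (p' := fun t j => u' j t) fun j => (hu' j t).1, ?_⟩⟩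
  · simp only [S.of_mat_mulVec]
    rw [S.integral_vec fun j => ?_]
    · congr 1; ext j; exact hu j t ht
    · exact ((hg j).comp (f := fun s => (t, s)) (by fun_prop)).mul (S.continuous_coord hf j)
  · refine (S.hasDerivAt_vec (p := fun t j => u' j t) (p' := fun t j => 4 * (S.η j / 2) * u j t
      - 2 * (S.coord (f t) j - S.coord c j)) fun j => (hu' j t).2).congr_deriv ?_
    rw [S.of_mat_mulVec, S.coord_vec]
    conv_rhs => rw [← S.vec_coord (f t), ← S.vec_coord c]
    ext μ
    simp only [Spectrum.vec, Pi.smul_apply, Pi.sub_apply, smul_eq_mul, mul_sum, ← sum_sub_distrib]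
    exact sum_congr rfl fun j _ => by ring

lemma isGreenD_of_scalar {T : ℝ} (g : Fin D → ℝ → ℝ → ℝ) (hg : ∀ j, 𝒞₂ (g j))
    (h : ∀ j, ∀ f : ℝ → ℝ, Continuous f → ∃ u u' : ℝ → ℝ,
      (∀ t ∈ Icc 0 T, u t = ∫ s in (0 : ℝ)..T, g j t s * f s) ∧ Continuous u ∧
      (∀ t, HasDerivAt u (u' t) t ∧ HasDerivAt u' (4 * (S.η j / 2) * u t - 2 * f t) t) ∧
      u 0 = 0 ∧ u T = 0) :
    IsGreenD T (Matrix.of (S.mat S.η)) fun t s => Matrix.of (S.mat fun j => g j t s) := by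
  intro f hf
  choose u u' hu huc hu' hu0 huT using fun j => h j _ (S.continuous_coord hf j)
  obtain ⟨h1, h2⟩ := solution_of_scalar S g hg hf 0 hu fun j t => by
    simpa [Spectrum.coord] using hu' j t
  simp only [sub_zero] at h2
  refine ⟨_, _, h1, (S.continuous_vec huc).continuousOn, fun t _ => h2 t, ?_, ?_⟩
  · simp only [hu0]; exact S.vec_zero
  · simp only [huT]; exact S.vec_zero

lemma isGreenSI_of_scalar {T : ℝ} (g : Fin D → ℝ → ℝ → ℝ) (hg : ∀ j, 𝒞₂ (g j))
    (h : ∀ j, ∀ f : ℝ → ℝ, Continuous f → ∃ u u' : ℝ → ℝ,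
      (∀ t ∈ Icc 0 T, u t = ∫ s in (0 : ℝ)..T, g j t s * f s) ∧ Continuous u ∧
      (∀ t, HasDerivAt u (u' t) t ∧ HasDerivAt u'
        (4 * (S.η j / 2) * u t - 2 * (f t - T⁻¹ * ∫ s in (0 : ℝ)..T, f s)) t) ∧
      u 0 = u T ∧ ∫ s in (0 : ℝ)..T, u s = 0) :
    IsGreenSI T (Matrix.of (S.mat S.η)) fun t s => Matrix.of (S.mat fun j => g j t s) := by
  intro f hf
  choose u u' hu huc hu' hu0 huT using fun j => h j _ (S.continuous_coord hf j)
  obtain ⟨h1, h2⟩ := solution_of_scalar S g hg hf (T⁻¹ • ∫ s in (0 : ℝ)..T, f s) hu fun j t => by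
    have e : S.coord (T⁻¹ • ∫ s in (0 : ℝ)..T, f s) j = T⁻¹ * ∫ s in (0 : ℝ)..T, S.coord (f s) j := by
      rw [← S.coord_integral hf]
      simp [Spectrum.coord, mul_sum, mul_left_comm]
    rw [e]
    exact hu' j t
  refine ⟨_, _, h1, (S.continuous_vec huc).continuousOn, fun t _ => h2 t, by simp only [hu0], ?_⟩
  rw [S.integral_vec huc]
  simp only [huT]; exact S.vec_zero

lemma bosAction_zero_points {T : ℝ} (g : Fin D → ℝ → ℝ → ℝ) (hg : ∀ j, 𝒞₂ (g j)) (a : Fin D → ℝ) :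
    bosAction (n := 0) T (fun t s => Matrix.of (S.mat fun j => g j t s)) a ![] ![]
      = ∑ j, S.coord a j ^ 2 * ∫ t in (0 : ℝ)..T, ∫ s in (0 : ℝ)..T, g j t s := by
  have hc : ∀ j t, Continuous fun s => g j t s := fun j t =>
    (hg j).comp (f := fun s => (t, s)) (by fun_prop)
  have hc2 : ∀ j, Continuous fun t => ∫ s in (0 : ℝ)..T, g j t s := fun j =>
    intervalIntegral.continuous_parametric_intervalIntegral_of_continuous' (hg j) _ _
  simp only [bosAction, Finset.univ_eq_empty, Finset.sum_empty, add_zero, S.of_mat_mulVec,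
    S.dotProduct_vec]
  have e : ∀ t, ∫ s in (0 : ℝ)..T, ∑ j, S.coord a j * (g j t s * S.coord a j)
      = ∑ j, S.coord a j ^ 2 * ∫ s in (0 : ℝ)..T, g j t s := by
    intro t
    rw [intervalIntegral.integral_finsetSum fun j _ =>
      Continuous.intervalIntegrable (((hc j t).mul_const _).const_mul _) _ _]
    refine sum_congr rfl fun j _ => ?_
    rw [intervalIntegral.integral_const_mul, intervalIntegral.integral_mul_const]
    ring
  simp only [e]
  rw [intervalIntegral.integral_finsetSum fun j _ =>
    Continuous.intervalIntegrable ((hc2 j).const_mul _) _ _]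
  simp

end

/-! ### The Green functions of the statement -/

lemma gD_scale {T : ℝ} (hT : 0 < T) (w t s : ℝ) :
    gD (w / 2) T (T * t) (T * s) = T * dirichlet.k (T ^ 2 * w) t s := by
  change _ = T * gD (T ^ 2 * w / 2) 1 t s
  rw [show T ^ 2 * w / 2 = w / 2 * T ^ 2 by ring]
  generalize w / 2 = w
  have h1 : hS w T = T * hS (w * T ^ 2) 1 := by rw [← hS_scale hT, mul_one]
  have h2 : (T * s ≤ T * t) = (s ≤ t) := by simp_all
  rw [gD, gD, show T - T * s = T * (1 - s) by ring, ← mul_sub, h1]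
  simp only [hS_scale hT, h2]
  grind

lemma gSI_scale {T : ℝ} (hT : 0 < T) (w t s : ℝ) :
    gSI (w / 2) T (T * t) (T * s) = T * periodic.k (T ^ 2 * w) t s := by
  change _ = T * gSI (T ^ 2 * w / 2) 1 t s
  rw [show T ^ 2 * w / 2 = w / 2 * T ^ 2 by ring]
  generalize w / 2 = w
  have h1 : hS w (T / 2) = T * hS (w * T ^ 2) (1 / 2) := by rw [← hS_scale hT]; ring_nf
  have h2 : (T * s ≤ T * t) = (s ≤ t) := by simp_all
  have h3 : pSI w T (T * (t - s)) = T * pSI (w * T ^ 2) 1 (t - s) := by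
    by_cases hw : w = 0
    · subst hw; simp only [pSI, zero_mul, if_pos]; field_simp
    · have : w * T ^ 2 ≠ 0 := by positivity
      rw [pSI, if_neg hw, pSI, if_neg this, h1, show T / 2 + T * (t - s) = T * (1 / 2 + (t - s)) by
        ring, hC_scale hT]
      grind
  rw [gSI, gSI, ← mul_sub, h3, hS_scale hT]
  grind

lemma integral_gD {w T : ℝ} (hT : 0 < T) (h : hS w T ≠ 0) :
    (∫ t in (0 : ℝ)..T, ∫ s in (0 : ℝ)..T, gD w T t s) / 2
      = evenFn (fun om => (om * T - Complex.tanh (om * T)) / (4 * om ^ 3)) (T ^ 3 / 12) w := by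
  rw [integral_congr (g := fun t => 2 * duhamel w (fun _ => 1) T / hS w T * hS w t
    - 2 * duhamel w (fun _ => 1) t) fun t ht => by
      rw [uIcc_of_le hT.le] at ht
      simpa using integral_gD_mul h (continuous_const (y := (1 : ℝ))) ht]
  by_cases hw : w = 0
  · subst hw
    have e : ∀ t : ℝ, duhamel 0 (fun _ => 1) t = t ^ 2 / 2 := by
      intro t
      simp only [duhamel, hS_of_zero, mul_one, intervalIntegral.integral_comp_sub_left fun x => x]
      simp
    simp only [e, hS_of_zero, evenFn, if_true]
    rw [integral_congr (g := fun t => T * t - t ^ 2) fun t _ => by field_simp,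
      intervalIntegral.integral_sub (Continuous.intervalIntegrable (by fun_prop) _ _)
        (Continuous.intervalIntegrable (by fun_prop) _ _), intervalIntegral.integral_const_mul]
    simp; ring
  · rw [evenFn_exp hw]
    have e : ∀ t : ℝ, duhamel w (fun _ => 1) t = (hC w t - 1) / (4 * w) := by
      intro t
      simp only [duhamel, mul_one]
      have := continuous_hS w
      rw [integral_eq_sub_of_hasDerivAt (f := fun s => -(hC w (t - s) / (4 * w))) (fun s _ => ?_)
        (Continuous.intervalIntegrable (by fun_prop) _ _), sub_self, hC_zero, sub_zero]
      · ring
      · refine (((hasDerivAt_hC w (t - s)).comp_const_sub t s).div_const (4 * w)).neg.congr_deriv ?_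
        field_simp
    simp only [e]
    have := continuous_hC w
    have := continuous_hS w
    rw [integral_eq_sub_of_hasDerivAt (f := fun t => 2 * ((hC w T - 1) / (4 * w)) / hS w T
      * (hC w t / (4 * w)) - 2 * ((hS w t - t) / (4 * w))) (fun t _ => ?_)
      (Continuous.intervalIntegrable (by fun_prop) _ _)]
    · have f1 := hS_add w (T / 2) (T / 2)
      have f2 := hC_add w (T / 2) (T / 2)
      have f3 := hC_sq w (T / 2)
      rw [add_halves] at f1 f2
      rw [hC_zero, hS_zero]
      have n1 : hS w (T / 2) ≠ 0 := by grind
      have n2 : hC w (T / 2) ≠ 0 := by grind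
      have f4 : hC w T = 1 + 8 * w * hS w (T / 2) ^ 2 := by rw [f2]; linear_combination f3
      have f5 : hS w T = 2 * hS w (T / 2) * hC w (T / 2) := by rw [f1]; ring
      rw [f4, f5]
      generalize hS w (T / 2) = a at *
      generalize hC w (T / 2) = c at *
      field_simp
      linear_combination (-16 * w * a ^ 2) * f3
    · refine ((((hasDerivAt_hC w t).div_const (4 * w)).const_mul _).sub
        ((((hasDerivAt_hS w t).sub (hasDerivAt_id t)).div_const (4 * w)).const_mul 2)).congr_deriv ?_
      field_simp

lemma bosAction_scaled {D : ℕ} {S : Spectrum D} {𝒦 : KernelDatum} {T : ℝ} (hT : 0 < T)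
    {g : Fin D → ℝ → ℝ → ℝ} (hg : ∀ j, 𝒞₂ (g j))
    (h : ∀ j t s, g j (T * t) (T * s) = T * 𝒦.k (T ^ 2 * S.η j) t s) (a : Fin D → ℝ) :
    bosAction (n := 0) T (fun t s => Matrix.of (S.mat fun j => g j t s)) a ![] ![]
      = T ^ 3 * quadForm 𝒦 S a (T ^ 2) := by
  rw [bosAction_zero_points _ _ hg, quadForm, mul_sum]
  refine sum_congr rfl fun j _ => ?_
  simp only [integral_eq_setIntegral_unit hT, h, integral_const_mul, KernelDatum.Q, KernelDatum.g]
  ring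

section
variable {D : ℕ} {V : E D → ℝ} (hV : Smooth V) (x : E D)

local notation "𝓢" => hessSpectrum hV x

lemma greenD_eq {T : ℝ} (hT : 0 < T) :
    greenD V x T = fun t s => Matrix.of (Spectrum.mat 𝓢 fun j => gD (Spectrum.η 𝓢 j / 2) T t s) := by
  ext t s μ ν
  rw [greenD, ofOmega_apply hV]
  simp only [evenFn_gD hT, Matrix.of_apply]

lemma greenSI_eq (T : ℝ) :
    greenSI V x T = fun t s => Matrix.of (Spectrum.mat 𝓢 fun j => gSI (Spectrum.η 𝓢 j / 2) T t s) := by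
  ext t s μ ν
  rw [greenSI, ofOmega_apply hV]
  simp only [evenFn_gSI, Matrix.of_apply]

lemma hess_eq_of : hess V x = Matrix.of (Spectrum.mat 𝓢 (Spectrum.η 𝓢)) := by
  ext μ ν
  rw [hess_eq hV, Matrix.of_apply]

lemma det_detMatD {T : ℝ} (hT : 0 < T) :
    (detMatD V x T).det = ∏ j, hS (Spectrum.η 𝓢 j / 2) T / T := by
  rw [detMatD, det_ofOmega hV]
  simp only [evenFn_detD hT]

lemma det_detMatSI {T : ℝ} (hT : 0 < T) :
    (detMatSI V x T).det = ∏ j, (2 * hS (Spectrum.η 𝓢 j / 2) (T / 2) / T) ^ 2 := by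
  rw [detMatSI, det_ofOmega hV]
  simp only [evenFn_detSI hT]

include hV in
lemma isGreenD_greenD {T : ℝ} (hT : 0 < T) (h : (detMatD V x T).det ≠ 0) :
    IsGreenD T (hess V x) (greenD V x T) ∧ bosAction (n := 0) T (greenD V x T) (grad V x) ![] ![] / 2
      = grad V x ⬝ᵥ (expMat V x T *ᵥ grad V x) := by
  rw [det_detMatD hV x hT, Finset.prod_ne_zero_iff] at h
  have h' : ∀ j, hS (Spectrum.η 𝓢 j / 2) T ≠ 0 := fun j h0 =>
    h j (Finset.mem_univ j) (by rw [h0, zero_div])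
  rw [greenD_eq hV x hT, hess_eq_of hV]
  refine ⟨isGreenD_of_scalar _ _ (fun j => continuous_gD _ _) fun j f hf =>
    green_dirichlet (h' j) hf, ?_⟩
  have he : expMat V x T = Matrix.of (Spectrum.mat 𝓢 fun j => evenFn (fun om =>
      (om * T - Complex.tanh (om * T)) / (4 * om ^ 3)) (T ^ 3 / 12) (Spectrum.η 𝓢 j / 2)) := by
    ext μ ν
    rw [expMat, ofOmega_apply hV, Matrix.of_apply]
  rw [bosAction_zero_points _ _ fun j => continuous_gD _ _, he, Spectrum.of_mat_mulVec,
    Spectrum.dotProduct_vec, sum_div]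
  refine sum_congr rfl fun j _ => ?_
  rw [← integral_gD hT (h' j)]
  ring

include hV in
lemma isGreenSI_greenSI {T : ℝ} (hT : 0 < T) (h : (detMatSI V x T).det ≠ 0) :
    IsGreenSI T (hess V x) (greenSI V x T) ∧
      bosAction (n := 0) T (greenSI V x T) (grad V x) ![] ![] = 0 := by
  rw [det_detMatSI hV x hT, Finset.prod_ne_zero_iff] at h
  have h' : ∀ j, hS (Spectrum.η 𝓢 j / 2) (T / 2) ≠ 0 := fun j h0 =>
    h j (Finset.mem_univ j) (by rw [h0]; simp)
  rw [greenSI_eq hV x, hess_eq_of hV]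
  refine ⟨isGreenSI_of_scalar _ _ (fun j => continuous_gSI) fun j f hf =>
    green_periodic hT (h' j) hf, ?_⟩
  rw [bosAction_zero_points _ _ fun j => continuous_gSI]
  refine sum_eq_zero fun j _ => ?_
  obtain ⟨u, u', hu, -, -, -, hz⟩ := green_periodic hT (h' j) (continuous_const (y := (1 : ℝ)))
  rw [integral_congr (g := u), hz, mul_zero]
  intro t ht
  rw [uIcc_of_le hT.le] at ht
  simp only [hu t ht, mul_one]

lemma greenD_scaled {T : ℝ} (hT : 0 < T) (s t : ℝ) (μ ν : Fin D) :
    greenD V x T (T * s) (T * t) μ ν = T * covMat dirichlet 𝓢 (T ^ 2) s t μ ν := by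
  simp only [greenD_eq hV x hT, gD_scale hT, Matrix.of_apply, covMat, Spectrum.mat, mul_sum]
  exact sum_congr rfl fun j _ => by ring

lemma greenSI_scaled {T : ℝ} (hT : 0 < T) (s t : ℝ) (μ ν : Fin D) :
    greenSI V x T (T * s) (T * t) μ ν = T * covMat periodic 𝓢 (T ^ 2) s t μ ν := by
  simp only [greenSI_eq hV x, gSI_scale hT, Matrix.of_apply, covMat, Spectrum.mat, mul_sum]
  exact sum_congr rfl fun j _ => by ring

lemma detFn_dirichlet {T : ℝ} (hT : 0 < T) : detFn dirichlet 𝓢 (T ^ 2) = (detMatD V x T).det := by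
  rw [det_detMatD hV x hT, detFn]
  refine prod_congr rfl fun j _ => ?_
  have := hS_scale hT (Spectrum.η 𝓢 j / 2) 1
  rw [mul_one] at this
  rw [this, mul_div_cancel_left₀ _ hT.ne']
  simp only [dirichlet]
  ring_nf

lemma detFn_periodic {T : ℝ} (hT : 0 < T) : detFn periodic 𝓢 (T ^ 2) = (detMatSI V x T).det := by
  rw [det_detMatSI hV x hT, detFn]
  refine prod_congr rfl fun j _ => ?_
  have := hS_scale hT (Spectrum.η 𝓢 j / 2) (1 / 2)
  rw [mul_one_div] at this
  rw [this, mul_left_comm, mul_div_cancel_left₀ _ hT.ne']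
  simp only [periodic]
  ring_nf

lemma quadForm_dirichlet {T : ℝ} (hT : 0 < T) (h : (detMatD V x T).det ≠ 0) :
    1 / 2 * T ^ 3 * quadForm dirichlet 𝓢 (grad V x) (T ^ 2)
      = grad V x ⬝ᵥ (expMat V x T *ᵥ grad V x) := by
  rw [← (isGreenD_greenD hV x hT h).2, greenD_eq hV x hT,
    bosAction_scaled hT (𝒦 := dirichlet) (fun j => continuous_gD _ _) fun j t s => gD_scale hT _ t s]
  ring

lemma quadForm_periodic {T : ℝ} (hT : 0 < T) (h : (detMatSI V x T).det ≠ 0) :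
    quadForm periodic 𝓢 (grad V x) (T ^ 2) = 0 := by
  have h1 := (isGreenSI_greenSI hV x hT h).2
  rw [greenSI_eq hV x,
    bosAction_scaled hT (𝒦 := periodic) (fun j => continuous_gSI) fun j t s => gSI_scale hT _ t s] at h1
  simpa [hT.ne'] using h1

end

end

section

open MvPolynomial

/-! ### The heat polynomials -/

section HeatPolynomials

variable {D n : ℕ}

def heatInt (κ : ℝ → ℝ → ℝ) (k : ℕ) (c : (Fin n → ℝ) → ℝ) (F : ℳ (𝕁 n)) (ζ : E D) : ℝ :=
  ∫ τ in cube n, c τ * wk (freeCov κ τ) (fun p => τ p.1 * ζ p.2) k F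

lemma hasDerivAt_wk_mean {ι : Type*} [Fintype ι] (C : ι → ι → ℝ) {b : ℝ → ι → ℝ} {b' : ι → ℝ}
    {x : ℝ} (hb : ∀ α, HasDerivAt (fun y => b y α) (b' α) x) (k : ℕ) (F : ℳ ι) :
    HasDerivAt (fun y => wk C (b y) k F) (∑ α, b' α * wk C (b x) k (pderiv α F)) x := by
  cases k with
  | zero => simpa only [wk_zero] using hasDerivAt_eval hb F
  | succ k =>
    refine (hasDerivAt_wk (C := fun _ => C) (C' := 0) (fun α β => hasDerivAt_const x _) hb k
      F).congr_deriv ?_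
    simp [contr_apply]

lemma freeCov_symm {κ : ℝ → ℝ → ℝ} (h : ∀ s t, κ s t = κ t s) (τ : Fin n → ℝ)
    (p q : 𝕁 n) : freeCov κ τ p q = freeCov κ τ q p := by
  simp only [freeCov, h (τ p.1), eq_comm (a := p.2)]

variable {κ : ℝ → ℝ → ℝ} (hκ : 𝒞₂ κ)
include hκ

lemma continuous_wk_heat (k : ℕ) (F : ℳ (𝕁 n)) :
    Continuous fun q : (Fin n → ℝ) × E D => wk (freeCov κ q.1) (fun p => q.1 p.1 * q.2 p.2) k F := by
  rw [← continuousOn_univ]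
  refine wk_continuousOn (fun α β => ?_) (fun α => ?_) k F
  · exact ((freeCov_continuous hκ α β).comp continuous_fst).continuousOn
  · exact Continuous.continuousOn (by fun_prop)

lemma continuous_wk_heat_right (k : ℕ) (F : ℳ (𝕁 n)) (ζ : E D) :
    Continuous fun τ : Fin n → ℝ => wk (freeCov κ τ) (fun p => τ p.1 * ζ p.2) k F :=
  (continuous_wk_heat hκ k F).comp (f := fun τ => (τ, ζ)) (by fun_prop)

lemma heatInt_add (k : ℕ) {c : (Fin n → ℝ) → ℝ} (hc : Continuous c) (F G : ℳ (𝕁 n)) (ζ : E D) :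
    heatInt κ k c (F + G) ζ = heatInt κ k c F ζ + heatInt κ k c G ζ := by
  simp only [heatInt, map_add, mul_add]
  exact integral_add (integrable_cube _ (hc.mul (continuous_wk_heat_right hκ k F ζ)))
    (integrable_cube _ (hc.mul (continuous_wk_heat_right hκ k G ζ)))

lemma heatInt_succ (k : ℕ) {c : (Fin n → ℝ) → ℝ} (hc : Continuous c) (F : ℳ (𝕁 n)) (ζ : E D) :
    heatInt κ (k + 1) c F ζ = (1 / (2 * ((k : ℝ) + 1))) * ∑ α, ∑ β,
      heatInt κ k (fun τ => c τ * freeCov κ τ α β) (pderiv α (pderiv β F)) ζ := by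
  have h : ∀ α β : 𝕁 n, Continuous fun τ : Fin n → ℝ => c τ * freeCov κ τ α β *
      wk (freeCov κ τ) (fun p => τ p.1 * ζ p.2) k (pderiv α (pderiv β F)) := fun α β =>
    (hc.mul (freeCov_continuous hκ α β)).mul (continuous_wk_heat_right hκ k _ ζ)
  simp only [heatInt]
  rw [sum_congr rfl fun α _ => (integral_finsetSum _ fun β _ => integrable_cube _ (h α β)).symm,
    ← integral_finsetSum _ fun α _ => integrable_cube _ (continuous_finsetSum _ fun β _ => h α β),
    ← integral_const_mul]
  congr 1; ext τ
  rw [wk_succ', ← mul_assoc, mul_comm (c τ), mul_assoc, mul_sum]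
  congr 1
  refine sum_congr rfl fun α _ => ?_
  rw [mul_sum]
  exact sum_congr rfl fun β _ => by ring

lemma contDiff_heatInt (k : ℕ) {c : (Fin n → ℝ) → ℝ} (hc : Continuous c)
    (F : ℳ (𝕁 n)) : Smooth (heatInt κ k c F) := by
  induction k generalizing c F with
  | zero =>
    induction F using MvPolynomial.induction_on' with
    | monomial e a =>
      have : heatInt κ 0 c (monomial e a) = fun ζ : E D =>
          (∫ τ in cube n, c τ * (a * ∏ p ∈ e.support, τ p.1 ^ e p)) * ∏ p ∈ e.support, ζ p.2 ^ e p := by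
        ext ζ
        rw [heatInt, ← integral_mul_const]
        congr 1; ext τ
        rw [wk_zero, eval_monomial, Finsupp.prod]
        simp only [mul_pow, Finset.prod_mul_distrib]
        ring
      rw [this]
      refine contDiff_const.mul (contDiff_prod fun p _ => ContDiff.pow ?_ _)
      exact (EuclideanSpace.proj (𝕜 := ℝ) p.2 : E D →L[ℝ] ℝ).contDiff
    | add F G hF hG =>
      have : heatInt κ 0 c (F + G) = fun ζ : E D => heatInt κ 0 c F ζ + heatInt κ 0 c G ζ :=
        funext (heatInt_add hκ 0 hc F G)
      rw [this]
      exact hF.add hG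
  | succ k ih =>
    have : heatInt κ (k + 1) c F = fun ζ : E D => _ := funext (heatInt_succ hκ k hc F)
    rw [this]
    exact contDiff_const.mul (ContDiff.sum fun α _ => ContDiff.sum fun β _ =>
      ih (hc.mul (freeCov_continuous hκ α β)) _)

lemma dd_heatInt (k : ℕ) {c : (Fin n → ℝ) → ℝ} (hc : Continuous c)
    (F : ℳ (𝕁 n)) (μ : Fin D) (ζ : E D) :
    dd μ (heatInt κ k c F) ζ = ∑ i, heatInt κ k (fun τ => c τ * τ i) (pderiv (i, μ) F) ζ := by
  set e : E D := EuclideanSpace.single μ 1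
  have hdir : HasDerivAt (fun s : ℝ => ζ + s • e) e 0 := by
    simpa using ((hasDerivAt_id (0 : ℝ)).smul_const e).const_add ζ
  have h1 : HasDerivAt (fun s : ℝ => heatInt κ k c F (ζ + s • e)) (dd μ (heatInt κ k c F) ζ) 0 := by
    have hd := ((contDiff_heatInt hκ k hc F).differentiable (by simp) (ζ + (0 : ℝ) • e)).hasFDerivAt
    have := hd.comp_hasDerivAt (0 : ℝ) hdir
    rw [zero_smul, add_zero] at this
    rw [dd_eq]
    exact this
  have hw : ∀ i, Continuous fun q : ℝ × (Fin n → ℝ) => wk (freeCov κ q.2)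
      (fun p => q.2 p.1 * (ζ + q.1 • e) p.2) k (pderiv (i, μ) F) := fun i =>
    (continuous_wk_heat hκ k (pderiv (i, μ) F)).comp
      (f := fun q : ℝ × (Fin n → ℝ) => (q.2, ζ + q.1 • e)) (by fun_prop)
  have h2 := hasDerivAt_setIntegral (μ := volume) (isCompact_cube (n := n)) isOpen_univ
    (ψ := fun s τ => c τ * wk (freeCov κ τ) (fun p => τ p.1 * (ζ + s • e) p.2) k F)
    (ψ' := fun s τ => ∑ i, c τ * τ i * wk (freeCov κ τ) (fun p => τ p.1 * (ζ + s • e) p.2) k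
      (pderiv (i, μ) F)) (x := 0)
    (fun s _ => (hc.mul (continuous_wk_heat_right hκ k F _)).continuousOn)
    (Continuous.continuousOn (by
      refine continuous_finsetSum _ fun i _ => Continuous.mul ?_ (hw i)
      fun_prop))
    (fun s _ τ _ => by
      refine ((hasDerivAt_wk_mean (freeCov κ τ) (b' := fun p => τ p.1 * e p.2)
        (fun p => ?_) k F).const_mul (c τ)).congr_deriv ?_
      · refine HasDerivAt.const_mul _ ?_
        simpa using ((hasDerivAt_id s).mul_const (e p.2)).const_add (ζ p.2)
      · rw [Fintype.sum_prod_type, mul_sum]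
        refine sum_congr rfl fun i _ => ?_
        rw [sum_eq_single μ]
        · simp [e, mul_assoc]
        · intro ν _ hν; simp [e, hν]
        · simp) (mem_univ 0)
  rw [h1.unique h2, integral_finsetSum]
  · simp only [zero_smul, add_zero]; rfl
  · intro i _
    refine integrable_cube _ (Continuous.mul (by fun_prop) ?_)
    exact (hw i).comp (f := fun τ => (0, τ)) (by fun_prop)

end HeatPolynomials

end

section

open MvPolynomial

section Transport

variable {D n : ℕ}

def freeD (s t : ℝ) : ℝ := s + t - |s - t| - 2 * s * t

lemma dirichlet_k_zero : dirichlet.k 0 = freeD := by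
  ext s t
  simp only [dirichlet, zero_div, gD_zero, freeD]

lemma continuous_freeD : 𝒞₂ freeD := by
  unfold freeD; fun_prop

lemma freeD_symm (s t : ℝ) : freeD s t = freeD t s := by
  rw [freeD, freeD, abs_sub_comm]; ring

lemma freeD_one {t : ℝ} (ht : t ≤ 1) : freeD 1 t = 0 := by
  rw [freeD, abs_of_nonneg (by linarith)]; ring

lemma hasDerivAt_freeD {s : ℝ} (hs : 0 < s) (t t' : ℝ) :
    HasDerivAt (fun s => freeD (s * t) (s * t')) (t + t' - |t - t'| - 4 * s * (t * t')) s := by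
  have h : (fun s => s * (t + t' - |t - t'|) - 2 * (t * t') * s ^ 2)
      =ᶠ[𝓝 s] fun s => freeD (s * t) (s * t') := by
    filter_upwards [lt_mem_nhds hs] with r hr
    rw [freeD, ← mul_sub, abs_mul, abs_of_pos hr]
    ring
  refine (HasDerivAt.congr_of_eventuallyEq ?_ h.symm)
  refine (((hasDerivAt_id s).mul_const _).sub ((hasDerivAt_pow 2 s).const_mul _)).congr_deriv ?_
  simp; ring

/-- The generators of the heat polynomials. -/
def heatPsi (P : ℳ (Fin D)) (n k : ℕ) : E D → ℝ :=
  heatInt (n := n) freeD k (fun _ => 1) (pt fun _ => P)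

lemma contDiff_heatPsi (P : ℳ (Fin D)) (n k : ℕ) : Smooth (heatPsi P n k) :=
  contDiff_heatInt continuous_freeD k continuous_const _

def radial (f : E D → ℝ) (ζ : E D) : ℝ := ∑ μ, ζ μ * dd μ f ζ

/-- The Laplace operator. -/
def lap (f : E D → ℝ) (ζ : E D) : ℝ := ∑ μ, dd μ (dd μ f) ζ

lemma radial_heatPsi (P : ℳ (Fin D)) (n k : ℕ) (ζ : E D) :
    radial (heatPsi P n k) ζ = ∫ τ in cube n, ∑ p : 𝕁 n, τ p.1 * ζ p.2 *
      wk (freeCov freeD τ) (fun p => τ p.1 * ζ p.2) k (pderiv p (pt fun _ => P)) := by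
  have hc : ∀ p : 𝕁 n, Continuous fun τ : Fin n → ℝ => τ p.1 * ζ p.2 *
      wk (freeCov freeD τ) (fun p => τ p.1 * ζ p.2) k (pderiv p (pt fun _ => P)) := fun p =>
    Continuous.mul (by fun_prop) (continuous_wk_heat_right continuous_freeD k _ ζ)
  rw [integral_finsetSum _ fun p _ => integrable_cube _ (hc p), Fintype.sum_prod_type_right, radial]
  refine sum_congr rfl fun μ _ => ?_
  rw [heatPsi, dd_heatInt continuous_freeD k continuous_const, mul_sum]
  refine sum_congr rfl fun i _ => ?_
  rw [heatInt, ← integral_const_mul]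
  congr 1; ext τ; ring

lemma lap_heatPsi (P : ℳ (Fin D)) (n k : ℕ) (ζ : E D) :
    lap (heatPsi P n k) ζ = ∫ τ in cube n, ∑ p : 𝕁 n, ∑ q : 𝕁 n,
      (if p.2 = q.2 then τ p.1 * τ q.1 else 0) *
      wk (freeCov freeD τ) (fun p => τ p.1 * ζ p.2) k (pderiv p (pderiv q (pt fun _ => P))) := by
  have hc : ∀ p q : 𝕁 n, Continuous fun τ : Fin n → ℝ =>
      (if p.2 = q.2 then τ p.1 * τ q.1 else 0) *
      wk (freeCov freeD τ) (fun p => τ p.1 * ζ p.2) k (pderiv p (pderiv q (pt fun _ => P))) := by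
    intro p q
    refine Continuous.mul ?_ (continuous_wk_heat_right continuous_freeD k _ ζ)
    split_ifs <;> fun_prop
  rw [integral_finsetSum _ fun p _ => integrable_cube _ (continuous_finsetSum _ fun q _ => hc p q)]
  simp only [integral_finsetSum _ fun q _ => integrable_cube _ (hc _ q)]
  rw [Fintype.sum_prod_type_right, lap]
  refine sum_congr rfl fun μ _ => ?_
  have h1 : dd μ (heatPsi P n k) = fun ζ => ∑ i, heatInt freeD k (fun τ => 1 * τ i)
      (pderiv (i, μ) (pt fun _ => P)) ζ :=
    funext (dd_heatInt continuous_freeD k continuous_const _ μ)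
  rw [h1, dd_sum fun i _ => contDiff_heatInt continuous_freeD k (by fun_prop) _]
  have h2 : ∀ (i : Fin n) F, dd μ (heatInt freeD k (fun τ => 1 * τ i) F) ζ = _ := fun i F =>
    dd_heatInt continuous_freeD k (c := fun τ => 1 * τ i) (by fun_prop) F μ ζ
  simp only [h2]
  rw [sum_comm]
  refine sum_congr rfl fun i _ => ?_
  rw [Fintype.sum_prod_type]
  refine sum_congr rfl fun j _ => ?_
  rw [sum_eq_single μ]
  · rw [heatInt]
    grind
  · intro ν _ hν
    simp [Ne.symm hν]
  · simp

/-- The integrand of the heat polynomials. -/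
lemma heatPsi_face (P : ℳ (Fin D)) (k : ℕ) (ζ : E D) (i : Fin (n + 1)) :
    ∫ τ in cube n, wk (freeCov freeD (i.insertNth (α := fun _ => ℝ) 1 τ))
        (fun p => i.insertNth (α := fun _ => ℝ) 1 τ p.1 * ζ p.2) k (pt fun _ => P)
      = eval (fun ν => ζ ν) P * heatPsi P n k ζ := by
  rw [heatPsi, heatInt, ← integral_const_mul]
  refine setIntegral_congr_fun measurableSet_cube fun τ hτ => ?_
  rw [mem_cube] at hτ
  simp only
  rw [pt_succAbove i, wk_vtx_mul (freeCov_symm freeD_symm _) (fun ν β => ?_),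
    wk_rename (skip_injective i)]
  · simp only [Fin.insertNth_apply_same, one_mul]
    have e1 : (fun p q : 𝕁 n => freeCov freeD (i.insertNth (α := fun _ => ℝ) 1 τ)
        (skip i p) (skip i q)) = freeCov freeD τ := by
      ext p q; simp [freeCov, skip]
    have e2 : (fun p : 𝕁 (n + 1) => i.insertNth (α := fun _ => ℝ) 1 τ p.1 * ζ p.2) ∘ skip i
        = fun p : 𝕁 n => τ p.1 * ζ p.2 := by
      ext p; simp [skip]
    rw [e1, e2]
  · simp only [freeCov, Fin.insertNth_apply_same]
    split_ifs
    · refine freeD_one ?_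
      refine Fin.succAboveCases i ?_ (fun j => ?_) β.1
      · simp
      simp_all
    · rfl

lemma radial_heatPsi_zero (P : ℳ (Fin D)) (n : ℕ) (ζ : E D) :
    ((n : ℝ) + 1) * heatPsi P (n + 1) 0 ζ + radial (heatPsi P (n + 1) 0) ζ
      = ((n : ℝ) + 1) * (eval (fun ν => ζ ν) P * heatPsi P n 0 ζ) := by
  have h := integral_cube_euler (n := n)
    (φ := fun τ => wk (freeCov freeD τ) (fun p => τ p.1 * ζ p.2) 0 (pt fun _ => P))
    (φ' := fun s τ => ∑ p : 𝕁 (n + 1), τ p.1 * ζ p.2 *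
      wk (freeCov freeD (s • τ)) (fun p => (s • τ) p.1 * ζ p.2) 0 (pderiv p (pt fun _ => P)))
    (continuous_wk_heat_right continuous_freeD 0 _ ζ)
    (continuous_finsetSum _ fun p _ => Continuous.mul (by fun_prop)
      ((continuous_wk_heat_right continuous_freeD 0 _ ζ).comp
        (f := fun q : ℝ × (Fin (n + 1) → ℝ) => q.1 • q.2) (by fun_prop)))
    (fun s hs τ => by
      simp only [wk_zero]
      refine hasDerivAt_eval (fun p => ?_) _
      simpa [mul_assoc] using (hasDerivAt_id s).mul_const (τ p.1 * ζ p.2))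
  simp only [heatPsi_face, one_smul, sum_const, Finset.card_univ, Fintype.card_fin,
    nsmul_eq_mul] at h
  rw [radial_heatPsi]
  push_cast at h
  rw [← h]
  simp only [heatPsi, heatInt, one_mul]

lemma radial_heatPsi_succ (P : ℳ (Fin D)) (n k : ℕ) (ζ : E D) :
    ((n : ℝ) + 1 + (k + 1)) * heatPsi P (n + 1) (k + 1) ζ + radial (heatPsi P (n + 1) (k + 1)) ζ
      = lap (heatPsi P (n + 1) k) ζ
        + ((n : ℝ) + 1) * (eval (fun ν => ζ ν) P * heatPsi P n (k + 1) ζ) := by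
  have c1 : ∀ (k : ℕ) (F : ℳ (𝕁 (n + 1))),
      Continuous fun q : ℝ × (Fin (n + 1) → ℝ) =>
      wk (freeCov freeD (q.1 • q.2)) (fun p => (q.1 • q.2) p.1 * ζ p.2) k F := fun k F =>
    (continuous_wk_heat_right continuous_freeD k _ ζ).comp
        (f := fun q : ℝ × (Fin (n + 1) → ℝ) => q.1 • q.2) (by fun_prop)
  have h := integral_cube_euler (n := n)
    (φ := fun τ => wk (freeCov freeD τ) (fun p => τ p.1 * ζ p.2) (k + 1) (pt fun _ => P))
    (φ' := fun s τ => 1 / 2 * (∑ p : 𝕁 (n + 1), ∑ q : 𝕁 (n + 1),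
        (if p.2 = q.2 then τ p.1 + τ q.1 - |τ p.1 - τ q.1| - 4 * s * (τ p.1 * τ q.1) else 0) *
          wk (freeCov freeD (s • τ)) (fun p => (s • τ) p.1 * ζ p.2) k
            (pderiv p (pderiv q (pt fun _ => P))))
      + ∑ p : 𝕁 (n + 1), τ p.1 * ζ p.2 *
      wk (freeCov freeD (s • τ)) (fun p => (s • τ) p.1 * ζ p.2) (k + 1) (pderiv p (pt fun _ => P)))
    (continuous_wk_heat_right continuous_freeD (k + 1) _ ζ)
    (by
      refine Continuous.add (continuous_const.mul (continuous_finsetSum _ fun p _ =>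
        continuous_finsetSum _ fun q _ => Continuous.mul ?_ (c1 _ _)))
        (continuous_finsetSum _ fun p _ => Continuous.mul (by fun_prop) (c1 _ _))
      split_ifs <;> fun_prop)
    (fun s hs τ => by
      rw [← map_contr]
      refine hasDerivAt_wk (fun p q => ?_) (fun p => ?_) k _
      · simp only [freeCov, Pi.smul_apply, smul_eq_mul]
        split_ifs
        · exact hasDerivAt_freeD hs _ _
        · exact hasDerivAt_const _ _
      · simpa [mul_assoc] using (hasDerivAt_id s).mul_const (τ p.1 * ζ p.2))
  have e : ∀ τ : Fin (n + 1) → ℝ, 1 / 2 * (∑ p : 𝕁 (n + 1), ∑ q : 𝕁 (n + 1),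
        (if p.2 = q.2 then τ p.1 + τ q.1 - |τ p.1 - τ q.1| - 4 * 1 * (τ p.1 * τ q.1) else 0) *
          wk (freeCov freeD τ) (fun p => τ p.1 * ζ p.2) k
            (pderiv p (pderiv q (pt fun _ => P))))
      = ((k : ℝ) + 1) * wk (freeCov freeD τ) (fun p => τ p.1 * ζ p.2) (k + 1) (pt fun _ => P)
        - ∑ p : 𝕁 (n + 1), ∑ q : 𝕁 (n + 1),
          (if p.2 = q.2 then τ p.1 * τ q.1 else 0) *
          wk (freeCov freeD τ) (fun p => τ p.1 * ζ p.2) k (pderiv p (pderiv q (pt fun _ => P))) := by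
    intro τ
    rw [← wk_contr, map_contr, mul_sum, mul_sum, ← sum_sub_distrib]
    refine sum_congr rfl fun p _ => ?_
    rw [mul_sum, mul_sum, ← sum_sub_distrib]
    refine sum_congr rfl fun q _ => ?_
    simp only [freeCov]
    split_ifs
    · rw [freeD]; ring
    · ring
  simp only [heatPsi_face, one_smul, sum_const, Finset.card_univ, Fintype.card_fin,
    nsmul_eq_mul, e] at h
  rw [radial_heatPsi, lap_heatPsi]
  push_cast at h
  have c2 : ∀ (k : ℕ) (F : ℳ (𝕁 (n + 1))),
      Continuous fun τ : Fin (n + 1) → ℝ =>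
      wk (freeCov freeD τ) (fun p => τ p.1 * ζ p.2) k F := fun k F =>
    continuous_wk_heat_right continuous_freeD k _ ζ
  have c3 : ∀ p q : 𝕁 (n + 1), Continuous fun τ : Fin (n + 1) → ℝ =>
      (if p.2 = q.2 then τ p.1 * τ q.1 else 0 : ℝ) := by
    intro p q; split_ifs <;> fun_prop
  rw [integral_add, integral_sub, integral_const_mul] at h
  · rw [← h]
    simp only [heatPsi, heatInt, one_mul]
    ring
  · exact integrable_cube _ (continuous_const.mul (c2 _ _))
  · exact integrable_cube _ (continuous_finsetSum _ fun p _ => continuous_finsetSum _ fun q _ =>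
      (c3 p q).mul (c2 _ _))
  · refine integrable_cube _ (Continuous.sub (continuous_const.mul (c2 _ _)) ?_)
    fun_prop
  · refine integrable_cube _ (continuous_finsetSum _ fun p _ => Continuous.mul ?_ (c2 _ _))
    fun_prop

lemma heatPsi_none (P : ℳ (Fin D)) (k : ℕ) :
    heatPsi P 0 k = fun _ => if k = 0 then 1 else 0 := by
  ext ζ
  cases k with
  | zero => simp [heatPsi, heatInt, wk_zero, pt, cube, Measure.real, Real.volume_Icc_pi]
  | succ k => simp [heatPsi, heatInt, wk_succ']

lemma radial_const (c : ℝ) (ζ : E D) : radial (fun _ : E D => c) ζ = 0 := by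
  simp [radial, dd_eq]

lemma lap_const (c : ℝ) (ζ : E D) : lap (fun _ : E D => c) ζ = 0 := by
  have : ∀ μ, dd μ (fun _ : E D => c) = fun _ => 0 := by intro μ; ext; simp [dd_eq]
  simp [lap, this, dd_eq]

lemma radial_sum {ι : Type*} {s : Finset ι} {c : ι → ℝ} {f : ι → E D → ℝ}
    (hf : ∀ i, Smooth (f i)) (ζ : E D) :
    radial (fun ζ => ∑ i ∈ s, c i * f i ζ) ζ = ∑ i ∈ s, c i * radial (f i) ζ := by
  simp only [radial]
  simp only [dd_sum fun i _ => contDiff_const.mul (hf i), dd_const_mul (hf _), mul_sum]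
  rw [sum_comm]
  grind

lemma lap_sum {ι : Type*} {s : Finset ι} {c : ι → ℝ} {f : ι → E D → ℝ}
    (hf : ∀ i, Smooth (f i)) (ζ : E D) :
    lap (fun ζ => ∑ i ∈ s, c i * f i ζ) ζ = ∑ i ∈ s, c i * lap (f i) ζ := by
  have h : ∀ μ, dd μ (fun ζ => ∑ i ∈ s, c i * f i ζ) = fun ζ => ∑ i ∈ s, c i * dd μ (f i) ζ := by
    intro μ; ext ζ
    simp only [dd_sum fun i _ => contDiff_const.mul (hf i), dd_const_mul (hf _)]
  simp only [lap, h]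
  simp only [dd_sum fun i _ => contDiff_const.mul (contDiff_dd (hf i) _),
    dd_const_mul (contDiff_dd (hf _) _), mul_sum]
  rw [sum_comm]

/-- The Hadamard coefficients for the potential `P`. -/
def hadamard (P : ℳ (Fin D)) (m : ℕ) (ζ : E D) : ℝ :=
  ∑ p ∈ antidiagonal m,
    (-1) ^ p.1 / (p.1.factorial : ℝ) * heatPsi P p.1 p.2 ζ

lemma contDiff_hadamard (P : ℳ (Fin D)) (m : ℕ) : Smooth (hadamard P m) :=
  ContDiff.sum fun _ _ => contDiff_const.mul (contDiff_heatPsi P _ _)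

lemma hadamard_zero (P : ℳ (Fin D)) (ζ : E D) : hadamard P 0 ζ = 1 := by
  simp [hadamard, heatPsi_none]

/-- The transport equations. -/
lemma hadamard_succ (P : ℳ (Fin D)) (m : ℕ) (ζ : E D) :
    ((m : ℝ) + 1) * hadamard P (m + 1) ζ + radial (hadamard P (m + 1)) ζ
      = lap (hadamard P m) ζ - eval (fun ν => ζ ν) P * hadamard P m ζ := by
  set A : ℕ × ℕ → ℝ := fun p => p.2.casesOn 0 fun k => lap (heatPsi P p.1 k) ζ with hA
  set B : ℕ × ℕ → ℝ := fun p => p.1.casesOn 0 fun n =>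
    ((n : ℝ) + 1) * (eval (fun ν => ζ ν) P * heatPsi P n p.2 ζ) with hB
  have key : ∀ p : ℕ × ℕ, ((p.1 : ℝ) + p.2) * heatPsi P p.1 p.2 ζ + radial (heatPsi P p.1 p.2) ζ
      = A p + B p := by
    rintro ⟨n, k⟩
    cases n with
    | zero =>
      cases k with
      | zero => simp [hA, hB, heatPsi_none, radial_const]
      | succ k => simp [hA, hB, heatPsi_none, radial_const, lap_const]
    | succ n =>
      cases k with
      | zero => simpa [hA, hB] using radial_heatPsi_zero P n ζ
      | succ k => simpa [hA, hB] using radial_heatPsi_succ P n k ζ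
  have h1 : ((m : ℝ) + 1) * hadamard P (m + 1) ζ + radial (hadamard P (m + 1)) ζ
      = ∑ p ∈ antidiagonal (m + 1),
        (-1) ^ p.1 / (p.1.factorial : ℝ) * (A p + B p) := by
    have : hadamard P (m + 1) = fun ζ => ∑ p ∈ antidiagonal (m + 1),
      (-1) ^ p.1 / (p.1.factorial : ℝ) * heatPsi P p.1 p.2 ζ := rfl
    rw [this, radial_sum fun p => contDiff_heatPsi P _ _, mul_sum, ← sum_add_distrib]
    refine sum_congr rfl fun p hp => ?_
    rw [← key p]
    have hp' : (p.1 : ℝ) + p.2 = m + 1 := by exact_mod_cast Finset.HasAntidiagonal.mem_antidiagonal.1 hp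
    rw [hp']
    ring
  rw [h1]
  simp only [mul_add, sum_add_distrib]
  rw [Finset.Nat.sum_antidiagonal_succ', Finset.Nat.sum_antidiagonal_succ]
  have hl : lap (hadamard P m) ζ = ∑ p ∈ antidiagonal m,
      (-1) ^ p.1 / (p.1.factorial : ℝ) * lap (heatPsi P p.1 p.2) ζ :=
    lap_sum (fun p => contDiff_heatPsi P _ _) ζ
  rw [hl, hadamard, mul_sum]
  have a0 : ∀ n, A (n, 0) = 0 := fun _ => rfl
  have a1 : ∀ n k, A (n, k + 1) = lap (heatPsi P n k) ζ := fun _ _ => rfl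
  have b0 : ∀ k, B (0, k) = 0 := fun _ => rfl
  have b1 : ∀ n k, B (n + 1, k) = ((n : ℝ) + 1) * (eval (fun ν => ζ ν) P * heatPsi P n k ζ) :=
    fun _ _ => rfl
  simp only [a0, a1, b0, b1, mul_zero, zero_add]
  rw [sub_eq_add_neg, ← Finset.sum_neg_distrib]
  congr 1
  refine sum_congr rfl fun p _ => ?_
  rw [Nat.factorial_succ, pow_succ]
  push_cast
  have : (p.1 : ℝ) + 1 ≠ 0 := by positivity
  field_simp

lemma hadamard_at_zero {v : Jet D} (hv : v.Sym) {M m : ℕ} (hM : 2 * m ≤ M) :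
    hadamard (taylorP v M) m 0 = heatCoef freeD m v := by
  refine sum_congr rfl fun p hp => ?_
  congr 1
  rw [heatPsi, heatInt]
  congr 1; ext τ
  have h2 : p.2 ≤ m := by have := Finset.HasAntidiagonal.mem_antidiagonal.1 hp; omega
  rw [one_mul, show (fun q : Fin p.1 × Fin D => τ q.1 * (0 : E D) q.2) = 0 by ext; simp,
    wk_taylorP _ _ (fun _ => v) (fun _ => hv) (fun _ => M) (fun _ => by omega)]

end Transport

end

section

/-! ### Duality with a parametrix -/

variable {D : ℕ}

/-- A solution of `∂_T k = Δk - U k` with `k T → δ₀` as `T → 0+`. -/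
structure IsFundamental (U : E D → ℝ) (k : ℝ → E D → ℝ) : Prop where
  contDiffOn : ContDiffOn ℝ 2 (fun q : ℝ × E D => k q.1 q.2) (Ioi 0 ×ˢ univ)
  heat_eq : ∀ T > 0, ∀ ζ, HasDerivAt (fun s => k s ζ) (lap (k T) ζ - U ζ * k T ζ) T
  initial : ∀ φ : E D → ℝ, Continuous φ → HasCompactSupport φ →
    Tendsto (fun T => ∫ ζ, k T ζ * φ ζ) (𝓝[>] 0) (𝓝 (φ 0))

lemma dd_eq_fderiv (ν : Fin D) (f : E D → ℝ) :
    dd ν f = fun x => fderiv ℝ f x (EuclideanSpace.single ν 1) := funext (dd_eq ν f)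

lemma contDiff_dd_of {m n : WithTop ℕ∞} {f : E D → ℝ} (hf : ContDiff ℝ n f) (h : m + 1 ≤ n)
    (ν : Fin D) : ContDiff ℝ m (dd ν f) := by
  rw [dd_eq_fderiv]
  fun_prop

lemma hasCompactSupport_dd {f : E D → ℝ} (hf : HasCompactSupport f) (ν : Fin D) :
    HasCompactSupport (dd ν f) := by
  rw [dd_eq_fderiv]
  exact hf.fderiv_apply ℝ _

lemma integral_mul_dd {f g : E D → ℝ} (hf : ContDiff ℝ 1 f) (hg : ContDiff ℝ 1 g)
    (hc : HasCompactSupport g) (ν : Fin D) :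
    ∫ ζ, f ζ * dd ν g ζ = -∫ ζ, dd ν f ζ * g ζ := by
  have h1 := (contDiff_dd_of (m := 0) hf (by simp) ν).continuous
  have h2 := (contDiff_dd_of (m := 0) hg (by simp) ν).continuous
  have hc' := hasCompactSupport_dd hc ν
  rw [dd_eq_fderiv] at h1 h2 hc' ⊢
  rw [dd_eq_fderiv]
  exact integral_mul_fderiv_eq_neg_fderiv_mul_of_integrable
    ((h1.mul hg.continuous).integrable_of_hasCompactSupport hc.mul_left)
    ((hf.continuous.mul h2).integrable_of_hasCompactSupport hc'.mul_left)
    ((hf.continuous.mul hg.continuous).integrable_of_hasCompactSupport hc.mul_left)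
    (fun x _ => hf.differentiable (by simp) x) (fun x _ => hg.differentiable (by simp) x)

lemma continuous_lap {f : E D → ℝ} (hf : ContDiff ℝ 2 f) : Continuous (lap f) :=
  continuous_finsetSum _ fun ν _ =>
    (contDiff_dd_of (m := 0) (contDiff_dd_of (m := 1) hf (by norm_num) ν) (by simp) ν).continuous

lemma hasCompactSupport_lap {f : E D → ℝ} (hf : HasCompactSupport f) :
    HasCompactSupport (lap f) := by
  have : lap f = ∑ ν, dd ν (dd ν f) := by ext; simp [lap]
  rw [this]
  refine Finset.sum_induction _ HasCompactSupport (fun _ _ => HasCompactSupport.add)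
    (by exact HasCompactSupport.zero) fun ν _ => hasCompactSupport_dd (hasCompactSupport_dd hf ν) ν

lemma integral_lap_mul {f g : E D → ℝ} (hf : ContDiff ℝ 2 f) (hg : ContDiff ℝ 2 g)
    (hc : HasCompactSupport g) : ∫ ζ, lap f ζ * g ζ = ∫ ζ, f ζ * lap g ζ := by
  have hf1 : ∀ ν, ContDiff ℝ 1 (dd ν f) := contDiff_dd_of hf (by norm_num)
  have hg1 : ∀ ν, ContDiff ℝ 1 (dd ν g) := contDiff_dd_of hg (by norm_num)
  have hf2 : ∀ ν, Continuous (dd ν (dd ν f)) := fun ν =>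
    (contDiff_dd_of (m := 0) (hf1 ν) (by simp) ν).continuous
  have hg2 : ∀ ν, Continuous (dd ν (dd ν g)) := fun ν =>
    (contDiff_dd_of (m := 0) (hg1 ν) (by simp) ν).continuous
  simp only [lap, sum_mul, mul_sum]
  rw [integral_finsetSum, integral_finsetSum]
  · refine sum_congr rfl fun ν _ => ?_
    rw [integral_mul_dd (hf.of_le (by norm_num)) (hg1 ν) (hasCompactSupport_dd hc ν),
      integral_mul_dd (hf1 ν) (hg.of_le (by norm_num)) hc, neg_neg]
  · exact fun ν _ => (hf.continuous.mul (hg2 ν)).integrable_of_hasCompactSupport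
      (hasCompactSupport_dd (hasCompactSupport_dd hc ν) ν).mul_left
  · exact fun ν _ => ((hf2 ν).mul hg.continuous).integrable_of_hasCompactSupport hc.mul_left

lemma hasCompactSupport_of_ball {f : E D → ℝ} {R : ℝ} (hf : ∀ ζ, R < ‖ζ‖ → f ζ = 0) :
    HasCompactSupport f :=
  HasCompactSupport.intro (isCompact_closedBall (0 : E D) R) fun ζ hζ => hf ζ (by simpa using hζ)

lemma integral_eq_ball {f : E D → ℝ} {R : ℝ} (hf : ∀ ζ, R < ‖ζ‖ → f ζ = 0) :
    ∫ ζ, f ζ = ∫ ζ in Metric.closedBall (0 : E D) R, f ζ :=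
  (setIntegral_eq_integral_of_forall_compl_eq_zero fun ζ hζ => hf ζ (by simpa using hζ)).symm

namespace IsFundamental

variable {U : E D → ℝ} {k : ℝ → E D → ℝ} (hk : IsFundamental U k)
include hk

lemma continuousOn : ContinuousOn (fun q : ℝ × E D => k q.1 q.2) (Ioi 0 ×ˢ univ) :=
  hk.contDiffOn.continuousOn

lemma contDiff_slice {T : ℝ} (hT : 0 < T) : ContDiff ℝ 2 (k T) :=
  contDiffOn_univ.1 (hk.contDiffOn.comp (f := fun ζ : E D => (T, ζ))
    (contDiff_const.prodMk contDiff_id).contDiffOn fun _ _ => ⟨hT, mem_univ _⟩)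

lemma continuousOn_deriv :
    ContinuousOn (fun q : ℝ × E D => lap (k q.1) q.2 - U q.2 * k q.1 q.2) (Ioi 0 ×ˢ univ) := by
  have ho : IsOpen (Ioi (0 : ℝ) ×ˢ (univ : Set (E D))) := isOpen_Ioi.prod isOpen_univ
  have h := hk.contDiffOn.continuousOn_fderiv_of_isOpen ho (by norm_num)
  refine (h.clm_apply (continuousOn_const (c := ((1 : ℝ), (0 : E D))))).congr fun q hq => ?_
  have hd := ((hk.contDiffOn.contDiffAt (ho.mem_nhds hq)).differentiableAt (by norm_num)).hasFDerivAt
  have h2 : HasDerivAt (fun s : ℝ => (s, q.2)) ((1 : ℝ), (0 : E D)) q.1 :=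
    (hasDerivAt_id q.1).prodMk (hasDerivAt_const q.1 q.2)
  have h3 : HasDerivAt (fun s => k s q.2) _ q.1 :=
    HasFDerivAt.comp_hasDerivAt (f := fun s : ℝ => (s, q.2)) q.1 hd h2
  exact (hk.heat_eq q.1 hq.1 q.2).unique h3

lemma continuousOn_pairing {θ : E D → ℝ} (hθ : Continuous θ) {R : ℝ}
    (hR : ∀ ζ, R < ‖ζ‖ → θ ζ = 0) : ContinuousOn (fun s => ∫ ζ, k s ζ * θ ζ) (Ioi 0) := by
  have : (fun s => ∫ ζ, k s ζ * θ ζ) = fun s => ∫ ζ in Metric.closedBall (0 : E D) R, k s ζ * θ ζ :=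
    funext fun s => integral_eq_ball fun ζ hζ => by simp_all
  rw [this]
  refine continuousOn_setIntegral (isCompact_closedBall _ _) (ContinuousOn.mul ?_ ?_)
  · exact hk.continuousOn.mono (prod_mono subset_rfl (subset_univ _))
  fun_prop

lemma exists_pairing_bound {θ : E D → ℝ} (hθ : Continuous θ) {R : ℝ}
    (hR : ∀ ζ, R < ‖ζ‖ → θ ζ = 0) : ∃ C, ∀ s ∈ Ioc (0 : ℝ) 1, |∫ ζ, k s ζ * θ ζ| ≤ C := by
  have h0 := (hk.initial θ hθ (hasCompactSupport_of_ball hR)).abs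
  have h1 : ∀ᶠ s in 𝓝[>] (0 : ℝ), |∫ ζ, k s ζ * θ ζ| < |θ 0| + 1 := h0.eventually_lt_const (by linarith)
  obtain ⟨δ, hδ, hδ'⟩ := mem_nhdsGT_iff_exists_Ioo_subset.1 h1
  have h2 : ContinuousOn (fun s => |∫ ζ, k s ζ * θ ζ|) (Icc (δ / 2) 1) :=
    ((hk.continuousOn_pairing hθ hR).mono fun s hs => lt_of_lt_of_le (half_pos hδ) hs.1).abs
  obtain ⟨C, hC⟩ := isCompact_Icc.bddAbove_image h2
  refine ⟨max (|θ 0| + 1) C, fun s hs => ?_⟩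
  rcases lt_or_ge s δ with h | h
  · exact (hδ' (show s ∈ Ioo 0 δ from ⟨hs.1, h⟩)).le.trans (le_max_left _ _)
  · refine (hC ⟨s, ⟨?_, hs.2⟩, rfl⟩).trans (le_max_right _ _)
    grind

/-- By the Banach-Steinhaus theorem the kernel is bounded in the dual of the continuous functions
on the unit ball. -/
lemma exists_uniform_bound : ∃ C, 0 ≤ C ∧ ∀ s ∈ Ioc (0 : ℝ) 1, ∀ h : E D → ℝ, Continuous h →
    (∀ ζ, 1 < ‖ζ‖ → h ζ = 0) → ∀ M, (∀ ζ, |h ζ| ≤ M) → |∫ ζ, k s ζ * h ζ| ≤ C * M := by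
  obtain ⟨χ, hχ, hχ1, hχ0⟩ : ∃ χ : E D → ℝ, Continuous χ ∧ (∀ ζ, ‖ζ‖ ≤ 1 → χ ζ = 1) ∧
      ∀ ζ, 2 < ‖ζ‖ → χ ζ = 0 := by
    refine ⟨fun ζ => max 0 (min 1 (2 - ‖ζ‖)), by fun_prop, fun ζ h => ?_, fun ζ h => ?_⟩
    · grind
    grind
  have hks : ∀ s : Ioc (0 : ℝ) 1, Continuous (k s) := fun s => (hk.contDiff_slice s.2.1).continuous
  have hcs : HasCompactSupport χ := hasCompactSupport_of_ball hχ0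
  have hint : ∀ (s : Ioc (0 : ℝ) 1) (f : BoundedContinuousFunction (E D) ℝ),
      Integrable fun ζ => k s ζ * (χ ζ * f ζ) := fun s f =>
    ((hks s).mul (hχ.mul f.continuous)).integrable_of_hasCompactSupport
      (HasCompactSupport.mul_left hcs.mul_right)
  let L : Ioc (0 : ℝ) 1 → BoundedContinuousFunction (E D) ℝ →L[ℝ] ℝ := fun s =>
    LinearMap.mkContinuous
      { toFun := fun f => ∫ ζ, k s ζ * (χ ζ * f ζ)
        map_add' := fun f g => by
          rw [← integral_add (hint s f) (hint s g)]
          congr 1; ext ζ; simp; ring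
        map_smul' := fun c f => by
          rw [RingHom.id_apply, smul_eq_mul, ← integral_const_mul]
          congr 1; ext ζ; simp; ring }
      (∫ ζ, |k s ζ * χ ζ|) fun f => by
        have h1 : Integrable fun ζ => |k s ζ * χ ζ| * ‖f‖ :=
          ((((hks s).mul hχ).integrable_of_hasCompactSupport hcs.mul_left).abs).mul_const _
        rw [← integral_mul_const]
        refine norm_integral_le_of_norm_le h1 (Eventually.of_forall fun ζ => ?_)
        rw [← mul_assoc, norm_mul]
        exact mul_le_mul_of_nonneg_left (f.norm_coe_le_norm ζ) (norm_nonneg _)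
  have hL : ∀ s f, L s f = ∫ ζ, k s ζ * (χ ζ * f ζ) := fun s f => rfl
  obtain ⟨C, hC⟩ := banach_steinhaus (g := L) fun f => by
    obtain ⟨C, hC⟩ := hk.exists_pairing_bound (hχ.mul f.continuous) (R := 2) fun ζ hζ => by
      rw [Pi.mul_apply, hχ0 ζ hζ, zero_mul]
    exact ⟨C, fun s => by rw [hL]; exact hC s s.2⟩
  refine ⟨max C 0, le_max_right _ _, fun s hs h hh hh0 M hM => ?_⟩
  have hM0 : 0 ≤ M := (abs_nonneg _).trans (hM 0)
  let f : BoundedContinuousFunction (E D) ℝ := BoundedContinuousFunction.ofNormedAddCommGroup h hh M hM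
  have h1 : ∫ ζ, k s ζ * h ζ = L ⟨s, hs⟩ f := by
    rw [hL]
    congr 1; ext ζ
    change k s ζ * h ζ = k s ζ * (χ ζ * h ζ)
    rcases le_or_gt ‖ζ‖ 1 with hz | hz
    · rw [hχ1 ζ hz, one_mul]
    · rw [hh0 ζ hz, mul_zero, mul_zero, mul_zero]
  rw [h1]
  calc |L ⟨s, hs⟩ f| ≤ ‖L ⟨s, hs⟩‖ * ‖f‖ := (L ⟨s, hs⟩).le_opNorm f
    _ ≤ max C 0 * M := mul_le_mul ((hC _).trans (le_max_left _ _))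
        (BoundedContinuousFunction.norm_ofNormedAddCommGroup_le _ hM0 _) (norm_nonneg _)
        (le_max_right _ _)

end IsFundamental

/-- A family of test functions supported in the unit ball, differentiable in the parameter. -/
structure IsTestFamily (B B' : ℝ → E D → ℝ) : Prop where
  contDiff : ∀ τ > 0, Smooth (B τ)
  support : ∀ τ ζ, 1 < ‖ζ‖ → B τ ζ = 0
  support' : ∀ τ ζ, 1 < ‖ζ‖ → B' τ ζ = 0
  cont : ContinuousOn (fun q : ℝ × E D => B q.1 q.2) (Ioi 0 ×ˢ univ)
  cont' : ContinuousOn (fun q : ℝ × E D => B' q.1 q.2) (Ioi 0 ×ˢ univ)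
  deriv : ∀ τ > 0, ∀ ζ, HasDerivAt (fun τ => B τ ζ) (B' τ ζ) τ

namespace IsFundamental

variable {U : E D → ℝ} {k : ℝ → E D → ℝ} (hk : IsFundamental U k) {B B' : ℝ → E D → ℝ}
  (hB : IsTestFamily B B')
include hk hB

lemma hasDerivAt_pairing (hU : Continuous U) {T s : ℝ} (hs : s ∈ Ioo 0 T) :
    HasDerivAt (fun s => ∫ ζ, k s ζ * B (T - s) ζ)
      (-∫ ζ, k s ζ * (B' (T - s) ζ - lap (B (T - s)) ζ + U ζ * B (T - s) ζ)) s := by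
  have hTs : 0 < T - s := sub_pos.2 hs.2
  have e : (fun s => ∫ ζ, k s ζ * B (T - s) ζ)
      = fun s => ∫ ζ in Metric.closedBall (0 : E D) 1, k s ζ * B (T - s) ζ :=
    funext fun s => integral_eq_ball fun ζ hζ => by rw [hB.support _ ζ hζ, mul_zero]
  have m1 : MapsTo (fun q : ℝ × E D => (q.1, q.2)) (Ioo 0 T ×ˢ Metric.closedBall 0 1)
      (Ioi 0 ×ˢ univ) := fun q hq => ⟨hq.1.1, mem_univ _⟩
  have m2 : MapsTo (fun q : ℝ × E D => (T - q.1, q.2)) (Ioo 0 T ×ˢ Metric.closedBall 0 1)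
      (Ioi 0 ×ˢ univ) := fun q hq => ⟨sub_pos.2 hq.1.2, mem_univ _⟩
  have h := hasDerivAt_setIntegral (μ := volume) (isCompact_closedBall (0 : E D) 1)
    (isOpen_Ioo (a := 0) (b := T)) (ψ := fun s ζ => k s ζ * B (T - s) ζ)
    (ψ' := fun s ζ => (lap (k s) ζ - U ζ * k s ζ) * B (T - s) ζ - k s ζ * B' (T - s) ζ)
    (fun s hs => ((hk.contDiff_slice hs.1).continuous.mul
      (hB.contDiff _ (sub_pos.2 hs.2)).continuous).continuousOn)
    (by
      have c1 := hk.continuousOn_deriv.comp (f := fun q : ℝ × E D => (q.1, q.2)) (by fun_prop) m1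
      have c2 := hk.continuousOn.comp (f := fun q : ℝ × E D => (q.1, q.2)) (by fun_prop) m1
      have c3 := hB.cont.comp (f := fun q : ℝ × E D => (T - q.1, q.2)) (by fun_prop) m2
      have c4 := hB.cont'.comp (f := fun q : ℝ × E D => (T - q.1, q.2)) (by fun_prop) m2
      exact (c1.mul c3).sub (c2.mul c4))
    (fun s hs ζ _ => by
      refine ((hk.heat_eq s hs.1 ζ).mul
        ((hB.deriv (T - s) (sub_pos.2 hs.2) ζ).comp_const_sub T s)).congr_deriv ?_
      ring) hs
  rw [e]
  refine h.congr_deriv ?_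
  have hkc := hk.contDiff_slice hs.1
  have hBc := hB.contDiff _ hTs
  have hBs : HasCompactSupport (B (T - s)) := hasCompactSupport_of_ball (hB.support _)
  have hBs' : HasCompactSupport (B' (T - s)) := hasCompactSupport_of_ball (hB.support' _)
  have hB'c : Continuous (B' (T - s)) := continuousOn_univ.1
    (hB.cont'.comp (f := fun ζ : E D => (T - s, ζ)) (by fun_prop) fun ζ _ => ⟨hTs, mem_univ _⟩)
  rw [← integral_eq_ball (R := 1) fun ζ hζ => by rw [hB.support _ ζ hζ, hB.support' _ ζ hζ]; ring,
    ← integral_neg]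
  have hBc2 : ContDiff ℝ 2 (B (T - s)) := contDiff_infty.1 hBc 2
  have i1 : Integrable fun ζ => lap (k s) ζ * B (T - s) ζ :=
    ((continuous_lap hkc).mul hBc.continuous).integrable_of_hasCompactSupport hBs.mul_left
  have i2 : Integrable fun ζ => k s ζ * (U ζ * B (T - s) ζ + B' (T - s) ζ) :=
    (hkc.continuous.mul ((hU.mul hBc.continuous).add hB'c)).integrable_of_hasCompactSupport
      (HasCompactSupport.mul_left (hBs.mul_left.add hBs'))
  have i3 : Integrable fun ζ => k s ζ * lap (B (T - s)) ζ :=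
    (hkc.continuous.mul (continuous_lap hBc2)).integrable_of_hasCompactSupport
      (hasCompactSupport_lap hBs).mul_left
  have e1 : ∫ ζ, ((lap (k s) ζ - U ζ * k s ζ) * B (T - s) ζ - k s ζ * B' (T - s) ζ)
      = (∫ ζ, lap (k s) ζ * B (T - s) ζ) - ∫ ζ, k s ζ * (U ζ * B (T - s) ζ + B' (T - s) ζ) := by
    rw [← integral_sub i1 i2]
    congr 1; ext ζ; ring
  rw [e1, integral_lap_mul hkc hBc2 hBs, ← integral_sub i3 i2]
  congr 1; ext ζ; ring

lemma tendsto_pairing_zero {T : ℝ} (hT : 0 < T) :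
    Tendsto (fun s => ∫ ζ, k s ζ * B (T - s) ζ) (𝓝[>] 0) (𝓝 (B T 0)) := by
  obtain ⟨C, hC0, hC⟩ := hk.exists_uniform_bound
  obtain ⟨M, hM⟩ := ((isCompact_Icc (a := T / 2) (b := T)).prod
    (isCompact_closedBall (0 : E D) 1)).bddAbove_image
    (f := fun q : ℝ × E D => |B' q.1 q.2|)
    (hB.cont'.mono fun q hq => ⟨lt_of_lt_of_le (half_pos hT) hq.1.1, mem_univ _⟩).abs
  have hM' : ∀ τ ∈ Icc (T / 2) T, ∀ ζ, |B' τ ζ| ≤ max M 0 := by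
    intro τ hτ ζ
    rcases le_or_gt ‖ζ‖ 1 with h | h
    · exact (hM ⟨(τ, ζ), ⟨hτ, by simpa using h⟩, rfl⟩).trans (le_max_left _ _)
    · rw [hB.support' _ _ h, abs_zero]; exact le_max_right _ _
  have hBT := hk.initial (B T) (hB.contDiff T hT).continuous
    (hasCompactSupport_of_ball (hB.support T))
  have hz : Tendsto (fun s => ∫ ζ, k s ζ * (B (T - s) ζ - B T ζ)) (𝓝[>] 0) (𝓝 0) := by
    have hb : Tendsto (fun s : ℝ => C * (max M 0 * s)) (𝓝[>] 0) (𝓝 0) := by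
      have : Continuous fun s : ℝ => C * (max M 0 * s) := by fun_prop
      simpa using (this.tendsto 0).mono_left nhdsWithin_le_nhds
    refine squeeze_zero_norm' ?_ hb
    have hmem : Ioo 0 (min 1 (T / 2)) ∈ 𝓝[>] (0 : ℝ) := Ioo_mem_nhdsGT (by positivity)
    filter_upwards [hmem] with s hs
    have hs1 : s < 1 := hs.2.trans_le (min_le_left _ _)
    have hs2 : s < T / 2 := hs.2.trans_le (min_le_right _ _)
    refine hC s ⟨hs.1, hs1.le⟩ _ ?_ (fun ζ hζ => ?_) _ fun ζ => ?_
    · exact (hB.contDiff _ (by linarith)).continuous.sub (hB.contDiff T hT).continuous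
    · rw [hB.support _ _ hζ, hB.support _ _ hζ, sub_zero]
    · have := (convex_Icc (T / 2) T).norm_image_sub_le_of_norm_hasDerivWithin_le
        (f := fun τ => B τ ζ) (f' := fun τ => B' τ ζ) (C := max M 0) (x := T) (y := T - s)
        (fun τ hτ => (hB.deriv τ (lt_of_lt_of_le (half_pos hT) hτ.1) ζ).hasDerivWithinAt)
        (fun τ hτ => hM' τ hτ ζ) ⟨by linarith, le_rfl⟩ ⟨by linarith, by linarith [hs.1]⟩
      rw [show T - s - T = -s by ring, norm_neg, Real.norm_of_nonneg hs.1.le] at this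
      exact this
  have h := hBT.add hz
  rw [add_zero] at h
  refine h.congr' ?_
  have hmem : Ioo 0 T ∈ 𝓝[>] (0 : ℝ) := Ioo_mem_nhdsGT hT
  filter_upwards [hmem] with s hs
  have hkc := (hk.contDiff_slice hs.1).continuous
  have c1 := (hB.contDiff T hT).continuous
  have c2 := (hB.contDiff (T - s) (sub_pos.2 hs.2)).continuous
  have s1 : HasCompactSupport (B T) := hasCompactSupport_of_ball (hB.support _)
  have s2 : HasCompactSupport (B (T - s)) := hasCompactSupport_of_ball (hB.support _)
  have i1 : Integrable fun ζ => k s ζ * B T ζ :=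
    (hkc.mul c1).integrable_of_hasCompactSupport s1.mul_left
  have i2 : Integrable fun ζ => k s ζ * (B (T - s) ζ - B T ζ) :=
    (hkc.mul (c2.sub c1)).integrable_of_hasCompactSupport (HasCompactSupport.mul_left (s2.sub s1))
  rw [← integral_add i1 i2]
  congr 1; ext ζ; ring

/-- Comparison of the kernel with a family of test functions approaching a multiple of the
`δ`-function. -/
lemma comparison (hU : Continuous U) {C : ℝ}
    (hC : ∀ s ∈ Ioc (0 : ℝ) 1, ∀ h : E D → ℝ, Continuous h →
      (∀ ζ, 1 < ‖ζ‖ → h ζ = 0) → ∀ M, (∀ ζ, |h ζ| ≤ M) → |∫ ζ, k s ζ * h ζ| ≤ C * M)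
    {T : ℝ} (hT : T ∈ Ioc (0 : ℝ) 1) {M ℓ : ℝ}
    (hM : ∀ τ ∈ Ioo 0 T, ∀ ζ, |B' τ ζ - lap (B τ) ζ + U ζ * B τ ζ| ≤ M)
    (hℓ : Tendsto (fun s => ∫ ζ, k s ζ * B (T - s) ζ) (𝓝[<] T) (𝓝 ℓ)) :
    |ℓ - B T 0| ≤ C * M * T := by
  set I : ℝ → ℝ := fun s => ∫ ζ, k s ζ * B (T - s) ζ with hI
  have hb : ∀ s ∈ Ioo 0 T, ∀ s' ∈ Ioo 0 T, |I s' - I s| ≤ C * M * T := by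
    intro s hs s' hs'
    have h := (convex_Ioo 0 T).norm_image_sub_le_of_norm_hasDerivWithin_le (f := I)
      (fun s hs => (hk.hasDerivAt_pairing hB hU hs).hasDerivWithinAt) (C := C * M)
      (fun s hs => ?_) hs hs'
    · refine h.trans ?_
      have hCM : 0 ≤ C * M := (abs_nonneg _).trans (hC s ⟨hs.1, hs.2.le.trans hT.2⟩ (fun _ => 0)
        continuous_const (fun _ _ => rfl) M fun ζ => by
          rw [abs_zero]; exact (abs_nonneg _).trans (hM s hs ζ))
      refine mul_le_mul_of_nonneg_left ?_ hCM
      rw [norm_eq_abs, abs_le]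
      grind
    · have hTs : 0 < T - s := sub_pos.2 hs.2
      have hB'c : Continuous (B' (T - s)) := continuousOn_univ.1
        (hB.cont'.comp (f := fun ζ : E D => (T - s, ζ)) (by fun_prop) fun ζ _ => ⟨hTs, mem_univ _⟩)
      rw [norm_neg]
      refine hC s ⟨hs.1, hs.2.le.trans hT.2⟩ _ ?_ (fun ζ hζ => ?_) M
        (hM (T - s) ⟨hTs, by linarith [hs.1]⟩)
      · have hBc := hB.contDiff _ hTs
        exact (hB'c.sub (continuous_lap (contDiff_infty.1 hBc 2))).add (hU.mul hBc.continuous)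
      · have h0 : lap (B (T - s)) ζ = 0 := by
          have hev : B (T - s) =ᶠ[𝓝 ζ] fun _ => 0 := by
            filter_upwards [(isOpen_lt continuous_const continuous_norm).mem_nhds hζ] with y hy
            exact hB.support _ y hy
          have hev' : ∀ μ, dd μ (B (T - s)) =ᶠ[𝓝 ζ] fun _ => 0 := by
            intro μ
            filter_upwards [hev.eventuallyEq_nhds] with y hy
            rw [dd_eq, hy.fderiv_eq]; simp
          simp only [lap]
          refine sum_eq_zero fun μ _ => ?_
          rw [dd_eq, (hev' μ).fderiv_eq]; simp
        rw [h0, hB.support _ _ hζ, hB.support' _ _ hζ]; ring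
  have h1 : ∀ s ∈ Ioo 0 T, |ℓ - I s| ≤ C * M * T := by
    intro s hs
    refine le_of_tendsto ((hℓ.sub_const (I s)).abs) ?_
    filter_upwards [Ioo_mem_nhdsLT hT.1] with s' hs' using hb s hs s' hs'
  refine le_of_tendsto (((hk.tendsto_pairing_zero hB hT.1).const_sub ℓ).abs) ?_
  filter_upwards [Ioo_mem_nhdsGT hT.1] with s hs using h1 s hs

end IsFundamental

end

section

/-! ### The Gaussian parametrix -/

variable {D : ℕ}

def gk (τ : ℝ) (ζ : E D) : ℝ := (4 * Real.pi * τ) ^ (-((D : ℝ) / 2)) * exp (-(‖ζ‖ ^ 2 / (4 * τ)))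

lemma gk_nonneg {τ : ℝ} (hτ : 0 < τ) (ζ : E D) : 0 ≤ gk τ ζ := by
  have := pi_pos
  rw [gk]; positivity

lemma gk_zero (τ : ℝ) : gk τ (0 : E D) = (4 * Real.pi * τ) ^ (-((D : ℝ) / 2)) := by simp [gk]

lemma contDiff_gk (τ : ℝ) : Smooth (gk τ : E D → ℝ) := by
  unfold gk
  exact contDiff_const.mul (((contDiff_norm_sq ℝ).div_const _).neg.exp)

lemma continuousOn_gk : ContinuousOn (fun q : ℝ × E D => gk q.1 q.2) (Ioi 0 ×ˢ univ) := by
  have hp := pi_pos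
  have h1 : ∀ q ∈ Ioi (0 : ℝ) ×ˢ (univ : Set (E D)), 4 * Real.pi * q.1 ≠ 0 ∨ 0 ≤ -((D : ℝ) / 2) :=
    fun q hq => Or.inl (by have : 0 < q.1 := hq.1; positivity)
  have h2 : ∀ q ∈ Ioi (0 : ℝ) ×ˢ (univ : Set (E D)), 4 * q.1 ≠ 0 :=
    fun q hq => by have : 0 < q.1 := hq.1; positivity
  unfold gk
  refine ContinuousOn.mul (ContinuousOn.rpow_const (by fun_prop) h1) ?_
  fun_prop

lemma hasDerivAt_gk {τ : ℝ} (hτ : 0 < τ) (ζ : E D) :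
    HasDerivAt (fun τ => gk τ ζ) (gk τ ζ * (‖ζ‖ ^ 2 / (4 * τ ^ 2) - D / (2 * τ))) τ := by
  have hp := pi_pos
  have h1 : HasDerivAt (fun τ : ℝ => 4 * Real.pi * τ) (4 * Real.pi) τ := by
    simpa using (hasDerivAt_id τ).const_mul (4 * Real.pi)
  have h2 := h1.rpow_const (p := -((D : ℝ) / 2)) (Or.inl (by positivity))
  have h3 : HasDerivAt (fun τ : ℝ => -(‖ζ‖ ^ 2 / (4 * τ))) (‖ζ‖ ^ 2 / (4 * τ ^ 2)) τ := by
    have h4 : HasDerivAt (fun τ : ℝ => 4 * τ) 4 τ := by simpa using (hasDerivAt_id τ).const_mul 4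
    refine ((hasDerivAt_const τ (‖ζ‖ ^ 2)).div h4 (by positivity)).neg.congr_deriv ?_
    field_simp; ring
  refine (h2.mul h3.exp).congr_deriv ?_
  rw [gk, Real.rpow_sub_one (by positivity)]
  field_simp
  ring

lemma differentiable_of_contDiff {f : E D → ℝ} (hf : Smooth f) : Differentiable ℝ f :=
  hf.differentiable (by simp)

lemma dd_mul {f g : E D → ℝ} (hf : Smooth f) (hg : Smooth g) (μ : Fin D) (ζ : E D) :
    dd μ (fun ζ => f ζ * g ζ) ζ = f ζ * dd μ g ζ + dd μ f ζ * g ζ := by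
  simp only [dd_eq]
  rw [fderiv_fun_mul (differentiable_of_contDiff hf ζ) (differentiable_of_contDiff hg ζ)]
  simp; ring

lemma dd_sub {f g : E D → ℝ} (hf : Smooth f) (hg : Smooth g) (μ : Fin D) (ζ : E D) :
    dd μ (fun ζ => f ζ - g ζ) ζ = dd μ f ζ - dd μ g ζ := by
  simp only [dd_eq]
  rw [fderiv_fun_sub (differentiable_of_contDiff hf ζ) (differentiable_of_contDiff hg ζ)]
  simp

lemma contDiff_coord (μ : Fin D) : Smooth fun ζ : E D => ζ μ :=
  (EuclideanSpace.proj (𝕜 := ℝ) μ : E D →L[ℝ] ℝ).contDiff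

lemma dd_coord (μ ν : Fin D) (ζ : E D) : dd μ (fun ζ : E D => ζ ν) ζ = if ν = μ then 1 else 0 := by
  have : fderiv ℝ (fun ζ : E D => ζ ν) ζ = (EuclideanSpace.proj (𝕜 := ℝ) ν : E D →L[ℝ] ℝ) :=
    (EuclideanSpace.proj (𝕜 := ℝ) ν : E D →L[ℝ] ℝ).fderiv
  rw [dd_eq, this]
  simp

lemma dd_gk {τ : ℝ} (hτ : 0 < τ) (μ : Fin D) (ζ : E D) :
    dd μ (gk τ) ζ = -(ζ μ / (2 * τ)) * gk τ ζ := by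
  have h1 : HasFDerivAt (fun ζ : E D => ‖ζ‖ ^ 2) (2 • (innerSL ℝ ζ)) ζ :=
    (hasStrictFDerivAt_norm_sq ζ).hasFDerivAt
  have h2 := ((h1.mul_const (4 * τ)⁻¹).fun_neg.exp).const_mul ((4 * Real.pi * τ) ^ (-((D : ℝ) / 2)))
  have h3 : (gk τ : E D → ℝ) = fun ζ => (4 * Real.pi * τ) ^ (-((D : ℝ) / 2))
      * exp (-(‖ζ‖ ^ 2 * (4 * τ)⁻¹)) := by rfl
  rw [dd_eq, h3, h2.fderiv]
  simp [EuclideanSpace.inner_single_right]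
  field_simp
  ring

lemma dd_gk_mul {τ : ℝ} (hτ : 0 < τ) {u : E D → ℝ} (hu : Smooth u) (μ : Fin D) :
    dd μ (fun ζ => gk τ ζ * u ζ) = fun ζ => gk τ ζ * (dd μ u ζ - 1 / (2 * τ) * (ζ μ * u ζ)) := by
  ext ζ
  rw [dd_mul (contDiff_gk τ) hu, dd_gk hτ]
  ring

lemma norm_sq_eq_sum (ζ : E D) : ‖ζ‖ ^ 2 = ∑ μ, ζ μ ^ 2 := by rw [EuclideanSpace.norm_sq_eq]; simp

lemma lap_gk_mul {τ : ℝ} (hτ : 0 < τ) {u : E D → ℝ} (hu : Smooth u) (ζ : E D) :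
    lap (fun ζ => gk τ ζ * u ζ) ζ
      = gk τ ζ * ((‖ζ‖ ^ 2 / (4 * τ ^ 2) - D / (2 * τ)) * u ζ - τ⁻¹ * radial u ζ + lap u ζ) := by
  have h : ∀ μ, dd μ (dd μ fun ζ => gk τ ζ * u ζ) ζ = gk τ ζ * ((ζ μ ^ 2 / (4 * τ ^ 2) - 1 / (2 * τ))
      * u ζ - τ⁻¹ * (ζ μ * dd μ u ζ) + dd μ (dd μ u) ζ) := by
    intro μ
    have c1 : Smooth fun ζ : E D => ζ μ * u ζ := (contDiff_coord μ).mul hu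
    have c2 : Smooth fun ζ : E D => 1 / (2 * τ) * (ζ μ * u ζ) := contDiff_const.mul c1
    rw [dd_gk_mul hτ hu, dd_gk_mul hτ ((contDiff_dd hu μ).sub c2)]
    simp only
    rw [dd_sub (contDiff_dd hu μ) c2, dd_const_mul c1, dd_mul (contDiff_coord μ) hu, dd_coord,
      if_pos rfl]
    field_simp
    ring
  rw [lap]
  simp only [h]
  rw [← mul_sum, sum_add_distrib, sum_sub_distrib, ← sum_mul,
    sum_sub_distrib, ← mul_sum, ← sum_div, ← norm_sq_eq_sum]
  simp [radial, lap]
  left; left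
  ring

lemma gk_mul_pow_le {τ : ℝ} (hτ : τ ∈ Ioc (0 : ℝ) 1) (q : ℕ) (ζ : E D) :
    gk τ ζ * ‖ζ‖ ^ (2 * q) ≤ 4 ^ q * (q.factorial : ℝ) * τ ^ q / τ ^ D := by
  have hτ0 := hτ.1
  have hp := Real.pi_gt_three
  have h1 : (4 * Real.pi * τ) ^ (-((D : ℝ) / 2)) ≤ 1 / τ ^ D := by
    rw [Real.rpow_neg (by positivity), ← one_div]
    refine one_div_le_one_div_of_le (by positivity) ?_
    calc τ ^ D = τ ^ (D : ℝ) := (Real.rpow_natCast _ _).symm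
      _ ≤ τ ^ ((D : ℝ) / 2) := Real.rpow_le_rpow_of_exponent_ge hτ0 hτ.2 (by simp)
      _ ≤ (4 * Real.pi * τ) ^ ((D : ℝ) / 2) :=
          Real.rpow_le_rpow hτ0.le (by nlinarith) (by positivity)
  have h2 : exp (-(‖ζ‖ ^ 2 / (4 * τ))) * ‖ζ‖ ^ (2 * q) ≤ 4 ^ q * (q.factorial : ℝ) * τ ^ q := by
    have h3 := Real.pow_div_factorial_le_exp (‖ζ‖ ^ 2 / (4 * τ)) (by positivity) q
    rw [div_pow, ← pow_mul] at h3
    rw [Real.exp_neg, inv_mul_le_iff₀ (Real.exp_pos _)]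
    have h4 : ‖ζ‖ ^ (2 * q) = ‖ζ‖ ^ (2 * q) / (4 * τ) ^ q / (q.factorial : ℝ)
        * (4 ^ q * (q.factorial : ℝ) * τ ^ q) := by
      have : (q.factorial : ℝ) ≠ 0 := by positivity
      rw [mul_pow]; field_simp
    rw [h4]
    exact mul_le_mul_of_nonneg_right h3 (by positivity)
  calc gk τ ζ * ‖ζ‖ ^ (2 * q)
      = (4 * Real.pi * τ) ^ (-((D : ℝ) / 2)) * (exp (-(‖ζ‖ ^ 2 / (4 * τ))) * ‖ζ‖ ^ (2 * q)) := by
        rw [gk]; ring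
    _ ≤ 1 / τ ^ D * (4 ^ q * (q.factorial : ℝ) * τ ^ q) :=
        mul_le_mul h1 h2 (by positivity) (by positivity)
    _ = _ := by ring

lemma integral_gk_one : ∫ ξ : E D, gk 1 ξ = 1 := by
  have hp := pi_pos
  have h := GaussianFourier.integral_rexp_neg_mul_sq_norm (V := E D) (b := 1 / 4) (by norm_num)
  have e : ∀ ξ : E D, gk 1 ξ = (4 * Real.pi) ^ (-((D : ℝ) / 2)) * exp (-(1 / 4) * ‖ξ‖ ^ 2) := by
    intro ξ
    rw [gk, mul_one, mul_one]
    congr 2; ring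
  simp only [e]
  rw [integral_const_mul, h, finrank_euclideanSpace_fin, show Real.pi / (1 / 4) = 4 * Real.pi by ring,
    ← Real.rpow_add (by positivity), neg_add_cancel, Real.rpow_zero]

lemma integrable_gk_one : Integrable (gk 1 : E D → ℝ) := by
  by_contra h
  have := integral_gk_one (D := D)
  rw [integral_undef h] at this
  exact zero_ne_one this

lemma integral_gk_mul {τ : ℝ} (hτ : 0 < τ) (H : E D → ℝ) :
    ∫ ζ, gk τ ζ * H ζ = ∫ ξ : E D, gk 1 ξ * H (√τ • ξ) := by
  have hs : 0 < √τ := sqrt_pos.2 hτ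
  have hp := pi_pos
  have h := Measure.integral_comp_smul_of_nonneg (volume : Measure (E D)) (fun ζ => gk τ ζ * H ζ) √τ
    (hR := hs.le)
  have e : ∀ ξ : E D, gk τ (√τ • ξ) = (√τ ^ D)⁻¹ * gk 1 ξ := by
    intro ξ
    rw [gk, gk, norm_smul, Real.norm_of_nonneg hs.le, mul_pow, sq_sqrt hτ.le,
      Real.mul_rpow (by positivity) hτ.le, mul_one, mul_one]
    have e1 : τ ^ (-((D : ℝ) / 2)) = (√τ ^ D)⁻¹ := by
      rw [Real.rpow_neg hτ.le, Real.sqrt_eq_rpow, ← Real.rpow_natCast, ← Real.rpow_mul hτ.le]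
      congr 2; ring
    grind
  simp only [e, finrank_euclideanSpace_fin, smul_eq_mul] at h
  have hD : (√τ ^ D)⁻¹ ≠ 0 := by positivity
  apply mul_left_cancel₀ hD
  rw [← h, ← integral_const_mul]
  congr 1; ext ξ; ring

lemma tendsto_integral_gk {H : ℝ → E D → ℝ} {δ M h₀ : ℝ} (hδ : 0 < δ)
    (hH : ∀ τ ∈ Ioo 0 δ, Continuous (H τ)) (hM : ∀ τ ∈ Ioo 0 δ, ∀ ζ, |H τ ζ| ≤ M)
    (hlim : ∀ ξ : E D, Tendsto (fun τ => H τ (√τ • ξ)) (𝓝[>] 0) (𝓝 h₀)) :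
    Tendsto (fun τ => ∫ ζ, gk τ ζ * H τ ζ) (𝓝[>] 0) (𝓝 h₀) := by
  have hmem : Ioo 0 δ ∈ 𝓝[>] (0 : ℝ) := Ioo_mem_nhdsGT hδ
  have h1 : Tendsto (fun τ => ∫ ξ : E D, gk 1 ξ * H τ (√τ • ξ)) (𝓝[>] 0)
      (𝓝 (∫ ξ : E D, gk 1 ξ * h₀)) := by
    refine tendsto_integral_filter_of_dominated_convergence (fun ξ => gk 1 ξ * M) ?_ ?_
      (integrable_gk_one.mul_const M) ?_
    · filter_upwards [hmem] with τ hτ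
      exact ((contDiff_gk 1).continuous.mul ((hH τ hτ).comp
        (continuous_const_smul _))).aestronglyMeasurable
    · filter_upwards [hmem] with τ hτ
      refine Eventually.of_forall fun ξ => ?_
      rw [norm_mul, Real.norm_of_nonneg (gk_nonneg one_pos ξ)]
      exact mul_le_mul_of_nonneg_left (hM τ hτ _) (gk_nonneg one_pos ξ)
    · exact Eventually.of_forall fun ξ => (hlim ξ).const_mul _
  rw [integral_mul_const, integral_gk_one, one_mul] at h1
  refine h1.congr' ?_
  filter_upwards [self_mem_nhdsWithin] with τ hτ
  exact (integral_gk_mul hτ _).symm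

def series (Û : ℕ → E D → ℝ) (N : ℕ) (τ : ℝ) (ζ : E D) : ℝ := ∑ m ∈ ℛ (N + 1), τ ^ m * Û m ζ

def series' (Û : ℕ → E D → ℝ) (N : ℕ) (τ : ℝ) (ζ : E D) : ℝ :=
  ∑ m ∈ ℛ (N + 1), (m : ℝ) * τ ^ (m - 1) * Û m ζ

def parametrix (Û : ℕ → E D → ℝ) (N : ℕ) (τ : ℝ) (ζ : E D) : ℝ := gk τ ζ * series Û N τ ζ

def parametrix' (Û : ℕ → E D → ℝ) (N : ℕ) (τ : ℝ) (ζ : E D) : ℝ :=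
  gk τ ζ * ((‖ζ‖ ^ 2 / (4 * τ ^ 2) - D / (2 * τ)) * series Û N τ ζ + series' Û N τ ζ)

section
variable {Û : ℕ → E D → ℝ} (hÛ : ∀ m, Smooth (Û m)) (N : ℕ)
include hÛ

lemma contDiff_series (τ : ℝ) : Smooth (series Û N τ) :=
  ContDiff.sum fun m _ => contDiff_const.mul (hÛ m)

lemma continuous_series : Continuous fun q : ℝ × E D => series Û N q.1 q.2 := by
  have := fun m => (hÛ m).continuous
  unfold series; fun_prop

lemma continuous_series' : Continuous fun q : ℝ × E D => series' Û N q.1 q.2 := by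
  have := fun m => (hÛ m).continuous
  unfold series'; fun_prop

lemma isTestFamily_parametrix (hs : ∀ m ζ, 1 < ‖ζ‖ → Û m ζ = 0) :
    IsTestFamily (parametrix Û N) (parametrix' Û N) where
  contDiff τ _ := (contDiff_gk τ).mul (contDiff_series hÛ N τ)
  support τ ζ hζ := by simp [parametrix, series, hs _ ζ hζ]
  support' τ ζ hζ := by simp [parametrix', series, series', hs _ ζ hζ]
  cont := continuousOn_gk.mul (continuous_series hÛ N).continuousOn
  cont' := by
    have h1 : ∀ q ∈ Ioi (0 : ℝ) ×ˢ (univ : Set (E D)), 4 * q.1 ^ 2 ≠ 0 :=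
      fun q hq => by have : 0 < q.1 := hq.1; positivity
    have h2 : ∀ q ∈ Ioi (0 : ℝ) ×ˢ (univ : Set (E D)), 2 * q.1 ≠ 0 := fun q hq => by simp_all
    refine continuousOn_gk.mul (ContinuousOn.add (ContinuousOn.mul (ContinuousOn.sub ?_ ?_)
      (continuous_series hÛ N).continuousOn) (continuous_series' hÛ N).continuousOn)
    · exact ContinuousOn.div (by fun_prop) (by fun_prop) h1
    fun_prop
  deriv τ hτ ζ := by
    have h : HasDerivAt (fun τ => series Û N τ ζ) (series' Û N τ ζ) τ :=
      HasDerivAt.fun_sum fun m _ => (hasDerivAt_pow m τ).mul_const _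
    refine ((hasDerivAt_gk hτ ζ).mul h).congr_deriv ?_
    rw [parametrix']; ring

lemma parametrix_defect (U : E D → ℝ) {τ : ℝ} (hτ : 0 < τ) (ζ : E D) :
    parametrix' Û N τ ζ - lap (parametrix Û N τ) ζ + U ζ * parametrix Û N τ ζ
      = gk τ ζ * (τ⁻¹ * radial (Û 0) ζ
        + (∑ m ∈ ℛ N, τ ^ m * (((m : ℝ) + 1) * Û (m + 1) ζ + radial (Û (m + 1)) ζ
          - lap (Û m) ζ + U ζ * Û m ζ)) + τ ^ N * (U ζ * Û N ζ - lap (Û N) ζ)) := by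
  have hp : parametrix Û N τ = fun ζ => gk τ ζ * series Û N τ ζ := rfl
  rw [hp, lap_gk_mul hτ (contDiff_series hÛ N τ), parametrix']
  have hser : series Û N τ = fun ζ => ∑ m ∈ ℛ (N + 1), τ ^ m * Û m ζ := rfl
  have hr : radial (series Û N τ) ζ = ∑ m ∈ ℛ (N + 1), τ ^ m * radial (Û m) ζ := radial_sum hÛ ζ
  have hl : lap (series Û N τ) ζ = ∑ m ∈ ℛ (N + 1), τ ^ m * lap (Û m) ζ := lap_sum hÛ ζ
  have e : series' Û N τ ζ + τ⁻¹ * radial (series Û N τ) ζ - lap (series Û N τ) ζ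
      + U ζ * series Û N τ ζ = τ⁻¹ * radial (Û 0) ζ
        + (∑ m ∈ ℛ N, τ ^ m * (((m : ℝ) + 1) * Û (m + 1) ζ + radial (Û (m + 1)) ζ
          - lap (Û m) ζ + U ζ * Û m ζ)) + τ ^ N * (U ζ * Û N ζ - lap (Û N) ζ) := by
    rw [hr, hl, series, series', sum_range_succ' (fun m => (m : ℝ) * τ ^ (m - 1) * Û m ζ),
      sum_range_succ' (fun m => τ ^ m * radial (Û m) ζ), sum_range_succ,
      sum_range_succ]
    simp only [mul_add, mul_sub, sum_add_distrib, sum_sub_distrib, mul_sum]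
    have e1 : ∀ m ∈ ℛ N, τ⁻¹ * (τ ^ (m + 1) * radial (Û (m + 1)) ζ)
        = τ ^ m * radial (Û (m + 1)) ζ := fun m _ => by grind
    have e2 : ∀ m ∈ ℛ N, ((m + 1 : ℕ) : ℝ) * τ ^ (m + 1 - 1) * Û (m + 1) ζ
        = τ ^ m * (((m : ℝ) + 1) * Û (m + 1) ζ) := fun m _ => by grind
    have e3 : ∀ m ∈ ℛ N, U ζ * (τ ^ m * Û m ζ) = τ ^ m * (U ζ * Û m ζ) := fun m _ => by ring
    rw [sum_congr rfl e1, sum_congr rfl e2, sum_congr rfl e3]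
    simp
    ring
  rw [← e]
  ring

end

end

section

open MvPolynomial

/-! ### The diagonal of the heat kernel -/

variable {D : ℕ}

lemma abs_gk_mul_le {τ C a b c ρ : ℝ} (hτ : τ ∈ Ioc (0 : ℝ) 1) (Q N : ℕ) (hN : N = Q + D)
    (hC : 0 ≤ C) (ζ : E D) (hρ : ρ = ‖ζ‖ ^ (2 * (Q + D + 1))) (ha : |a| ≤ C * ρ)
    (hb : |b| ≤ N * (C * ρ)) (hc : |c| ≤ C) :
    |gk τ ζ * (τ⁻¹ * a + b + τ ^ N * c)|
      ≤ (C * (N + 1) * (4 ^ (Q + D + 1) * ((Q + D + 1).factorial : ℝ)) + C) * τ ^ Q := by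
  have hτ0 := hτ.1
  have hg := gk_nonneg hτ0 ζ
  have hinv : 1 ≤ τ⁻¹ := (one_le_inv₀ hτ0).2 hτ.2
  have hρ0 : 0 ≤ ρ := by rw [hρ]; positivity
  have k1 := gk_mul_pow_le hτ (Q + D + 1) ζ
  rw [← hρ] at k1
  have k2 := gk_mul_pow_le hτ 0 ζ
  simp only [mul_zero, pow_zero, mul_one, Nat.factorial_zero, Nat.cast_one] at k2
  set w : ℝ := 4 ^ (Q + D + 1) * ((Q + D + 1).factorial : ℝ)
  have e1 : |τ⁻¹ * a + b + τ ^ N * c| ≤ τ⁻¹ * (C * (N + 1)) * ρ + τ ^ N * C := by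
    have i1 : |τ⁻¹ * a| ≤ τ⁻¹ * (C * ρ) := by rw [abs_mul, abs_of_pos (by positivity)]; gcongr
    have i2 : |b| ≤ τ⁻¹ * (N * (C * ρ)) := hb.trans (le_mul_of_one_le_left (by positivity) hinv)
    have i3 : |τ ^ N * c| ≤ τ ^ N * C := by rw [abs_mul, abs_of_pos (by positivity)]; gcongr
    calc _ ≤ |τ⁻¹ * a| + |b| + |τ ^ N * c| :=
          (abs_add_le _ _).trans (add_le_add_left (abs_add_le _ _) _)
      _ ≤ τ⁻¹ * (C * ρ) + τ⁻¹ * (N * (C * ρ)) + τ ^ N * C := by gcongr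
      _ = _ := by ring
  rw [abs_mul, abs_of_nonneg hg]
  calc _ ≤ gk τ ζ * (τ⁻¹ * (C * (N + 1)) * ρ + τ ^ N * C) := by gcongr
    _ = τ⁻¹ * (C * (N + 1)) * (gk τ ζ * ρ) + τ ^ N * C * gk τ ζ := by ring
    _ ≤ τ⁻¹ * (C * (N + 1)) * (w * τ ^ (Q + D + 1) / τ ^ D) + τ ^ N * C * (1 / τ ^ D) := by gcongr
    _ = _ := by
        rw [hN, pow_add, pow_add]
        field_simp

/-- The parametrix approximates the kernel on the diagonal. -/
lemma IsFundamental.exists_diagonal_bound {U : E D → ℝ} {k : ℝ → E D → ℝ}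
    (hk : IsFundamental U k) (hU : Continuous U) {Û : ℕ → E D → ℝ} (hÛ : ∀ m, Smooth (Û m))
    (hs : ∀ m ζ, 1 < ‖ζ‖ → Û m ζ = 0) (h0 : Û 0 0 = 1) {Q N : ℕ} (hN : N = Q + D) {C : ℝ}
    (hC : 0 ≤ C) (h1 : ∀ ζ, |radial (Û 0) ζ| ≤ C * ‖ζ‖ ^ (2 * (Q + D + 1)))
    (h2 : ∀ m < N, ∀ ζ, |((m : ℝ) + 1) * Û (m + 1) ζ + radial (Û (m + 1)) ζ - lap (Û m) ζ
      + U ζ * Û m ζ| ≤ C * ‖ζ‖ ^ (2 * (Q + D + 1)))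
    (h3 : ∀ ζ, |U ζ * Û N ζ - lap (Û N) ζ| ≤ C) :
    ∃ C', ∀ T ∈ Ioc (0 : ℝ) 1, |k T 0 - gk T (0 : E D) * series Û N T 0| ≤ C' * T ^ (Q + 1) := by
  obtain ⟨C₁, hC₁, hb⟩ := hk.exists_uniform_bound
  set A : ℝ := C * (N + 1) * (4 ^ (Q + D + 1) * ((Q + D + 1).factorial : ℝ)) + C
  have hA : 0 ≤ A := by positivity
  refine ⟨C₁ * A, fun T hT => ?_⟩
  have hT0 := hT.1
  have hB := isTestFamily_parametrix hÛ N hs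
  have hM : ∀ τ ∈ Ioo 0 T, ∀ ζ, |parametrix' Û N τ ζ - lap (parametrix Û N τ) ζ
      + U ζ * parametrix Û N τ ζ| ≤ A * T ^ Q := by
    intro τ hτ ζ
    rw [parametrix_defect hÛ N U hτ.1]
    refine (abs_gk_mul_le ⟨hτ.1, hτ.2.le.trans hT.2⟩ Q N hN hC ζ rfl (h1 ζ) ?_ (h3 ζ)).trans ?_
    · refine (abs_sum_le_sum_abs _ _).trans ?_
      refine (sum_le_sum (g := fun _ => C * ‖ζ‖ ^ (2 * (Q + D + 1))) fun m hm => ?_).trans ?_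
      · rw [abs_mul, abs_of_pos (pow_pos hτ.1 m)]
        exact (mul_le_of_le_one_left (abs_nonneg _)
          (pow_le_one₀ hτ.1.le (hτ.2.le.trans hT.2))).trans (h2 m (Finset.mem_range.1 hm) ζ)
      · simp
    · exact mul_le_mul_of_nonneg_left (pow_le_pow_left₀ hτ.1.le hτ.2.le Q) hA
  have hcH : ContinuousOn (fun q : ℝ × E D => k (T - q.1) q.2 * series Û N q.1 q.2)
      (Iio T ×ˢ univ) := by
    refine ContinuousOn.mul ?_ (continuous_series hÛ N).continuousOn
    exact hk.continuousOn.comp (f := fun q : ℝ × E D => (T - q.1, q.2))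
      (by fun_prop) fun q hq => ⟨sub_pos.2 (mem_Iio.1 hq.1), mem_univ _⟩
  obtain ⟨M, hMb⟩ := ((isCompact_Icc (a := (0 : ℝ)) (b := T / 2)).prod
    (isCompact_closedBall (0 : E D) 1)).bddAbove_image
    (f := fun q : ℝ × E D => |k (T - q.1) q.2 * series Û N q.1 q.2|)
    (hcH.mono fun q hq => ⟨lt_of_le_of_lt hq.1.2 (half_lt_self hT0), mem_univ _⟩).abs
  have hlim := tendsto_integral_gk (H := fun τ ζ => k (T - τ) ζ * series Û N τ ζ) (half_pos hT0)
    (M := max M 0) (h₀ := k T 0)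
    (fun τ hτ => hcH.comp_continuous (f := fun ζ : E D => (τ, ζ)) (by fun_prop)
      fun ζ => ⟨hτ.2.trans (half_lt_self hT0), mem_univ _⟩)
    (fun τ hτ ζ => by
      rcases le_or_gt ‖ζ‖ 1 with h | h
      · exact (hMb (mem_image_of_mem _ (show (τ, ζ) ∈ Icc 0 (T / 2) ×ˢ Metric.closedBall (0 : E D) 1
          from ⟨⟨hτ.1.le, hτ.2.le⟩, by simpa using h⟩))).trans (le_max_left _ _)
      · simp [series, hs _ ζ h])
    (fun ξ => by
      have hat : ContinuousAt (fun q : ℝ × E D => k (T - q.1) q.2 * series Û N q.1 q.2)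
          ((0 : ℝ), (0 : E D)) :=
        hcH.continuousAt ((isOpen_Iio.prod isOpen_univ).mem_nhds ⟨hT0, mem_univ _⟩)
      have hc : Tendsto (fun τ : ℝ => (τ, √τ • ξ)) (𝓝[>] 0) (𝓝 ((0 : ℝ), (0 : E D))) := by
        have : Continuous fun τ : ℝ => (τ, √τ • ξ) := by fun_prop
        have h := (this.tendsto 0).mono_left (nhdsWithin_le_nhds (s := Ioi 0))
        simpa using h
      have h := hat.tendsto.comp hc
      have e0 : series Û N 0 (0 : E D) = 1 := by rw [series, sum_range_succ']; simp [h0]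
      simpa [e0, Function.comp_def] using h)
  have hsub : Tendsto (fun s => T - s) (𝓝[<] T) (𝓝[>] 0) := by
    refine tendsto_nhdsWithin_iff.2 ⟨?_, ?_⟩
    · have : Continuous fun s : ℝ => T - s := by fun_prop
      have h := (this.tendsto T).mono_left (nhdsWithin_le_nhds (s := Iio T))
      simpa using h
    · filter_upwards [self_mem_nhdsWithin] with s hs
      exact sub_pos.2 (mem_Iio.1 hs)
  have hℓ : Tendsto (fun s => ∫ ζ, k s ζ * parametrix Û N (T - s) ζ) (𝓝[<] T) (𝓝 (k T 0)) := by
    refine (hlim.comp hsub).congr fun s => ?_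
    simp only [Function.comp, sub_sub_cancel, parametrix]
    congr 1; ext ζ; ring
  have := hk.comparison hB hU hb hT hM hℓ
  refine this.trans (le_of_eq ?_)
  ring

/-! ### Taylor's theorem -/

lemma fderiv_eq_sum (F : E D → ℝ) (y v : E D) : fderiv ℝ F y v = ∑ ν, v ν * dd ν F y := by
  have hv : v = ∑ ν, v ν • EuclideanSpace.single ν (1 : ℝ) := by
    ext i; simp [Finset.sum_apply, Pi.single_apply]
  conv_lhs => rw [hv]
  rw [map_sum]
  exact sum_congr rfl fun ν _ => by rw [map_smul, dd_eq, smul_eq_mul]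

lemma abs_coord_le (v : E D) (ν : Fin D) : |v ν| ≤ ‖v‖ := by simpa using PiLp.norm_apply_le v ν

lemma abs_le_of_abs_dd_le {F : E D → ℝ} (hF : Smooth F) (h0 : F 0 = 0) {C : ℝ} (hC : 0 ≤ C)
    {p : ℕ} (h : ∀ ν ζ, ‖ζ‖ ≤ 1 → |dd ν F ζ| ≤ C * ‖ζ‖ ^ p) (ζ : E D) (hζ : ‖ζ‖ ≤ 1) :
    |F ζ| ≤ D * C * ‖ζ‖ ^ (p + 1) := by
  have hb : ∀ y ∈ Metric.closedBall (0 : E D) ‖ζ‖, ‖fderiv ℝ F y‖ ≤ D * (C * ‖ζ‖ ^ p) := by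
    intro y hy
    have hy' : ‖y‖ ≤ ‖ζ‖ := by simpa using hy
    refine ContinuousLinearMap.opNorm_le_bound _ (by positivity) fun v => ?_
    rw [fderiv_eq_sum, norm_eq_abs]
    refine (abs_sum_le_sum_abs _ _).trans ?_
    refine (sum_le_sum (g := fun _ => ‖v‖ * (C * ‖ζ‖ ^ p)) fun ν _ => ?_).trans ?_
    · rw [abs_mul]
      have := (h ν y (hy'.trans hζ)).trans
        (mul_le_mul_of_nonneg_left (pow_le_pow_left₀ (norm_nonneg _) hy' p) hC)
      exact mul_le_mul (abs_coord_le v ν) this (abs_nonneg _) (norm_nonneg _)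
    · simp; apply le_of_eq; ring
  have := (convex_closedBall (0 : E D) ‖ζ‖).norm_image_sub_le_of_norm_fderiv_le
    (fun y _ => differentiable_of_contDiff hF y) hb (x := 0) (y := ζ) (by simp) (by simp)
  rw [h0, sub_zero, sub_zero, norm_eq_abs] at this
  refine this.trans (le_of_eq ?_)
  ring

lemma contDiff_eval (P : ℳ (Fin D)) :
    Smooth fun ζ : E D => eval (fun ν => ζ ν) P := by
  induction P using MvPolynomial.induction_on with
  | C a => simpa using contDiff_const
  | add p q hp hq => simpa using hp.add hq
  | mul_X p i hp => simpa using hp.mul (contDiff_coord i)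

lemma dd_eval (P : ℳ (Fin D)) (ν : Fin D) (ζ : E D) :
    dd ν (fun ζ : E D => eval (fun ν => ζ ν) P) ζ = eval (fun ν => ζ ν) (pderiv ν P) := by
  induction P using MvPolynomial.induction_on with
  | C a => simp [dd_eq]
  | add p q hp hq =>
    simp only [map_add]
    rw [dd_add (contDiff_eval p) (contDiff_eval q), hp, hq]
  | mul_X p i hp =>
    simp only [map_mul, eval_X]
    rw [dd_mul (contDiff_eval p) (contDiff_coord i), hp, dd_coord]
    by_cases h : i = ν
    · subst h; simp [mul_comm]
    · simp [h, pderiv_X_of_ne h, mul_comm]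

lemma dd_translate (f : E D → ℝ) (x : E D) (ν : Fin D) (ζ : E D) :
    dd ν (fun ζ => f (x + ζ)) ζ = dd ν f (x + ζ) := by
  rw [dd_eq, dd_eq, fderiv_comp_add_left]

lemma contDiff_translate {f : E D → ℝ} {n : WithTop ℕ∞} (hf : ContDiff ℝ n f) (x : E D) :
    ContDiff ℝ n fun ζ => f (x + ζ) :=
  hf.comp (contDiff_const.add contDiff_id)

lemma exists_taylor_bound {V : E D → ℝ} (hV : Smooth V) (x : E D) (M : ℕ) :
    ∃ C, 0 ≤ C ∧ ∀ ζ : E D, ‖ζ‖ ≤ 1 →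
      |V (x + ζ) - eval (fun ν => ζ ν) (taylorP 𝒿 M)| ≤ C * ‖ζ‖ ^ (M + 1) := by
  have hF : ∀ (V : E D → ℝ) (M : ℕ), Smooth V → Smooth fun ζ : E D =>
      V (x + ζ) - eval (fun ν => ζ ν) (taylorP 𝒿 M) := fun V M hV =>
    (contDiff_translate hV x).sub (contDiff_eval _)
  have hF0 : ∀ (V : E D → ℝ) (M : ℕ),
      V (x + 0) - eval (fun ν => (0 : E D) ν) (taylorP 𝒿 M) = 0 := fun V M => by
    have : (fun ν => (0 : E D) ν) = 0 := rfl
    rw [this, eval_zero_taylorP, add_zero, Jet.val0, jetAt]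
    simp [pd]
  induction M generalizing V with
  | zero =>
    have hb : ∀ ν, ∃ C, ∀ ζ : E D, ‖ζ‖ ≤ 1 → |dd ν (fun ζ : E D =>
        V (x + ζ) - eval (fun ν => ζ ν) (taylorP 𝒿 0)) ζ| ≤ C := by
      intro ν
      obtain ⟨C, hC⟩ := (isCompact_closedBall (0 : E D) 1).bddAbove_image
        (contDiff_dd (hF V 0 hV) ν).continuous.abs.continuousOn
      exact ⟨C, fun ζ hζ => hC (mem_image_of_mem _ (by simpa using hζ))⟩
    choose C hC using hb
    have hC' : ∀ ν, |C ν| ≤ ∑ ν, |C ν| := fun ν =>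
      single_le_sum (f := fun ν => |C ν|) (fun _ _ => abs_nonneg _) (Finset.mem_univ ν)
    have h0 : 0 ≤ ∑ ν, |C ν| := sum_nonneg fun _ _ => abs_nonneg _
    refine ⟨D * ∑ ν, |C ν|, by positivity, abs_le_of_abs_dd_le (hF V 0 hV) (hF0 V 0) h0
      fun ν ζ hζ => ?_⟩
    rw [pow_zero, mul_one]
    exact (hC ν ζ hζ).trans ((le_abs_self _).trans (hC' ν))
  | succ M ih =>
    choose C hC0 hC using fun ν => ih (contDiff_dd hV ν)
    have hC' : ∀ ν, C ν ≤ ∑ ν, C ν := fun ν =>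
      single_le_sum (f := C) (fun ν _ => hC0 ν) (Finset.mem_univ ν)
    have h0 : 0 ≤ ∑ ν, C ν := sum_nonneg fun ν _ => hC0 ν
    refine ⟨D * ∑ ν, C ν, by positivity, abs_le_of_abs_dd_le (hF V (M + 1) hV) (hF0 V (M + 1)) h0
      fun ν ζ hζ => ?_⟩
    rw [dd_sub (contDiff_translate hV x) (contDiff_eval _), dd_translate, dd_eval,
      pderiv_taylorP_succ (jetAt_sym hV x), ← jetAt_dd hV]
    exact (hC ν ζ hζ).trans (mul_le_mul_of_nonneg_right (hC' ν) (by positivity))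

end

section

open MvPolynomial

variable {D : ℕ}

/-! ### The heat kernel coefficients -/

lemma dd_congr {f g : E D → ℝ} {ζ : E D} (h : f =ᶠ[𝓝 ζ] g) (ν : Fin D) :
    dd ν f =ᶠ[𝓝 ζ] dd ν g := by
  filter_upwards [h.fderiv (𝕜 := ℝ)] with y hy
  rw [dd_eq, dd_eq, hy]

lemma radial_congr {f g : E D → ℝ} {ζ : E D} (h : f =ᶠ[𝓝 ζ] g) : radial f ζ = radial g ζ :=
  sum_congr rfl fun ν _ => by rw [(dd_congr h ν).eq_of_nhds]

lemma lap_congr {f g : E D → ℝ} {ζ : E D} (h : f =ᶠ[𝓝 ζ] g) : lap f ζ = lap g ζ :=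
  sum_congr rfl fun ν _ => (dd_congr (dd_congr h ν) ν).eq_of_nhds

lemma continuous_radial {f : E D → ℝ} (hf : Smooth f) : Continuous (radial f) :=
  continuous_finsetSum _ fun ν _ => (contDiff_coord ν).continuous.mul (contDiff_dd hf ν).continuous

lemma exists_global_bound {F : E D → ℝ} (hF : Continuous F) (hs : ∀ ζ, 1 < ‖ζ‖ → F ζ = 0) {C : ℝ}
    (hC : 0 ≤ C) {p : ℕ} (h : ∀ ζ, ‖ζ‖ < 1 / 2 → |F ζ| ≤ C * ‖ζ‖ ^ p) :
    ∃ C', 0 ≤ C' ∧ ∀ ζ, |F ζ| ≤ C' * ‖ζ‖ ^ p := by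
  obtain ⟨M, hM⟩ := (isCompact_closedBall (0 : E D) 1).bddAbove_image hF.abs.continuousOn
  have hM0 : 0 ≤ M := (abs_nonneg _).trans (hM (mem_image_of_mem _ (show (0 : E D) ∈ _ by simp)))
  refine ⟨C + M * 2 ^ p, by positivity, fun ζ => ?_⟩
  have hn : 0 ≤ ‖ζ‖ ^ p := by positivity
  rw [add_mul]
  rcases lt_or_ge ‖ζ‖ (1 / 2) with h1 | h1
  · have : 0 ≤ M * 2 ^ p * ‖ζ‖ ^ p := by positivity
    linarith [h ζ h1]
  · rcases le_or_gt ‖ζ‖ 1 with h2 | h2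
    · have h3 := hM (mem_image_of_mem _ (show ζ ∈ _ by simpa using h2))
      have h4 : 1 ≤ 2 ^ p * ‖ζ‖ ^ p := by rw [← mul_pow]; exact one_le_pow₀ (by linarith)
      have h5 : M ≤ M * (2 ^ p * ‖ζ‖ ^ p) := le_mul_of_one_le_right hM0 h4
      have : 0 ≤ C * ‖ζ‖ ^ p := by positivity
      exact h3.trans (by linarith)
    · rw [hs ζ h2, abs_zero]; positivity

lemma eventuallyEq_zero_of_support {f : E D → ℝ} (hf : ∀ ζ, 1 < ‖ζ‖ → f ζ = 0) {ζ : E D}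
    (hζ : 1 < ‖ζ‖) : f =ᶠ[𝓝 ζ] fun _ => 0 := by
  filter_upwards [(isOpen_lt continuous_const continuous_norm).mem_nhds hζ] with y hy using hf y hy

lemma exists_bound_of_ball {F : E D → ℝ} (hF : Continuous F) (hs : ∀ ζ, 1 < ‖ζ‖ → F ζ = 0) :
    ∃ C, 0 ≤ C ∧ ∀ ζ, |F ζ| ≤ C := by
  obtain ⟨M, hM⟩ := (isCompact_closedBall (0 : E D) 1).bddAbove_image hF.abs.continuousOn
  have hM0 : 0 ≤ M := (abs_nonneg _).trans (hM (mem_image_of_mem _ (show (0 : E D) ∈ _ by simp)))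
  refine ⟨M, hM0, fun ζ => ?_⟩
  rcases le_or_gt ‖ζ‖ 1 with h | h
  · exact hM (mem_image_of_mem _ (show ζ ∈ _ by simpa using h))
  · rw [hs ζ h, abs_zero]; exact hM0

lemma IsFundamental.exists_heatCoef_bound {V : E D → ℝ} (hV : Smooth V) (x : E D)
    {k : ℝ → E D → ℝ} (hk : IsFundamental (fun ζ => V (x + ζ)) k) (Q : ℕ) :
    ∃ C', ∀ T ∈ Ioc (0 : ℝ) 1, |k T 0 - gk T (0 : E D) *
      ∑ m ∈ ℛ (Q + D + 1), T ^ m * heatCoef freeD m 𝒿| ≤ C' * T ^ (Q + 1) := by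
  set M : ℕ := 2 * (Q + D) + 1
  set P := taylorP 𝒿 M
  set N := Q + D with hN
  let χ : ContDiffBump (0 : E D) := ⟨1 / 2, 1, by norm_num, by norm_num⟩
  set Û : ℕ → E D → ℝ := fun m ζ => χ ζ * hadamard P m ζ with hÛdef
  have hU : Smooth fun ζ => V (x + ζ) := contDiff_translate hV x
  have hÛ : ∀ m, Smooth (Û m) := fun m => χ.contDiff.mul (contDiff_hadamard P m)
  have hs : ∀ m ζ, 1 < ‖ζ‖ → Û m ζ = 0 := fun m ζ h => by
    simp only [hÛdef]
    rw [χ.zero_of_le_dist (by simpa [χ] using h.le), zero_mul]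
  have hin : ∀ m (ζ : E D), ‖ζ‖ < 1 / 2 → Û m =ᶠ[𝓝 ζ] hadamard P m := fun m ζ h => by
    filter_upwards [(isOpen_lt continuous_norm continuous_const).mem_nhds h] with y hy
    simp only [hÛdef]
    rw [χ.one_of_mem_closedBall (by simpa [χ] using (le_of_lt hy)), one_mul]
  have h0 : Û 0 0 = 1 := by rw [(hin 0 0 (by simp)).eq_of_nhds, hadamard_zero]
  have hval : ∀ m ≤ N, Û m 0 = heatCoef freeD m 𝒿 := fun m hm => by
    rw [(hin m 0 (by simp)).eq_of_nhds, hadamard_at_zero (jetAt_sym hV x) (by omega)]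
  obtain ⟨C₁, hC₁, h1⟩ := exists_global_bound (p := 2 * (Q + D + 1)) (continuous_radial (hÛ 0))
    (fun ζ hζ => by
      rw [radial_congr (eventuallyEq_zero_of_support (hs 0) hζ), radial_const]) (le_refl 0)
    (fun ζ hζ => by rw [radial_congr (hin 0 ζ hζ), funext (hadamard_zero P), radial_const]; simp)
  obtain ⟨CT, hCT, hT⟩ := exists_taylor_bound hV x M
  have h2 : ∀ m : ℕ, ∃ C, 0 ≤ C ∧ ∀ ζ, |((m : ℝ) + 1) * Û (m + 1) ζ + radial (Û (m + 1)) ζ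
      - lap (Û m) ζ + V (x + ζ) * Û m ζ| ≤ C * ‖ζ‖ ^ (2 * (Q + D + 1)) := by
    intro m
    obtain ⟨B, hB⟩ := (isCompact_closedBall (0 : E D) 1).bddAbove_image
      (contDiff_hadamard P m).continuous.abs.continuousOn
    have hB0 : 0 ≤ B := (abs_nonneg _).trans (hB (mem_image_of_mem _ (show (0 : E D) ∈ _ by simp)))
    refine exists_global_bound (C := CT * B) ?_ ?_ (by positivity) ?_
    · exact (((continuous_const.mul (hÛ _).continuous).add (continuous_radial (hÛ _))).sub
        (continuous_lap (contDiff_infty.1 (hÛ m) 2))).add (hU.continuous.mul (hÛ m).continuous)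
    · intro ζ hζ
      rw [radial_congr (eventuallyEq_zero_of_support (hs _) hζ), radial_const,
        lap_congr (eventuallyEq_zero_of_support (hs _) hζ), lap_const, hs m ζ hζ, hs (m + 1) ζ hζ]
      simp
    · intro ζ hζ
      rw [radial_congr (hin _ ζ hζ), lap_congr (hin _ ζ hζ), (hin m ζ hζ).eq_of_nhds,
        (hin (m + 1) ζ hζ).eq_of_nhds, hadamard_succ]
      have e : lap (hadamard P m) ζ - eval (fun ν => ζ ν) P * hadamard P m ζ
          - lap (hadamard P m) ζ + V (x + ζ) * hadamard P m ζ
          = (V (x + ζ) - eval (fun ν => ζ ν) P) * hadamard P m ζ := by ring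
      rw [e, abs_mul]
      have hζ1 : ‖ζ‖ ≤ 1 := by linarith
      have i1 := hT ζ hζ1
      have i2 := hB (mem_image_of_mem _ (show ζ ∈ _ by simpa using hζ1))
      calc _ ≤ (CT * ‖ζ‖ ^ (M + 1)) * B := mul_le_mul i1 i2 (abs_nonneg _) (by positivity)
        _ = _ := by rw [show M + 1 = 2 * (Q + D + 1) by omega]; ring
  choose C₂ hC₂ h2 using h2
  obtain ⟨C₃, hC₃, h3⟩ := exists_bound_of_ball (F := fun ζ => V (x + ζ) * Û N ζ - lap (Û N) ζ)
    ((hU.continuous.mul (hÛ N).continuous).sub (continuous_lap (contDiff_infty.1 (hÛ N) 2)))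
    (fun ζ hζ => by
      rw [hs N ζ hζ, lap_congr (eventuallyEq_zero_of_support (hs N) hζ), lap_const]; simp)
  have hsum : 0 ≤ ∑ m ∈ ℛ N, C₂ m := sum_nonneg fun m _ => hC₂ m
  obtain ⟨C', hC'⟩ := hk.exists_diagonal_bound hU.continuous hÛ hs h0 hN
    (C := C₁ + (∑ m ∈ ℛ N, C₂ m) + C₃) (by positivity)
    (fun ζ => (h1 ζ).trans (mul_le_mul_of_nonneg_right (by linarith) (by positivity)))
    (fun m hm ζ => (h2 m ζ).trans (mul_le_mul_of_nonneg_right (by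
      have := single_le_sum (f := C₂) (fun m _ => hC₂ m) (Finset.mem_range.2 hm)
      linarith) (by positivity)))
    (fun ζ => (h3 ζ).trans (by linarith))
  refine ⟨C', fun T hT => ?_⟩
  have e : series Û N T 0 = ∑ m ∈ ℛ (Q + D + 1), T ^ m * heatCoef freeD m 𝒿 :=
    sum_congr rfl fun m hm => by rw [hval m (by have := Finset.mem_range.1 hm; omega)]
  rw [← e]
  exact hC' T hT

lemma pd_two_eq {f : E D → ℝ} (hf : ContDiff ℝ 2 f) (μ : Fin D) (y : E D) :
    pd f y ![μ, μ] = dd μ (dd μ f) y := by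
  have hd : DifferentiableAt ℝ (fderiv ℝ f) y :=
    (hf.fderiv_right (m := 1) (by norm_num)).differentiable (by norm_num) y
  rw [dd_eq, dd_eq_fderiv, fderiv_clm_apply hd (by fun_prop), pd, iteratedFDeriv_two_apply]
  simp

lemma IsHeatKernel.isFundamental {V : E D → ℝ} {K : ℝ → E D → E D → ℝ} (hK : IsHeatKernel V K)
    (x : E D) : IsFundamental (fun ζ => V (x + ζ)) fun T ζ => K T (x + ζ) x where
  contDiffOn := (hK.contDiffOn x).comp (f := fun q : ℝ × E D => (q.1, x + q.2))
    (contDiff_fst.prodMk (contDiff_const.add contDiff_snd)).contDiffOn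
    fun q hq => ⟨hq.1, mem_univ _⟩
  heat_eq T hT ζ := by
    have hc : ContDiff ℝ 2 fun y => K T y x :=
      contDiffOn_univ.1 ((hK.contDiffOn x).comp (f := fun y : E D => (T, y))
        (contDiff_const.prodMk contDiff_id).contDiffOn fun _ _ => ⟨hT, mem_univ _⟩)
    refine (hK.heat_eq T hT (x + ζ) x).congr_deriv ?_
    congr 1
    refine sum_congr rfl fun μ _ => ?_
    rw [pd_two_eq hc, show (dd μ fun ζ => K T (x + ζ) x)
      = fun ζ => dd μ (fun y => K T y x) (x + ζ) from
        funext (dd_translate (fun y => K T y x) x μ), dd_translate]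
  initial φ hφ hc := by
    have h := hK.initial (fun y => φ (y - x)) (hφ.comp (continuous_id.sub continuous_const))
      (hc.comp_homeomorph (Homeomorph.subRight x)) x
    rw [sub_self] at h
    refine h.congr fun T => ?_
    rw [← integral_add_left_eq_self _ x]
    simp

/-- The diagonal of the heat kernel has an asymptotic expansion with coefficients `heatCoef`. -/
lemma IsHeatKernel.isBigO {V : E D → ℝ} (hV : Smooth V) {K : ℝ → E D → E D → ℝ}
    (hK : IsHeatKernel V K) (x : E D) (N : ℕ) :
    (fun T => (4 * Real.pi * T) ^ ((D : ℝ) / 2) * K T x x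
      - ∑ m ∈ ℛ (N + 1), heatCoef freeD m 𝒿 * T ^ m)
      =O₀ (N + 1) := by
  have hp := pi_pos
  obtain ⟨C, hC⟩ := (hK.isFundamental x).exists_heatCoef_bound hV x N
  have hI : Ioc (0 : ℝ) 1 ∈ 𝓝[>] (0 : ℝ) := Ioc_mem_nhdsGT one_pos
  have h1 : (fun T => (4 * Real.pi * T) ^ ((D : ℝ) / 2) * K T x x
      - ∑ m ∈ ℛ (N + D + 1), heatCoef freeD m 𝒿 * T ^ m)
      =O₀ (N + 1) := by
    refine IsBigO.of_bound ((4 * Real.pi) ^ ((D : ℝ) / 2) * C) ?_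
    filter_upwards [hI] with T hT
    have hT0 := hT.1
    have h := hC T hT
    simp only [add_zero] at h
    have e : (4 * Real.pi * T) ^ ((D : ℝ) / 2) * K T x x
        - ∑ m ∈ ℛ (N + D + 1), heatCoef freeD m 𝒿 * T ^ m
        = (4 * Real.pi * T) ^ ((D : ℝ) / 2) * (K T x x - gk T (0 : E D) *
          ∑ m ∈ ℛ (N + D + 1), T ^ m * heatCoef freeD m 𝒿) := by
      rw [mul_sub, ← mul_assoc, gk_zero, ← Real.rpow_add (by positivity), add_neg_cancel,
        Real.rpow_zero, one_mul]
      simp only [mul_comm]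
    rw [e, norm_mul, Real.norm_of_nonneg (by positivity), norm_eq_abs, norm_eq_abs,
      abs_of_pos (pow_pos hT0 (N + 1)), mul_assoc (_ ^ _) C]
    have h4 : (4 * Real.pi * T) ^ ((D : ℝ) / 2) ≤ (4 * Real.pi) ^ ((D : ℝ) / 2) :=
      Real.rpow_le_rpow (by positivity) (mul_le_of_le_one_right (by positivity) hT.2) (by positivity)
    exact mul_le_mul h4 h (abs_nonneg _) (by positivity)
  have h2 : (fun T : ℝ => ∑ m ∈ ℛ D, heatCoef freeD (N + 1 + m) 𝒿
      * T ^ (N + 1 + m)) =O₀ (N + 1) := by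
    refine IsBigO.fun_sum fun m _ => (IsBigO.const_mul_left ?_ _)
    refine IsBigO.of_bound 1 ?_
    filter_upwards [hI] with T hT
    rw [pow_add, norm_mul, one_mul]
    refine mul_le_of_le_one_right (norm_nonneg _) ?_
    rw [norm_pow, Real.norm_of_nonneg hT.1.le]
    exact pow_le_one₀ hT.1.le hT.2
  refine (h1.add h2).congr_left fun T => ?_
  rw [show N + D + 1 = (N + 1) + D by omega, Finset.sum_range_add]
  ring

end

section

open MvPolynomial

set_option hygiene false in
local notation "𝒮" => PowerSeries (JetPoly D)
set_option hygiene false in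
local notation:max "𝓜" p:max => PowerSeries.map (restrictHom (D := D) p).toRingHom
local notation "osc" => fun k : ℕ => k = 1 ∨ k = 2

/-! ### The generalized heat kernel coefficients -/

variable {D : ℕ} {κ : ℝ → ℝ → ℝ} (hκ : 𝒞₂ κ)

lemma heatCoef_zero (κ : ℝ → ℝ → ℝ) (v : Jet D) : heatCoef κ 0 v = 1 := by
  simp [heatCoef, wj, cube, Measure.real, Real.volume_Icc_pi]

include hκ in
lemma exists_heatPoly (m : ℕ) :
    ∃ P : JetPoly D, ∀ v : Jet D, eval v P = heatCoef κ m v := by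
  have h : ∀ p : ℕ × ℕ, ∃ P : JetPoly D, ∀ v : Jet D, eval v P = ∫ τ in cube p.1,
      1 * wj (freeCov κ τ) p.2 fun _ : Fin p.1 => v := fun p =>
    exists_jetPoly_integral_wj (fun f hf => integrable_cube _ hf)
      (fun α β => freeCov_continuous hκ α β) p.2 _ continuous_const (fun _ i => i)
  choose P hP using h
  refine ⟨∑ p ∈ antidiagonal m,
    MvPolynomial.C ((-1) ^ p.1 / (p.1.factorial : ℝ)) * P p, fun v => ?_⟩
  rw [map_sum]
  refine sum_congr rfl fun p _ => ?_
  simp_all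

def heatPoly (m : ℕ) : JetPoly D := (exists_heatPoly hκ m).choose

lemma eval_heatPoly (m : ℕ) (v : Jet D) : eval v (heatPoly hκ m) = heatCoef κ m v :=
  (exists_heatPoly hκ m).choose_spec v

section Restrict

variable (p : ℕ → Prop) [DecidablePred p]

/-- The jet without the derivatives of certain orders. -/
def Jet.restrict (v : Jet D) : Jet D := fun i => if p i.1 then v i else 0

lemma Jet.Sym.restrict {v : Jet D} (hv : v.Sym) : (v.restrict p).Sym := by
  intro k μ σ
  simp only [Jet.restrict, hv k μ σ]

def restrictHom : JetPoly D →ₐ[ℝ] JetPoly D := aeval fun i => if p i.1 then X i else 0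

lemma eval_restrictHom (v : Jet D) (P : JetPoly D) :
    eval v (restrictHom p P) = eval (v.restrict p) P := by
  induction P using MvPolynomial.induction_on with
  | C a => simp [restrictHom]
  | add P Q hP hQ => simp_all
  | mul_X P i hP =>
    rw [map_mul, map_mul, map_mul, hP, eval_X]
    congr 1
    simp only [restrictHom, aeval_X, Jet.restrict]
    split_ifs <;> simp

variable {p} in
lemma restrictHom_comp {q r : ℕ → Prop} [DecidablePred q] [DecidablePred r]
    (h : ∀ k, r k ↔ p k ∧ q k) (P : JetPoly D) :
    restrictHom p (restrictHom q P) = restrictHom r P := by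
  refine MvPolynomial.funext fun v => ?_
  rw [eval_restrictHom, eval_restrictHom, eval_restrictHom]
  congr 2
  funext i
  simp only [Jet.restrict, h]
  grind

open Classical in
lemma coeff_restrictHom (P : JetPoly D) (m : ((k : ℕ) × (Fin k → Fin D)) →₀ ℕ) :
    coeff m (restrictHom p P) = if ∀ i ∈ m.support, p i.1 then coeff m P else 0 := by
  induction P using MvPolynomial.induction_on' with
  | add P Q hP hQ => rw [map_add, coeff_add, coeff_add, hP, hQ]; split_ifs <;> simp
  | monomial u a =>
    by_cases hu : ∀ i ∈ u.support, p i.1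
    · have e : restrictHom p (monomial u a) = monomial u a := by
        rw [restrictHom, aeval_monomial, monomial_eq]
        congr 1
        exact prod_congr rfl fun i hi => by grind
      rw [e, coeff_monomial]
      grind
    · have e : restrictHom p (monomial u a) = 0 := by
        push Not at hu
        obtain ⟨i, hi, hpi⟩ := hu
        rw [restrictHom, aeval_monomial, Finsupp.prod, prod_eq_zero hi, mul_zero]
        simp_all
      rw [e, coeff_zero, coeff_monomial]
      grind

end Restrict

lemma higherOnly_of_restrictHom {P : JetPoly D} (h1 : restrictHom (1 ≤ ·) P = P)
    (h2 : restrictHom osc P = 0) : P.HigherOnly := by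
  classical
  intro m hm
  have hm' := MvPolynomial.mem_support_iff.1 hm
  have h3 : ∀ i ∈ m.support, 1 ≤ i.1 := by
    by_contra h
    rw [← h1, coeff_restrictHom, if_neg h] at hm'
    exact hm' rfl
  refine ⟨?_, h3⟩
  by_contra h
  push Not at h
  have h4 := congrArg (coeff m) h2
  rw [coeff_restrictHom, if_pos, coeff_zero] at h4
  · exact hm' h4
  grind

/-- The generating series of the heat kernel coefficients. -/
def heatSeries : 𝒮 := PowerSeries.mk (heatPoly hκ)

/-- The heat kernel coefficients without the undifferentiated potential. -/
def reducedSeries : 𝒮 := 𝓜 (1 ≤ ·) (heatSeries hκ)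

/-- The heat kernel coefficients of the harmonic oscillator. -/
def oscillatorSeries : 𝒮 := 𝓜 osc (heatSeries hκ)

/-- The generalized heat kernel coefficients. -/
def resummedSeries : 𝒮 := reducedSeries hκ * PowerSeries.invOfUnit (oscillatorSeries hκ) 1

lemma heatPoly_zero : heatPoly hκ 0 = (1 : JetPoly D) := by
  refine MvPolynomial.funext fun v => ?_
  rw [eval_heatPoly, heatCoef_zero, map_one]

lemma constantCoeff_oscillatorSeries :
    PowerSeries.constantCoeff (oscillatorSeries hκ : 𝒮) = ((1 : (JetPoly D)ˣ) : JetPoly D) := by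
  rw [← PowerSeries.coeff_zero_eq_constantCoeff_apply, oscillatorSeries, PowerSeries.coeff_map,
    heatSeries, PowerSeries.coeff_mk, heatPoly_zero, map_one, Units.val_one]

lemma resummedSeries_mul :
    resummedSeries hκ * oscillatorSeries hκ = (reducedSeries hκ : 𝒮) := by
  rw [resummedSeries, mul_assoc, mul_comm (PowerSeries.invOfUnit _ _),
    PowerSeries.mul_invOfUnit _ _ (constantCoeff_oscillatorSeries hκ), mul_one]

lemma isUnit_oscillatorSeries : IsUnit (oscillatorSeries hκ : 𝒮) :=
  IsUnit.of_mul_eq_one _ (PowerSeries.mul_invOfUnit _ 1 (constantCoeff_oscillatorSeries hκ))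

lemma map_map_heatSeries {p q r : ℕ → Prop} [DecidablePred p] [DecidablePred q] [DecidablePred r]
    (h : ∀ k, r k ↔ p k ∧ q k) :
    𝓜 p (𝓜 q (heatSeries hκ)) = 𝓜 r (heatSeries hκ) := by
  ext1 n
  rw [PowerSeries.coeff_map, PowerSeries.coeff_map, PowerSeries.coeff_map]
  exact restrictHom_comp h _

lemma map_resummedSeries_one :
    𝓜 (1 ≤ ·) (resummedSeries hκ) = resummedSeries hκ := by
  have h := congrArg (𝓜 (1 ≤ ·)) (resummedSeries_mul hκ)
  rw [map_mul, oscillatorSeries, reducedSeries, map_map_heatSeries hκ (r := osc) (by grind),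
    map_map_heatSeries hκ (r := (1 ≤ ·)) (by grind), ← oscillatorSeries, ← reducedSeries,
    ← resummedSeries_mul] at h
  exact (isUnit_oscillatorSeries hκ).mul_right_cancel h

lemma map_resummedSeries_two :
    𝓜 osc (resummedSeries hκ) = 1 := by
  have h := congrArg (𝓜 osc) (resummedSeries_mul hκ)
  rw [map_mul, oscillatorSeries, reducedSeries, map_map_heatSeries hκ (r := osc) (by grind),
    map_map_heatSeries hκ (r := osc) (by grind), ← oscillatorSeries] at h
  exact (isUnit_oscillatorSeries hκ).mul_right_cancel (h.trans (one_mul _).symm)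

lemma higherOnly_resummedSeries {j : ℕ} (hj : 1 ≤ j) :
    (PowerSeries.coeff j (resummedSeries hκ : 𝒮)).HigherOnly := by
  refine higherOnly_of_restrictHom ?_ ?_
  · have h := congrArg (PowerSeries.coeff j) (map_resummedSeries_one (D := D) hκ)
    simp_all
  · have h := congrArg (PowerSeries.coeff j) (map_resummedSeries_two (D := D) hκ)
    rwa [PowerSeries.coeff_map, PowerSeries.coeff_one, if_neg (by omega)] at h

/-! ### Asymptotic expansions -/

lemma isBigO_mul_polynomial {f : ℝ → ℝ} {a : ℕ → ℝ} {N : ℕ}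
    (hf : (fun T => f T - ∑ m ∈ ℛ (N + 1), a m * T ^ m) =O₀ (N + 1))
    (b : ℕ → ℝ) :
    (fun T => f T * (∑ m ∈ ℛ (N + 1), b m * T ^ m) - ∑ m ∈ ℛ (N + 1),
      (∑ p ∈ antidiagonal m, a p.1 * b p.2) * T ^ m)
      =O₀ (N + 1) := by
  have h1 := isBigO_truncate N (fun _ => N + 1) (fun _ => le_rfl) fun n k => a n * b k
  have h2 : (fun T : ℝ => ∑ m ∈ ℛ (N + 1), b m * T ^ m) =O[𝓝[>] 0] fun _ => (1 : ℝ) :=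
    IsBigO.fun_sum fun m _ => by simpa using isBigO_const_mul_pow (b m) (Nat.zero_le m)
  have h3 := hf.mul h2
  simp only [mul_one] at h3
  refine (h3.add h1).congr_left fun T => ?_
  have e : (∑ m ∈ ℛ (N + 1), a m * T ^ m) * (∑ m ∈ ℛ (N + 1), b m * T ^ m)
      = ∑ n ∈ ℛ (N + 1), ∑ k ∈ ℛ (N + 1), a n * b k * T ^ (n + k) := by
    rw [Finset.sum_mul_sum]
    grind
  rw [← e]
  ring

lemma isBigO_of_mul {f n g : ℝ → ℝ} (hn : Tendsto n (𝓝[>] 0) (𝓝 1))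
    (h : (fun T => n T * f T) =O[𝓝[>] 0] g) : f =O[𝓝[>] 0] g := by
  have h1 : (fun T => (n T)⁻¹) =O[𝓝[>] 0] fun _ => (1 : ℝ) := (hn.inv₀ one_ne_zero).isBigO_one ℝ
  have h2 := h1.mul h
  simp only [one_mul] at h2
  refine h2.congr' ?_ .rfl
  filter_upwards [hn.eventually_ne one_ne_zero] with T hT
  simp_all

section Resummed

variable (𝒦 : KernelDatum) (S : Spectrum D)

lemma redTerm_zero (v : Jet D) (T : ℝ) (k : Fin 0 → ℕ) : redTerm 𝒦 S v T 0 k = 1 := by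
  simp [redTerm, pt, cube, Measure.real, Real.volume_Icc_pi, W_one]

lemma redSum_of_piece {v w : Jet D} (h1 : w.grad = v.grad) (h3 : ∀ k, 3 ≤ k → piece w k = piece v k)
    (N : ℕ) (T : ℝ) : redSum 𝒦 S w N T = redSum 𝒦 S v N T := by
  refine sum_congr rfl fun n _ => sum_congr rfl fun k hk => ?_
  have hk' := fun i => (Finset.mem_Icc.1 (Fintype.mem_piFinset.1 (Finset.mem_filter.1 hk).1 i)).1
  rw [redTerm, redTerm, h1, show (fun i => piece w (k i)) = fun i => piece v (k i) from
    funext fun i => h3 _ (hk' i)]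

lemma redSum_of_piece_zero {v : Jet D} (h3 : ∀ k, 3 ≤ k → piece v k = 0) (N : ℕ) (T : ℝ) :
    redSum 𝒦 S v N T = 1 := by
  rw [redSum, sum_eq_single 0]
  · rw [sum_congr rfl fun k _ => redTerm_zero 𝒦 S v T k]
    simp
  · intro n _ hn
    refine sum_eq_zero fun k hk => ?_
    have hk' := fun i => (Finset.mem_Icc.1 (Fintype.mem_piFinset.1 (Finset.mem_filter.1 hk).1 i)).1
    have hz : pt (fun i => piece v (k i)) = 0 := by
      rw [pt]
      refine prod_eq_zero (Finset.mem_univ (⟨0, Nat.pos_of_ne_zero hn⟩ : Fin n)) ?_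
      rw [h3 _ (hk' _)]
      simp [vtx]
    rw [redTerm, hz]
    simp
  · simp

lemma piece_restrict (p : ℕ → Prop) [DecidablePred p] (v : Jet D) {k : ℕ} (hk : p k) :
    piece (v.restrict p) k = piece v k := by simp [piece, Jet.restrict, hk]

lemma piece_restrict_zero (p : ℕ → Prop) [DecidablePred p] (v : Jet D) {k : ℕ} (hk : ¬ p k) :
    piece (v.restrict p) k = 0 := by simp [piece, Jet.restrict, hk]

variable {v : Jet D} (hv : v.Sym) (hH : ∀ μ ν, v ⟨2, ![μ, ν]⟩ = S.mat S.η μ ν)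
include hv hH

lemma tendsto_normFn : Tendsto (fun T => normFn 𝒦 S v.val0 v.grad T 1) (𝓝[>] 0) (𝓝 1) := by
  have h := resummation 𝒦 S v hv hH 0
  have e : ∀ T, redSum 𝒦 S v 0 T = 1 := fun T => by
    rw [redSum, Finset.sum_range_one, sum_congr rfl fun k _ => redTerm_zero 𝒦 S v T k]
    simp
  simp only [e, mul_one, zero_add, Finset.sum_range_one, heatCoef_zero, pow_zero, pow_one] at h
  simpa using (h.trans_tendsto (tendsto_id.mono_left nhdsWithin_le_nhds)).add_const 1

lemma normFn_isBigO (hκ : 𝒞₂ (𝒦.k 0)) (N : ℕ) : (fun T => normFn 𝒦 S 0 v.grad T 1 - ∑ m ∈ ℛ (N + 1),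
      eval v (PowerSeries.coeff m (oscillatorSeries hκ)) * T ^ m)
      =O₀ (N + 1) := by
  have h := resummation 𝒦 S (v.restrict osc) (hv.restrict _)
    (fun μ ν => by simp [Jet.restrict, hH]) N
  have e : ∀ T, redSum 𝒦 S (v.restrict osc) N T = 1 :=
    redSum_of_piece_zero 𝒦 S (fun k hk => piece_restrict_zero _ _ (by omega)) N
  simp only [e, mul_one] at h
  refine h.congr_left fun T => ?_
  congr 1
  refine sum_congr rfl fun m _ => ?_
  rw [oscillatorSeries, PowerSeries.coeff_map, heatSeries, PowerSeries.coeff_mk, ← eval_heatPoly hκ,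
    ← eval_restrictHom]
  rfl

lemma normFn_mul_redSum_isBigO (hκ : 𝒞₂ (𝒦.k 0)) (N : ℕ) :
    (fun T => normFn 𝒦 S 0 v.grad T 1 * redSum 𝒦 S v N T - ∑ m ∈ ℛ (N + 1),
      eval v (PowerSeries.coeff m (reducedSeries hκ)) * T ^ m)
      =O₀ (N + 1) := by
  have h := resummation 𝒦 S (v.restrict (1 ≤ ·)) (hv.restrict _)
    (fun μ ν => by simp [Jet.restrict, hH]) N
  have hg : (v.restrict (1 ≤ ·)).grad = v.grad := by rfl
  have h0 : (v.restrict (1 ≤ ·)).val0 = 0 := by rfl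
  have e : ∀ T, redSum 𝒦 S (v.restrict (1 ≤ ·)) N T = redSum 𝒦 S v N T :=
    redSum_of_piece 𝒦 S hg (fun k hk => piece_restrict _ _ (by omega)) N
  simp only [e, hg, h0] at h
  refine h.congr_left fun T => ?_
  congr 1
  refine sum_congr rfl fun m _ => ?_
  rw [reducedSeries, PowerSeries.coeff_map, heatSeries, PowerSeries.coeff_mk, ← eval_heatPoly hκ,
    ← eval_restrictHom]
  rfl

/-- The perturbative expansion around the full Green function in powers of `T`. -/
lemma redSum_isBigO (hκ : 𝒞₂ (𝒦.k 0)) (N : ℕ) : (fun T => redSum 𝒦 S v N T - ∑ m ∈ ℛ (N + 1),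
      eval v (PowerSeries.coeff m (resummedSeries hκ)) * T ^ m)
      =O₀ (N + 1) := by
  have h1 := normFn_mul_redSum_isBigO 𝒦 S hv hH hκ N
  have h2 := isBigO_mul_polynomial (normFn_isBigO 𝒦 S hv hH hκ N)
    fun m => eval v (PowerSeries.coeff m (resummedSeries hκ))
  have ht : Tendsto (fun T => normFn 𝒦 S 0 v.grad T 1) (𝓝[>] 0) (𝓝 1) :=
    tendsto_normFn 𝒦 S (v := v.restrict (1 ≤ ·)) (hv.restrict _)
      (fun μ ν => by simp [Jet.restrict, hH])
  refine isBigO_of_mul ht ((h1.sub h2).congr_left fun T => ?_)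
  have e : ∀ m, eval v (PowerSeries.coeff m (reducedSeries hκ))
      = ∑ p ∈ antidiagonal m, eval v (PowerSeries.coeff p.1 (oscillatorSeries hκ))
        * eval v (PowerSeries.coeff p.2 (resummedSeries hκ)) := fun m => by
    rw [← resummedSeries_mul, mul_comm, PowerSeries.coeff_mul, map_sum]
    simp
  simp only [e]
  ring

end Resummed

end

section

set_option hygiene false in
local notation "𝓢" => hessSpectrum hV x

/-! ### The heat kernel and the worldline expansions -/

variable {D : ℕ}

lemma JetPoly.val_eq (P : JetPoly D) (V : E D → ℝ) (x : E D) :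
    P.val V x = MvPolynomial.eval 𝒿 P := rfl

def freeSI (s t : ℝ) : ℝ := 1 / 6 - |s - t| + (s - t) ^ 2

lemma periodic_k_zero : periodic.k 0 = freeSI := by
  ext s t
  simp only [periodic, zero_div, gSI_zero, freeSI]

lemma continuous_freeSI : 𝒞₂ freeSI := by unfold freeSI; fun_prop

lemma continuous_dirichlet_k_zero : 𝒞₂ (dirichlet.k 0) := by
  rw [dirichlet_k_zero]; exact continuous_freeD

lemma continuous_periodic_k_zero : 𝒞₂ (periodic.k 0) := by
  rw [periodic_k_zero]; exact continuous_freeSI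

lemma eventually_detFn_pos (𝒦 : KernelDatum) (S : Spectrum D) :
    ∀ᶠ T in 𝓝[>] (0 : ℝ), 0 < detFn 𝒦 S (T ^ 2) := by
  have h : Tendsto (fun T : ℝ => T ^ 2) (𝓝[>] 0) (𝓝 0) := by
    have := ((continuous_pow 2).tendsto (0 : ℝ)).mono_left (nhdsWithin_le_nhds (s := Ioi 0))
    simpa using this
  exact ((detFn_tendsto 𝒦 S).comp h).eventually_const_lt one_pos

lemma exp_quadForm_isBigO_one (𝒦 : KernelDatum) (S : Spectrum D) (a : Fin D → ℝ) :
    (fun T => exp (1 / 2 * T ^ 3 * quadForm 𝒦 S a (T ^ 2))) =O[𝓝[>] 0] fun _ => (1 : ℝ) := by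
  refine IsBigO.of_bound (exp (∑ j, S.coord a j ^ 2 * 2)) ?_
  filter_upwards [eventually_admissible 𝒦 S, Ioc_mem_nhdsGT one_pos] with T hA hT
  have hq := quadForm_bound 𝒦 S a (z := T ^ 2) fun j => by
    have := hA.abs_lt (l := 1) ⟨by norm_num, by norm_num⟩ j
    rwa [one_mul] at this
  rw [norm_eq_abs, Real.abs_exp, norm_one, mul_one]
  refine Real.exp_le_exp.2 ((le_abs_self _).trans ?_)
  rw [abs_mul]
  have h3 : |1 / 2 * T ^ 3| ≤ 1 := by
    have h4 := pow_le_one₀ (n := 3) hT.1.le hT.2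
    have h5 := pow_nonneg hT.1.le 3
    rw [abs_of_nonneg (by positivity)]
    linarith
  calc _ ≤ 1 * ∑ j, S.coord a j ^ 2 * 2 := mul_le_mul h3 hq (abs_nonneg _) zero_le_one
    _ = _ := one_mul _

lemma normFn_one (𝒦 : KernelDatum) (S : Spectrum D) (v₀ : ℝ) (a : Fin D → ℝ) (T : ℝ) :
    normFn 𝒦 S v₀ a T 1 = exp (-T * v₀) * exp (1 / 2 * T ^ 3 * quadForm 𝒦 S a (T ^ 2))
      * detFn 𝒦 S (T ^ 2) ^ (-(1 / 2) : ℝ) := by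
  rw [normFn, ← Real.exp_add]
  simp

section

variable {V : E D → ℝ} (hV : Smooth V) (x : E D)
include hV

lemma jetAt_hess (μ ν : Fin D) : 𝒿 ⟨2, ![μ, ν]⟩ = (𝓢).mat (𝓢).η μ ν := by rw [← hess_eq hV x]; rfl

lemma mul_prefactorD {T : ℝ} (hT : 0 < T) :
    (4 * Real.pi * T) ^ ((D : ℝ) / 2) * (prefactorD V x T * exp (1 / 2 * T ^ 3
      * quadForm dirichlet 𝓢 (grad V x) (T ^ 2)))
      = normFn dirichlet 𝓢 (V x) (grad V x) T 1 := by
  have hp := pi_pos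
  have h : (4 * Real.pi * T) ^ ((D : ℝ) / 2) ≠ 0 := by positivity
  rw [normFn_one, prefactorD, ← detFn_dirichlet hV x hT]
  field_simp

lemma mul_prefactorSI {T : ℝ} (hT : 0 < T) (hd : 0 < detFn periodic 𝓢 (T ^ 2)) :
    (4 * Real.pi * T) ^ ((D : ℝ) / 2) * prefactorSI V x T
      = normFn periodic 𝓢 (V x) (grad V x) T 1 := by
  have hp := pi_pos
  have h : (4 * Real.pi * T) ^ ((D : ℝ) / 2) ≠ 0 := by positivity
  have hd' : (detMatSI V x T).det ≠ 0 := by rw [← detFn_periodic hV x hT]; exact hd.ne'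
  rw [normFn_one, prefactorSI, ← detFn_periodic hV x hT, quadForm_periodic hV x hT hd', mul_zero,
    Real.exp_zero, mul_one]
  field_simp

lemma worldlineSum_greenD (N : ℕ) : ∀ᶠ T in 𝓝[>] (0 : ℝ), worldlineSum V x (greenD V x) N T
    = exp (1 / 2 * T ^ 3 * quadForm dirichlet 𝓢 (grad V x) (T ^ 2)) * redSum dirichlet 𝓢 𝒿 N T := by
  filter_upwards [self_mem_nhdsWithin, eventually_admissible dirichlet 𝓢] with T hT hA
  exact worldlineSum_eq dirichlet _ V x _ hT hA (fun s _ t _ μ ν => greenD_scaled hV x hT s t μ ν) N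

lemma worldlineSum_greenSI (N : ℕ) : ∀ᶠ T in 𝓝[>] (0 : ℝ), worldlineSum V x (greenSI V x) N T
    = redSum periodic 𝓢 𝒿 N T := by
  filter_upwards [self_mem_nhdsWithin, eventually_admissible periodic 𝓢,
    eventually_detFn_pos periodic 𝓢] with T hT hA hd
  have hd' : (detMatSI V x T).det ≠ 0 := by rw [← detFn_periodic hV x hT]; exact hd.ne'
  rw [worldlineSum_eq periodic 𝓢 V x _ hT hA
    (fun s _ t _ μ ν => greenSI_scaled hV x hT s t μ ν) N, quadForm_periodic hV x hT hd']
  simp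

variable {K : ℝ → E D → E D → ℝ} (hK : IsHeatKernel V K)
include hK

lemma heat_sub_redSum_isBigO (N : ℕ) : (fun T => K T x x / (prefactorD V x T * exp (1 / 2 * T ^ 3
        * quadForm dirichlet 𝓢 (grad V x) (T ^ 2)))
      - redSum dirichlet 𝓢 𝒿 N T) =O₀ (N + 1) := by
  have hp := pi_pos
  have h1 := hK.isBigO hV x N
  have h2 := resummation dirichlet 𝓢 𝒿 (jetAt_sym hV x) (jetAt_hess hV x) N
  rw [dirichlet_k_zero] at h2
  refine isBigO_of_mul (tendsto_normFn dirichlet 𝓢 (jetAt_sym hV x)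
    (jetAt_hess hV x)) ((h1.sub h2).congr' ?_ EventuallyEq.rfl)
  filter_upwards [self_mem_nhdsWithin, eventually_detFn_pos dirichlet 𝓢] with T hT hd
  have hT' : 0 < T := hT
  have e : normFn dirichlet 𝓢 (𝒿).val0 (𝒿).grad T 1 = normFn dirichlet 𝓢 (V x) (grad V x) T 1 := by
    congr 1
  have h0 : prefactorD V x T * exp (1 / 2 * T ^ 3
        * quadForm dirichlet 𝓢 (grad V x) (T ^ 2)) ≠ 0 := by
    rw [prefactorD, ← detFn_dirichlet hV x hT]
    positivity
  rw [e, ← mul_prefactorD hV x hT]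
  generalize prefactorD V x T * exp (1 / 2 * T ^ 3
    * quadForm dirichlet 𝓢 (grad V x) (T ^ 2)) = c at h0 ⊢
  field_simp
  ring

/-- The worldline path integral computes the heat kernel to all orders. -/
lemma heat_div_prefactorD_isBigO (N : ℕ) :
    (fun T => K T x x / prefactorD V x T - worldlineSum V x (greenD V x) N T) =O₀ (N + 1) := by
  have h := (exp_quadForm_isBigO_one dirichlet 𝓢 (grad V x)).mul (heat_sub_redSum_isBigO hV x hK N)
  simp only [one_mul] at h
  refine h.congr' ?_ EventuallyEq.rfl
  filter_upwards [worldlineSum_greenD hV x N] with T h1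
  rw [h1, mul_sub, ← div_div, mul_div_cancel₀ _ (Real.exp_ne_zero _)]

lemma exists_resummed : ∃ S : ℝ → ℝ,
    (∀ T > 0, 0 < (detMatD V x T).det → K T x x = prefactorD V x T *
      exp (grad V x ⬝ᵥ (expMat V x T *ᵥ grad V x)) * S T) ∧
    ∀ N : ℕ, (fun T => S T - ∑ j ∈ ℛ (N + 1),
      (PowerSeries.coeff j (resummedSeries continuous_dirichlet_k_zero)).val V x * T ^ j)
      =O₀ (N + 1) := by
  refine ⟨fun T => K T x x / (prefactorD V x T * exp (1 / 2 * T ^ 3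
    * quadForm dirichlet 𝓢 (grad V x) (T ^ 2))), fun T hT hd => ?_, fun N => ?_⟩
  · have hp := pi_pos
    have h0 : prefactorD V x T ≠ 0 := by rw [prefactorD]; positivity
    rw [← quadForm_dirichlet hV x hT hd.ne', mul_div_cancel₀]
    exact mul_ne_zero h0 (Real.exp_ne_zero _)
  · refine ((heat_sub_redSum_isBigO hV x hK N).add (redSum_isBigO dirichlet 𝓢
      (jetAt_sym hV x) (jetAt_hess hV x) continuous_dirichlet_k_zero N)).congr_left fun T => ?_
    simp only [JetPoly.val_eq]
    ring

lemma heat_sub_stringInspired_isBigO (N : ℕ) : (fun T => (4 * Real.pi * T) ^ ((D : ℝ) / 2) *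
        (K T x x - prefactorSI V x T * worldlineSum V x (greenSI V x) N T)
      - ∑ n ∈ ℛ (N + 1), (heatCoef freeD n 𝒿 - heatCoef freeSI n 𝒿) * T ^ n) =O₀ (N + 1) := by
  have h1 := hK.isBigO hV x N
  have h2 := resummation periodic 𝓢 𝒿 (jetAt_sym hV x) (jetAt_hess hV x) N
  rw [periodic_k_zero] at h2
  refine (h1.sub h2).congr' ?_ EventuallyEq.rfl
  filter_upwards [self_mem_nhdsWithin, eventually_detFn_pos periodic 𝓢,
    worldlineSum_greenSI hV x N] with T hT hd hw
  have e : normFn periodic 𝓢 (𝒿).val0 (𝒿).grad T 1 = normFn periodic 𝓢 (V x) (grad V x) T 1 := by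
    congr 1
  rw [e, ← mul_prefactorSI hV x hT hd, hw]
  simp only [sub_mul, sum_sub_distrib]
  ring

end

lemma worldlineSum_greenSI_isBigO {V : E D → ℝ} (hV : Smooth V) (x : E D) (N : ℕ) :
    (fun T => worldlineSum V x (greenSI V x) N T - (1 + ∑ j ∈ ℛ (N + 1),
      (PowerSeries.coeff j (resummedSeries continuous_periodic_k_zero - 1)).val V x * T ^ j))
      =O₀ (N + 1) := by
  refine (redSum_isBigO periodic 𝓢 (jetAt_sym hV x) (jetAt_hess hV x)
    continuous_periodic_k_zero N).congr' ?_ EventuallyEq.rfl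
  filter_upwards [worldlineSum_greenSI hV x N] with T hw
  have h1 : ∑ j ∈ ℛ (N + 1), MvPolynomial.eval 𝒿
      (PowerSeries.coeff j (1 : PowerSeries (JetPoly D))) * T ^ j = 1 := by
    rw [sum_range_succ']
    simp [PowerSeries.coeff_one]
  have h2 : ∑ j ∈ ℛ (N + 1), (PowerSeries.coeff j
      (resummedSeries continuous_periodic_k_zero - 1)).val V x * T ^ j
      = ∑ j ∈ ℛ (N + 1), MvPolynomial.eval 𝒿
        (PowerSeries.coeff j (resummedSeries continuous_periodic_k_zero)) * T ^ j - 1 := by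
    rw [← h1, ← sum_sub_distrib]
    refine sum_congr rfl fun j _ => ?_
    rw [JetPoly.val_eq, map_sub (PowerSeries.coeff j), map_sub, sub_mul]
  rw [hw, h2]
  ring

end

section

/-! ### Total divergences -/

variable {D n : ℕ}

lemma addD_addD_comm {V : Fin n → E D → ℝ} (hV : ∀ i, Smooth (V i)) (α β γ δ : 𝕁 n) :
    addD γ (addD δ (addD α (addD β V))) = addD α (addD β (addD γ (addD δ V))) := by
  rw [addD_comm (addD_contDiff hV β) δ α, addD_comm hV δ β,
    addD_comm (addD_contDiff (addD_contDiff hV δ) β) γ α, addD_comm (addD_contDiff hV δ) γ β]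

lemma wj_succ_jetAt (C : 𝕁 n → 𝕁 n → ℝ) (k : ℕ) {V : Fin n → E D → ℝ}
    (hV : ∀ i, Smooth (V i)) (x : E D) :
    wj C (k + 1) (fun i => jetAt (V i) x) = (1 / (2 * ((k : ℝ) + 1))) * ∑ α, ∑ β,
      C α β * wj C k (fun i => jetAt (addD α (addD β V) i) x) := by
  rw [wj]
  simp only [addDeriv_jetAt hV, addDeriv_jetAt (addD_contDiff hV _)]

lemma hasDerivAt_wj (x : E D) {C : ℝ → 𝕁 n → 𝕁 n → ℝ}
    {C' : 𝕁 n → 𝕁 n → ℝ} {l : ℝ}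
    (hC : ∀ α β, HasDerivAt (fun l => C l α β) (C' α β) l) (k : ℕ) {V : Fin n → E D → ℝ}
    (hV : ∀ i, Smooth (V i)) :
    HasDerivAt (fun l => wj (C l) (k + 1) (fun i => jetAt (V i) x))
      (1 / 2 * ∑ α, ∑ β, C' α β * wj (C l) k (fun i => jetAt (addD α (addD β V) i) x)) l := by
  induction k generalizing V with
  | zero =>
    simp only [fun l => wj_succ_jetAt (C l) 0 hV x]
    refine ((HasDerivAt.fun_sum fun α _ => HasDerivAt.fun_sum fun β _ =>
      (hC α β).mul_const _).const_mul _).congr_deriv ?_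
    rw [show (1 / (2 * (((0 : ℕ) : ℝ) + 1))) = 1 / 2 by norm_num]
    rfl
  | succ k ih =>
    simp only [fun l => wj_succ_jetAt (C l) (k + 1) hV x]
    refine ((HasDerivAt.fun_sum fun α _ => HasDerivAt.fun_sum fun β _ =>
      (hC α β).mul (ih (addD_contDiff (addD_contDiff hV β) α))).const_mul _).congr_deriv ?_
    have e : ∑ α, ∑ β, C l α β * (1 / 2 * ∑ γ, ∑ δ, C' γ δ *
        wj (C l) k (fun i => jetAt (addD γ (addD δ (addD α (addD β V))) i) x))
        = ((k : ℝ) + 1) * ∑ γ, ∑ δ, C' γ δ * wj (C l) (k + 1) (fun i => jetAt (addD γ (addD δ V) i) x) := by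
      simp only [fun γ δ => wj_succ_jetAt (C l) k (addD_contDiff (addD_contDiff hV δ) γ) x, mul_sum]
      rw [sum_congr rfl fun α _ => sum_comm, sum_comm]
      refine sum_congr rfl fun γ _ => ?_
      rw [sum_congr rfl fun α _ => sum_comm, sum_comm]
      refine sum_congr rfl fun δ _ => sum_congr rfl fun α _ => sum_congr rfl fun β _ => ?_
      rw [addD_addD_comm hV α β γ δ]
      field_simp
    simp only [sum_add_distrib, e]
    grind

def shiftFn (s : ℝ) : ℝ := 1 / 12 - s * (1 - s)

lemma freeSI_eq (s t : ℝ) : freeSI s t = freeD s t + (shiftFn s + shiftFn t) := by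
  rw [freeSI, freeD, shiftFn, shiftFn]; ring

def pathCov (q : ℝ × (Fin n → ℝ)) : 𝕁 n → 𝕁 n → ℝ :=
  freeCov (fun s t => freeD s t + q.1 * (shiftFn s + shiftFn t)) q.2

lemma continuous_pathCov (α β : 𝕁 n) :
    Continuous fun q : ℝ × (Fin n → ℝ) => pathCov q α β := by
  unfold pathCov freeCov freeD shiftFn
  split_ifs <;> fun_prop

/-- The measure on the space of the interpolation parameter and the positions of the vertices. -/
def pathMeasure (n : ℕ) : Measure (ℝ × (Fin n → ℝ)) :=
  (volume.restrict (Icc 0 1)).prod (volume.restrict (cube n))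

lemma integrable_pathMeasure {f : ℝ × (Fin n → ℝ) → ℝ} (hf : Continuous f) :
    Integrable f (pathMeasure n) := by
  rw [pathMeasure, Measure.prod_restrict]
  exact hf.continuousOn.integrableOn_compact (isCompact_Icc.prod isCompact_cube)

lemma integral_pathMeasure {f : ℝ × (Fin n → ℝ) → ℝ} (hf : Continuous f) :
    ∫ q, f q ∂pathMeasure n = ∫ τ in cube n, ∫ l in (0 : ℝ)..1, f (l, τ) := by
  have h := integral_prod_symm f (integrable_pathMeasure hf)
  rw [← pathMeasure] at h
  rw [h]
  congr 1; ext τ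
  rw [integral_of_le zero_le_one, integral_Icc_eq_integral_Ioc]

lemma exists_currentPoly (k : ℕ) (i : Fin n) (μ : Fin D) : ∃ P : JetPoly D,
    ∀ V : E D → ℝ, Smooth V → ∀ y, P.val V y = ∫ q, shiftFn (q.2 i) *
      wj (pathCov q) k (fun j => jetAt (addD (i, μ) (fun _ => V) j) y) ∂pathMeasure n := by
  have hc : Continuous fun q : ℝ × (Fin n → ℝ) => shiftFn (q.2 i) := by unfold shiftFn; fun_prop
  obtain ⟨P, hP⟩ := exists_jetPoly_integral_wj (m := pathMeasure n)
    (fun f hf => integrable_pathMeasure hf) (continuous_pathCov (D := D)) k _ hc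
    (fun j => if j = i then consIdx μ else id)
  refine ⟨P, fun V hV y => ?_⟩
  rw [JetPoly.val_eq, hP]
  congr 1; ext q
  congr 2
  funext j
  rw [← congrFun (addDeriv_jetAt (V := fun _ : Fin n => V) (fun _ => hV) (i, μ) y) j]
  by_cases h : j = i
  · subst h; simp [addDeriv]; rfl
  · simp [addDeriv, h]

lemma half_sum_shift (r : Fin n → ℝ) {w : 𝕁 n → 𝕁 n → ℝ} (hw : ∀ α β, w α β = w β α) :
    1 / 2 * ∑ α, ∑ β, (if α.2 = β.2 then r α.1 + r β.1 else 0) * w α β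
      = ∑ i, ∑ μ, r i * ∑ j, w (j, μ) (i, μ) := by
  have h1 : ∀ f : 𝕁 n → 𝕁 n → ℝ,
      ∑ α, ∑ β, (if α.2 = β.2 then f α β else 0) = ∑ i, ∑ μ, ∑ j, f (i, μ) (j, μ) := by
    intro f
    simp only [Fintype.sum_prod_type]
    simp
  simp only [ite_mul, zero_mul]
  rw [h1]
  simp only [add_mul, sum_add_distrib]
  have h2 : ∑ i, ∑ μ, ∑ j, r j * w (i, μ) (j, μ) = ∑ i, ∑ μ, ∑ j, r i * w (i, μ) (j, μ) := by
    rw [sum_congr rfl fun i _ => sum_comm, sum_comm]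
    refine sum_congr rfl fun i _ => ?_
    rw [sum_comm]
    grind
  rw [h2]
  have h3 : ∑ i, ∑ μ, ∑ j, r i * w (i, μ) (j, μ) = ∑ i, ∑ μ, r i * ∑ j, w (j, μ) (i, μ) :=
    sum_congr rfl fun i _ => sum_congr rfl fun μ _ => by rw [mul_sum]; grind
  rw [h3]
  ring

lemma integral_wj_sub {V : E D → ℝ} (hV : Smooth V) (k : ℕ) (x : E D) :
    (∫ τ in cube n, wj (freeCov freeSI τ) (k + 1) (fun _ : Fin n => 𝒿))
      - ∫ τ in cube n, wj (freeCov freeD τ) (k + 1) (fun _ : Fin n => 𝒿)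
      = ∑ i : Fin n, ∑ μ : Fin D, dd μ (fun y => ∫ q, shiftFn (q.2 i) *
        wj (pathCov q) k (fun j => jetAt (addD (i, μ) (fun _ => V) j) y) ∂pathMeasure n) x := by
  have hVs : ∀ _ : Fin n, Smooth V := fun _ => hV
  have hc : ∀ i, Continuous fun q : ℝ × (Fin n → ℝ) => shiftFn (q.2 i) := fun i => by
    unfold shiftFn; fun_prop
  have hcw : ∀ (i : Fin n) (W : Fin n → Jet D),
      Continuous fun q : ℝ × (Fin n → ℝ) => shiftFn (q.2 i) * wj (pathCov q) k W := fun i W =>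
    (hc i).mul (continuous_wj continuous_pathCov k W)
  have e1 : ∀ τ : Fin n → ℝ, wj (freeCov freeSI τ) (k + 1) (fun _ : Fin n => 𝒿)
      - wj (freeCov freeD τ) (k + 1) (fun _ : Fin n => 𝒿)
      = ∫ l in (0 : ℝ)..1, ∑ i, ∑ μ, ∑ j, shiftFn (τ i) * wj (pathCov (l, τ)) k
        (fun j' => jetAt (addD (j, μ) (addD (i, μ) fun _ => V) j') x) := by
    intro τ
    have hd : ∀ l : ℝ, HasDerivAt (fun l => wj (pathCov (l, τ)) (k + 1) (fun _ : Fin n => 𝒿))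
        (∑ i, ∑ μ, ∑ j, shiftFn (τ i) * wj (pathCov (l, τ)) k
        (fun j' => jetAt (addD (j, μ) (addD (i, μ) fun _ => V) j') x)) l := by
      intro l
      have h := hasDerivAt_wj x (C := fun l => pathCov (D := D) (l, τ)) (l := l)
        (C' := fun α β => if α.2 = β.2 then shiftFn (τ α.1) + shiftFn (τ β.1) else 0)
        (fun α β => by
          simp only [pathCov, freeCov]
          split_ifs
          · simpa using ((hasDerivAt_id l).mul_const (shiftFn (τ α.1) + shiftFn (τ β.1))).const_add
              (freeD (τ α.1) (τ β.1))
          · exact hasDerivAt_const l 0) k hVs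
      refine h.congr_deriv ?_
      rw [half_sum_shift (fun i => shiftFn (τ i)) fun α β => by rw [addD_comm hVs]]
      simp only [mul_sum]
    rw [integral_eq_sub_of_hasDerivAt (fun l _ => hd l)]
    · simp only [pathCov]
      congr 2
      · congr 1; ext s t; rw [freeSI_eq]; ring
      simp
    · refine Continuous.intervalIntegrable ?_ _ _
      refine continuous_finsetSum _ fun i _ => continuous_finsetSum _ fun μ _ =>
        continuous_finsetSum _ fun j _ => ?_
      exact (hcw i _).comp (by fun_prop : Continuous fun l : ℝ => (l, τ))
  have hcκ : ∀ {κ : ℝ → ℝ → ℝ} (_ : 𝒞₂ κ),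
      IntegrableOn (fun τ => wj (freeCov κ τ) (k + 1) (fun _ : Fin n => 𝒿)) (cube n) :=
    fun hκ => integrable_cube _ (continuous_wj (fun α β => freeCov_continuous hκ α β) _ _)
  rw [← integral_sub (hcκ continuous_freeSI) (hcκ continuous_freeD)]
  simp only [e1]
  rw [← integral_pathMeasure (f := fun q => ∑ i, ∑ μ, ∑ j, shiftFn (q.2 i) * wj (pathCov q) k
        (fun j' => jetAt (addD (j, μ) (addD (i, μ) fun _ => V) j') x))]
  · rw [integral_finsetSum _ fun i _ => integrable_pathMeasure (continuous_finsetSum _ fun μ _ =>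
      continuous_finsetSum _ fun j _ => hcw i _)]
    refine sum_congr rfl fun i _ => ?_
    rw [integral_finsetSum _ fun μ _ => integrable_pathMeasure (continuous_finsetSum _ fun j _ =>
      hcw i _)]
    refine sum_congr rfl fun μ _ => ?_
    rw [integral_finsetSum _ fun j _ => integrable_pathMeasure (hcw i _),
      (dd_integral_wj (fun f hf => integrable_pathMeasure hf) continuous_pathCov k _ (hc i)
        (addD (i, μ) fun _ => V) (addD_contDiff hVs (i, μ))).2]
  fun_prop

lemma contDiff_val (P : JetPoly D) {V : E D → ℝ} (hV : Smooth V) :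
    Smooth fun y => P.val V y := by
  simp only [JetPoly.val]
  induction P using MvPolynomial.induction_on with
  | C a => simpa using contDiff_const
  | add p q hp hq => simpa using hp.add hq
  | mul_X p i hp => simpa using hp.mul (contDiff_pd hV i.2)

/-- The two families of heat kernel coefficients agree up to total divergences. -/
lemma exists_current (m : ℕ) : ∃ J : Fin D → JetPoly D, ∀ V : E D → ℝ, Smooth V → ∀ x,
    heatCoef freeD m 𝒿 - heatCoef freeSI m 𝒿 = ∑ μ, dd μ (fun y => (J μ).val V y) x := by
  have key : ∀ p : ℕ × ℕ, ∃ J : Fin D → JetPoly D, ∀ V : E D → ℝ, Smooth V → ∀ x,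
      (∫ τ in cube p.1, wj (freeCov freeSI τ) p.2 (fun _ : Fin p.1 => 𝒿))
      - ∫ τ in cube p.1, wj (freeCov freeD τ) p.2 (fun _ : Fin p.1 => 𝒿)
      = ∑ μ, dd μ (fun y => (J μ).val V y) x := by
    rintro ⟨n, k⟩
    cases k with
    | zero =>
      refine ⟨fun _ => 0, fun V hV x => ?_⟩
      have : ∀ μ : Fin D, dd μ (fun y => (0 : JetPoly D).val V y) x = 0 := fun μ => by
        simp [JetPoly.val, dd_eq]
      simp [wj, this]
    | succ k =>
      choose P hP using exists_currentPoly (D := D) (n := n) k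
      refine ⟨fun μ => ∑ i, P i μ, fun V hV x => ?_⟩
      have e : ∀ μ, (fun y => (∑ i, P i μ).val V y) = fun y => ∑ i, (P i μ).val V y := fun μ => by
        ext y; simp [JetPoly.val]
      simp only [integral_wj_sub hV k x, e]
      rw [sum_comm]
      refine sum_congr rfl fun μ _ => ?_
      rw [dd_sum fun i _ => contDiff_val (P i μ) hV]
      simp_all
  choose J hJ using key
  refine ⟨fun μ => ∑ p ∈ antidiagonal m,
    MvPolynomial.C (-((-1) ^ p.1 / (p.1.factorial : ℝ))) * J p μ, fun V hV x => ?_⟩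
  have e : ∀ μ, (fun y => JetPoly.val (∑ p ∈ antidiagonal m,
      MvPolynomial.C (-((-1) ^ p.1 / (p.1.factorial : ℝ))) * J p μ) V y)
      = fun y => ∑ p ∈ antidiagonal m,
        -((-1) ^ p.1 / (p.1.factorial : ℝ)) * (J p μ).val V y := fun μ => by
    ext y
    simp only [JetPoly.val, map_sum, map_mul, MvPolynomial.eval_C]
  simp only [e]
  simp only [dd_sum fun p _ => contDiff_const.mul (contDiff_val (J p _) hV),
    dd_const_mul (contDiff_val (J _ _) hV)]
  rw [sum_comm, heatCoef, heatCoef, ← sum_sub_distrib]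
  refine sum_congr rfl fun p _ => ?_
  rw [← mul_sum, ← hJ p V hV x]
  ring

end

section

/-! ### Contractions of one and two points -/

variable {D n : ℕ}

/-- The jets `v` and `w` cannot be distinguished by a product with `K` derivatives. -/
def Agree (K : ℕ) (v w : Fin n → Jet D) : Prop := ∃ (Z : Finset (Fin n)) (r : Fin n → ℤ),
    (∀ i ∈ Z, (v i).val0 = 0 ∧ (w i).val0 = 0) ∧
    (∀ i (a : JetVar D), (a.1 : ℤ) ≤ r i → v i a = w i a) ∧
    ∀ i, (K : ℤ) ≤ r i + (Z.erase i).card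

lemma Agree.addDeriv {K : ℕ} {v w : Fin n → Jet D} (h : Agree (K + 1) v w) (α : 𝕁 n) :
    Agree K (addDeriv α v) (addDeriv α w) := by
  obtain ⟨Z, r, h0, h1, h2⟩ := h
  refine ⟨Z.erase α.1, update r α.1 (r α.1 - 1), fun i hi => ?_, fun i a ha => ?_, fun i => ?_⟩
  · have hne := Finset.ne_of_mem_erase hi
    simp only [Worldline.addDeriv, update_of_ne hne]
    exact h0 i (Finset.mem_of_mem_erase hi)
  · by_cases hi : i = α.1
    · subst hi
      simp only [Worldline.addDeriv, update_self] at ha ⊢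
      refine h1 _ _ ?_
      simp only [consIdx]
      push_cast
      linarith
    · simp only [Worldline.addDeriv, update_of_ne hi] at ha ⊢
      exact h1 i a ha
  · have := h2 i
    by_cases hi : i = α.1
    · subst hi
      rw [update_self, Finset.erase_idem]
      push_cast at this
      linarith
    · rw [update_of_ne hi]
      have hc : (Z.erase i).card ≤ ((Z.erase α.1).erase i).card + 1 := by
        rw [Finset.erase_right_comm]
        have := Finset.pred_card_le_card_erase (s := Z.erase i) (a := α.1)
        omega
      push_cast at this
      have hc' : ((Z.erase i).card : ℤ) ≤ ((Z.erase α.1).erase i).card + 1 := by exact_mod_cast hc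
      linarith

lemma wj_eq_of_agree (C : 𝕁 n → 𝕁 n → ℝ) (k : ℕ) {v w : Fin n → Jet D}
    (h : Agree (2 * k) v w) : wj C k v = wj C k w := by
  induction k generalizing v w with
  | zero =>
    obtain ⟨Z, r, h0, h1, h2⟩ := h
    rw [wj, wj]
    by_cases hZ : Z.Nonempty
    · obtain ⟨i, hi⟩ := hZ
      rw [prod_eq_zero (Finset.mem_univ i) (h0 i hi).1,
        prod_eq_zero (Finset.mem_univ i) (h0 i hi).2]
    · refine prod_congr rfl fun i _ => h1 i _ ?_
      have := h2 i
      rw [Finset.not_nonempty_iff_eq_empty.1 hZ] at this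
      simpa using this
  | succ k ih =>
    rw [wj, wj]
    congr 1
    exact sum_congr rfl fun α _ => sum_congr rfl fun β _ => by
      rw [ih ((Agree.addDeriv (K := 2 * k + 1) h β).addDeriv α)]

lemma wj_congr (C : 𝕁 n → 𝕁 n → ℝ) (k : ℕ) {v w : Jet D}
    (hv : v.val0 = 0) (hw : w.val0 = 0) (h : ∀ a : JetVar D, a.1 + n ≤ 2 * k + 1 → v a = w a) :
    wj C k (fun _ => v) = wj C k fun _ => w := by
  refine wj_eq_of_agree C k ⟨Finset.univ, fun _ => 2 * k + 1 - n, fun _ _ => ⟨hv, hw⟩,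
    fun _ a ha => h a (by
      have ha' : (a.1 : ℤ) ≤ 2 * k + 1 - n := ha
      omega), fun i => ?_⟩
  have hn := i.pos
  rw [Finset.card_erase_of_mem (Finset.mem_univ i), Finset.card_univ, Fintype.card_fin,
    Nat.cast_sub hn]
  push_cast
  linarith

def trace : ℕ → Jet D → ℝ
  | 0, v => v.val0
  | k + 1, v => ∑ μ, trace k ((v.shift μ).shift μ)

lemma wj_one (κ : ℝ → ℝ → ℝ) (τ : Fin 1 → ℝ) (k : ℕ) (v : Jet D) :
    wj (freeCov κ τ) k (fun _ => v) = κ (τ 0) (τ 0) ^ k / (2 ^ k * (k.factorial : ℝ)) * trace k v := by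
  induction k generalizing v with
  | zero => simp [wj, trace]
  | succ k ih =>
    have e : ∀ μ ν : Fin D, addDeriv (0, μ) (addDeriv (0, ν) fun _ : Fin 1 => v)
        = fun _ => (v.shift ν).shift μ := by
      intro μ ν
      funext i
      rw [Subsingleton.elim i 0]
      simp [addDeriv]
    rw [wj, trace]
    simp only [Fintype.sum_prod_type, Finset.univ_unique, Fin.default_eq_zero, Finset.sum_singleton,
      Fin.isValue, e, ih, freeCov, ite_mul, zero_mul, Finset.sum_ite_eq, Finset.mem_univ, if_true]
    rw [← mul_sum, ← mul_sum, Nat.factorial_succ]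
    push_cast
    field_simp
    ring

/-- The contraction of two jets: `a` and `c` traces on the first and on the second one, and `b` mutual
contractions. -/
def pairing : ℕ → ℕ → ℕ → Jet D → Jet D → ℝ
  | a + 1, b, c, p, q => ∑ μ, pairing a b c ((p.shift μ).shift μ) q
  | 0, b + 1, c, p, q => ∑ μ, pairing 0 b c (p.shift μ) (q.shift μ)
  | 0, 0, c + 1, p, q => ∑ μ, pairing 0 0 c p ((q.shift μ).shift μ)
  | 0, 0, 0, p, q => p.val0 * q.val0

lemma pairing_left (a b c : ℕ) (p q : Jet D) :
    ∑ μ, pairing a b c ((p.shift μ).shift μ) q = pairing (a + 1) b c p q := by rw [pairing]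

lemma pairing_mutual (a b c : ℕ) {p : Jet D} (hp : p.Sym) (q : Jet D) :
    ∑ μ, pairing a b c (p.shift μ) (q.shift μ) = pairing a (b + 1) c p q := by
  induction a generalizing p with
  | zero => simp [pairing]
  | succ a ih =>
    simp only [pairing]
    rw [sum_comm]
    refine sum_congr rfl fun ν _ => ?_
    rw [← ih ((hp.shift ν).shift ν)]
    refine sum_congr rfl fun μ _ => ?_
    rw [hp.shift_comm μ ν, (hp.shift ν).shift_comm μ ν]

lemma pairing_right (a b c : ℕ) (p : Jet D) {q : Jet D} (hq : q.Sym) :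
    ∑ μ, pairing a b c p ((q.shift μ).shift μ) = pairing a b (c + 1) p q := by
  induction a generalizing p with
  | zero =>
    induction b generalizing p q with
    | zero => simp [pairing]
    | succ b ih =>
      simp only [pairing]
      rw [sum_comm]
      refine sum_congr rfl fun ν _ => ?_
      rw [← ih]
      swap
      · exact hq.shift ν
      refine sum_congr rfl fun μ _ => ?_
      rw [(hq.shift μ).shift_comm μ ν, hq.shift_comm μ ν]
  | succ a ih =>
    simp only [pairing]
    rw [sum_comm]
    exact sum_congr rfl fun ν _ => ih _

lemma pairing_symm (a b c : ℕ) {p q : Jet D} (hp : p.Sym) (hq : q.Sym) :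
    pairing a b c p q = pairing c b a q p := by
  induction a generalizing p with
  | zero =>
    induction b generalizing p q with
    | zero =>
      induction c generalizing q with
      | zero => simp [pairing, mul_comm]
      | succ c ih =>
        rw [pairing, pairing]
        exact sum_congr rfl fun μ _ => ih ((hq.shift μ).shift μ)
    | succ b ih =>
      rw [pairing, ← pairing_mutual _ _ _ hq]
      exact sum_congr rfl fun μ _ => ih (hq.shift μ) (hp.shift μ)
  | succ a ih =>
    rw [pairing, ← pairing_right _ _ _ _ hp]
    exact sum_congr rfl fun μ _ => ih ((hp.shift μ).shift μ)

section Two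

variable {κ : ℝ → ℝ → ℝ} (hκ : ∀ s t, κ s t = κ t s) (τ : Fin 2 → ℝ)
include hκ

lemma wj_two_succ (k : ℕ) (p q : Jet D) :
    wj (freeCov κ τ) (k + 1) ![p, q] = 1 / (2 * ((k : ℝ) + 1)) *
      (κ (τ 0) (τ 0) * ∑ μ, wj (freeCov κ τ) k ![(p.shift μ).shift μ, q]
        + 2 * κ (τ 0) (τ 1) * ∑ μ, wj (freeCov κ τ) k ![p.shift μ, q.shift μ]
        + κ (τ 1) (τ 1) * ∑ μ, wj (freeCov κ τ) k ![p, (q.shift μ).shift μ]) := by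
  have e0 : ∀ (p q : Jet D) (μ : Fin D), addDeriv (0, μ) ![p, q] = ![p.shift μ, q] := by
    intro p q μ
    funext i; fin_cases i <;> simp [addDeriv]
  have e1 : ∀ (p q : Jet D) (μ : Fin D), addDeriv (1, μ) ![p, q] = ![p, q.shift μ] := by
    intro p q μ
    funext i; fin_cases i <;> simp [addDeriv]
  rw [wj]
  simp only [Fintype.sum_prod_type, Fin.sum_univ_two, freeCov, ite_mul, zero_mul, Finset.sum_ite_eq,
    Finset.mem_univ, if_true, sum_add_distrib, e0, e1, hκ (τ 1) (τ 0), ← mul_sum]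
  ring

omit hκ in
lemma wj_two_zero (p q : Jet D) : wj (freeCov κ τ) 0 ![p, q] = pairing 0 0 0 p q := by
  simp [wj, pairing, Fin.prod_univ_two]

lemma wj_two_one (p q : Jet D) : wj (freeCov κ τ) 1 ![p, q]
    = κ (τ 0) (τ 0) / 2 * pairing 1 0 0 p q + κ (τ 0) (τ 1) * pairing 0 1 0 p q
      + κ (τ 1) (τ 1) / 2 * pairing 0 0 1 p q := by
  rw [wj_two_succ hκ]
  simp only [wj_two_zero]
  simp [pairing]
  ring

lemma wj_two_two {p q : Jet D} (hp : p.Sym) (hq : q.Sym) : wj (freeCov κ τ) 2 ![p, q]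
    = κ (τ 0) (τ 0) ^ 2 / 8 * pairing 2 0 0 p q
      + κ (τ 0) (τ 0) / 2 * κ (τ 0) (τ 1) * pairing 1 1 0 p q
      + κ (τ 0) (τ 1) ^ 2 / 2 * pairing 0 2 0 p q
      + κ (τ 0) (τ 0) / 2 * (κ (τ 1) (τ 1) / 2) * pairing 1 0 1 p q
      + κ (τ 0) (τ 1) * (κ (τ 1) (τ 1) / 2) * pairing 0 1 1 p q
      + κ (τ 1) (τ 1) ^ 2 / 8 * pairing 0 0 2 p q := by
  rw [wj_two_succ hκ]
  simp only [wj_two_one hκ, sum_add_distrib, ← mul_sum, pairing_left, pairing_mutual _ _ _ hp,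
    pairing_right _ _ _ _ hq]
  push_cast
  ring

lemma wj_two_three {p q : Jet D} (hp : p.Sym) (hq : q.Sym) : wj (freeCov κ τ) 3 ![p, q]
    = κ (τ 0) (τ 0) ^ 3 / 48 * pairing 3 0 0 p q
      + κ (τ 0) (τ 0) ^ 2 / 8 * κ (τ 0) (τ 1) * pairing 2 1 0 p q
      + κ (τ 0) (τ 0) ^ 2 / 8 * (κ (τ 1) (τ 1) / 2) * pairing 2 0 1 p q
      + κ (τ 0) (τ 0) / 2 * (κ (τ 0) (τ 1) ^ 2 / 2) * pairing 1 2 0 p q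
      + κ (τ 0) (τ 0) / 2 * κ (τ 0) (τ 1) * (κ (τ 1) (τ 1) / 2) * pairing 1 1 1 p q
      + κ (τ 0) (τ 0) / 2 * (κ (τ 1) (τ 1) ^ 2 / 8) * pairing 1 0 2 p q
      + κ (τ 0) (τ 1) ^ 3 / 6 * pairing 0 3 0 p q
      + κ (τ 0) (τ 1) ^ 2 / 2 * (κ (τ 1) (τ 1) / 2) * pairing 0 2 1 p q
      + κ (τ 0) (τ 1) * (κ (τ 1) (τ 1) ^ 2 / 8) * pairing 0 1 2 p q
      + κ (τ 1) (τ 1) ^ 3 / 48 * pairing 0 0 3 p q := by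
  have hl : ∀ μ, ((p.shift μ).shift μ).Sym := fun μ => (hp.shift μ).shift μ
  have hr : ∀ μ, ((q.shift μ).shift μ).Sym := fun μ => (hq.shift μ).shift μ
  rw [wj_two_succ hκ]
  simp only [fun μ => wj_two_two hκ τ (hl μ) hq, fun μ => wj_two_two hκ τ hp (hr μ),
    fun μ => wj_two_two hκ τ (hp.shift μ) (hq.shift μ), sum_add_distrib, ← mul_sum,
    pairing_left, pairing_mutual _ _ _ hp, pairing_right _ _ _ _ hq]
  push_cast
  ring

end Two

end

section

open MvPolynomial

/-! ### The first generalized coefficients -/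

variable {D : ℕ}

lemma integral_cube_zero (f : (Fin 0 → ℝ) → ℝ) : ∫ τ in cube 0, f τ = f default := by
  have h : f = fun _ => f default := funext fun τ => by rw [Subsingleton.elim τ default]
  rw [h]
  simp [cube, Measure.real, Real.volume_Icc_pi]

lemma integral_cube_one {f : ℝ → ℝ} (hf : Continuous f) :
    ∫ τ in cube 1, f (τ 0) = ∫ s in (0 : ℝ)..1, f s := by
  have hc : Continuous fun τ : Fin 1 → ℝ => f (τ 0) := by fun_prop
  rw [integral_cube_succ 0 hc.continuousOn, integral_of_le zero_le_one,
    ← integral_Icc_eq_integral_Ioc]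
  congr 1; ext s
  rw [integral_cube_zero]
  simp

lemma integral_cube_two {F : ℝ → ℝ → ℝ} (hF : 𝒞₂ F) :
    ∫ τ in cube 2, F (τ 0) (τ 1) = ∫ s in (0 : ℝ)..1, ∫ t in (0 : ℝ)..1, F s t := by
  have hc : Continuous fun τ : Fin 2 → ℝ => F (τ 0) (τ 1) :=
    hF.comp (f := fun τ : Fin 2 → ℝ => (τ 0, τ 1)) (by fun_prop)
  rw [integral_cube_succ 0 hc.continuousOn, integral_of_le zero_le_one,
    ← integral_Icc_eq_integral_Ioc]
  congr 1; ext s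
  have hs : Continuous fun t => F s t := hF.comp (f := fun t : ℝ => (s, t)) (by fun_prop)
  rw [← integral_cube_one hs]
  simp

lemma pairing_unlinked (a c : ℕ) (p q : Jet D) : pairing a 0 c p q = trace a p * trace c q := by
  induction a generalizing p with
  | zero =>
    induction c generalizing q with
    | zero => simp [pairing, trace]
    | succ c ih => simp only [pairing, ih, trace, ← mul_sum]
  | succ a ih => simp only [pairing, ih, trace, sum_mul]

section Terms

variable {κ : ℝ → ℝ → ℝ} (hκ : 𝒞₂ κ)

/-- The contribution of `n` vertices and `k` propagators to `heatCoef`. -/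
def heatTerm (κ : ℝ → ℝ → ℝ) (n k : ℕ) (u : Jet D) : ℝ :=
  (-1) ^ n / (n.factorial : ℝ) * ∫ τ in cube n, wj (freeCov κ τ) k fun _ : Fin n => u

lemma heatCoef_eq (m : ℕ) (u : Jet D) :
    heatCoef κ m u = ∑ p ∈ antidiagonal m, heatTerm κ p.1 p.2 u := rfl

lemma heatTerm_congr (n k : ℕ) {u w : Jet D} (hu : u.val0 = 0) (hw : w.val0 = 0)
    (h : ∀ a : JetVar D, a.1 + n ≤ 2 * k + 1 → u a = w a) :
    heatTerm κ n k u = heatTerm κ n k w := by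
  simp only [heatTerm, fun τ : Fin n → ℝ => wj_congr (freeCov κ τ) k hu hw h]

include hκ in
lemma heatTerm_one (k : ℕ) (u : Jet D) : heatTerm κ 1 k u
    = -((∫ s in (0 : ℝ)..1, κ s s ^ k) / (2 ^ k * (k.factorial : ℝ))) * trace k u := by
  have hd : Continuous fun s => κ s s := hκ.comp (f := fun s : ℝ => (s, s)) (by fun_prop)
  rw [heatTerm]
  simp only [wj_one]
  rw [integral_mul_const, integral_div, integral_cube_one (f := fun s => κ s s ^ k) (hd.pow k)]
  simp

/-- The moments of the Green function. -/
def moment (κ : ℝ → ℝ → ℝ) (a b c : ℕ) : ℝ :=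
  ∫ s in (0 : ℝ)..1, ∫ t in (0 : ℝ)..1, κ s s ^ a * κ s t ^ b * κ t t ^ c

section Two

variable (hs : ∀ s t, κ s t = κ t s)
include hκ

lemma continuous_momentFn (a b c : ℕ) :
    Continuous fun p : ℝ × ℝ => κ p.1 p.1 ^ a * κ p.1 p.2 ^ b * κ p.2 p.2 ^ c := by fun_prop

lemma integral_cube_moment (a b c : ℕ) :
    ∫ τ in cube 2, κ (τ 0) (τ 0) ^ a * κ (τ 0) (τ 1) ^ b * κ (τ 1) (τ 1) ^ c = moment κ a b c :=
  integral_cube_two (F := fun s t => κ s s ^ a * κ s t ^ b * κ t t ^ c) (continuous_momentFn hκ a b c)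

lemma integrable_cube_moment (a b c : ℕ) (r : ℝ) :
    Integrable (fun τ : Fin 2 → ℝ => r * (κ (τ 0) (τ 0) ^ a * κ (τ 0) (τ 1) ^ b * κ (τ 1) (τ 1) ^ c))
      (volume.restrict (cube 2)) := by
  refine integrable_cube _ (continuous_const.mul ?_)
  fun_prop

include hs in
lemma moment_symm (a b c : ℕ) : moment κ a b c = moment κ c b a := by
  rw [moment, intervalIntegral_swap_of_continuous (continuous_momentFn hκ a b c), moment]
  grind

omit hκ in
lemma moment_unlinked (a c : ℕ) :
    moment κ a 0 c = (∫ s in (0 : ℝ)..1, κ s s ^ a) * ∫ s in (0 : ℝ)..1, κ s s ^ c := by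
  simp only [moment, pow_zero, mul_one, intervalIntegral.integral_const_mul,
    intervalIntegral.integral_mul_const]

variable {u : Jet D} (hu : u.Sym)
include hs hu

lemma heatTerm_two_two (h0 : u.val0 = 0) : heatTerm κ 2 2 u
    = 1 / 2 * moment κ 1 1 0 * pairing 1 1 0 u u + (1 / 4 * moment κ 0 2 0 * pairing 0 2 0 u u
      + 1 / 8 * moment κ 1 0 1 * pairing 1 0 1 u u) := by
  have e : ∀ τ : Fin 2 → ℝ, wj (freeCov κ τ) 2 (fun _ => u)
      = pairing 1 1 0 u u / 2 * (κ (τ 0) (τ 0) ^ 1 * κ (τ 0) (τ 1) ^ 1 * κ (τ 1) (τ 1) ^ 0)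
      + pairing 1 1 0 u u / 2 * (κ (τ 0) (τ 0) ^ 0 * κ (τ 0) (τ 1) ^ 1 * κ (τ 1) (τ 1) ^ 1)
      + pairing 0 2 0 u u / 2 * (κ (τ 0) (τ 0) ^ 0 * κ (τ 0) (τ 1) ^ 2 * κ (τ 1) (τ 1) ^ 0)
      + pairing 1 0 1 u u / 4 * (κ (τ 0) (τ 0) ^ 1 * κ (τ 0) (τ 1) ^ 0 * κ (τ 1) (τ 1) ^ 1) := by
    intro τ
    rw [show (fun _ : Fin 2 => u) = ![u, u] by funext i; fin_cases i <;> rfl, wj_two_two hs τ hu hu,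
      pairing_symm 0 1 1 hu hu, pairing_unlinked 2 0, pairing_unlinked 0 2]
    simp only [trace, h0]
    ring
  rw [heatTerm]
  simp only [e]
  rw [integral_add, integral_add, integral_add]
  · simp only [integral_const_mul, integral_cube_moment hκ, moment_symm hκ hs 0 1 1]
    simp
    ring
  all_goals repeat' first | exact integrable_cube_moment hκ _ _ _ _ | apply Integrable.fun_add

lemma heatTerm_two_three (h0 : u.val0 = 0) : heatTerm κ 2 3 u
    = 1 / 8 * moment κ 1 1 1 * pairing 1 1 1 u u + 1 / 12 * moment κ 0 3 0 * pairing 0 3 0 u u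
      + 1 / 4 * moment κ 1 2 0 * pairing 1 2 0 u u + 1 / 8 * moment κ 2 1 0 * pairing 0 1 2 u u
      + 1 / 16 * moment κ 1 0 2 * (trace 1 u * trace 2 u) := by
  have e : ∀ τ : Fin 2 → ℝ, wj (freeCov κ τ) 3 (fun _ => u)
      = pairing 1 1 1 u u / 4 * (κ (τ 0) (τ 0) ^ 1 * κ (τ 0) (τ 1) ^ 1 * κ (τ 1) (τ 1) ^ 1)
      + pairing 0 3 0 u u / 6 * (κ (τ 0) (τ 0) ^ 0 * κ (τ 0) (τ 1) ^ 3 * κ (τ 1) (τ 1) ^ 0)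
      + pairing 1 2 0 u u / 4 * (κ (τ 0) (τ 0) ^ 1 * κ (τ 0) (τ 1) ^ 2 * κ (τ 1) (τ 1) ^ 0)
      + pairing 1 2 0 u u / 4 * (κ (τ 0) (τ 0) ^ 0 * κ (τ 0) (τ 1) ^ 2 * κ (τ 1) (τ 1) ^ 1)
      + pairing 0 1 2 u u / 8 * (κ (τ 0) (τ 0) ^ 2 * κ (τ 0) (τ 1) ^ 1 * κ (τ 1) (τ 1) ^ 0)
      + pairing 0 1 2 u u / 8 * (κ (τ 0) (τ 0) ^ 0 * κ (τ 0) (τ 1) ^ 1 * κ (τ 1) (τ 1) ^ 2)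
      + trace 1 u * trace 2 u / 16 * (κ (τ 0) (τ 0) ^ 1 * κ (τ 0) (τ 1) ^ 0 * κ (τ 1) (τ 1) ^ 2)
      + trace 1 u * trace 2 u / 16 * (κ (τ 0) (τ 0) ^ 2 * κ (τ 0) (τ 1) ^ 0 * κ (τ 1) (τ 1) ^ 1) := by
    intro τ
    rw [show (fun _ : Fin 2 => u) = ![u, u] by funext i; fin_cases i <;> rfl,
      wj_two_three hs τ hu hu, pairing_symm 0 2 1 hu hu, pairing_symm 2 1 0 hu hu,
      pairing_unlinked 3 0, pairing_unlinked 0 3, pairing_unlinked 1 2, pairing_unlinked 2 1]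
    simp only [trace, h0]
    ring
  rw [heatTerm]
  simp only [e]
  rw [integral_add, integral_add, integral_add, integral_add, integral_add, integral_add, integral_add]
  · simp only [integral_const_mul, integral_cube_moment hκ, moment_symm hκ hs 0 2 1,
      moment_symm hκ hs 0 1 2, moment_symm hκ hs 2 0 1]
    simp
    ring
  all_goals repeat' first | exact integrable_cube_moment hκ _ _ _ _ | apply Integrable.fun_add

end Two

section Coefficients

variable (hs : ∀ s t, κ s t = κ t s) {v : Jet D} (hv : v.Sym)
include hκ

lemma sum_coeff_mul (m : ℕ) : ∑ p ∈ antidiagonal m,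
      eval v (PowerSeries.coeff p.1 (resummedSeries hκ))
        * heatCoef κ p.2 (v.restrict fun k => k = 1 ∨ k = 2) = heatCoef κ m (v.restrict (1 ≤ ·)) := by
  have h := congrArg (fun f => eval v (PowerSeries.coeff m f)) (resummedSeries_mul (D := D) hκ)
  simp only [PowerSeries.coeff_mul, map_sum, map_mul] at h
  have e1 : eval v (PowerSeries.coeff m (reducedSeries hκ)) = heatCoef κ m (v.restrict (1 ≤ ·)) := by
    rw [reducedSeries, PowerSeries.coeff_map, heatSeries, PowerSeries.coeff_mk, ← eval_heatPoly hκ,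
      ← eval_restrictHom]
    rfl
  have e2 : ∀ m, eval v (PowerSeries.coeff m (oscillatorSeries hκ))
      = heatCoef κ m (v.restrict fun k => k = 1 ∨ k = 2) := fun m => by
    rw [oscillatorSeries, PowerSeries.coeff_map, heatSeries, PowerSeries.coeff_mk, ← eval_heatPoly hκ,
      ← eval_restrictHom]
    rfl
  simp_all

omit hκ in
lemma heatTerm_restrict (n k : ℕ) (h : 2 * k ≤ n + 1) :
    heatTerm κ n k (v.restrict (1 ≤ ·)) = heatTerm κ n k (v.restrict fun k => k = 1 ∨ k = 2) := by
  refine heatTerm_congr n k (by rfl) (by rfl) fun a ha => ?_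
  have : a.1 ≤ 2 := by omega
  simp only [Jet.restrict, show (1 ≤ a.1) ↔ (a.1 = 1 ∨ a.1 = 2) by omega]

omit hκ in
lemma coeff_of_convolution {c r s : ℕ → ℝ}
    (h : ∀ m, ∑ p ∈ antidiagonal m, c p.1 * r p.2 = s m) (hr0 : r 0 = 1)
    (hs0 : s 0 = 1) (hr1 : r 1 = 0) (h1 : s 1 = r 1) (h2 : s 2 = r 2) :
    c 0 = 1 ∧ c 1 = 0 ∧ c 2 = 0 ∧ c 3 = s 3 - r 3 ∧ c 4 = s 4 - r 4 ∧
      c 5 = s 5 - r 5 - (s 3 - r 3) * r 2 := by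
  have e0 := h 0
  have e1 := h 1
  have e2 := h 2
  have e3 := h 3
  have e4 := h 4
  have e5 := h 5
  simp [Finset.Nat.antidiagonal_succ, hr0, hr1] at e0 e1 e2 e3 e4 e5
  grind

omit hκ in
lemma heatTerm_none_succ (k : ℕ) (u : Jet D) : heatTerm κ 0 (k + 1) u = 0 := by simp [heatTerm, wj]

omit hκ in
lemma heatTerm_zero (n : ℕ) {u : Jet D} (h0 : u.val0 = 0) : heatTerm κ (n + 1) 0 u = 0 := by
  simp [heatTerm, wj, h0]

include hs hv

/-- The first generalized coefficients in terms of moments of the Green function. -/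
lemma eval_coeff_resummedSeries :
    eval v (PowerSeries.coeff 0 (resummedSeries hκ)) = 1 ∧
    eval v (PowerSeries.coeff 1 (resummedSeries hκ)) = 0 ∧
    eval v (PowerSeries.coeff 2 (resummedSeries hκ)) = 0 ∧
    eval v (PowerSeries.coeff 3 (resummedSeries hκ))
      = -((∫ s in (0 : ℝ)..1, κ s s ^ 2) / 8) * trace 2 v ∧
    eval v (PowerSeries.coeff 4 (resummedSeries hκ)) = 1 / 2 * moment κ 1 1 0 * pairing 1 1 0 v v
        - (∫ s in (0 : ℝ)..1, κ s s ^ 3) / 48 * trace 3 v ∧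
    eval v (PowerSeries.coeff 5 (resummedSeries hκ))
      = 1 / 8 * moment κ 1 1 1 * pairing 1 1 1 v v + 1 / 12 * moment κ 0 3 0 * pairing 0 3 0 v v
      + 1 / 8 * moment κ 2 1 0 * pairing 0 1 2 v v + 1 / 4 * moment κ 1 2 0 * pairing 1 2 0 v v
      - (∫ s in (0 : ℝ)..1, κ s s ^ 4) / 384 * trace 4 v := by
  set u := v.restrict (1 ≤ ·) with hu
  set w := v.restrict fun k => k = 1 ∨ k = 2 with hw
  have hu0 : u.val0 = 0 := by rfl
  have hw0 : w.val0 = 0 := by rfl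
  have hus : u.Sym := hv.restrict _
  have hws : w.Sym := hv.restrict _
  have expand : ∀ x : Jet D, x.val0 = 0 → heatCoef κ 1 x = 0 ∧ heatCoef κ 2 x = heatTerm κ 1 1 x ∧
      heatCoef κ 3 x = heatTerm κ 1 2 x + heatTerm κ 2 1 x ∧
      heatCoef κ 4 x = heatTerm κ 1 3 x + heatTerm κ 2 2 x + heatTerm κ 3 1 x ∧
      heatCoef κ 5 x = heatTerm κ 1 4 x + heatTerm κ 2 3 x + heatTerm κ 3 2 x + heatTerm κ 4 1 x := by
    intro x hx
    refine ⟨?_, ?_, ?_, ?_, ?_⟩ <;>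
    · rw [heatCoef_eq]
      simp [Finset.Nat.antidiagonal_succ, fun k => heatTerm_none_succ (κ := κ) k x,
        heatTerm_zero (κ := κ) _ hx]
      try ring
  obtain ⟨u1, u2, u3, u4, u5⟩ := expand u hu0
  obtain ⟨w1, w2, w3, w4, w5⟩ := expand w hw0
  have tr := heatTerm_restrict (κ := κ) (v := v)
  have t2 : trace 2 u = trace 2 v ∧ trace 2 w = 0 := by
    simp [trace, hu, hw, Jet.shift, consIdx, Jet.restrict, Jet.val0]
  have t3 : trace 3 u = trace 3 v ∧ trace 3 w = 0 := by
    simp [trace, hu, hw, Jet.shift, consIdx, Jet.restrict, Jet.val0]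
  have t4 : trace 4 u = trace 4 v ∧ trace 4 w = 0 := by
    simp [trace, hu, hw, Jet.shift, consIdx, Jet.restrict, Jet.val0]
  have t1 : trace 1 u = trace 1 w := by rfl
  have p110 : pairing 1 1 0 u u = pairing 1 1 0 v v ∧ pairing 1 1 0 w w = 0 := by
    simp [pairing, hu, hw, Jet.shift, consIdx, Jet.restrict, Jet.val0]
  have p020 : pairing 0 2 0 u u = pairing 0 2 0 w w := by
    simp [pairing, hu, hw, Jet.shift, consIdx, Jet.restrict, Jet.val0]
  have p101 : pairing 1 0 1 u u = pairing 1 0 1 w w := by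
    simp [pairing, hu, hw, Jet.shift, consIdx, Jet.restrict, Jet.val0]
  have p111 : pairing 1 1 1 u u = pairing 1 1 1 v v ∧ pairing 1 1 1 w w = 0 := by
    simp [pairing, hu, hw, Jet.shift, consIdx, Jet.restrict, Jet.val0]
  have p030 : pairing 0 3 0 u u = pairing 0 3 0 v v ∧ pairing 0 3 0 w w = 0 := by
    simp [pairing, hu, hw, Jet.shift, consIdx, Jet.restrict, Jet.val0]
  have p120 : pairing 1 2 0 u u = pairing 1 2 0 v v ∧ pairing 1 2 0 w w = 0 := by
    simp [pairing, hu, hw, Jet.shift, consIdx, Jet.restrict, Jet.val0]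
  have p012 : pairing 0 1 2 u u = pairing 0 1 2 v v ∧ pairing 0 1 2 w w = 0 := by
    simp [pairing, hu, hw, Jet.shift, consIdx, Jet.restrict, Jet.val0]
  obtain ⟨c0, c1, c2, c3, c4, c5⟩ := coeff_of_convolution
    (c := fun m => eval v (PowerSeries.coeff m (resummedSeries hκ)))
    (r := fun m => heatCoef κ m w) (s := fun m => heatCoef κ m u) (sum_coeff_mul hκ (v := v))
    (heatCoef_zero _ _) (heatCoef_zero _ _) w1 (u1.trans w1.symm)
    (by simp_all)
  have i12 := heatTerm_one hκ 2 u
  have j12 := heatTerm_one hκ 2 w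
  have i13 := heatTerm_one hκ 3 u
  have j13 := heatTerm_one hκ 3 w
  have i14 := heatTerm_one hκ 4 u
  have j14 := heatTerm_one hκ 4 w
  have j11 := heatTerm_one hκ 1 w
  have i22 := heatTerm_two_two hκ hs hus hu0
  have j22 := heatTerm_two_two hκ hs hws hw0
  have i23 := heatTerm_two_three hκ hs hus hu0
  have j23 := heatTerm_two_three hκ hs hws hw0
  have x21 : heatTerm κ 2 1 u = heatTerm κ 2 1 w := tr 2 1 (by norm_num)
  have x31 : heatTerm κ 3 1 u = heatTerm κ 3 1 w := tr 3 1 (by norm_num)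
  have x32 : heatTerm κ 3 2 u = heatTerm κ 3 2 w := tr 3 2 (by norm_num)
  have x41 : heatTerm κ 4 1 u = heatTerm κ 4 1 w := tr 4 1 (by norm_num)
  rw [t2.1] at i12 i23
  rw [t2.2] at j12 j23
  rw [t3.1] at i13
  rw [t3.2] at j13
  rw [t4.1] at i14
  rw [t4.2] at j14
  rw [p110.1, p020, p101] at i22
  rw [p110.2] at j22
  rw [p111.1, p030.1, p120.1, p012.1, t1, moment_unlinked] at i23
  rw [p111.2, p030.2, p120.2, p012.2] at j23
  rw [show (2 : ℝ) ^ 2 * ((2 : ℕ).factorial : ℝ) = 8 by ring] at i12 j12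
  rw [show (2 : ℝ) ^ 3 * ((3 : ℕ).factorial : ℝ) = 48 by ring] at i13 j13
  rw [show (2 : ℝ) ^ 4 * ((4 : ℕ).factorial : ℝ) = 384 by ring] at i14 j14
  rw [show (2 : ℝ) ^ 1 * ((1 : ℕ).factorial : ℝ) = 2 by simp] at j11
  grind

end Coefficients

end Terms

end

section

open Polynomial

/-! ### The moments of the free Green functions -/

lemma integral_eq_eval_sub {f : ℝ → ℝ} {a b : ℝ} (P : ℝ[X])
    (h : ∀ t ∈ uIcc a b, f t = P.derivative.eval t) : ∫ t in a..b, f t = P.eval b - P.eval a := by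
  rw [integral_congr h]
  exact integral_eq_sub_of_hasDerivAt (fun t _ => P.hasDerivAt t)
    (P.derivative.continuous.intervalIntegrable _ _)

lemma integral_halves {f : ℝ → ℝ} (hf : Continuous f) {s : ℝ} (hs : s ∈ 𝕀) (P Q : ℝ[X])
    (hP : ∀ t ≤ s, f t = P.derivative.eval t) (hQ : ∀ t, s ≤ t → f t = Q.derivative.eval t) :
    ∫ t in (0 : ℝ)..1, f t = P.eval s - P.eval 0 + (Q.eval 1 - Q.eval s) := by
  rw [← intervalIntegral.integral_add_adjacent_intervals (hf.intervalIntegrable 0 s)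
    (hf.intervalIntegrable s 1), integral_eq_eval_sub P, integral_eq_eval_sub Q]
  · exact fun t ht => hQ t (uIcc_of_le hs.2 ▸ ht).1
  · exact fun t ht => hP t (uIcc_of_le hs.1 ▸ ht).2

lemma moment_eq {κ : ℝ → ℝ → ℝ} {a b c : ℕ} {g : ℝ → ℝ}
    (h : ∀ s ∈ 𝕀, ∫ t in (0 : ℝ)..1, κ s t ^ b * κ t t ^ c = g s) :
    moment κ a b c = ∫ s in (0 : ℝ)..1, κ s s ^ a * g s := by
  refine integral_congr fun s hs => ?_
  rw [uIcc_of_le zero_le_one] at hs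
  simp only [← h s hs, ← intervalIntegral.integral_const_mul, mul_assoc]

lemma freeD_of_le {s t : ℝ} (h : t ≤ s) : freeD s t = 2 * t * (1 - s) := by
  rw [freeD, abs_of_nonneg (by linarith)]; ring

lemma freeD_of_ge {s t : ℝ} (h : s ≤ t) : freeD s t = 2 * s * (1 - t) := by
  rw [freeD, abs_of_nonpos (by linarith)]; ring

lemma integral_freeD {s : ℝ} (b c : ℕ) (hs : s ∈ 𝕀) (P Q : ℝ[X])
    (hP : ∀ t, (2 * t * (1 - s)) ^ b * (2 * t * (1 - t)) ^ c = P.derivative.eval t)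
    (hQ : ∀ t, (2 * s * (1 - t)) ^ b * (2 * t * (1 - t)) ^ c = Q.derivative.eval t) :
    ∫ t in (0 : ℝ)..1, freeD s t ^ b * freeD t t ^ c
      = P.eval s - P.eval 0 + (Q.eval 1 - Q.eval s) := by
  have h1 : Continuous fun t => freeD s t := by unfold freeD; fun_prop
  have h2 : Continuous fun t => freeD t t := by unfold freeD; fun_prop
  refine integral_halves (by fun_prop) hs P Q (fun t ht => ?_) fun t ht => ?_
  · rw [freeD_of_le ht, freeD_of_le le_rfl, hP]
  · rw [freeD_of_ge ht, freeD_of_le le_rfl, hQ]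

lemma integral_freeD_one {s : ℝ} (hs : s ∈ 𝕀) :
    ∫ t in (0 : ℝ)..1, freeD s t ^ 1 * freeD t t ^ 0 = s * (1 - s) := by
  rw [integral_freeD 1 0 hs (C (1 - s) * X ^ 2) (C s * (C 2 * X - X ^ 2))] <;> intros <;> simp <;> ring

lemma integral_freeD_two {s : ℝ} (hs : s ∈ 𝕀) :
    ∫ t in (0 : ℝ)..1, freeD s t ^ 2 * freeD t t ^ 0 = 4 / 3 * (s * (1 - s)) ^ 2 := by
  rw [integral_freeD 2 0 hs (C (4 / 3 * (1 - s) ^ 2) * X ^ 3)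
    (C (4 / 3 * s ^ 2) * (C 3 * X - C 3 * X ^ 2 + X ^ 3))] <;>
    intros <;> simp [derivative_pow] <;> ring

lemma integral_freeD_three {s : ℝ} (hs : s ∈ 𝕀) :
    ∫ t in (0 : ℝ)..1, freeD s t ^ 3 * freeD t t ^ 0 = 2 * (s * (1 - s)) ^ 3 := by
  rw [integral_freeD 3 0 hs (C (2 * (1 - s) ^ 3) * X ^ 4)
    (C (2 * s ^ 3) * (C 4 * X - C 6 * X ^ 2 + C 4 * X ^ 3 - X ^ 4))] <;>
    intros <;> simp [derivative_pow] <;> ring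

lemma integral_freeD_one_one {s : ℝ} (hs : s ∈ 𝕀) :
    ∫ t in (0 : ℝ)..1, freeD s t ^ 1 * freeD t t ^ 1 = (s - 2 * s ^ 3 + s ^ 4) / 3 := by
  rw [integral_freeD 1 1 hs (C (4 * (1 - s)) * (C (1 / 3) * X ^ 3 - C (1 / 4) * X ^ 4))
    (C (4 * s) * (C (1 / 2) * X ^ 2 - C (2 / 3) * X ^ 3 + C (1 / 4) * X ^ 4))] <;>
    intros <;> simp <;> ring

lemma integral_freeD_diag (a : ℕ) (g : ℝ → ℝ) (P : ℝ[X])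
    (h : ∀ s, (2 * s * (1 - s)) ^ a * g s = P.derivative.eval s) :
    ∫ s in (0 : ℝ)..1, freeD s s ^ a * g s = P.eval 1 - P.eval 0 := by
  refine integral_eq_eval_sub P fun s _ => ?_
  rw [freeD_of_le le_rfl, h]

lemma integral_freeD_diag_two : ∫ s in (0 : ℝ)..1, freeD s s ^ 2 = 2 / 15 := by
  have h := integral_freeD_diag 2 (fun _ => 1)
    (C (4 / 3) * X ^ 3 - C 2 * X ^ 4 + C (4 / 5) * X ^ 5) fun s => by simp; ring
  simp only [mul_one] at h
  rw [h]; norm_num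

lemma integral_freeD_diag_three : ∫ s in (0 : ℝ)..1, freeD s s ^ 3 = 2 / 35 := by
  have h := integral_freeD_diag 3 (fun _ => 1)
    (C 2 * X ^ 4 - C (24 / 5) * X ^ 5 + C 4 * X ^ 6 - C (8 / 7) * X ^ 7) fun s => by simp; ring
  simp only [mul_one] at h
  rw [h]; norm_num

lemma integral_freeD_diag_four : ∫ s in (0 : ℝ)..1, freeD s s ^ 4 = 8 / 315 := by
  have h := integral_freeD_diag 4 (fun _ => 1) (C (16 / 5) * X ^ 5 - C (32 / 3) * X ^ 6
    + C (96 / 7) * X ^ 7 - C 8 * X ^ 8 + C (16 / 9) * X ^ 9) fun s => by simp; ring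
  simp only [mul_one] at h
  rw [h]; norm_num

lemma moment_freeD_one_one_zero : moment freeD 1 1 0 = 1 / 15 := by
  rw [moment_eq fun s hs => integral_freeD_one hs, integral_freeD_diag 1 _
    (C (2 / 3) * X ^ 3 - X ^ 4 + C (2 / 5) * X ^ 5) fun s => by simp; ring]
  norm_num

lemma moment_freeD_one_one_one : moment freeD 1 1 1 = 17 / 630 := by
  rw [moment_eq fun s hs => integral_freeD_one_one hs, integral_freeD_diag 1 _
    (C (2 / 9) * X ^ 3 - C (1 / 6) * X ^ 4 - C (4 / 15) * X ^ 5 + C (1 / 3) * X ^ 6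
      - C (2 / 21) * X ^ 7) fun s => by simp; ring]
  norm_num

lemma moment_freeD_zero_three_zero : moment freeD 0 3 0 = 1 / 70 := by
  rw [moment_eq fun s hs => integral_freeD_three hs, integral_freeD_diag 0 _
    (C (1 / 2) * X ^ 4 - C (6 / 5) * X ^ 5 + X ^ 6 - C (2 / 7) * X ^ 7) fun s => by simp; ring]
  norm_num

lemma moment_freeD_two_one_zero : moment freeD 2 1 0 = 1 / 35 := by
  rw [moment_eq fun s hs => integral_freeD_one hs, integral_freeD_diag 2 _
    (X ^ 4 - C (12 / 5) * X ^ 5 + C 2 * X ^ 6 - C (4 / 7) * X ^ 7) fun s => by simp; ring]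
  norm_num

lemma moment_freeD_one_two_zero : moment freeD 1 2 0 = 2 / 105 := by
  rw [moment_eq fun s hs => integral_freeD_two hs, integral_freeD_diag 1 _ (C (2 / 3) * X ^ 4
    - C (8 / 5) * X ^ 5 + C (4 / 3) * X ^ 6 - C (8 / 21) * X ^ 7) fun s => by simp; ring]
  norm_num

lemma freeSI_diag (s : ℝ) : freeSI s s = 1 / 6 := by simp [freeSI]

lemma moment_freeSI (a b : ℕ) (R : ℝ[X]) (h : ∀ w, (1 / 6 - w + w ^ 2) ^ b = R.derivative.eval w) :
    moment freeSI a b 0 = (1 / 6) ^ a * (R.eval 1 - R.eval 0) := by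
  rw [moment_eq (g := fun _ => R.eval 1 - R.eval 0) fun s hs => ?_]
  · simp [freeSI_diag]
  have hc : Continuous fun t => freeSI s t ^ b * freeSI t t ^ 0 := by simp only [freeSI]; fun_prop
  rw [integral_halves hc hs (-R.comp (C s - X)) (-R.comp (C (1 + s) - X))]
  · simp; ring
  · intro t ht
    rw [freeSI, abs_of_nonneg (by linarith), pow_zero, mul_one, h]
    simp [derivative_comp]
  · intro t ht
    rw [freeSI, abs_of_nonpos (by linarith), pow_zero, mul_one,
      show 1 / 6 - -(s - t) + (s - t) ^ 2 = 1 / 6 - (1 + s - t) + (1 + s - t) ^ 2 by ring, h]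
    simp [derivative_comp]

lemma moment_freeSI_one (a : ℕ) : moment freeSI a 1 0 = 0 := by
  rw [moment_freeSI a 1 (C (1 / 6) * X - C (1 / 2) * X ^ 2 + C (1 / 3) * X ^ 3) fun w => by simp; ring]
  norm_num

lemma moment_freeSI_zero_three : moment freeSI 0 3 0 = 1 / 3780 := by
  rw [moment_freeSI 0 3 (C (1 / 216) * X - C (1 / 24) * X ^ 2 + C (7 / 36) * X ^ 3
    - C (1 / 2) * X ^ 4 + C (7 / 10) * X ^ 5 - C (1 / 2) * X ^ 6 + C (1 / 7) * X ^ 7)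
    fun w => by simp; ring]
  norm_num

lemma moment_freeSI_one_two : moment freeSI 1 2 0 = 1 / 1080 := by
  rw [moment_freeSI 1 2 (C (1 / 36) * X - C (1 / 6) * X ^ 2 + C (4 / 9) * X ^ 3
    - C (1 / 2) * X ^ 4 + C (1 / 5) * X ^ 5) fun w => by simp; ring]
  norm_num

lemma moment_freeSI_one_one_one : moment freeSI 1 1 1 = 0 := by
  have h : moment freeSI 1 1 1 = 1 / 6 * moment freeSI 1 1 0 := by
    simp only [moment, freeSI_diag, pow_zero, mul_one, pow_one, intervalIntegral.integral_mul_const]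
    ring
  rw [h, moment_freeSI_one, mul_zero]

/-! ### The first generalized coefficients of a potential -/

section Potential

variable {D : ℕ} {V : E D → ℝ} (x : E D)

lemma trace_jetAt_two : trace 2 𝒿 = ∑ μ, ∑ ν, pd V x ![μ, μ, ν, ν] := rfl

lemma trace_jetAt_three :
    trace 3 𝒿 = ∑ μ, ∑ ν, ∑ ρ, pd V x ![μ, μ, ν, ν, ρ, ρ] := rfl

lemma trace_jetAt_four :
    trace 4 𝒿 = ∑ μ, ∑ ν, ∑ ρ, ∑ σ, pd V x ![μ, μ, ν, ν, ρ, ρ, σ, σ] := rfl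

lemma pairing_jetAt_one_one_zero : pairing 1 1 0 𝒿 𝒿
    = ∑ μ, ∑ ν, pd V x ![μ, μ, ν] * pd V x ![ν] := by
  simp only [pairing]; rfl

lemma pairing_jetAt_one_one_one : pairing 1 1 1 𝒿 𝒿
    = ∑ μ, ∑ ν, ∑ ρ, pd V x ![μ, μ, ν] * pd V x ![ν, ρ, ρ] := by
  simp only [pairing]; rfl

lemma pairing_jetAt_zero_three_zero : pairing 0 3 0 𝒿 𝒿
    = ∑ μ, ∑ ν, ∑ ρ, pd V x ![μ, ν, ρ] * pd V x ![μ, ν, ρ] := by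
  simp only [pairing]; rfl

lemma pairing_jetAt_one_two_zero : pairing 1 2 0 𝒿 𝒿
    = ∑ μ, ∑ ν, ∑ ρ, pd V x ![μ, μ, ν, ρ] * pd V x ![ν, ρ] := by
  simp only [pairing]; rfl

lemma pairing_jetAt_zero_one_two : pairing 0 1 2 𝒿 𝒿
    = ∑ ρ, ∑ μ, ∑ ν, pd V x ![ρ] * pd V x ![ρ, μ, μ, ν, ν] := by
  simp only [pairing]; rfl

end Potential

end

section

variable {D : ℕ} {V : E D → ℝ} (hV : Smooth V) (x : E D)
include hV

lemma val_coeff_dirichlet {κ : ℝ → ℝ → ℝ} (hκ : 𝒞₂ κ)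
    (h : κ = freeD) (c : ℕ → JetPoly D) (hc : c = fun j => PowerSeries.coeff j (resummedSeries hκ)) :
    (c 0).val V x = 1 ∧ (c 1).val V x = 0 ∧ (c 2).val V x = 0 ∧
    (c 3).val V x = -(1 / 60) * ∑ μ, ∑ ν, pd V x ![μ, μ, ν, ν] ∧
    (c 4).val V x = 1 / 30 * (∑ μ, ∑ ν, pd V x ![μ, μ, ν] * pd V x ![ν])
      - 1 / 840 * ∑ μ, ∑ ν, ∑ ρ, pd V x ![μ, μ, ν, ν, ρ, ρ] ∧
    (c 5).val V x = 17 / 5040 * (∑ μ, ∑ ν, ∑ ρ, pd V x ![μ, μ, ν] * pd V x ![ν, ρ, ρ])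
      + 1 / 840 * (∑ μ, ∑ ν, ∑ ρ, pd V x ![μ, ν, ρ] * pd V x ![μ, ν, ρ])
      + 1 / 280 * (∑ ρ, ∑ μ, ∑ ν, pd V x ![ρ, μ, μ, ν, ν] * pd V x ![ρ])
      + 1 / 210 * (∑ μ, ∑ ν, ∑ ρ, pd V x ![μ, ν] * pd V x ![ρ, ρ, μ, ν])
      - 1 / 15120 * ∑ μ, ∑ ν, ∑ ρ, ∑ σ, pd V x ![μ, μ, ν, ν, ρ, ρ, σ, σ] := by
  subst h hc
  have e3 : ∑ ρ, ∑ μ, ∑ ν, pd V x ![ρ, μ, μ, ν, ν] * pd V x ![ρ] = pairing 0 1 2 𝒿 𝒿 := by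
    rw [pairing_jetAt_zero_one_two]
    simp only [mul_comm]
  have e4 : ∑ μ, ∑ ν, ∑ ρ, pd V x ![μ, ν] * pd V x ![ρ, ρ, μ, ν] = pairing 1 2 0 𝒿 𝒿 := by
    rw [pairing_jetAt_one_two_zero, Finset.sum_comm' (t' := Finset.univ) (s' := fun _ => Finset.univ)
      (by simp)]
    conv_rhs => rw [sum_comm]
    rw [sum_comm]
    refine sum_congr rfl fun μ _ => ?_
    rw [sum_comm]
    exact sum_congr rfl fun ρ _ => sum_congr rfl fun ν _ => mul_comm _ _
  obtain ⟨c0, c1, c2, c3, c4, c5⟩ := eval_coeff_resummedSeries hκ freeD_symm (jetAt_sym hV x)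
  simp only [JetPoly.val_eq]
  rw [e3, e4, ← trace_jetAt_two, ← trace_jetAt_three, ← trace_jetAt_four,
    ← pairing_jetAt_one_one_zero, ← pairing_jetAt_one_one_one, ← pairing_jetAt_zero_three_zero,
    c3, c4, c5, integral_freeD_diag_two, integral_freeD_diag_three, integral_freeD_diag_four,
    moment_freeD_one_one_zero, moment_freeD_one_one_one, moment_freeD_zero_three_zero,
    moment_freeD_two_one_zero, moment_freeD_one_two_zero]
  exact ⟨c0, c1, c2, by ring, by ring, by ring⟩

omit hV in
lemma freeSI_symm (s t : ℝ) : freeSI s t = freeSI t s := by rw [freeSI, freeSI, abs_sub_comm]; ring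

lemma val_coeff_periodic {κ : ℝ → ℝ → ℝ} (hκ : 𝒞₂ κ) (h : κ = freeSI) (c : ℕ → JetPoly D)
    (hc : c = fun j => PowerSeries.coeff j (resummedSeries hκ - 1)) :
    (c 0).val V x = 0 ∧ (c 1).val V x = 0 ∧ (c 2).val V x = 0 ∧
    (c 3).val V x = -(1 / 288) * ∑ μ, ∑ ν, pd V x ![μ, μ, ν, ν] ∧
    (c 4).val V x = -(1 / 10368) * ∑ μ, ∑ ν, ∑ ρ, pd V x ![μ, μ, ν, ν, ρ, ρ] ∧
    (c 5).val V x = 1 / 45360 * (∑ μ, ∑ ν, ∑ ρ, pd V x ![μ, ν, ρ] * pd V x ![μ, ν, ρ])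
      + 1 / 4320 * (∑ μ, ∑ ρ, ∑ σ, pd V x ![μ, μ, ρ, σ] * pd V x ![ρ, σ])
      - 1 / 497664 * ∑ μ, ∑ ν, ∑ ρ, ∑ σ, pd V x ![μ, μ, ν, ν, ρ, ρ, σ, σ] := by
  subst h hc
  obtain ⟨c0, c1, c2, c3, c4, c5⟩ := eval_coeff_resummedSeries hκ freeSI_symm (jetAt_sym hV x)
  simp only [JetPoly.val_eq, map_sub, PowerSeries.coeff_one]
  rw [← trace_jetAt_two, ← trace_jetAt_three, ← trace_jetAt_four,
    ← pairing_jetAt_zero_three_zero, ← pairing_jetAt_one_two_zero, c0, c1, c2, c3, c4, c5,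
    moment_freeSI_one, moment_freeSI_one_one_one, moment_freeSI_zero_three,
    moment_freeSI_one, moment_freeSI_one_two]
  simp only [freeSI_diag, intervalIntegral.integral_const, smul_eq_mul]
  refine ⟨by simp, by simp, by simp, ?_, ?_, ?_⟩ <;>
  · rw [if_neg (by norm_num), map_zero]
    ring

omit hV in
lemma higherOnly_coeff_sub_one {κ : ℝ → ℝ → ℝ} (hκ : 𝒞₂ κ)
    {j : ℕ} (hj : 1 ≤ j) : (PowerSeries.coeff j (resummedSeries (D := D) hκ - 1)).HigherOnly := by
  rw [map_sub, PowerSeries.coeff_one, if_neg (by omega), sub_zero]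
  exact higherOnly_resummedSeries hκ hj

end

end Worldline

end

theorem mainTheorem8 (D : ℕ) :
    ∃ (c cSI : ℕ → JetPoly D) (J : ℕ → Fin D → JetPoly D),
      (∀ j ≥ 1, (c j).HigherOnly ∧ (cSI j).HigherOnly) ∧
      ∀ V : E D → ℝ, ContDiff ℝ ∞ V →
        -- the worldline Green functions and the value of the bosonic action at the source `∂V`
        (∀ x, ∀ T > 0, (detMatD V x T).det ≠ 0 →
          IsGreenD T (hess V x) (greenD V x T) ∧
          bosAction T (greenD V x T) (grad V x) ![] ![] / 2
            = grad V x ⬝ᵥ (expMat V x T *ᵥ grad V x)) ∧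
        (∀ x, ∀ T > 0, (detMatSI V x T).det ≠ 0 →
          IsGreenSI T (hess V x) (greenSI V x T) ∧
          bosAction T (greenSI V x T) (grad V x) ![] ![] = 0) ∧
        -- the diagonal of the heat kernel
        (∀ K : ℝ → E D → E D → ℝ, IsHeatKernel V K → ∀ x,
          (∀ N : ℕ, (fun T => K T x x / prefactorD V x T - worldlineSum V x (greenD V x) N T)
            =O[𝓝[>] 0] fun T => T ^ (N + 1)) ∧
          (∃ S : ℝ → ℝ,
            (∀ T > 0, 0 < (detMatD V x T).det →
              K T x x = prefactorD V x T *
                Real.exp (grad V x ⬝ᵥ (expMat V x T *ᵥ grad V x)) * S T) ∧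
            ∀ N : ℕ, (fun T => S T - ∑ j ∈ Finset.range (N + 1), (c j).val V x * T ^ j)
              =O[𝓝[>] 0] fun T => T ^ (N + 1))) ∧
        -- the first generalized coefficients
        (∀ x, (c 0).val V x = 1 ∧ (c 1).val V x = 0 ∧ (c 2).val V x = 0 ∧
          (c 3).val V x = -(1 / 60) * ∑ μ, ∑ ν, pd V x ![μ, μ, ν, ν] ∧
          (c 4).val V x = 1 / 30 * (∑ μ, ∑ ν, pd V x ![μ, μ, ν] * pd V x ![ν])
            - 1 / 840 * ∑ μ, ∑ ν, ∑ ρ, pd V x ![μ, μ, ν, ν, ρ, ρ] ∧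
          (c 5).val V x =
            17 / 5040 * (∑ μ, ∑ ν, ∑ ρ, pd V x ![μ, μ, ν] * pd V x ![ν, ρ, ρ])
            + 1 / 840 * (∑ μ, ∑ ν, ∑ ρ, pd V x ![μ, ν, ρ] * pd V x ![μ, ν, ρ])
            + 1 / 280 * (∑ ρ, ∑ μ, ∑ ν, pd V x ![ρ, μ, μ, ν, ν] * pd V x ![ρ])
            + 1 / 210 * (∑ μ, ∑ ν, ∑ ρ, pd V x ![μ, ν] * pd V x ![ρ, ρ, μ, ν])
            - 1 / 15120 * ∑ μ, ∑ ν, ∑ ρ, ∑ σ, pd V x ![μ, μ, ν, ν, ρ, ρ, σ, σ]) ∧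
        -- the string-inspired expansion
        (∀ x, ∀ N : ℕ, (fun T => worldlineSum V x (greenSI V x) N T
            - (1 + ∑ j ∈ Finset.range (N + 1), (cSI j).val V x * T ^ j))
          =O[𝓝[>] 0] fun T => T ^ (N + 1)) ∧
        (∀ x, (cSI 0).val V x = 0 ∧ (cSI 1).val V x = 0 ∧ (cSI 2).val V x = 0 ∧
          (cSI 3).val V x = -(1 / 288) * ∑ μ, ∑ ν, pd V x ![μ, μ, ν, ν] ∧
          (cSI 4).val V x = -(1 / 10368) * ∑ μ, ∑ ν, ∑ ρ, pd V x ![μ, μ, ν, ν, ρ, ρ] ∧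
          (cSI 5).val V x =
            1 / 45360 * (∑ μ, ∑ ν, ∑ ρ, pd V x ![μ, ν, ρ] * pd V x ![μ, ν, ρ])
            + 1 / 4320 * (∑ μ, ∑ ρ, ∑ σ, pd V x ![μ, μ, ρ, σ] * pd V x ![ρ, σ])
            - 1 / 497664 * ∑ μ, ∑ ν, ∑ ρ, ∑ σ, pd V x ![μ, μ, ν, ν, ρ, ρ, σ, σ]) ∧
        -- the two expansions agree up to a total divergence, order by order in `T`
        (∀ K : ℝ → E D → E D → ℝ, IsHeatKernel V K → ∀ x, ∀ N : ℕ,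
          (fun T => (4 * Real.pi * T) ^ ((D : ℝ) / 2) *
              (K T x x - prefactorSI V x T * worldlineSum V x (greenSI V x) N T)
            - ∑ n ∈ Finset.range (N + 1),
                (∑ μ, pd (fun y => (J n μ).val V y) x ![μ]) * T ^ n)
          =O[𝓝[>] 0] fun T => T ^ (N + 1)) := by
  choose J hJ using exists_current (D := D)
  refine ⟨fun j => PowerSeries.coeff j (resummedSeries continuous_dirichlet_k_zero),
    fun j => PowerSeries.coeff j (resummedSeries continuous_periodic_k_zero - 1), J,
    fun j hj => ⟨higherOnly_resummedSeries _ hj, higherOnly_coeff_sub_one _ hj⟩, fun V hV =>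
    ⟨fun x T hT h => isGreenD_greenD hV x hT h, fun x T hT h => isGreenSI_greenSI hV x hT h,
      fun K hK x => ⟨fun N => heat_div_prefactorD_isBigO hV x hK N, exists_resummed hV x hK⟩,
      fun x => val_coeff_dirichlet hV x _ dirichlet_k_zero _ rfl,
      fun x N => worldlineSum_greenSI_isBigO hV x N,
      fun x => val_coeff_periodic hV x _ periodic_k_zero _ rfl,
      fun K hK x N => (heat_sub_stringInspired_isBigO hV x hK N).congr_left fun T => ?_⟩⟩
  simp only [hJ _ V hV x]
  rfl
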